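/- Let $A$ be either the set $\Sigma^*$ of words over a finite alphabet $\Sigma$, or the set $\mathcal T_\Sigma$ of finite ranked trees over a finite ranked alphabet $\Sigma$. Let $\bot\notin\Sigma$ be a padding symbol (of rank $0$) and let $u\otimes v$ denote the convolution of $u,v\in A$, i.e. the word (ranked tree) over $(\Sigma\cup\{\bot\})^2$ obtained by overlaying $u$ and $v$ and padding missing positions with $\bot$; the rank of a pair of letters is the maximum of their ranks. A relation $R\subseteq A\times A$ is given by an automaton $\mathcal A$ if $L(\mathcal A)=\{u\otimes v \mid (u,v)\in R\}$. The automata are NFAs (possibly with $\varepsilon$-transitions) in the word case and nondeterministic top-down tree automata (NTAs) in the tree case. The alphabet is not part of the representation of an automaton: it consists of the letters occurring in the transitions. Consider the following two problems. * **Infinite clique problem**: given an automaton for a relation $R\subseteq A\times A$, is there an infinite sequence $(a_i)_{i\ge1}$ of pairwise distinct elements of $A$ such that $(a_i,a_j)\in R$ for all $i<j$? * **Recurrent reachability**: given an automaton for a relation $R\subseteq A\times A$, an automaton for a language $L\subseteq A$, and an element $a\in A$, is there an infinite sequence $(a_i)_{i\ge1}$ of (not necessarily distinct) elements of $A$ with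 $a_1=a$ such that $(a_i,a_j)\in R$ for all $i<j$ and $a_i\in L$ for infinitely many $i$? **Proposition.** Both over words and over trees, the infinite clique problem and recurrent reachability are logspace equivalent, that is, each of them is reducible to the other by a many-one reduction that is computable in deterministic logarithmic space. Moreover, the reduction from recurrent reachability to the infinite clique problem can be chosen such that 1. if the given relation $R$ is transitive, then so is the relation of the constructed instance; and 2. if the given automata for $R$ and $L$ are deterministic, then so is the constructed automaton. Here deterministic means DFA in the word case; in the tree case the statement holds both for deterministic top-down tree automata and for deterministic bottom-up tree automata (with an arbitrary set of final states), by the same reduction. Deterministic automata need not be complete. -/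

import Mathlib

namespace AutRel

/-! ### Logspace computable functions -/

/-- The finite alphabet over which inputs and outputs of algorithms are written. -/
inductive Symbol : Type
  | zero
  | one
  | bot
  | lpar
  | rpar

/-- Head movements. -/
inductive Move : Type
  | left
  | stay
  | right

/-- What a head sees on the input tape, which holds the input between two end markers. -/
inductive InputCell : Type
  | leftEnd
  | letter (a : Symbol)
  | rightEnd

/-- A deterministic Turing transducer with a read-only two-way input tape, `k` work tapes
(infinite to the right) over a finite alphabet, and a write-only output tape.
The value `none` of `step` means that the machine halts. -/
structure Transducer where
  State : Type
  finite_state : Finite State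
  WorkSymbol : Type
  finite_workSymbol : Finite WorkSymbol
  blank : WorkSymbol
  k : ℕ
  start : State
  step : State → InputCell → (Fin k → WorkSymbol) →
    Option (State × Move × (Fin k → WorkSymbol × Move) × Option Symbol)

namespace Transducer

/-- Configurations of a transducer. -/
structure Config (M : Transducer) where
  state : M.State
  inputHead : ℕ
  work : Fin M.k → ℕ → M.WorkSymbol
  workHead : Fin M.k → ℕ
  output : List Symbol

/-- The content of cell `p` of the input tape: the left end marker is in cell `0`, the input `x`
is in the cells `1, …, |x|`, and the right end marker is in cell `|x| + 1`. -/
def inputCell (x : List Symbol) : ℕ → InputCell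
  | 0 => .leftEnd
  | p + 1 => (x[p]?).elim .rightEnd .letter

/-- The input head cannot leave the cells `0, …, n + 1`. -/
def moveInput (n : ℕ) (p : ℕ) : Move → ℕ
  | .left => p - 1
  | .stay => p
  | .right => min (p + 1) (n + 1)

/-- A work head cannot move to the left of cell `0`. -/
def moveWork (p : ℕ) : Move → ℕ
  | .left => p - 1
  | .stay => p
  | .right => p + 1

/-- The initial configuration. -/
def init (M : Transducer) : M.Config where
  state := M.start
  inputHead := 0
  work := fun _ _ => M.blank
  workHead := fun _ => 0
  output := []

/-- One step on input `x`. -/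
def next (M : Transducer) (x : List Symbol) (c : M.Config) : Option M.Config :=
  (M.step c.state (inputCell x c.inputHead) (fun i => c.work i (c.workHead i))).map
    fun r =>
      { state := r.1
        inputHead := moveInput x.length c.inputHead r.2.1
        work := fun i => Function.update (c.work i) (c.workHead i) (r.2.2.1 i).1
        workHead := fun i => moveWork (c.workHead i) (r.2.2.1 i).2
        output := c.output ++ r.2.2.2.toList }

/-- Configuration `c` occurs in the computation of `M` on input `x`. -/
def Reaches (M : Transducer) (x : List Symbol) (c : M.Config) : Prop :=
  StateTransition.Reaches (M.next x) M.init c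

/-- `M` halts on every input `x`, with output `f x`. -/
def Computes (M : Transducer) (f : List Symbol → List Symbol) : Prop :=
  ∀ x, ∃ c, M.Reaches x c ∧ M.next x c = none ∧ c.output = f x

/-- On inputs of length `n` the machine only visits the first `O(log n)` cells of its work tapes. -/
def RunsInLogspace (M : Transducer) : Prop :=
  ∃ C : ℕ, ∀ x c, M.Reaches x c → ∀ i, c.workHead i ≤ C * Nat.log 2 x.length + C

end Transducer

/-- Functions on strings that are computable in deterministic logarithmic space. -/
def LogspaceComputable (f : List Symbol → List Symbol) : Prop :=
  ∃ M : Transducer, M.Computes f ∧ M.RunsInLogspace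

/-! ### Promise problems and reductions -/

/-- A decision problem: an injective encoding of its objects by strings, the objects that
are instances of the problem, and the property that has to be decided for these. -/
structure Problem (ι : Type) where
  enc : ι → List Symbol
  enc_injective : Function.Injective enc
  Valid : ι → Prop
  Yes : ι → Prop

/-- `f` maps (encodings of) instances of `P` to instances of `P'`, positive ones to positive ones
and negative ones to negative ones. -/
def IsReduction {ι κ : Type} (P : Problem ι) (P' : Problem κ)
    (f : List Symbol → List Symbol) : Prop :=
  ∀ I, P.Valid I → ∃ J, f (P.enc I) = P'.enc J ∧ P'.Valid J ∧ (P.Yes I ↔ P'.Yes J)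

/-- Logspace (many-one) reducibility. -/
def LogspaceReduces {ι κ : Type} (P : Problem ι) (P' : Problem κ) : Prop :=
  ∃ f, LogspaceComputable f ∧ IsReduction P P' f

/-- If `f` maps an instance `I` of `P` with property `p` to `J`, then `J` has property `p'`. -/
def Preserves {ι κ : Type} (P : Problem ι) (P' : Problem κ) (f : List Symbol → List Symbol)
    (p : ι → Prop) (p' : κ → Prop) : Prop :=
  ∀ I J, P.Valid I → f (P.enc I) = P'.enc J → p I → p' J

/-! ### Infinite cliques and recurrent reachability -/

/-- There are pairwise distinct `a 0, a 1, …` with `R (a i) (a j)` for all `i < j`. -/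
def HasInfiniteClique {X : Type} (R : X → X → Prop) : Prop :=
  ∃ a : ℕ → X, Function.Injective a ∧ ∀ i j, i < j → R (a i) (a j)

/-- The set `Rec(L)[R]` of all `x` such that there is a sequence `a 0 = x, a 1, …`, not necessarily
of distinct elements, with `R (a i) (a j)` for all `i < j` that visits `L` infinitely often. -/
def Rec {X : Type} (R : X → X → Prop) (L : Set X) : Set X :=
  {x | ∃ a : ℕ → X, a 0 = x ∧ (∀ i j, i < j → R (a i) (a j)) ∧ {i | a i ∈ L}.Infinite}

/-! ### String encodings -/

/-- Names (of states and letters) are bit strings. -/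
abbrev Name : Type := List Bool

def encBit : Bool → Symbol
  | false => .zero
  | true => .one

def encName (s : Name) : List Symbol := .lpar :: s.map encBit ++ [.rpar]

/-- Numbers are encoded in unary. -/
def encUnary (n : ℕ) : List Symbol := encName (List.replicate n true)

def encList {α : Type} (e : α → List Symbol) (l : List α) : List Symbol :=
  .lpar :: l.flatMap e ++ [.rpar]

def encOption {α : Type} (e : α → List Symbol) : Option α → List Symbol
  | none => [.bot]
  | some a => e a

def encPair {α β : Type} (e : α → List Symbol) (e' : β → List Symbol) (p : α × β) : List Symbol :=
  e p.1 ++ e' p.2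

/-- `e` is an injective encoding, no code is a proper prefix of another one, and all codes
begin with a left parenthesis or with `⊥`. -/
structure IsCode {α : Type} (e : α → List Symbol) : Prop where
  inj : ∀ x y r s, e x ++ r = e y ++ s → x = y ∧ r = s
  head : ∀ x, (e x).head? = some .lpar ∨ (e x).head? = some .bot

theorem IsCode.injective {α : Type} {e : α → List Symbol} (h : IsCode e) :
    Function.Injective e := fun x y hxy =>
  (h.inj x y [] [] (by rw [hxy])).1

theorem isCode_encName : IsCode encName where
  inj := by
    intro x y r s h
    simp only [encName, List.cons_append, List.cons.injEq, true_and, List.append_assoc,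
      List.nil_append] at h
    induction x generalizing y with
    | nil =>
      cases y with
      | nil => simpa using h
      | cons b y => cases b <;> simp [encBit] at h
    | cons a x ih =>
      cases y with
      | nil => cases a <;> simp [encBit] at h
      | cons b y =>
        simp only [List.map_cons, List.cons_append, List.cons.injEq] at h
        obtain ⟨h1, h2⟩ := ih y h.2
        refine ⟨?_, h2⟩
        subst h1
        have := h.1
        cases a <;> cases b <;> simp_all [encBit]
  head := fun x => by simp [encName]

theorem isCode_encUnary : IsCode encUnary where
  inj := by
    intro x y r s h
    obtain ⟨h1, h2⟩ := isCode_encName.inj _ _ r s h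
    exact ⟨by simpa using congrArg List.length h1, h2⟩
  head := fun x => isCode_encName.head _

theorem IsCode.list {α : Type} {e : α → List Symbol} (he : IsCode e) : IsCode (encList e) where
  inj := by
    have key : ∀ (a : α) (t u : List Symbol), e a ++ t ≠ .rpar :: u := by
      intro a t u h
      have h' := he.head a
      cases hx : e a with
      | nil => simp [hx] at h'
      | cons b l =>
        rw [hx] at h h'
        simp only [List.cons_append, List.cons.injEq] at h
        rw [h.1] at h'
        simp at h'
    intro x y r s h
    simp only [encList, List.cons_append, List.cons.injEq, true_and, List.append_assoc,
      List.nil_append] at h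
    induction x generalizing y with
    | nil =>
      cases y with
      | nil => simpa using h
      | cons b y =>
        simp only [List.flatMap_nil, List.nil_append, List.flatMap_cons, List.append_assoc] at h
        exact absurd h.symm (key _ _ _)
    | cons a x ih =>
      cases y with
      | nil =>
        simp only [List.flatMap_nil, List.nil_append, List.flatMap_cons, List.append_assoc] at h
        exact absurd h (key _ _ _)
      | cons b y =>
        simp only [List.flatMap_cons, List.append_assoc] at h
        obtain ⟨h1, h2⟩ := he.inj _ _ _ _ h
        obtain ⟨h3, h4⟩ := ih y h2
        exact ⟨by rw [h1, h3], h4⟩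
  head := fun x => by simp [encList]

theorem IsCode.pair {α β : Type} {e : α → List Symbol} {e' : β → List Symbol}
    (he : IsCode e) (he' : IsCode e') : IsCode (encPair e e') where
  inj := by
    rintro ⟨x, x'⟩ ⟨y, y'⟩ r s h
    simp only [encPair, List.append_assoc] at h
    obtain ⟨h1, h2⟩ := he.inj _ _ _ _ h
    obtain ⟨h3, h4⟩ := he'.inj _ _ _ _ h2
    exact ⟨by rw [h1, h3], h4⟩
  head := by
    rintro ⟨x, x'⟩
    rcases he.head x with h | h <;> simp [encPair, h]

/-- For the encoding of an optional object no code of an object may be the one of `⊥`. -/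
theorem IsCode.option {α : Type} {e : α → List Symbol} (he : IsCode e)
    (hb : ∀ x, (e x).head? = some .lpar) : IsCode (encOption e) where
  inj := by
    have key : ∀ (a : α) (t u : List Symbol), e a ++ t ≠ .bot :: u := by
      intro a t u h
      have h' := hb a
      cases hx : e a with
      | nil => simp [hx] at h'
      | cons b l =>
        rw [hx] at h h'
        simp only [List.cons_append, List.cons.injEq] at h
        rw [h.1] at h'
        simp at h'
    intro x y r s h
    cases x with
    | none =>
      cases y with
      | none => simpa [encOption] using h
      | some b => exact absurd h.symm (key b s r)
    | some a =>
      cases y with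
      | none => exact absurd h (key a r s)
      | some b =>
        obtain ⟨h1, h2⟩ := he.inj a b r s h
        exact ⟨by rw [h1], h2⟩
  head := by
    rintro (_ | x)
    · simp [encOption]
    · exact he.head x

/-! ### Words and word automata -/

/-- Letters are named by bit strings. An automaton has finitely many transitions, so it only deals
with the finite alphabet of the letters that occur in them. -/
abbrev Letter : Type := Name

abbrev Word : Type := List Letter

/-- An NFA over `α`, possibly with `ε`-transitions (those with `none` in the middle).
Its states are the names that occur in it. -/
structure WordAutomaton (α : Type) where
  start : Name
  final : List Name
  trans : List (Name × Option α × Name)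

namespace WordAutomaton

variable {α : Type}

/-- The automaton as an object of Mathlib. -/
def toεNFA (A : WordAutomaton α) : εNFA α Name where
  step q a := {q' | (q, a, q') ∈ A.trans}
  start := {A.start}
  accept := {q | q ∈ A.final}

/-- The language recognized by the automaton. -/
def accepts (A : WordAutomaton α) : Set (List α) := A.toεNFA.accepts

/-- The automaton is a (not necessarily complete) DFA. -/
def IsDFA (A : WordAutomaton α) : Prop :=
  (∀ q q', (q, none, q') ∉ A.trans) ∧
  ∀ q a q₁ q₂, (q, some a, q₁) ∈ A.trans → (q, some a, q₂) ∈ A.trans → q₁ = q₂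

def enc (e : α → List Symbol) (A : WordAutomaton α) : List Symbol :=
  encName A.start ++ (encList encName A.final ++
    encList (encPair encName (encPair (encOption e) encName)) A.trans)

theorem isCode_enc {e : α → List Symbol} (he : IsCode (encOption e)) : IsCode (enc e) where
  inj := by
    rintro ⟨x, x', x''⟩ ⟨y, y', y''⟩ r s h
    simp only [enc, List.append_assoc] at h
    obtain ⟨h1, h⟩ := isCode_encName.inj _ _ _ _ h
    obtain ⟨h2, h⟩ := isCode_encName.list.inj _ _ _ _ h
    obtain ⟨h3, h⟩ := (isCode_encName.pair (he.pair isCode_encName)).list.inj _ _ _ _ h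
    exact ⟨by rw [h1, h2, h3], h⟩
  head := fun x => by simp [enc, encName]

end WordAutomaton

/-- The convolution `u ⊗ v`, where `none` stands for the padding symbol `⊥`. -/
def Word.conv (u v : Word) : List (Option Letter × Option Letter) := List.zipWithAll Prod.mk u v

/-- Automata over `Σ_⊥ × Σ_⊥`. -/
abbrev WordPairAutomaton : Type := WordAutomaton (Option Letter × Option Letter)

/-- The automaton recognizes the relation `R`. -/
def WordPairAutomaton.Recognizes (A : WordPairAutomaton) (R : Word → Word → Prop) : Prop :=
  A.accepts = {x | ∃ u v, R u v ∧ x = Word.conv u v}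

/-- The set of pairs of words whose convolution is accepted. If the automaton recognizes any
relation, then it recognizes this one and no other. -/
def WordPairAutomaton.rel (A : WordPairAutomaton) (u v : Word) : Prop := Word.conv u v ∈ A.accepts

/-- Letters of `Σ_⊥ × Σ_⊥` are put in parentheses, to tell them from `ε`. -/
def encLetterPair (p : Option Letter × Option Letter) : List Symbol :=
  .lpar :: encPair (encOption encName) (encOption encName) p

theorem isCode_encOption_encName : IsCode (encOption encName) :=
  isCode_encName.option fun x => by simp [encName]

theorem isCode_encLetterPair : IsCode encLetterPair where
  inj := by
    intro x y r s h
    simp only [encLetterPair, List.cons_append, List.cons.injEq, true_and] at h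
    exact (isCode_encOption_encName.pair isCode_encOption_encName).inj _ _ _ _ h
  head := fun x => by simp [encLetterPair]

/-- The string that presents an automaton for a word relation. -/
def WordPairAutomaton.code : WordPairAutomaton → List Symbol := WordAutomaton.enc encLetterPair

theorem WordPairAutomaton.isCode_code : IsCode WordPairAutomaton.code :=
  WordAutomaton.isCode_enc (isCode_encLetterPair.option fun x => by simp [encLetterPair])

/-- An input of recurrent reachability over words: automata for `R` and `L`, and a word. -/
structure WordRecInput where
  R : WordPairAutomaton
  L : WordAutomaton Letter
  w : Word

def WordRecInput.code (I : WordRecInput) : List Symbol :=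
  I.R.code ++ (I.L.enc encName ++ encList encName I.w)

theorem WordRecInput.code_injective : Function.Injective WordRecInput.code := by
  rintro ⟨x, x', x''⟩ ⟨y, y', y''⟩ h
  simp only [code] at h
  obtain ⟨h1, h⟩ := WordPairAutomaton.isCode_code.inj _ _ _ _ h
  obtain ⟨h2, h⟩ := (WordAutomaton.isCode_enc isCode_encOption_encName).inj _ _ _ _ h
  rw [h1, h2, isCode_encName.list.injective h]

/-- The kinds of word automata by which relations and languages can be given. -/
inductive WordModel : Type
  | nfa
  | dfa

def WordModel.Holds {α : Type} : WordModel → WordAutomaton α → Prop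
  | .nfa, _ => True
  | .dfa, A => A.IsDFA

/-- The infinite clique problem over regular relations given by automata of kind `K`. -/
def wordClique (K : WordModel) : Problem WordPairAutomaton where
  enc := WordPairAutomaton.code
  enc_injective := WordPairAutomaton.isCode_code.injective
  Valid A := K.Holds A ∧ A.Recognizes A.rel
  Yes A := HasInfiniteClique A.rel

/-- Recurrent reachability over regular relations given by automata of kind `K`. -/
def wordRec (K : WordModel) : Problem WordRecInput where
  enc := WordRecInput.code
  enc_injective := WordRecInput.code_injective
  Valid I := K.Holds I.R ∧ K.Holds I.L ∧ I.R.Recognizes I.R.rel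
  Yes I := I.w ∈ Rec I.R.rel I.L.accepts

/-! ### Ranked trees and tree automata -/

/-- Finite ranked trees over a ranked alphabet. -/
inductive RankedTree {α : Type} (rk : α → ℕ) : Type
  | node (a : α) (children : Fin (rk a) → RankedTree rk) : RankedTree rk

/-- Letters of the ranked alphabets. -/
structure RankedLetter where
  name : Name
  rank : ℕ

abbrev Tree : Type := RankedTree RankedLetter.rank

/-- A transition `(q, a, q₁, …, q_r)`, where `r` is the rank of `a`. -/
structure TreeTransition {α : Type} (rk : α → ℕ) where
  source : Name
  letter : α
  targets : Fin (rk letter) → Name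

/-- Tree automata. The states are the names that occur in the automaton. In an accepting run
the root has to be labeled by a state in `root`: these are the initial states if one reads the
automaton top-down and the final states if one reads it bottom-up. -/
structure TreeAutomaton {α : Type} (rk : α → ℕ) where
  root : List Name
  trans : List (TreeTransition rk)

namespace TreeAutomaton

variable {α : Type} {rk : α → ℕ}

/-- There is a run on the given tree with the given state at the root. -/
def HasRun (A : TreeAutomaton rk) : RankedTree rk → Name → Prop
  | .node a c, q => ∃ qs : Fin (rk a) → Name, ⟨q, a, qs⟩ ∈ A.trans ∧ ∀ i, A.HasRun (c i) (qs i)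

/-- The tree language recognized by the automaton. -/
def accepts (A : TreeAutomaton rk) : Set (RankedTree rk) := {t | ∃ q ∈ A.root, A.HasRun t q}

/-- Nondeterministic (top-down) tree automata have one initial state. -/
def IsNTA (A : TreeAutomaton rk) : Prop := ∃ q, A.root = [q]

/-- Deterministic top-down tree automata (not necessarily complete). -/
def IsTopDownDet (A : TreeAutomaton rk) : Prop :=
  A.IsNTA ∧ ∀ q a (qs qs' : Fin (rk a) → Name),
    ⟨q, a, qs⟩ ∈ A.trans → ⟨q, a, qs'⟩ ∈ A.trans → qs = qs'

/-- Deterministic bottom-up tree automata (not necessarily complete, any set of final states). -/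
def IsBottomUpDet (A : TreeAutomaton rk) : Prop :=
  ∀ q q' a (qs : Fin (rk a) → Name), ⟨q, a, qs⟩ ∈ A.trans → ⟨q', a, qs⟩ ∈ A.trans → q = q'

end TreeAutomaton

def TreeTransition.enc {α : Type} {rk : α → ℕ} (e : α → List Symbol) (t : TreeTransition rk) :
    List Symbol :=
  encName t.source ++ (e t.letter ++ encList encName (List.ofFn t.targets))

theorem TreeTransition.isCode_enc {α : Type} {rk : α → ℕ} {e : α → List Symbol} (he : IsCode e) :
    IsCode (TreeTransition.enc (rk := rk) e) where
  inj := by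
    rintro ⟨q, a, t⟩ ⟨q', a', t'⟩ r s h
    simp only [enc, List.append_assoc] at h
    obtain ⟨h1, h⟩ := isCode_encName.inj _ _ _ _ h
    obtain ⟨h2, h'⟩ := he.inj _ _ _ _ h
    clear h
    subst h1 h2
    obtain ⟨h3, h4⟩ := isCode_encName.list.inj _ _ _ _ h'
    exact ⟨by rw [List.ofFn_injective h3], h4⟩
  head := fun x => by simp [enc, encName]

def TreeAutomaton.enc {α : Type} {rk : α → ℕ} (e : α → List Symbol) (A : TreeAutomaton rk) :
    List Symbol :=
  encList encName A.root ++ encList (TreeTransition.enc e) A.trans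

theorem TreeAutomaton.isCode_enc {α : Type} {rk : α → ℕ} {e : α → List Symbol} (he : IsCode e) :
    IsCode (TreeAutomaton.enc (rk := rk) e) where
  inj := by
    rintro ⟨x, x'⟩ ⟨y, y'⟩ r s h
    simp only [enc, List.append_assoc] at h
    obtain ⟨h1, h⟩ := isCode_encName.list.inj _ _ _ _ h
    obtain ⟨h2, h⟩ := (TreeTransition.isCode_enc he).list.inj _ _ _ _ h
    exact ⟨by rw [h1, h2], h⟩
  head := fun x => by simp [enc, encList]

/-- The rank of a letter of `Σ_⊥ × Σ_⊥` is the maximum of the ranks, where `⊥` has rank `0`. -/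
def pairRank (p : Option RankedLetter × Option RankedLetter) : ℕ :=
  max (p.1.elim 0 RankedLetter.rank) (p.2.elim 0 RankedLetter.rank)

/-- Ranked trees over `Σ_⊥ × Σ_⊥`. -/
abbrev PairTree : Type := RankedTree pairRank

/-- The convolution of `t` with the empty tree. -/
def Tree.convLeft : Tree → PairTree
  | .node a c => .node (some a, none) fun i =>
      Tree.convLeft (c ⟨i, lt_of_lt_of_eq i.isLt (Nat.max_zero a.rank)⟩)

/-- The convolution of the empty tree with `t`. -/
def Tree.convRight : Tree → PairTree
  | .node a c => .node (none, some a) fun i =>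
      Tree.convRight (c ⟨i, lt_of_lt_of_eq i.isLt (Nat.zero_max a.rank)⟩)

/-- The convolution `s ⊗ t`. -/
def Tree.conv : Tree → Tree → PairTree
  | .node a c, .node b d => .node (some a, some b) fun i =>
      if h : i < a.rank then
        if h' : i < b.rank then Tree.conv (c ⟨i, h⟩) (d ⟨i, h'⟩) else Tree.convLeft (c ⟨i, h⟩)
      else Tree.convRight (d ⟨i, (lt_max_iff.mp i.isLt).resolve_left h⟩)

/-- Tree automata over `Σ_⊥ × Σ_⊥`. -/
abbrev TreePairAutomaton : Type := TreeAutomaton pairRank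

/-- The automaton recognizes the relation `R`. -/
def TreePairAutomaton.Recognizes (A : TreePairAutomaton) (R : Tree → Tree → Prop) : Prop :=
  A.accepts = {x | ∃ s t, R s t ∧ x = Tree.conv s t}

/-- The set of pairs of trees whose convolution is accepted. If the automaton recognizes any
relation, then it recognizes this one and no other. -/
def TreePairAutomaton.rel (A : TreePairAutomaton) (s t : Tree) : Prop := Tree.conv s t ∈ A.accepts

def encRankedLetter (a : RankedLetter) : List Symbol := encName a.name ++ encUnary a.rank

theorem isCode_encRankedLetter : IsCode encRankedLetter where
  inj := by
    rintro ⟨x, x'⟩ ⟨y, y'⟩ r s h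
    simp only [encRankedLetter, List.append_assoc] at h
    obtain ⟨h1, h⟩ := isCode_encName.inj _ _ _ _ h
    obtain ⟨h2, h⟩ := isCode_encUnary.inj _ _ _ _ h
    exact ⟨by rw [h1, h2], h⟩
  head := fun x => by simp [encRankedLetter, encName]

def encRankedLetterPair : Option RankedLetter × Option RankedLetter → List Symbol :=
  encPair (encOption encRankedLetter) (encOption encRankedLetter)

theorem isCode_encRankedLetterPair : IsCode encRankedLetterPair :=
  have h : IsCode (encOption encRankedLetter) :=
    isCode_encRankedLetter.option fun x => by simp [encRankedLetter, encName]
  h.pair h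

/-- Trees are written in prefix notation. -/
def Tree.enc : Tree → List Symbol
  | .node a c => encRankedLetter a ++ (List.ofFn fun i => Tree.enc (c i)).flatten

theorem Tree.isCode_enc : IsCode Tree.enc where
  inj := by
    have aux : ∀ (n : ℕ) (c d : Fin n → Tree)
        (_ : ∀ i y r s, Tree.enc (c i) ++ r = Tree.enc y ++ s → c i = y ∧ r = s)
        (r s : List Symbol), (List.ofFn fun i => Tree.enc (c i)).flatten ++ r =
          (List.ofFn fun i => Tree.enc (d i)).flatten ++ s → c = d ∧ r = s := by
      intro n
      induction n with
      | zero => exact fun c d _ r s h => ⟨Subsingleton.elim _ _, by simpa using h⟩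
      | succ n ih =>
        intro c d hc r s h
        simp only [List.ofFn_succ, List.flatten_cons, List.append_assoc] at h
        obtain ⟨h1, h⟩ := hc _ _ _ _ h
        obtain ⟨h2, h⟩ := ih (fun i => c i.succ) (fun i => d i.succ) (fun i => hc i.succ) r s h
        refine ⟨funext fun i => ?_, h⟩
        cases i using Fin.cases with
        | zero => exact h1
        | succ i => exact congrFun h2 i
    intro x
    induction x with
    | node a c ih =>
      rintro ⟨b, d⟩ r s h
      simp only [Tree.enc, List.append_assoc] at h
      obtain ⟨h1, h⟩ := isCode_encRankedLetter.inj _ _ _ _ h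
      subst h1
      obtain ⟨h2, h⟩ := aux _ c d ih r s h
      exact ⟨by rw [h2], h⟩
  head := by
    rintro ⟨a, c⟩
    simp [Tree.enc, encRankedLetter, encName]

/-- The string that presents an automaton for a tree relation. -/
def TreePairAutomaton.code : TreePairAutomaton → List Symbol :=
  TreeAutomaton.enc encRankedLetterPair

theorem TreePairAutomaton.isCode_code : IsCode TreePairAutomaton.code :=
  TreeAutomaton.isCode_enc isCode_encRankedLetterPair

/-- An input of recurrent reachability over trees: automata for `R` and `L`, and a tree. -/
structure TreeRecInput where
  R : TreePairAutomaton
  L : TreeAutomaton RankedLetter.rank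
  t : Tree

def TreeRecInput.code (I : TreeRecInput) : List Symbol :=
  I.R.code ++ (I.L.enc encRankedLetter ++ I.t.enc)

theorem TreeRecInput.code_injective : Function.Injective TreeRecInput.code := by
  rintro ⟨x, x', x''⟩ ⟨y, y', y''⟩ h
  simp only [code] at h
  obtain ⟨h1, h⟩ := TreePairAutomaton.isCode_code.inj _ _ _ _ h
  obtain ⟨h2, h⟩ := (TreeAutomaton.isCode_enc isCode_encRankedLetter).inj _ _ _ _ h
  rw [h1, h2, Tree.isCode_enc.injective h]

/-- The kinds of tree automata by which relations and languages can be given. -/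
inductive TreeModel : Type
  | nta
  | topDownDet
  | bottomUpDet

def TreeModel.Holds {α : Type} {rk : α → ℕ} : TreeModel → TreeAutomaton rk → Prop
  | .nta, A => A.IsNTA
  | .topDownDet, A => A.IsTopDownDet
  | .bottomUpDet, A => A.IsBottomUpDet

/-- The infinite clique problem over tree-regular relations given by automata of kind `K`. -/
def treeClique (K : TreeModel) : Problem TreePairAutomaton where
  enc := TreePairAutomaton.code
  enc_injective := TreePairAutomaton.isCode_code.injective
  Valid A := K.Holds A ∧ A.Recognizes A.rel
  Yes A := HasInfiniteClique A.rel

/-- Recurrent reachability over tree-regular relations given by automata of kind `K`. -/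
def treeRec (K : TreeModel) : Problem TreeRecInput where
  enc := TreeRecInput.code
  enc_injective := TreeRecInput.code_injective
  Valid I := K.Holds I.R ∧ K.Holds I.L ∧ I.R.Recognizes I.R.rel
  Yes I := I.t ∈ Rec I.R.rel I.L.accepts

end AutRel

/-! From cliques to recurrent reachability. An automaton only uses finitely many letters, and there
are only finitely many words (trees) of bounded length (height) over them. So along a suitable
subsequence of an infinite clique, length or height grows strictly. One may therefore keep only
those pairs of the relation whose second component is longer (for trees: has a node that the first
one lacks). This condition is visible in the convolution as a letter without first component, and it
forces the elements of a sequence to be distinct. What remains is to supply a starting point: the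
empty word, or a special tree, is related to everything over the alphabet that may follow. The set
to be visited infinitely often consists of everything over the alphabet, so recurrence is no
restriction. See `WordPairAutomaton.hasInfiniteClique_iff` and
`TreePairAutomaton.hasInfiniteClique_iff`.

From recurrent reachability to cliques. A witness that starts with `w` can be thinned out to members
of `L`, after which all later elements `y` satisfy `R w y` and `y ∈ L`. These are conditions on the
second component of a pair, so they can be built into the relation. The elements may still repeat,
hence each gets a number that has to increase strictly along the relation. Conversely one forgets
the numbers and puts `w` in front. For words the number is the length after padding with a new
symbol. For trees it is the length of a chain that hangs next to the tree under a new binary root.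
See `WordRecInput.mem_rec_iff` and `TreeRecInput.mem_rec_iff`. Transitivity is inherited because all
conditions compose.

The automaton of the new relation is a product of three simulations, which run `R` on `(x, y)`, `L`
on `y`, and `R` on `(w, y)`. A word automaton keeps the unread rest of `w` in its state. A bottom-up
tree automaton does not know where in the tree it is, so the subtree of `w` at a node is written
into the label of that node (`overlayTree`), from which either kind of deterministic automaton can
read it. Removing transitions on the pair of blanks and adding one state for what lies beyond the
end keeps the simulated automata deterministic.

Logarithmic space. Counters of polynomial size fit in logarithmic space in binary, so programs with
finitely many such counters suffice (`LogspaceComputable.of_prog`). On top of these programs there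
is a calculus of numerical functions `Num`, tests `Test` and outputs `Out`, closed under
composition, case distinction, bounded iteration and loops. The reductions are nested loops over
positions in the input at which states, transitions, suffixes or subtrees are written. The lemmas
with names ending in `Reduction_code` identify their outputs with the codes of the constructed
instances. -/

namespace AutRel

/-! ### Counter programs with polynomially bounded counters run in logarithmic space. -/

/-! ### Structured counter programs -/

/-- Elementary actions of counter programs. -/
inductive Action : Type
  | emit (s : Symbol)
  | inc (i : ℕ)
  | dec (i : ℕ)
  | move (m : Move)

/-- Conditions that counter programs can test. -/
inductive Cond : Type
  | nonzero (i : ℕ)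
  | cell (f : InputCell → Bool)

/-- Structured programs with counters and a two-way read-only input head. -/
inductive Prog : Type
  | skip
  | act (a : Action)
  | seq (p q : Prog)
  | ite (c : Cond) (p q : Prog)
  | loop (c : Cond) (p : Prog)

/-- The memory of a counter program. -/
structure Store where
  head : ℕ
  reg : ℕ → ℕ
  out : List Symbol

def Cond.holds (x : List Symbol) : Cond → Store → Bool
  | .nonzero i, σ => σ.reg i != 0
  | .cell f, σ => f (Transducer.inputCell x σ.head)

/-- The effect of an action on input `x`, when counters must not exceed `B`. -/
inductive Action.Runs (B : ℕ) (x : List Symbol) : Action → Store → Store → Prop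
  | emit (s : Symbol) (σ : Store) : Runs B x (.emit s) σ { σ with out := σ.out ++ [s] }
  | inc (i : ℕ) (σ : Store) (h : σ.reg i < B) :
      Runs B x (.inc i) σ { σ with reg := Function.update σ.reg i (σ.reg i + 1) }
  | dec (i : ℕ) (σ : Store) (h : 0 < σ.reg i) :
      Runs B x (.dec i) σ { σ with reg := Function.update σ.reg i (σ.reg i - 1) }
  | move (m : Move) (σ : Store) :
      Runs B x (.move m) σ { σ with head := Transducer.moveInput x.length σ.head m }

/-- Terminating computations of programs on input `x`, with counters bounded by `B`. -/
inductive Prog.Runs (B : ℕ) (x : List Symbol) : Prog → Store → Store → Prop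
  | skip (σ : Store) : Runs B x .skip σ σ
  | act {a : Action} {σ σ' : Store} (h : a.Runs B x σ σ') : Runs B x (.act a) σ σ'
  | seq {p q : Prog} {σ σ' σ'' : Store} (h : Runs B x p σ σ') (h' : Runs B x q σ' σ'') :
      Runs B x (.seq p q) σ σ''
  | iteTrue {c : Cond} {p q : Prog} {σ σ' : Store} (hc : c.holds x σ = true)
      (h : Runs B x p σ σ') : Runs B x (.ite c p q) σ σ'
  | iteFalse {c : Cond} {p q : Prog} {σ σ' : Store} (hc : c.holds x σ = false)
      (h : Runs B x q σ σ') : Runs B x (.ite c p q) σ σ'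
  | loopTrue {c : Cond} {p : Prog} {σ σ' σ'' : Store} (hc : c.holds x σ = true)
      (h : Runs B x p σ σ') (h' : Runs B x (.loop c p) σ' σ'') : Runs B x (.loop c p) σ σ''
  | loopFalse {c : Cond} {p : Prog} {σ : Store} (hc : c.holds x σ = false) :
      Runs B x (.loop c p) σ σ

theorem Action.Runs.mono {B B' : ℕ} (hB : B ≤ B') {x : List Symbol} {a : Action} {σ σ' : Store}
    (h : a.Runs B x σ σ') : a.Runs B' x σ σ' := by
  cases h with
  | emit => exact .emit _ _
  | inc i _ h => exact .inc _ _ (h.trans_le hB)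
  | dec i _ h => exact .dec _ _ h
  | move => exact .move _ _

theorem Prog.Runs.mono {B B' : ℕ} (hB : B ≤ B') {x : List Symbol} {p : Prog} {σ σ' : Store}
    (h : p.Runs B x σ σ') : p.Runs B' x σ σ' := by
  induction h with
  | skip => exact .skip _
  | act h => exact .act (h.mono hB)
  | seq _ _ h h' => exact .seq h h'
  | iteTrue hc _ h => exact .iteTrue hc h
  | iteFalse hc _ h => exact .iteFalse hc h
  | loopTrue hc _ _ h h' => exact .loopTrue hc h h'
  | loopFalse hc => exact .loopFalse hc

/-- Serves sequential composition: the bound of the first run is the size of the data with which the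
second run starts. -/
theorem Prog.Runs.reg_le {B : ℕ} {x : List Symbol} {p : Prog} {σ σ' : Store}
    (h : p.Runs B x σ σ') (hσ : ∀ i, σ.reg i ≤ B) : ∀ i, σ'.reg i ≤ B := by
  induction h with
  | skip => exact hσ
  | act h =>
    cases h with
    | emit => exact hσ
    | inc i _ h =>
      intro j
      by_cases hj : j = i
      · subst hj; simpa using h
      · simpa [hj] using hσ j
    | dec i _ h =>
      intro j
      by_cases hj : j = i
      · subst hj; simpa using (hσ j).trans (Nat.le_succ B)
      · simpa [hj] using hσ j
    | move => exact hσ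
  | seq _ _ h h' => exact h' (h hσ)
  | iteTrue hc _ h => exact h hσ
  | iteFalse hc _ h => exact h hσ
  | loopTrue hc _ _ h h' => exact h' (h hσ)
  | loopFalse hc => exact hσ

/-! ### Flow charts -/

/-- Instructions of flow charts, with their successors. -/
inductive Instr (S : Type) : Type
  | act (a : Action) (s : S)
  | test (c : Cond) (s t : S)

def Instr.map {S T : Type} (f : S → T) : Instr S → Instr T
  | .act a s => .act a (f s)
  | .test c s t => .test c (f s) (f t)

/-- Flow charts with one exit, which is written `none`. -/
structure Flow where
  Pos : Type
  finite_pos : Finite Pos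
  entry : Pos
  instr : Pos → Instr (Option Pos)

namespace Flow

inductive Step (F : Flow) (B : ℕ) (x : List Symbol) :
    Option F.Pos × Store → Option F.Pos × Store → Prop
  | act {s : F.Pos} {a : Action} {o : Option F.Pos} {σ σ' : Store} (hs : F.instr s = .act a o)
      (h : a.Runs B x σ σ') : Step F B x (some s, σ) (o, σ')
  | testTrue {s : F.Pos} {c : Cond} {o o' : Option F.Pos} {σ : Store}
      (hs : F.instr s = .test c o o') (hc : c.holds x σ = true) : Step F B x (some s, σ) (o, σ)
  | testFalse {s : F.Pos} {c : Cond} {o o' : Option F.Pos} {σ : Store}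
      (hs : F.instr s = .test c o o') (hc : c.holds x σ = false) : Step F B x (some s, σ) (o', σ)

abbrev Steps (F : Flow) (B : ℕ) (x : List Symbol) := Relation.ReflTransGen (F.Step B x)

/-- A flow chart `F` can be embedded into `G`, the exit being mapped to `out`. -/
theorem Steps.embed {F G : Flow} (f : F.Pos → G.Pos) (out : Option G.Pos)
    (hf : ∀ s, G.instr (f s) = (F.instr s).map fun o => o.elim out (some ∘ f))
    {B : ℕ} {x : List Symbol} {c c' : Option F.Pos × Store} (h : F.Steps B x c c') :
    G.Steps B x (c.1.elim out (some ∘ f), c.2) (c'.1.elim out (some ∘ f), c'.2) := by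
  refine Relation.ReflTransGen.lift
    (fun c : Option F.Pos × Store => ((c.1.elim out (some ∘ f), c.2) : Option G.Pos × Store))
    ?_ _ _ h
  intro c c' h
  cases h with
  | @act s a o σ σ' hs h =>
    exact .act (o := o.elim out (some ∘ f)) (by rw [hf, hs]; rfl) h
  | @testTrue s c o o' σ hs hc =>
    exact .testTrue (o := o.elim out (some ∘ f)) (o' := o'.elim out (some ∘ f))
      (by rw [hf, hs]; rfl) hc
  | @testFalse s c o o' σ hs hc =>
    exact .testFalse (o := o.elim out (some ∘ f)) (o' := o'.elim out (some ∘ f))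
      (by rw [hf, hs]; rfl) hc

/-- The flow chart with a single action. -/
def act (a : Action) : Flow := ⟨Unit, inferInstance, (), fun _ => .act a none⟩

/-- The flow chart that does nothing. -/
def skip : Flow := ⟨Unit, inferInstance, (), fun _ => .test (.nonzero 0) none none⟩

/-- Sequential composition. -/
def seq (F G : Flow) : Flow where
  Pos := F.Pos ⊕ G.Pos
  finite_pos := by
    have := F.finite_pos
    have := G.finite_pos
    infer_instance
  entry := .inl F.entry
  instr := Sum.elim
    (fun s => (F.instr s).map fun o => o.elim (some (.inr G.entry)) (some ∘ .inl))
    (fun s => (G.instr s).map fun o => o.elim none (some ∘ .inr))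

/-- Conditional branching. -/
def ite (c : Cond) (F G : Flow) : Flow where
  Pos := Option (F.Pos ⊕ G.Pos)
  finite_pos := by
    have := F.finite_pos
    have := G.finite_pos
    infer_instance
  entry := none
  instr := fun
    | none => .test c (some (some (.inl F.entry))) (some (some (.inr G.entry)))
    | some (.inl s) => (F.instr s).map fun o => o.elim none (some ∘ some ∘ .inl)
    | some (.inr s) => (G.instr s).map fun o => o.elim none (some ∘ some ∘ .inr)

/-- While loops. -/
def loop (c : Cond) (F : Flow) : Flow where
  Pos := Option F.Pos
  finite_pos := by
    have := F.finite_pos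
    infer_instance
  entry := none
  instr := fun
    | none => .test c (some (some F.entry)) none
    | some s => (F.instr s).map fun o => o.elim (some none) (some ∘ some)

end Flow

/-- The flow chart of a program. -/
def Prog.flow : Prog → Flow
  | .skip => .skip
  | .act a => .act a
  | .seq p q => p.flow.seq q.flow
  | .ite c p q => .ite c p.flow q.flow
  | .loop c p => .loop c p.flow

/-- The chart of a compound program contains copies of the charts of its parts, so the runs of the
parts are transported by `Flow.Steps.embed`; only the place to which an exit leads differs. -/
theorem Prog.Runs.steps {B : ℕ} {x : List Symbol} {p : Prog} {σ σ' : Store}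
    (h : p.Runs B x σ σ') : p.flow.Steps B x (some p.flow.entry, σ) (none, σ') := by
  induction h with
  | skip σ =>
    -- Every position needs an instruction; `skip` is a test both of whose branches lead to the
    -- exit.
    cases hc : (Cond.nonzero 0).holds x σ
    · exact .single (Flow.Step.testFalse (F := Flow.skip) (s := ()) rfl hc)
    · exact .single (Flow.Step.testTrue (F := Flow.skip) (s := ()) rfl hc)
  | @act a σ σ' h => exact .single (Flow.Step.act (F := Flow.act a) (s := ()) rfl h)
  | @seq p q σ σ' σ'' _ _ h h' =>
    refine (Flow.Steps.embed (G := p.flow.seq q.flow) Sum.inl (some (Sum.inr q.flow.entry))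
      (fun s => rfl) h).trans ?_
    exact Flow.Steps.embed (G := p.flow.seq q.flow) Sum.inr none (fun s => rfl) h'
  | @iteTrue c p q σ σ' hc _ h =>
    refine .head (Flow.Step.testTrue (F := Flow.ite c p.flow q.flow) (s := none) rfl hc) ?_
    exact Flow.Steps.embed (G := Flow.ite c p.flow q.flow) (some ∘ Sum.inl) none (fun s => rfl) h
  | @iteFalse c p q σ σ' hc _ h =>
    refine .head (Flow.Step.testFalse (F := Flow.ite c p.flow q.flow) (s := none) rfl hc) ?_
    exact Flow.Steps.embed (G := Flow.ite c p.flow q.flow) (some ∘ Sum.inr) none (fun s => rfl) h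
  | @loopTrue c p σ σ' σ'' hc _ _ h h' =>
    refine .head (Flow.Step.testTrue (F := Flow.loop c p.flow) (s := none) rfl hc) ?_
    -- The exit of the body is glued to the test, where the run `h'` of the remaining rounds begins.
    exact (Flow.Steps.embed (G := Flow.loop c p.flow) some (some none) (fun s => rfl) h).trans h'
  | @loopFalse c p σ hc =>
    exact .single (Flow.Step.testFalse (F := Flow.loop c p.flow) (s := none) rfl hc)

/-- All counters that occur have numbers below `k`. -/
def Action.Uses (k : ℕ) : Action → Prop
  | .inc i => i < k
  | .dec i => i < k
  | _ => True

def Cond.Uses (k : ℕ) : Cond → Prop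
  | .nonzero i => i < k
  | _ => True

def Instr.Uses {S : Type} (k : ℕ) : Instr S → Prop
  | .act a _ => a.Uses k
  | .test c _ _ => c.Uses k

theorem Instr.uses_map {S T : Type} (k : ℕ) (f : S → T) (i : Instr S) :
    (i.map f).Uses k ↔ i.Uses k := by
  cases i <;> rfl

theorem Action.exists_uses (a : Action) : ∃ k, ∀ k' ≥ k, a.Uses k' := by
  cases a with
  | inc i => exact ⟨i + 1, fun _ h => h⟩
  | dec i => exact ⟨i + 1, fun _ h => h⟩
  | _ => exact ⟨0, fun _ _ => trivial⟩

theorem Cond.exists_uses (c : Cond) : ∃ k, ∀ k' ≥ k, c.Uses k' := by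
  cases c with
  | nonzero i => exact ⟨i + 1, fun _ h => h⟩
  | _ => exact ⟨0, fun _ _ => trivial⟩

/-- The number of work tapes must be fixed in advance. The claim covers all larger numbers too, so
that the maximum serves for compound programs. -/
theorem Prog.exists_uses (p : Prog) : ∃ k, ∀ k' ≥ k, ∀ s, (p.flow.instr s).Uses k' := by
  induction p with
  -- The chart of `skip` tests counter 0, so one counter is needed even here.
  | skip => exact ⟨1, fun k hk _ => (hk : 0 < k)⟩
  | act a => exact a.exists_uses.imp fun k h k' hk' _ => h k' hk'
  | seq p q hp hq =>
    obtain ⟨k, hk⟩ := hp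
    obtain ⟨l, hl⟩ := hq
    refine ⟨max k l, fun m hm s => ?_⟩
    rcases s with s | s
    · exact (Instr.uses_map _ _ _).2 (hk m (le_of_max_le_left hm) s)
    · exact (Instr.uses_map _ _ _).2 (hl m (le_of_max_le_right hm) s)
  | ite c p q hp hq =>
    obtain ⟨k, hk⟩ := hp
    obtain ⟨l, hl⟩ := hq
    obtain ⟨j, hj⟩ := c.exists_uses
    refine ⟨max j (max k l), fun m hm s => ?_⟩
    have hm' := le_of_max_le_right hm
    rcases s with _ | s | s
    · exact hj m (le_of_max_le_left hm)
    · exact (Instr.uses_map _ _ _).2 (hk m (le_of_max_le_left hm') s)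
    · exact (Instr.uses_map _ _ _).2 (hl m (le_of_max_le_right hm') s)
  | loop c p hp =>
    obtain ⟨k, hk⟩ := hp
    obtain ⟨j, hj⟩ := c.exists_uses
    refine ⟨max j k, fun m hm s => ?_⟩
    rcases s with _ | s
    · exact hj m (le_of_max_le_left hm)
    · exact (Instr.uses_map _ _ _).2 (hk m (le_of_max_le_right hm) s)

/-! ### Binary counters -/

/-- Operations on a counter. -/
inductive CounterOp : Type
  | inc
  | dec
  | test

namespace CounterOp

/-- The bit at which the operation stops moving to more significant bits. -/
def haltBit : CounterOp → Bool
  | inc => false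
  | _ => true

/-- The bit that replaces the bit `b`. -/
def write : CounterOp → Bool → Bool
  | test, b => b
  | _, b => !b

/-- The new bits of the counter (least significant ones first), and the result of the test. -/
def run (op : CounterOp) : List Bool → List Bool × Bool
  | [] => match op with
    | inc => ([true], true)
    | dec => ([], true)
    | test => ([], false)
  | b :: l => if b = op.haltBit then (op.write b :: l, true)
      else (op.write b :: (run op l).1, (run op l).2)

end CounterOp

/-- The value of a bit string, least significant bit first. -/
def bitsVal : List Bool → ℕ
  | [] => 0
  | b :: l => b.toNat + 2 * bitsVal l

theorem CounterOp.val_inc (l : List Bool) : bitsVal (inc.run l).1 = bitsVal l + 1 := by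
  induction l with
  | nil => rfl
  | cons b l ih => cases b <;> simp [run, haltBit, write, bitsVal, ih] <;> omega

theorem CounterOp.val_dec (l : List Bool) (h : 0 < bitsVal l) :
    bitsVal (dec.run l).1 = bitsVal l - 1 := by
  induction l with
  | nil => simp [bitsVal] at h
  | cons b l ih =>
    cases b
    · simp only [bitsVal, Bool.toNat_false, zero_add] at h
      simp [run, haltBit, write, bitsVal, ih (by omega)]
      omega
    · simp [run, haltBit, write, bitsVal]

theorem CounterOp.run_test (l : List Bool) : test.run l = (l, bitsVal l != 0) := by
  induction l with
  | nil => rfl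
  | cons b l ih =>
    cases b
    · have : (2 * bitsVal l != 0) = (bitsVal l != 0) := by
        rw [Bool.eq_iff_iff, bne_iff_ne, bne_iff_ne]; omega
      simp [run, haltBit, write, bitsVal, ih, this]
    · simp [run, haltBit, write, bitsVal]

/-- Leading zeros are never removed, so the length cannot be read off the current value. But a digit
is added only if all bits are ones, in which case the new value is `2 ^ l.length`; this ties the
length to the bound on the values. -/
theorem CounterOp.length_inc (l : List Bool) : (inc.run l).1.length = l.length ∨
    (inc.run l).1.length = l.length + 1 ∧ bitsVal l + 1 = 2 ^ l.length := by
  induction l with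
  | nil => right; simp [run, bitsVal]
  | cons b l ih =>
    cases b
    · left; simp [run, haltBit]
    · simp only [run, haltBit, Bool.true_eq_false, if_false, List.length_cons, bitsVal,
        Bool.toNat_true, pow_succ]
      omega

theorem CounterOp.length_dec (l : List Bool) : (dec.run l).1.length = l.length := by
  induction l with
  | nil => rfl
  | cons b l ih => cases b <;> simp [run, haltBit, ih]

/-! ### From flow charts to transducers -/

/-- Symbols on the work tapes of counter machines. -/
inductive TapeSymbol : Type
  | blank
  | mark
  | bit (b : Bool)

instance : Finite TapeSymbol :=
  Finite.of_injective (β := Option (Option Bool))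
    (fun | .blank => none | .mark => some none | .bit b => some (some b)) (by
      intro a b
      cases a <;> cases b <;> simp)

/-- Phases of the simulation of a test or an action. -/
inductive Phase : Type
  | ready
  | up
  | down (b : Bool)

instance : Finite Phase :=
  Finite.of_injective (β := Option (Option Bool))
    (fun | .ready => none | .up => some none | .down b => some (some b)) (by
      intro a b
      cases a <;> cases b <;> simp)

/-- What is written by an operation in the phase `up`, and the result if this phase ends. -/
def CounterOp.writeCell (op : CounterOp) : TapeSymbol → TapeSymbol × Option Bool
  | .bit b => (.bit (op.write b), if b = op.haltBit then some true else none)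
  | w => match op with
    | inc => (.bit true, some true)
    | dec => (w, some true)
    | test => (w, some false)

/-- The counter that an instruction works with. -/
def Instr.counter {S : Type} : Instr S → Option (ℕ × CounterOp)
  | .act (.inc i) _ => some (i, .inc)
  | .act (.dec i) _ => some (i, .dec)
  | .test (.nonzero i) _ _ => some (i, .test)
  | _ => none

def Instr.next {S : Type} : Instr S → Bool → S
  | .act _ s, _ => s
  | .test _ s t, b => if b then s else t

namespace Flow

/-- The effect on the tapes if only tape `i` is touched. -/
def touch {k : ℕ} (work : Fin k → TapeSymbol) (i : ℕ) (w : TapeSymbol) (m : Move) :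
    Fin k → TapeSymbol × Move :=
  fun j => if j.val = i then (w, m) else (work j, .stay)

def readTape {k : ℕ} (work : Fin k → TapeSymbol) (i : ℕ) : TapeSymbol :=
  if h : i < k then work ⟨i, h⟩ else .blank

/-- The step function of the transducer at a position of the flow chart. -/
def stepAt {S : Type} {k : ℕ} (s : S) (ins : Instr (Option S)) (ph : Phase) (cell : InputCell)
    (work : Fin k → TapeSymbol) :
    Option (Option (Option S × Phase) × Move × (Fin k → TapeSymbol × Move) × Option Symbol) :=
  -- A counter operation leaves the mark in cell 0, carries through the bits in phase `up`, and
  -- returns to the mark in phase `down b`, where `b` remembers the result of a test.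
  match ins.counter with
  | some (i, op) => match ph with
    | .ready => some (some (some s, .up), .stay, touch work i .mark .right, none)
    | .up => match op.writeCell (readTape work i) with
      | (w, none) => some (some (some s, .up), .stay, touch work i w .right, none)
      | (w, some b) => some (some (some s, .down b), .stay, touch work i w .left, none)
    | .down b => match readTape work i with
      | .mark => some (some (ins.next b, .ready), .stay, fun j => (work j, .stay), none)
      | w => some (some (some s, .down b), .stay, touch work i w .left, none)
  | none => match ins with
    | .act (.emit a) o => some (some (o, .ready), .stay, fun j => (work j, .stay), some a)
    | .act (.move m) o => some (some (o, .ready), m, fun j => (work j, .stay), none)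
    | .test (.cell f) o o' =>
      some (some (if f cell then o else o', .ready), .stay, fun j => (work j, .stay), none)
    | _ => none

/-- The transducer that executes a flow chart with `k` counters in binary. -/
def transducer (F : Flow) (k : ℕ) : Transducer where
  State := Option (Option F.Pos × Phase)
  finite_state := by
    have := F.finite_pos
    infer_instance
  WorkSymbol := TapeSymbol
  finite_workSymbol := inferInstance
  blank := .blank
  k := k
  start := none
  step q cell work := match q with
    -- The extra start state writes the marks that stop the heads on their way back.
    | none => some (some (some F.entry, .ready), .stay, fun _ => (.mark, .stay), none)
    | some (none, _) => none
    | some (some s, ph) => stepAt s (F.instr s) ph cell work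

/-- A tape with a counter. -/
def tape (l : List Bool) : ℕ → TapeSymbol
  | 0 => .mark
  | j + 1 => (l[j]?).elim .blank .bit

theorem tape_append (pre : List Bool) (b : Bool) (suf : List Bool) :
    tape (pre ++ b :: suf) (pre.length + 1) = .bit b := by
  simp [tape]

theorem tape_length (l : List Bool) : tape l (l.length + 1) = .blank := by
  simp [tape]

theorem update_tape_append (pre : List Bool) (b b' : Bool) (suf : List Bool) :
    Function.update (tape (pre ++ b :: suf)) (pre.length + 1) (.bit b') =
      tape (pre ++ b' :: suf) := by
  funext j
  rcases j with _ | j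
  · rfl
  · by_cases h : j = pre.length
    · subst h; simp [tape]
    · rw [Function.update_of_ne (by simpa using h)]
      simp only [tape]
      congr 1
      simp only [List.getElem?_append]
      split
      · rfl
      · obtain ⟨m, hm⟩ : ∃ m, j - pre.length = m + 1 := ⟨j - pre.length - 1, by omega⟩
        simp [hm]

theorem update_tape_length (l : List Bool) (b : Bool) :
    Function.update (tape l) (l.length + 1) (.bit b) = tape (l ++ [b]) := by
  funext j
  rcases j with _ | j
  · rfl
  · by_cases h : j = l.length
    · subst h; simp [tape]
    · rw [Function.update_of_ne (by simpa using h)]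
      simp only [tape]
      congr 1
      simp only [List.getElem?_append]
      split
      · rfl
      · rw [List.getElem?_eq_none (by omega), List.getElem?_eq_none (by simp; omega)]

variable {F : Flow} {k : ℕ}

/-- Configurations of the transducer whose tapes hold counters. -/
def conf (F : Flow) (k : ℕ) (q : Option (Option F.Pos × Phase)) (h : ℕ) (T : Fin k → List Bool)
    (H : Fin k → ℕ) (out : List Symbol) : (F.transducer k).Config :=
  { state := q, inputHead := h, work := fun i => tape (T i), workHead := H, output := out }

/-- Computations that stay within the first `W` cells of the work tapes. -/
abbrev Path (M : Transducer) (W : ℕ) (x : List Symbol) :=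
  Relation.ReflTransGen fun a b : M.Config => M.next x a = some b ∧ ∀ i, a.workHead i ≤ W

/-- Computations are deterministic: whatever is reachable lies on the one path to the halting
configuration, so a space bound on this path is a space bound on everything. -/
theorem Path.bounded {M : Transducer} {W : ℕ} {x : List Symbol} {a b c : M.Config}
    (h : Path M W x a b) (hb : M.next x b = none) (hb' : ∀ i, b.workHead i ≤ W)
    (hc : StateTransition.Reaches (M.next x) a c) : ∀ i, c.workHead i ≤ W := by
  induction h using Relation.ReflTransGen.head_induction_on with
  | refl =>
    rcases Relation.ReflTransGen.cases_head hc with rfl | ⟨d, hd, _⟩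
    · exact hb'
    · simp [hb] at hd
  | head h _ ih =>
    rcases Relation.ReflTransGen.cases_head hc with rfl | ⟨d, hd, hd'⟩
    · exact h.2
    · rw [h.1, Option.mem_some_iff] at hd
      subst hd
      exact ih hd'

theorem Path.reaches {M : Transducer} {W : ℕ} {x : List Symbol} {a b : M.Config}
    (h : Path M W x a b) : StateTransition.Reaches (M.next x) a b :=
  Relation.ReflTransGen.mono (fun _ _ h => h.1) _ _ h

/-- During a counter operation all heads except that of tape `i` rest in cell 0. This isolates such
a step, so that only the step function and one tape remain to be examined. -/
theorem next_conf_touch {s : F.Pos} {q' : Option (Option F.Pos × Phase)} {ph : Phase} {h : ℕ}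
    {T : Fin k → List Bool} {out : List Symbol} {x : List Symbol} {i : Fin k} {j : ℕ}
    {w : TapeSymbol} {m : Move} {l l' : List Bool}
    (hl : Function.update (tape l) j w = tape l')
    (hstep : stepAt s (F.instr s) ph (Transducer.inputCell x h)
      (fun a => tape (Function.update T i l a) (Function.update (fun _ => 0) i j a)) =
      some (q', .stay, touch (fun a => tape (Function.update T i l a)
        (Function.update (fun _ => 0) i j a)) i w m, none)) :
    (F.transducer k).next x (conf F k (some (some s, ph)) h (Function.update T i l)
      (Function.update (fun _ => 0) i j) out) =
    some (conf F k q' h (Function.update T i l')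
      (Function.update (fun _ => 0) i (Transducer.moveWork j m)) out) := by
  have e : (F.transducer k).next x (conf F k (some (some s, ph)) h (Function.update T i l)
      (Function.update (fun _ => 0) i j) out) = (stepAt s (F.instr s) ph
        (Transducer.inputCell x h)
      (fun a => tape (Function.update T i l a) (Function.update (fun _ => 0) i j a))).map
      fun r =>
      { state := r.1
        inputHead := Transducer.moveInput x.length h r.2.1
        work := fun a => Function.update (tape (Function.update T i l a))
          (Function.update (fun _ => 0) i j a) (r.2.2.1 a).1
        workHead := fun a => Transducer.moveWork (Function.update (fun _ => 0) i j a)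
          (r.2.2.1 a).2
        output := out ++ r.2.2.2.toList } := rfl
  rw [e, hstep]
  simp only [Option.map_some, Option.some.injEq, conf, Transducer.moveInput, Option.toList_none,
    List.append_nil]
  congr 1
  · refine funext fun (a : Fin k) => ?_
    change Function.update (tape (Function.update T i l a)) (Function.update (fun _ => 0) i j a)
      (if a.val = i.val then (w, m) else _).1 = tape (Function.update T i l' a)
    by_cases ha : a = i
    · subst ha
      rw [if_pos rfl, Function.update_self, Function.update_self, Function.update_self]
      exact hl
    · rw [if_neg fun h => ha (Fin.ext h), ]
      refine (Function.update_eq_self _ _).trans ?_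
      rw [Function.update_of_ne ha, Function.update_of_ne ha]
  · refine funext fun (a : Fin k) => ?_
    change Transducer.moveWork (Function.update (fun _ => 0) i j a)
      (if a.val = i.val then (w, m) else (_, .stay)).2 =
        Function.update (fun _ => 0) i (Transducer.moveWork j m) a
    by_cases ha : a = i
    · subst ha
      rw [if_pos rfl, Function.update_self, Function.update_self]
    · rw [if_neg fun h => ha (Fin.ext h), Function.update_of_ne ha, Function.update_of_ne ha]
      rfl

theorem next_conf_still {s : F.Pos} {q' : Option (Option F.Pos × Phase)} {h : ℕ}
    {T : Fin k → List Bool} {out : List Symbol} {x : List Symbol} {m : Move} {a : Option Symbol}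
    (hstep : stepAt s (F.instr s) .ready (Transducer.inputCell x h) (fun a => tape (T a) 0) =
      some (q', m, fun j => (tape (T j) 0, .stay), a)) :
    (F.transducer k).next x (conf F k (some (some s, .ready)) h T (fun _ => 0) out) =
    some (conf F k q' (Transducer.moveInput x.length h m) T (fun _ => 0) (out ++ a.toList)) := by
  refine (congrArg (Option.map _) hstep).trans (congrArg some ?_)
  simp only [conf]
  congr 1
  exact funext fun (a : Fin k) => Function.update_eq_self 0 (tape (T a))

theorem head_le {i : Fin k} {j W : ℕ} (h : j ≤ W) (a : Fin k) :
    Function.update (fun _ : Fin k => 0) i j a ≤ W := by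
  by_cases ha : a = i
  · subst ha; simpa using h
  · simp [ha]

theorem readTape_update {T : Fin k → List Bool} {i : Fin k} {j : ℕ} {l : List Bool} :
    readTape (fun a => tape (Function.update T i l a) (Function.update (fun _ => 0) i j a)) i =
      tape l j := by
  simp [readTape]

/-- The bits `pre` have been processed and the head stands on the first bit of `suf`, shifted by one
because of the mark. Of the final head position `j` one only needs that no blank lies between it and
the mark. -/
theorem path_up {W : ℕ} {x : List Symbol} {s : F.Pos} {i : Fin k} {op : CounterOp}
    (hs : (F.instr s).counter = some (i.val, op)) {h : ℕ} {T : Fin k → List Bool}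
    {out : List Symbol} (suf pre : List Bool) (hW : (pre ++ suf).length < W) :
    ∃ j, j ≤ W ∧ j ≤ (pre ++ (op.run suf).1).length ∧ Path (F.transducer k) W x
      (conf F k (some (some s, .up)) h (Function.update T i (pre ++ suf))
        (Function.update (fun _ => 0) i (pre.length + 1)) out)
      (conf F k (some (some s, .down (op.run suf).2)) h
        (Function.update T i (pre ++ (op.run suf).1)) (Function.update (fun _ => 0) i j) out) := by
  induction suf generalizing pre with
  | nil =>
    rw [List.append_nil] at hW ⊢
    refine ⟨pre.length, by omega, by simp, .single ⟨?_, head_le (by simpa using hW)⟩⟩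
    cases op with
    | inc =>
      exact next_conf_touch (w := .bit true) (m := .left) (update_tape_length pre true)
        (by simp [stepAt, hs, readTape_update, tape_length, CounterOp.writeCell, CounterOp.run])
    | dec =>
      exact next_conf_touch (w := .blank) (m := .left) (l' := pre ++ [])
        (by rw [List.append_nil, ← tape_length pre, Function.update_eq_self])
        (by simp [stepAt, hs, readTape_update, tape_length, CounterOp.writeCell, CounterOp.run])
    | test =>
      exact next_conf_touch (w := .blank) (m := .left) (l' := pre ++ [])
        (by rw [List.append_nil, ← tape_length pre, Function.update_eq_self])
        (by simp [stepAt, hs, readTape_update, tape_length, CounterOp.writeCell, CounterOp.run])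
  | cons b suf ih =>
    have hW' : pre.length + 1 ≤ W := by simp at hW; omega
    by_cases hb : b = op.haltBit
    · refine ⟨pre.length, by omega, by simp, .single ⟨?_, head_le hW'⟩⟩
      exact next_conf_touch (w := .bit (op.write b)) (m := .left)
        (by rw [update_tape_append]; simp [CounterOp.run, hb])
        (by simp [stepAt, hs, readTape_update, tape_append, CounterOp.writeCell, hb,
          CounterOp.run])
    · obtain ⟨j, hj, hj', hp⟩ := ih (pre ++ [op.write b]) (by simpa using hW)
      refine ⟨j, hj, by simpa [CounterOp.run, hb] using hj', .head (b := ?_) ⟨?_, head_le hW'⟩ ?_⟩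
      · exact conf F k (some (some s, .up)) h (Function.update T i (pre ++ op.write b :: suf))
          (Function.update (fun _ => 0) i (pre.length + 1 + 1)) out
      · exact next_conf_touch (w := .bit (op.write b)) (m := .right) (update_tape_append _ _ _ _)
          (by simp [stepAt, hs, readTape_update, tape_append, CounterOp.writeCell, hb])
      · simpa [CounterOp.run, hb] using hp

theorem path_down {W : ℕ} {x : List Symbol} {s : F.Pos} {i : Fin k} {op : CounterOp}
    (hs : (F.instr s).counter = some (i.val, op)) {h : ℕ} {T : Fin k → List Bool}
    {out : List Symbol} {l : List Bool} {b : Bool} (j : ℕ) (hj : j ≤ W) (hl : j ≤ l.length) :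
    Path (F.transducer k) W x
      (conf F k (some (some s, .down b)) h (Function.update T i l)
        (Function.update (fun _ => 0) i j) out)
      (conf F k (some ((F.instr s).next b, .ready)) h (Function.update T i l)
        (fun _ => 0) out) := by
  induction j with
  | zero =>
    refine .single ⟨?_, head_le (Nat.zero_le W)⟩
    have := next_conf_touch (F := F) (k := k) (s := s) (ph := .down b) (h := h) (T := T)
      (out := out) (x := x) (i := i) (j := 0) (w := .mark) (m := .stay) (l := l) (l' := l)
      (q' := some ((F.instr s).next b, .ready))
      (Function.update_eq_self 0 (tape l)) (by
        have h0 : tape l 0 = .mark := rfl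
        simp only [stepAt, hs, readTape_update, h0, Option.some.injEq, Prod.mk.injEq, true_and,
          and_true]
        funext a
        simp only [touch]
        by_cases ha : a = i
        · subst ha; simp [tape]
        · have : a.val ≠ i.val := fun h => ha (Fin.ext h)
          simp [this])
    simpa [Transducer.moveWork] using this
  | succ j ih =>
    refine .head ⟨?_, head_le hj⟩ (ih (by omega) (by omega))
    refine next_conf_touch (w := tape l (j + 1)) (m := .left) (Function.update_eq_self _ _) ?_
    have : tape l (j + 1) = .bit l[j] := by
      simp [tape, List.getElem?_eq_getElem (show j < l.length by omega)]
    simp only [stepAt, hs, readTape_update, this]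

theorem path_counter {W : ℕ} {x : List Symbol} {s : F.Pos} {i : Fin k} {op : CounterOp}
    (hs : (F.instr s).counter = some (i.val, op)) {h : ℕ} {T : Fin k → List Bool}
    {out : List Symbol} (hW : (T i).length < W) :
    Path (F.transducer k) W x
      (conf F k (some (some s, .ready)) h T (fun _ => 0) out)
      (conf F k (some ((F.instr s).next (op.run (T i)).2, .ready)) h
        (Function.update T i (op.run (T i)).1) (fun _ => 0) out) := by
  have h0 : (F.transducer k).next x (conf F k (some (some s, .ready)) h T (fun _ => 0) out) =
      some (conf F k (some (some s, .up)) h T (Function.update (fun _ => 0) i 1) out) := by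
    have := next_conf_touch (F := F) (k := k) (s := s) (ph := .ready) (h := h) (T := T)
      (out := out) (x := x) (i := i) (j := 0) (w := .mark) (m := .right) (l := T i) (l' := T i)
      (q' := some (some s, .up)) (Function.update_eq_self 0 (tape _)) (by
        simp [stepAt, hs])
    simpa [Transducer.moveWork] using this
  obtain ⟨j, hj, hj', hp⟩ := path_up (x := x) hs (h := h) (T := T) (out := out) (T i) []
    (by simpa using hW)
  refine .head ⟨h0, fun _ => Nat.zero_le W⟩ (.trans ?_ (path_down hs j hj hj'))
  simpa using hp

/-- The bits `T` represent the counters of the store. -/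
def Represents (W : ℕ) (T : Fin k → List Bool) (σ : Store) : Prop :=
  ∀ i, (T i).length < W ∧ bitsVal (T i) = σ.reg i

theorem Represents.update {W : ℕ} {T : Fin k → List Bool} {σ : Store} (hT : Represents W T σ)
    {i : Fin k} {l : List Bool} {v : ℕ} (hl : l.length < W) (hv : bitsVal l = v) :
    Represents W (Function.update T i l) { σ with reg := Function.update σ.reg i v } := by
  intro a
  by_cases ha : a = i
  · subst ha; simpa using ⟨hl, hv⟩
  · have : a.val ≠ i.val := fun h => ha (Fin.ext h)
    simpa [ha, this] using hT a

theorem path_test {W : ℕ} (hk : ∀ s, (F.instr s).Uses k) {x : List Symbol} {s : F.Pos} {c : Cond}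
    {o o' : Option F.Pos} {σ : Store} (hs : F.instr s = .test c o o') {b : Bool}
    (hc : c.holds x σ = b) {T : Fin k → List Bool} (hT : Represents W T σ) :
    ∃ T', Represents W T' σ ∧ Path (F.transducer k) W x
      (conf F k (some (some s, .ready)) σ.head T (fun _ => 0) σ.out)
      (conf F k (some (if b then o else o', .ready)) σ.head T' (fun _ => 0) σ.out) := by
  subst hc
  cases c with
  | cell f =>
    refine ⟨T, hT, .single ⟨?_, fun _ => Nat.zero_le W⟩⟩
    refine (next_conf_still (q' := some (if f (Transducer.inputCell x σ.head) then o else o',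
      .ready)) (m := .stay) (a := none) (by simp [stepAt, hs, Instr.counter])).trans ?_
    simp only [Option.toList_none, List.append_nil, Cond.holds, Transducer.moveInput]
    rfl
  | nonzero i =>
    have hik : i < k := by have := hk s; rwa [hs] at this
    have h1 := hT ⟨i, hik⟩
    have := path_counter (x := x) (s := s) (i := ⟨i, hik⟩) (op := .test) (by rw [hs]; rfl)
      (h := σ.head) (out := σ.out) h1.1
    rw [hs, CounterOp.run_test, h1.2] at this
    simp only [Function.update_eq_self] at this
    exact ⟨T, hT, this⟩

theorem Step.path {W B : ℕ} (hW : B < 2 ^ (W - 1)) (hk : ∀ s, (F.instr s).Uses k)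
    {x : List Symbol} {s : Option F.Pos × Store} {t : Option F.Pos × Store} (h : F.Step B x s t)
    {T : Fin k → List Bool} (hT : Represents W T s.2) :
    ∃ T', Represents W T' t.2 ∧ Path (F.transducer k) W x
      (conf F k (some (s.1, .ready)) s.2.head T (fun _ => 0) s.2.out)
      (conf F k (some (t.1, .ready)) t.2.head T' (fun _ => 0) t.2.out) := by
  cases h with
  | @act s a o σ σ' hs h =>
    cases h with
    | emit a =>
      exact ⟨T, hT, .single ⟨next_conf_still (q' := some (o, .ready)) (m := .stay) (a := some a)
        (by simp [stepAt, hs, Instr.counter]), fun _ => Nat.zero_le W⟩⟩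
    | move m =>
      refine ⟨T, hT, .single ⟨(next_conf_still (q' := some (o, .ready)) (m := m) (a := none)
        (by simp [stepAt, hs, Instr.counter])).trans (by simp), fun _ => Nat.zero_le W⟩⟩
    | inc i _ hi =>
      have hik : i < k := by have := hk s; rwa [hs] at this
      have := path_counter (x := x) (s := s) (i := ⟨i, hik⟩) (op := .inc) (by rw [hs]; rfl)
        (h := σ.head) (out := σ.out) (hT ⟨i, hik⟩).1
      rw [hs] at this
      refine ⟨_, hT.update (i := ⟨i, hik⟩) ?_ ?_, this⟩
      · have h1 := hT ⟨i, hik⟩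
        rcases CounterOp.length_inc (T ⟨i, hik⟩) with h2 | ⟨h2, h3⟩
        · rw [h2]; exact h1.1
        · rw [h1.2] at h3
          -- If the counter gets longer, its new value is the power of two on the left. It is at
          -- most `B`, hence there is room for one more bit.
          have h4 : 2 ^ (T ⟨i, hik⟩).length < 2 ^ (W - 1) := by
            rw [← h3]; simp only; omega
          have := (Nat.pow_lt_pow_iff_right (by norm_num)).1 h4
          omega
      · rw [CounterOp.val_inc, (hT ⟨i, hik⟩).2]
    | dec i _ hi =>
      have hik : i < k := by have := hk s; rwa [hs] at this
      have h1 := hT ⟨i, hik⟩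
      have := path_counter (x := x) (s := s) (i := ⟨i, hik⟩) (op := .dec) (by rw [hs]; rfl)
        (h := σ.head) (out := σ.out) h1.1
      rw [hs] at this
      refine ⟨_, hT.update (i := ⟨i, hik⟩) ?_ ?_, this⟩
      · rw [CounterOp.length_dec]; exact h1.1
      · rw [CounterOp.val_dec _ (by rw [h1.2]; exact hi), h1.2]
  | @testTrue s c o o' σ hs hc => exact path_test hk hs hc hT
  | @testFalse s c o o' σ hs hc => exact path_test hk hs hc hT

theorem Steps.path {W B : ℕ} (hW : B < 2 ^ (W - 1)) (hk : ∀ s, (F.instr s).Uses k)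
    {x : List Symbol} {s : Option F.Pos × Store} {t : Option F.Pos × Store} (h : F.Steps B x s t)
    {T : Fin k → List Bool} (hT : Represents W T s.2) :
    ∃ T', Represents W T' t.2 ∧ Path (F.transducer k) W x
      (conf F k (some (s.1, .ready)) s.2.head T (fun _ => 0) s.2.out)
      (conf F k (some (t.1, .ready)) t.2.head T' (fun _ => 0) t.2.out) := by
  induction h with
  | refl => exact ⟨T, hT, .refl⟩
  | tail _ h ih =>
    obtain ⟨T', hT', hp⟩ := ih
    obtain ⟨T'', hT'', hp'⟩ := h.path hW hk hT'
    exact ⟨T'', hT'', hp.trans hp'⟩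

end Flow

/-- A function that is computed by a program with polynomially bounded counters is computable in
logarithmic space. -/
theorem LogspaceComputable.of_prog {f : List Symbol → List Symbol} (p : Prog) (d : ℕ)
    (h : ∀ x, ∃ σ, p.Runs ((x.length + 2) ^ d) x ⟨0, fun _ => 0, []⟩ σ ∧ σ.out = f x) :
    LogspaceComputable f := by
  obtain ⟨k, hk⟩ := p.exists_uses
  replace hk := hk k le_rfl
  have key : ∀ x : List Symbol, ∃ c, Flow.Path (p.flow.transducer k)
      (d * (Nat.log 2 x.length + 2) + 2) x (p.flow.transducer k).init c ∧
      (p.flow.transducer k).next x c = none ∧ (∀ i, c.workHead i = 0) ∧ c.output = f x := by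
    intro x
    obtain ⟨σ, hσ, hf⟩ := h x
    -- The bound on the tapes is chosen such that counters up to `(n + 2) ^ d` fit, using `n + 2 ≤ 2
    -- ^ (log n + 2)`.
    have hW : (x.length + 2) ^ d < 2 ^ (d * (Nat.log 2 x.length + 2) + 2 - 1) := by
      have h1 : x.length < 2 ^ (Nat.log 2 x.length + 1) := Nat.lt_pow_succ_log_self (by norm_num) _
      have h2 : x.length + 2 ≤ 2 ^ (Nat.log 2 x.length + 2) := by
        rw [pow_succ]
        have : 2 ≤ 2 ^ (Nat.log 2 x.length + 1) := by
          rw [pow_succ]; have := Nat.one_le_two_pow (n := Nat.log 2 x.length); omega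
        omega
      calc (x.length + 2) ^ d ≤ (2 ^ (Nat.log 2 x.length + 2)) ^ d := Nat.pow_le_pow_left h2 d
        _ = 2 ^ (d * (Nat.log 2 x.length + 2)) := by rw [← pow_mul, mul_comm]
        _ < _ := Nat.pow_lt_pow_right (by norm_num) (by omega)
    obtain ⟨T, hT, hp⟩ := hσ.steps.path hW hk (T := fun _ => []) (fun i => ⟨by simp, rfl⟩)
    refine ⟨_, .head ⟨?_, fun i => Nat.zero_le _⟩ hp, rfl, fun i => rfl, hf⟩
    change some _ = some _
    simp only [Option.some.injEq, Flow.conf, Transducer.init, Transducer.moveInput,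
      Transducer.moveWork, Option.toList_none, List.append_nil]
    congr 1
    funext i j
    rcases j with _ | j
    · rfl
    · rfl
  -- With `C = 3 * d + 2` the bound `d * (log n + 2) + 2` is at most `C * log n + C`.
  refine ⟨p.flow.transducer k, fun x => ?_, d + 2 * d + 2, fun x c hc i => ?_⟩
  · obtain ⟨c, hp, hn, -, ho⟩ := key x
    exact ⟨c, hp.reaches, hn, ho⟩
  · obtain ⟨c', hp, hn, hw, -⟩ := key x
    have := hp.bounded hn (fun i => by rw [hw i]; exact Nat.zero_le _) hc i
    refine this.trans ?_
    nlinarith [Nat.zero_le (Nat.log 2 x.length), Nat.zero_le d]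

/-! ### A calculus of functions and outputs that are computable with polynomially bounded counters.
-/

/-! ### Programs that transform registers -/

/-- Some program turns the registers `ρ` into `t x ρ` and appends `F x ρ` to the output, on all
inputs `x` and registers `ρ` with property `P`, within polynomially bounded registers. -/
def Code (P : List Symbol → (ℕ → ℕ) → Prop) (t : List Symbol → (ℕ → ℕ) → ℕ → ℕ)
    (F : List Symbol → (ℕ → ℕ) → List Symbol) : Prop :=
  -- The bound is polynomial in any `N` above the input length and the initial registers, not in the
  -- length alone; this makes the notion closed under composition. The input head starts and ends at
  -- cell 0.
  ∃ p d, ∀ x ρ o N, P x ρ → x.length ≤ N → (∀ i, ρ i ≤ N) →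
    Prog.Runs ((N + 2) ^ d) x p ⟨0, ρ, o⟩ ⟨0, t x ρ, o ++ F x ρ⟩

namespace Code

variable {P Q : List Symbol → (ℕ → ℕ) → Prop} {t u : List Symbol → (ℕ → ℕ) → ℕ → ℕ}
  {F G : List Symbol → (ℕ → ℕ) → List Symbol}

theorem congr (h : Code Q u G) (hP : ∀ x ρ, P x ρ → Q x ρ ∧ u x ρ = t x ρ ∧ G x ρ = F x ρ) :
    Code P t F := by
  obtain ⟨p, d, h⟩ := h
  refine ⟨p, d, fun x ρ o N hρ hx hN => ?_⟩
  obtain ⟨h1, h2, h3⟩ := hP x ρ hρ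
  rw [← h2, ← h3]
  exact h x ρ o N h1 hx hN

theorem of_imp (h : Code Q t F) (hP : ∀ x ρ, P x ρ → Q x ρ) : Code P t F :=
  h.congr fun x ρ hρ => ⟨hP x ρ hρ, rfl, rfl⟩

theorem bound_mono {N d d' : ℕ} (h : d ≤ d') : (N + 2) ^ d ≤ (N + 2) ^ d' :=
  Nat.pow_le_pow_right (by omega) h

theorem bound_self (N d : ℕ) : N ≤ (N + 2) ^ (d + 1) :=
  (show N ≤ (N + 2) ^ 1 by simp).trans (bound_mono (by omega))

theorem bound_comp (N d d' : ℕ) : ((N + 2) ^ (d + 1) + 2) ^ d' ≤ (N + 2) ^ ((d + 2) * d') := by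
  rw [pow_mul]
  refine Nat.pow_le_pow_left ?_ d'
  rw [pow_succ (N + 2) (d + 1)]
  have : 2 ≤ (N + 2) ^ (d + 1) :=
    (show 2 ≤ (N + 2) ^ 1 by simp).trans (bound_mono (by omega))
  nlinarith

/-- The second program starts from registers as large as the bound of the first, so the new bound is
a polynomial in a polynomial (`bound_comp`). -/
theorem comp (h : Code P t F) (h' : Code Q u G) (hPQ : ∀ x ρ, P x ρ → Q x (t x ρ)) :
    Code P (fun x ρ => u x (t x ρ)) (fun x ρ => F x ρ ++ G x (t x ρ)) := by
  obtain ⟨p, d, hp⟩ := h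
  obtain ⟨q, d', hq⟩ := h'
  refine ⟨.seq p q, (d + 1) + (d + 2) * d', fun x ρ o N hρ hx hN => ?_⟩
  have h1 := (hp x ρ o N hρ hx hN).mono (bound_mono (N := N) (Nat.le_succ d))
  have h2 := hq x (t x ρ) (o ++ F x ρ) ((N + 2) ^ (d + 1)) (hPQ x ρ hρ)
    (hx.trans (bound_self N d)) (h1.reg_le (σ := ⟨0, ρ, o⟩) fun i => (hN i).trans (bound_self N d))
  rw [← List.append_assoc]
  exact .seq (h1.mono (bound_mono (by omega)))
    (h2.mono ((bound_comp N d d').trans (bound_mono (by omega))))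

/-- The composition of two programs the first of which has no output. -/
theorem comp_left (h : Code P t fun _ _ => []) (h' : Code Q u G)
    (hPQ : ∀ x ρ, P x ρ → Q x (t x ρ)) :
    Code P (fun x ρ => u x (t x ρ)) (fun x ρ => G x (t x ρ)) :=
  h.comp h' hPQ

theorem skip : Code (fun _ _ => True) (fun _ ρ => ρ) (fun _ _ => []) :=
  ⟨.skip, 0, fun _ _ _ _ _ _ _ => by rw [List.append_nil]; exact .skip _⟩

theorem emit (s : Symbol) : Code (fun _ _ => True) (fun _ ρ => ρ) (fun _ _ => [s]) :=
  ⟨.act (.emit s), 0, fun _ _ _ _ _ _ _ => .act (.emit s _)⟩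

theorem emits (l : List Symbol) : Code (fun _ _ => True) (fun _ ρ => ρ) (fun _ _ => l) := by
  induction l with
  | nil => exact skip
  | cons a l ih => exact (emit a).comp ih fun _ _ _ => trivial

theorem inc (i : ℕ) : Code (fun _ _ => True) (fun _ ρ => Function.update ρ i (ρ i + 1))
    (fun _ _ => []) :=
  ⟨.act (.inc i), 1, fun x ρ o N _ _ h => by
    rw [List.append_nil]
    exact .act (.inc i ⟨0, ρ, o⟩ (by have := h i; simp; omega))⟩

theorem dec (i : ℕ) : Code (fun _ ρ => 0 < ρ i) (fun _ ρ => Function.update ρ i (ρ i - 1))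
    (fun _ _ => []) :=
  ⟨.act (.dec i), 1, fun x ρ o N hi _ h => by
    rw [List.append_nil]
    exact .act (.dec i ⟨0, ρ, o⟩ hi)⟩

theorem ite {c : ℕ} {R : List Symbol → (ℕ → ℕ) → Prop} (h : Code P t F) (h' : Code Q u G)
    (hP : ∀ x ρ, R x ρ → ρ c ≠ 0 → P x ρ) (hQ : ∀ x ρ, R x ρ → ρ c = 0 → Q x ρ) :
    Code R (fun x ρ => if ρ c ≠ 0 then t x ρ else u x ρ)
      (fun x ρ => if ρ c ≠ 0 then F x ρ else G x ρ) := by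
  obtain ⟨p, d, hp⟩ := h
  obtain ⟨q, d', hq⟩ := h'
  refine ⟨.ite (.nonzero c) p q, max d d', fun x ρ o N hρ hx hN => ?_⟩
  by_cases hc : ρ c = 0
  · simp only [hc, ne_eq, not_true_eq_false, if_false]
    exact .iteFalse (by simp [Cond.holds, hc])
      ((hq x ρ o N (hQ x ρ hρ hc) hx hN).mono (bound_mono (le_max_right _ _)))
  · simp only [hc, ne_eq, not_false_eq_true, if_true]
    exact .iteTrue (by simp [Cond.holds, hc])
      ((hp x ρ o N (hP x ρ hρ hc) hx hN).mono (bound_mono (le_max_left _ _)))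

theorem ite_silent {c : ℕ} {R : List Symbol → (ℕ → ℕ) → Prop} (h : Code P t fun _ _ => [])
    (h' : Code Q u fun _ _ => [])
    (hP : ∀ x ρ, R x ρ → ρ c ≠ 0 → P x ρ) (hQ : ∀ x ρ, R x ρ → ρ c = 0 → Q x ρ) :
    Code R (fun x ρ => if ρ c ≠ 0 then t x ρ else u x ρ) (fun _ _ => []) :=
  (h.ite h' hP hQ).congr fun _ _ h => ⟨h, rfl, by simp⟩

/-- A loop that is controlled by counter `c`; the registers after `j` rounds are `s x ρ j`. -/
theorem loop {c : ℕ} (s : List Symbol → (ℕ → ℕ) → ℕ → ℕ → ℕ)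
    (H : List Symbol → (ℕ → ℕ) → ℕ → List Symbol) (d₀ : ℕ)
    (body : Code Q t F) (h0 : ∀ x ρ, P x ρ → s x ρ 0 = ρ)
    (hc : ∀ x ρ j, P x ρ → j ≤ ρ c → s x ρ j c = ρ c - j)
    (hs : ∀ x ρ j, P x ρ → j < ρ c →
      Q x (s x ρ j) ∧ t x (s x ρ j) = s x ρ (j + 1) ∧ F x (s x ρ j) = H x ρ j)
    (hb : ∀ x ρ N, P x ρ → x.length ≤ N → (∀ i, ρ i ≤ N) →
      ∀ j ≤ ρ c, ∀ i, s x ρ j i ≤ (N + 2) ^ d₀) :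
    Code P (fun x ρ => s x ρ (ρ c)) (fun x ρ => (List.range (ρ c)).flatMap (H x ρ)) := by
  obtain ⟨p, d, hp⟩ := body
  -- The hypothesis `hb` bounds the registers before every round by the same polynomial in `N`, so
  -- the exponents do not accumulate over the rounds.
  refine ⟨.loop (.nonzero c) p, (d₀ + 2) * d, fun x ρ o N hρ hx hN => ?_⟩
  have key : ∀ m j, j + m = ρ c → Prog.Runs ((N + 2) ^ ((d₀ + 2) * d)) x (.loop (.nonzero c) p)
      ⟨0, s x ρ j, o ++ (List.range j).flatMap (H x ρ)⟩
      ⟨0, s x ρ (ρ c), o ++ (List.range (ρ c)).flatMap (H x ρ)⟩ := by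
    intro m
    induction m with
    | zero =>
      intro j hj
      rw [show j = ρ c by omega]
      exact .loopFalse (by simp [Cond.holds, hc x ρ (ρ c) hρ le_rfl])
    | succ m ih =>
      intro j hj
      obtain ⟨h1, h2, h3⟩ := hs x ρ j hρ (by omega)
      refine .loopTrue (by simp [Cond.holds, hc x ρ j hρ (by omega)]; omega) ?_
        (ih (j + 1) (by omega))
      have := hp x (s x ρ j) (o ++ (List.range j).flatMap (H x ρ)) ((N + 2) ^ (d₀ + 1)) h1
        (hx.trans (bound_self N d₀))
        (fun i => (hb x ρ N hρ hx hN j (by omega) i).trans (bound_mono (by omega)))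
      rw [h2, h3] at this
      simpa [List.range_succ] using this.mono (bound_comp N d₀ d)
  have := key (ρ c) 0 (by omega)
  simpa [h0 x ρ hρ] using this

/-- A loop without output. -/
theorem loop_silent {c : ℕ} (s : List Symbol → (ℕ → ℕ) → ℕ → ℕ → ℕ) (d₀ : ℕ)
    (body : Code Q t fun _ _ => []) (h0 : ∀ x ρ, P x ρ → s x ρ 0 = ρ)
    (hc : ∀ x ρ j, P x ρ → j ≤ ρ c → s x ρ j c = ρ c - j)
    (hs : ∀ x ρ j, P x ρ → j < ρ c → Q x (s x ρ j) ∧ t x (s x ρ j) = s x ρ (j + 1))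
    (hb : ∀ x ρ N, P x ρ → x.length ≤ N → (∀ i, ρ i ≤ N) →
      ∀ j ≤ ρ c, ∀ i, s x ρ j i ≤ (N + 2) ^ d₀) :
    Code P (fun x ρ => s x ρ (ρ c)) (fun _ _ => []) :=
  (loop s (fun _ _ _ => []) d₀ body h0 hc (fun x ρ j h h' => by
    obtain ⟨h1, h2⟩ := hs x ρ j h h'
    exact ⟨h1, h2, rfl⟩) hb).congr fun x ρ h => ⟨h, rfl, by simp⟩

theorem clear (i : ℕ) : Code (fun _ _ => True) (fun _ ρ => Function.update ρ i 0)
    (fun _ _ => []) := by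
  refine (loop_silent (P := fun _ _ => True) (c := i) (fun _ ρ j => Function.update ρ i (ρ i - j))
    1 (dec i) (fun _ ρ _ => by simp) (fun _ ρ j _ _ => by simp) ?_ ?_).congr ?_
  · intro x ρ j _ hj
    refine ⟨by simpa using hj, ?_⟩
    simp [Nat.sub_sub]
  · intro x ρ N _ _ hN j hj a
    have := hN a
    simp only [Function.update_apply, pow_one]
    split
    · subst a; omega
    · omega
  · intro x ρ _
    simp

/-- Adds a register to another one and clears it. -/
theorem move {i j : ℕ} (hij : i ≠ j) : Code (fun _ _ => True)
    (fun _ ρ => Function.update (Function.update ρ i 0) j (ρ j + ρ i)) (fun _ _ => []) := by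
  refine (loop_silent (P := fun _ _ => True) (c := i)
    (fun _ ρ m => Function.update (Function.update ρ i (ρ i - m)) j (ρ j + m))
    2 ((dec i).comp_left (inc j) fun _ _ _ => trivial)
    (fun _ ρ _ => by simp) (fun _ ρ j _ _ => by simp [hij]) ?_ ?_).congr ?_
  · intro x ρ m _ hm
    refine ⟨by simpa [hij] using hm, ?_⟩
    funext a
    simp only [Function.update_apply]
    split_ifs <;> omega
  · intro x ρ N _ _ hN m hm a
    have h1 := hN a
    have h2 := hN i
    have h3 := hN j
    have : N + N ≤ (N + 2) ^ 2 := by nlinarith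
    simp only [Function.update_apply]
    split_ifs <;> omega
  · intro x ρ _
    simp

/-- Copies a register to another one. -/
theorem copy {i j k : ℕ} (hij : i ≠ j) (hik : i ≠ k) (hjk : j ≠ k) :
    Code (fun _ ρ => ρ j = 0 ∧ ρ k = 0) (fun _ ρ => Function.update ρ j (ρ i))
      (fun _ _ => []) := by
  -- Reading a register destroys it: it is emptied into both `j` and the scratch register `k`, and
  -- then `k` is moved back.
  refine ((loop_silent (P := fun _ ρ => ρ j = 0 ∧ ρ k = 0) (c := i)
    (fun _ ρ m => Function.update (Function.update (Function.update ρ i (ρ i - m)) j m) k m)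
    1 (((dec i).comp_left (inc j) fun _ _ _ => trivial).comp_left (inc k)
      fun _ _ _ => trivial) ?_ (fun _ ρ j _ _ => by simp [hij, hik]) ?_ ?_).comp_left
    (move hik.symm) (Q := fun _ _ => True) fun _ _ _ => trivial).congr ?_
  · rintro x ρ ⟨h1, h2⟩
    funext a
    simp only [Function.update_apply]
    split_ifs <;> simp_all
  · rintro x ρ m ⟨h1, h2⟩ hm
    refine ⟨by simpa [hij, hik] using hm, ?_⟩
    funext a
    simp only [Function.update_apply]
    split_ifs <;> simp_all; omega
  · rintro x ρ N ⟨h1, h2⟩ _ hN m hm a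
    have h1 := hN a
    have h2 := hN i
    simp only [Function.update_apply, pow_one]
    split_ifs <;> omega
  · rintro x ρ ⟨h1, h2⟩
    refine ⟨⟨h1, h2⟩, ?_, by simp⟩
    funext a
    simp only [Function.update_apply]
    split_ifs <;> simp_all

/-- Truncated subtraction of registers. -/
theorem sub {i j : ℕ} (hij : i ≠ j) : Code (fun _ _ => True)
    (fun _ ρ => Function.update (Function.update ρ i 0) j (ρ j - ρ i)) (fun _ _ => []) := by
  refine (loop_silent (P := fun _ _ => True) (c := i)
    (fun _ ρ m => Function.update (Function.update ρ i (ρ i - m)) j (ρ j - m))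
    1 ((dec i).comp_left
      (ite_silent (c := j) (R := fun _ _ => True) (dec j) skip (fun _ _ _ h => Nat.pos_of_ne_zero h)
        (fun _ _ _ _ => trivial)) fun _ _ _ => trivial)
    (fun _ ρ _ => by simp) (fun _ ρ j _ _ => by simp [hij]) ?_ ?_).congr ?_
  · intro x ρ m _ hm
    refine ⟨by simpa [hij] using hm, ?_⟩
    funext a
    split <;> rename_i h <;> simp only [Function.update_apply, if_neg hij.symm, if_pos] at h ⊢ <;>
      split_ifs <;> omega
  · intro x ρ N _ _ hN m hm a
    have h1 := hN a
    have h2 := hN i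
    have h3 := hN j
    simp only [Function.update_apply, pow_one]
    split_ifs <;> omega
  · intro x ρ _
    simp

theorem runs_rewind {B : ℕ} {x : List Symbol} {ρ : ℕ → ℕ} {o : List Symbol} (h : ℕ) :
    Prog.Runs B x (.loop (.cell fun | .leftEnd => false | _ => true) (.act (.move .left)))
      ⟨h, ρ, o⟩ ⟨0, ρ, o⟩ := by
  induction h with
  | zero => exact .loopFalse rfl
  | succ h ih =>
    refine .loopTrue ?_ (.act (.move .left _)) ih
    simp only [Cond.holds, Transducer.inputCell]
    cases x[h]? <;> rfl

theorem runs_forward {B : ℕ} {x : List Symbol} {o : List Symbol} {n : ℕ} (v : ℕ) {ρ : ℕ → ℕ}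
    (hv : ρ n = v) {h : ℕ} (hh : h ≤ x.length + 1) :
    Prog.Runs B x (.loop (.nonzero n) (.seq (.act (.dec n)) (.act (.move .right))))
      ⟨h, ρ, o⟩ ⟨min (h + v) (x.length + 1), Function.update ρ n 0, o⟩ := by
  induction v generalizing ρ h with
  | zero =>
    rw [← hv, Function.update_eq_self, hv, Nat.add_zero, min_eq_left hh]
    exact .loopFalse (by simp [Cond.holds, hv])
  | succ v ih =>
    refine .loopTrue (by simp [Cond.holds, hv])
      (.seq (.act (.dec n _ (by simp [hv]))) (.act (.move _ _))) ?_
    have := ih (ρ := Function.update ρ n (ρ n - 1)) (by simp [hv])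
      (h := min (h + 1) (x.length + 1)) (min_le_right _ _)
    rw [Function.update_idem] at this
    convert this using 2
    simp only [Transducer.moveInput]
    omega

/-- A test of the letter at the position that is given by a register. -/
theorem cell (f : Option Symbol → Bool) (n : ℕ) : Code (fun _ _ => True)
    (fun x ρ => Function.update ρ n (f x[ρ n]?).toNat) (fun _ _ => []) := by
  -- Position `p` of the input is in cell `p + 1`, hence the first move. Positions beyond the input
  -- end at the right marker, which counts as `none`.
  refine ⟨.seq (.act (.move .right)) (.seq
    (.loop (.nonzero n) (.seq (.act (.dec n)) (.act (.move .right))))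
    (.seq (.ite (.cell fun c => f (match c with | .letter a => some a | _ => none))
      (.act (.inc n)) .skip)
    (.loop (.cell fun | .leftEnd => false | _ => true) (.act (.move .left))))), 1,
    fun x ρ o N _ hx hN => ?_⟩
  rw [List.append_nil]
  refine .seq (.act (.move _ _)) (.seq (runs_forward (n := n) (ρ n) rfl (min_le_right _ _))
    (.seq (?_ : Prog.Runs _ _ _ _ ⟨min (1 + ρ n) (x.length + 1),
      Function.update ρ n (f x[ρ n]?).toNat, o⟩) (runs_rewind _)))
  have hcell : (match Transducer.inputCell x (min (1 + ρ n) (x.length + 1)) with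
      | .letter a => some a | _ => none) = x[ρ n]? := by
    have : min (1 + ρ n) (x.length + 1) = min (ρ n) x.length + 1 := by omega
    rw [this, Transducer.inputCell]
    by_cases h : ρ n < x.length
    · rw [min_eq_left h.le, List.getElem?_eq_getElem h]; rfl
    · rw [min_eq_right (not_lt.1 h), List.getElem?_eq_none le_rfl,
        List.getElem?_eq_none (not_lt.1 h)]; rfl
  have hm : min (min (0 + 1) (x.length + 1) + ρ n) (x.length + 1) =
      min (1 + ρ n) (x.length + 1) := by omega
  simp only [Transducer.moveInput]
  rw [hm]
  cases hf : f x[ρ n]?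
  · exact .iteFalse (by simp only [Cond.holds, hcell, hf]) (.skip _)
  · refine .iteTrue (by simp only [Cond.holds, hcell, hf]) (.act ?_)
    have := Action.Runs.inc (B := (N + 2) ^ 1) (x := x) n
      ⟨min (1 + ρ n) (x.length + 1), Function.update ρ n 0, o⟩ (by simp)
    simpa using this

theorem runs_scan {B : ℕ} {x : List Symbol} {o : List Symbol} {n : ℕ} (m : ℕ) {ρ : ℕ → ℕ} {h : ℕ}
    (hm : h + m = x.length + 1) (hB : ρ n + m ≤ B) :
    Prog.Runs B x (.loop (.cell fun | .rightEnd => false | _ => true)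
      (.seq (.act (.inc n)) (.act (.move .right))))
      ⟨h, ρ, o⟩ ⟨x.length + 1, Function.update ρ n (ρ n + m), o⟩ := by
  induction m generalizing ρ h with
  | zero =>
    obtain rfl : h = x.length + 1 := by omega
    rw [Nat.add_zero (ρ n), Function.update_eq_self]
    exact .loopFalse (by simp [Cond.holds, Transducer.inputCell])
  | succ m ih =>
    refine .loopTrue ?_ (.seq (.act (.inc n _ (by simp only; omega))) (.act (.move _ _))) ?_
    · simp only [Cond.holds]
      rcases h with _ | h
      · rfl
      · rw [Transducer.inputCell, List.getElem?_eq_getElem (by omega)]; rfl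
    · have := ih (ρ := Function.update ρ n (ρ n + 1)) (h := h + 1) (by omega) (by simp; omega)
      rw [Function.update_idem, Function.update_self] at this
      convert this using 2
      · simp only [Transducer.moveInput]; omega
      · rw [add_assoc, add_comm 1 m]

/-- Computes the length of the input. -/
theorem length (n : ℕ) : Code (fun _ ρ => ρ n = 0) (fun x ρ => Function.update ρ n x.length)
    (fun _ _ => []) := by
  -- The scan from cell 0 to the right marker takes one step more than the length.
  have h : Code (fun _ ρ => ρ n = 0) (fun x ρ => Function.update ρ n (x.length + 1))
      (fun _ _ => []) := by
    refine ⟨.seq (.loop (.cell fun | .rightEnd => false | _ => true)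
      (.seq (.act (.inc n)) (.act (.move .right))))
      (.loop (.cell fun | .leftEnd => false | _ => true) (.act (.move .left))), 1,
      fun x ρ o N hn hx hN => ?_⟩
    rw [List.append_nil]
    refine .seq ?_ (runs_rewind (x.length + 1))
    have := runs_scan (B := (N + 2) ^ 1) (x := x) (o := o) (n := n) (x.length + 1) (ρ := ρ)
      (h := 0) (by omega) (by rw [hn, pow_one]; omega)
    rw [hn, zero_add] at this
    exact this
  refine (h.comp_left (dec n) fun x ρ _ => by simp).congr fun x ρ hn => ⟨hn, ?_, rfl⟩
  simp

end Code

/-! ### Logspace computable numerical functions and outputs -/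

/-- All registers from `n` on are zero. -/
def ZeroFrom (n : ℕ) (_ : List Symbol) (ρ : ℕ → ℕ) : Prop := ∀ i, n ≤ i → ρ i = 0

/-- Functions of the input and of numbers (which are given by registers) with values in `ℕ` that
can be computed by programs. -/
def Num {k : ℕ} (f : List Symbol → (Fin k → ℕ) → ℕ) : Prop :=
  -- A stack discipline: arguments are in registers below `n`, everything from `n` on is free and
  -- zero, the value is left in register `n`, and all other registers end as they began.
  ∀ (e : Fin k → ℕ) (n : ℕ), (∀ i, e i < n) →
    Code (ZeroFrom n) (fun x ρ => Function.update ρ n (f x fun i => ρ (e i))) (fun _ _ => [])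

/-- Functions of the input and of numbers whose values can be output by programs. -/
def Out {k : ℕ} (F : List Symbol → (Fin k → ℕ) → List Symbol) : Prop :=
  ∀ (e : Fin k → ℕ) (n : ℕ), (∀ i, e i < n) →
    Code (ZeroFrom n) (fun _ ρ => ρ) (fun x ρ => F x fun i => ρ (e i))

theorem LogspaceComputable.of_out {f : List Symbol → List Symbol}
    (h : Out (k := 0) fun x _ => f x) : LogspaceComputable f := by
  obtain ⟨p, d, h⟩ := h Fin.elim0 0 (fun i => i.elim0)
  exact .of_prog p d fun x => ⟨_, h x (fun _ => 0) [] x.length (fun _ _ => rfl) le_rfl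
    (fun _ => Nat.zero_le _), rfl⟩

theorem update_lt {k : ℕ} {e : Fin k → ℕ} {n m : ℕ} (he : ∀ i, e i < n) (hm : n ≤ m)
    (ρ : ℕ → ℕ) (v : ℕ) : (fun i => Function.update ρ m v (e i)) = fun i => ρ (e i) := by
  funext i
  rw [Function.update_of_ne ((he i).trans_le hm).ne]

theorem ZeroFrom.update {n : ℕ} {x : List Symbol} {ρ : ℕ → ℕ} (h : ZeroFrom n x ρ) (v : ℕ) :
    ZeroFrom (n + 1) x (Function.update ρ n v) := by
  intro i hi
  rw [Function.update_of_ne (by omega)]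
  exact h i (by omega)

theorem cons_lt {k : ℕ} {e : Fin k → ℕ} {n : ℕ} (he : ∀ i, e i < n) (i : Fin (k + 1)) :
    (Fin.cons n e : Fin (k + 1) → ℕ) i < n + 1 := by
  refine Fin.cases ?_ (fun i => ?_) i
  · simp
  · simpa using (he i).trans (Nat.lt_succ_self n)

namespace Num

variable {k l : ℕ} {f g : List Symbol → (Fin k → ℕ) → ℕ}

theorem const (c : ℕ) : Num fun _ (_ : Fin k → ℕ) => c := by
  intro e n he
  induction c with
  | zero =>
    exact (Code.clear n).congr fun _ _ _ => ⟨trivial, rfl, rfl⟩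
  | succ c ih =>
    exact (ih.comp_left (Code.inc n) fun _ _ _ => trivial).congr fun x ρ h =>
      ⟨h, by simp, rfl⟩

theorem var (i : Fin k) : Num fun _ (v : Fin k → ℕ) => v i := by
  intro e n he
  exact (Code.copy (i := e i) (j := n) (k := n + 1) (he i).ne (by have := he i; omega)
    (by omega)).congr fun x ρ h => ⟨⟨h _ le_rfl, h _ (by omega)⟩, rfl, rfl⟩

theorem length : Num fun x (_ : Fin k → ℕ) => x.length := by
  intro e n he
  exact (Code.length n).congr fun x ρ h => ⟨h _ le_rfl, rfl, rfl⟩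

theorem rename {f : List Symbol → (Fin k → ℕ) → ℕ} (hf : Num f) (r : Fin k → Fin l) :
    Num fun x (v : Fin l → ℕ) => f x fun i => v (r i) :=
  fun e n he => hf (fun i => e (r i)) n fun i => he (r i)

theorem tail (hf : Num f) : Num fun x (v : Fin (k + 1) → ℕ) => f x (Fin.tail v) :=
  hf.rename Fin.succ

/-- The intermediate value is pushed to register `n` and becomes argument 0 of `h`, whose value
appears in register `n + 1` and is then moved down. -/
theorem bind {h : List Symbol → (Fin k → ℕ) → ℕ → ℕ}
    (hh : Num fun x (w : Fin (k + 1) → ℕ) => h x (Fin.tail w) (w 0)) (hg : Num g) :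
    Num fun x v => h x v (g x v) := by
  intro e n he
  refine ((((hg e n he).comp_left (hh (Fin.cons n e) (n + 1) (cons_lt he))
    fun x ρ hρ => hρ.update _).comp_left (Code.clear n) fun _ _ _ => trivial).comp_left
    (Code.move (i := n + 1) (j := n) (by omega)) fun _ _ _ => trivial).congr fun x ρ hρ =>
    ⟨hρ, ?_, rfl⟩
  have h1 : Fin.tail (fun i => Function.update ρ n (g x fun i => ρ (e i))
      ((Fin.cons n e : Fin (k + 1) → ℕ) i)) = fun i => ρ (e i) := update_lt he le_rfl _ _
  simp only [h1, Fin.cons_zero, Function.update_self]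
  have h2 := hρ (n + 1) (by omega)
  funext a
  simp only [Function.update_apply]
  split_ifs <;> simp_all

theorem comp1 {f : List Symbol → ℕ → ℕ} (hf : Num fun x (v : Fin 1 → ℕ) => f x (v 0))
    (hg : Num g) : Num fun x v => f x (g x v) :=
  bind (h := fun x _ a => f x a) (hf.rename fun _ => 0) hg

theorem comp2 {f : List Symbol → ℕ → ℕ → ℕ} (hf : Num fun x (v : Fin 2 → ℕ) => f x (v 0) (v 1))
    {g₁ g₂ : List Symbol → (Fin k → ℕ) → ℕ} (h₁ : Num g₁) (h₂ : Num g₂) :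
    Num fun x v => f x (g₁ x v) (g₂ x v) :=
  bind (h := fun x v a => f x (g₁ x v) a) (bind (h := fun x w a => f x a (w 0))
    (hf.rename ![0, 1]) h₁.tail) h₂

theorem add (hf : Num f) (hg : Num g) : Num fun x v => f x v + g x v := by
  have : Num fun _ (v : Fin 2 → ℕ) => v 0 + v 1 := by
    intro e n he
    refine (((var 0 e n he).comp_left (var 1 e (n + 1) fun i => (he i).trans (by omega))
      fun x ρ hρ => hρ.update _).comp_left (Code.move (i := n + 1) (j := n) (by omega))
      fun _ _ _ => trivial).congr fun x ρ hρ => ⟨hρ, ?_, rfl⟩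
    have h2 := hρ (n + 1) (by omega)
    have h4 : Function.update ρ n (ρ (e 0)) (e 1) = ρ (e 1) :=
      Function.update_of_ne (he 1).ne _ _
    simp only [h4]
    funext a
    simp only [Function.update_apply]
    split_ifs <;> first | omega | (subst_vars; omega)
  exact comp2 (f := fun _ a b => a + b) this hf hg

theorem sub (hf : Num f) (hg : Num g) : Num fun x v => f x v - g x v := by
  have : Num fun _ (v : Fin 2 → ℕ) => v 0 - v 1 := by
    intro e n he
    refine (((var 0 e n he).comp_left (var 1 e (n + 1) fun i => (he i).trans (by omega))
      fun x ρ hρ => hρ.update _).comp_left (Code.sub (i := n + 1) (j := n) (by omega))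
      fun _ _ _ => trivial).congr fun x ρ hρ => ⟨hρ, ?_, rfl⟩
    have h2 := hρ (n + 1) (by omega)
    have h4 : Function.update ρ n (ρ (e 0)) (e 1) = ρ (e 1) :=
      Function.update_of_ne (he 1).ne _ _
    simp only [h4]
    funext a
    simp only [Function.update_apply]
    split_ifs <;> first | omega | (subst_vars; omega)
  exact comp2 (f := fun _ a b => a - b) this hf hg

theorem min (hf : Num f) (hg : Num g) : Num fun x v => min (f x v) (g x v) := by
  have : (fun x v => Min.min (f x v) (g x v)) = fun x v => f x v - (f x v - g x v) := by
    funext x v; omega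
  rw [this]
  exact hf.sub (hf.sub hg)

/-- The test whether a letter is at a position. -/
theorem letter (p : Option Symbol → Bool) (hg : Num g) :
    Num fun x v => (p x[g x v]?).toNat := by
  intro e n he
  refine ((hg e n he).comp_left (Code.cell p n) fun _ _ _ => trivial).congr fun x ρ hρ =>
    ⟨hρ, ?_, rfl⟩
  simp

theorem max (hf : Num f) (hg : Num g) : Num fun x v => max (f x v) (g x v) := by
  have : (fun x v => Max.max (f x v) (g x v)) = fun x v => f x v + (g x v - f x v) := by
    funext x v; omega
  rw [this]
  exact hf.add (hg.sub hf)

end Num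

/-- Decidable relations between the input and numbers. -/
def Test {k : ℕ} (b : List Symbol → (Fin k → ℕ) → Bool) : Prop := Num fun x v => (b x v).toNat

theorem Num.ite {k : ℕ} {b : List Symbol → (Fin k → ℕ) → Bool}
    {f g : List Symbol → (Fin k → ℕ) → ℕ} (hb : Test b) (hf : Num f) (hg : Num g) :
    Num fun x v => if b x v = true then f x v else g x v := by
  intro e n he
  refine ((hb e n he).comp_left (Q := fun x ρ => ZeroFrom (n + 1) x ρ)
    (Code.ite_silent (c := n) (((Code.clear n).of_imp (P := ZeroFrom (n + 1)) fun _ _ _ => trivial).comp_left (hf e n he) ?_) (hg e n he) (fun _ _ h _ => h) ?_) fun x ρ hρ => hρ.update _).congr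
    fun x ρ hρ => ⟨hρ, ?_, rfl⟩
  · intro x ρ hρ i hi
    by_cases h : i = n
    · simp [h]
    · rw [Function.update_of_ne h]; exact hρ i (by omega)
  · intro x ρ hρ h i hi
    by_cases h' : i = n
    · rw [h', h]
    · exact hρ i (by omega)
  · cases h : b x fun i => ρ (e i)
    · simp [h, update_lt he le_rfl]
    · simp [h, update_lt he le_rfl]

namespace Test

variable {k : ℕ} {b c : List Symbol → (Fin k → ℕ) → Bool}
  {f g : List Symbol → (Fin k → ℕ) → ℕ}

theorem letter (p : Option Symbol → Bool) (hg : Num g) : Test fun x v => p x[g x v]? :=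
  Num.letter p hg

theorem not (hb : Test b) : Test fun x v => !b x v := by
  have := Num.ite hb (.const 0) (.const 1)
  refine Eq.mp (congrArg Num ?_) this
  funext x v
  dsimp only
  cases b x v <;> rfl

theorem and (hb : Test b) (hc : Test c) : Test fun x v => b x v && c x v := by
  have := Num.ite hb hc (.const 0)
  refine Eq.mp (congrArg Num ?_) this
  funext x v
  dsimp only
  cases b x v <;> rfl

theorem or (hb : Test b) (hc : Test c) : Test fun x v => b x v || c x v := by
  have := Num.ite hb (.const 1) hc
  refine Eq.mp (congrArg Num ?_) this
  funext x v
  dsimp only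
  cases b x v <;> rfl

theorem lt (hf : Num f) (hg : Num g) : Test fun x v => decide (f x v < g x v) := by
  have := (Num.const 1).min (hg.sub hf)
  refine Eq.mp (congrArg Num ?_) this
  funext x v
  by_cases h : f x v < g x v
  · simp [h]; omega
  · simp [h]; omega

theorem le (hf : Num f) (hg : Num g) : Test fun x v => decide (f x v ≤ g x v) := by
  have := (lt hg hf).not
  refine Eq.mp (congrArg Test ?_) this
  funext x v
  rw [Bool.eq_iff_iff]
  simp

theorem eq (hf : Num f) (hg : Num g) : Test fun x v => decide (f x v = g x v) := by
  have := (le hf hg).and (le hg hf)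
  refine Eq.mp (congrArg Test ?_) this
  funext x v
  rw [Bool.eq_iff_iff]
  simp [le_antisymm_iff]

theorem comp1 {b : List Symbol → ℕ → Bool} (hb : Test fun x (v : Fin 1 → ℕ) => b x (v 0))
    (hg : Num g) : Test fun x v => b x (g x v) :=
  Num.comp1 (f := fun x a => (b x a).toNat) hb hg

end Test

/-! ### Iteration -/

/-- Iteration of a function on pairs of numbers, truncated at the length of the input. -/
def iterPair (x : List Symbol) (h : ℕ → ℕ → ℕ × ℕ) (m : ℕ) (s : ℕ × ℕ) : ℕ × ℕ :=
  (fun s : ℕ × ℕ => (min (h s.1 s.2).1 x.length, min (h s.1 s.2).2 x.length))^[m] s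

/-- Iteration of a function on numbers, truncated at the length of the input. -/
def iter (x : List Symbol) (h : ℕ → ℕ) (m s : ℕ) : ℕ := (fun s => min (h s) x.length)^[m] s

theorem iterPair_succ (x : List Symbol) (h : ℕ → ℕ → ℕ × ℕ) (m : ℕ) (s : ℕ × ℕ) :
    iterPair x h (m + 1) s = (min (h (iterPair x h m s).1 (iterPair x h m s).2).1 x.length,
      min (h (iterPair x h m s).1 (iterPair x h m s).2).2 x.length) :=
  Function.iterate_succ_apply' _ _ _

theorem iterPair_le (x : List Symbol) (h : ℕ → ℕ → ℕ × ℕ) (m : ℕ) (s : ℕ × ℕ) {N : ℕ}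
    (hx : x.length ≤ N) (h1 : s.1 ≤ N) (h2 : s.2 ≤ N) :
    (iterPair x h m s).1 ≤ N ∧ (iterPair x h m s).2 ≤ N := by
  cases m with
  | zero => exact ⟨h1, h2⟩
  | succ m =>
    rw [iterPair_succ]
    exact ⟨(min_le_right _ _).trans hx, (min_le_right _ _).trans hx⟩

/-- Truncation at the input length is what keeps the registers bounded in all rounds. Register `n`
counts the rounds, `n + 1` and `n + 2` hold the pair; the new pair is first formed in `n + 3` and `n
+ 4`, since both components depend on the old one. -/
theorem Num.iterPair {k : ℕ} {h : List Symbol → (Fin k → ℕ) → ℕ → ℕ → ℕ × ℕ}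
    (h₁ : Num fun x (w : Fin (k + 2) → ℕ) => (h x (Fin.tail (Fin.tail w)) (w 0) (w 1)).1)
    (h₂ : Num fun x (w : Fin (k + 2) → ℕ) => (h x (Fin.tail (Fin.tail w)) (w 0) (w 1)).2)
    {m a b : List Symbol → (Fin k → ℕ) → ℕ} (hm : Num m) (ha : Num a) (hb : Num b) :
    Num fun x v => (iterPair x (h x v) (m x v) (a x v, b x v)).1 := by
  intro e n he
  have he3 : ∀ i, (Fin.cons (n + 1) (Fin.cons (n + 2) e : Fin (k + 1) → ℕ) : Fin (k + 2) → ℕ) i <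
      n + 3 := by
    refine Fin.cases (by simp) (Fin.cases (by simp) fun i => ?_)
    simpa using (he i).trans (by omega)
  have hz : ∀ (x : List Symbol) (ρ : ℕ → ℕ), 0 < ρ n ∧ ZeroFrom (n + 3) x ρ →
      ZeroFrom (n + 3) x (Function.update ρ n (ρ n - 1)) := fun x ρ hρ i hi => by
    rw [Function.update_of_ne (by omega)]; exact hρ.2 i hi
  have body := ((((((((Code.dec n).of_imp (P := fun x ρ => 0 < ρ n ∧ ZeroFrom (n + 3) x ρ)
    fun x ρ h => h.1).comp_left ((h₁.min .length) _ (n + 3) he3) hz).comp_left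
    ((h₂.min .length) _ (n + 4) fun i => (he3 i).trans (by omega))
    fun x ρ hρ => (hz x ρ hρ).update _).comp_left (Code.clear (n + 1))
    fun _ _ _ => trivial).comp_left (Code.clear (n + 2))
    fun _ _ _ => trivial).comp_left (Code.move (i := n + 3) (j := n + 1) (by omega))
    fun _ _ _ => trivial).comp_left (Code.move (i := n + 4) (j := n + 2) (by omega))
    fun _ _ _ => trivial).congr (P := fun x ρ => 0 < ρ n ∧ ZeroFrom (n + 3) x ρ)
    (t := fun x ρ => Function.update (Function.update (Function.update ρ n (ρ n - 1)) (n + 1)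
      (Min.min (h x (fun i => ρ (e i)) (ρ (n + 1)) (ρ (n + 2))).1 x.length)) (n + 2)
      (Min.min (h x (fun i => ρ (e i)) (ρ (n + 1)) (ρ (n + 2))).2 x.length))
    (F := fun _ _ => []) fun x ρ hρ => ⟨hρ, ?_, rfl⟩
  · have lp := Code.loop_silent (P := ZeroFrom (n + 3)) (c := n) (fun x ρ j => Function.update
      (Function.update (Function.update ρ n (ρ n - j)) (n + 1)
        (AutRel.iterPair x (h x fun i => ρ (e i)) j (ρ (n + 1), ρ (n + 2))).1) (n + 2)
      (AutRel.iterPair x (h x fun i => ρ (e i)) j (ρ (n + 1), ρ (n + 2))).2) 1 body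
      ?_ ?_ ?_ ?_
    · refine ((((((hm e n he).comp_left (ha e (n + 1) fun i => (he i).trans (by omega))
        fun x ρ hρ => hρ.update _).comp_left (hb e (n + 2) fun i => (he i).trans (by omega))
        fun x ρ hρ => (hρ.update _).update _).comp_left lp
        fun x ρ hρ => ((hρ.update _).update _).update _).comp_left (Code.clear (n + 2))
        fun _ _ _ => trivial).comp_left (Code.move (i := n + 1) (j := n) (by omega))
        fun _ _ _ => trivial).congr fun x ρ hρ => ⟨hρ, ?_, rfl⟩
      have e1 := fun v ρ => update_lt he le_rfl ρ v
      have e2 := fun v ρ => update_lt he (show n ≤ n + 1 by omega) ρ v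
      have e3 := fun v ρ => update_lt he (show n ≤ n + 2 by omega) ρ v
      have z1 := hρ (n + 1) (by omega)
      have z2 := hρ (n + 2) (by omega)
      simp only [e1, e2, e3]
      funext i
      simp only [Function.update_apply]
      by_cases h0 : i = n
      · simp [h0]
      by_cases h1 : i = n + 1
      · simp [h1, z1]
      by_cases h2 : i = n + 2
      · simp [h2, z2]
      simp [h0, h1, h2]
    · intro x ρ hρ
      simp [AutRel.iterPair]
    · intro x ρ j hρ hj
      simp
    · intro x ρ j hρ hj
      have e1 := fun v ρ => update_lt he le_rfl ρ v
      have e2 := fun v ρ => update_lt he (show n ≤ n + 1 by omega) ρ v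
      have e3 := fun v ρ => update_lt he (show n ≤ n + 2 by omega) ρ v
      refine ⟨⟨by simpa using hj, fun i hi => ?_⟩, ?_⟩
      · rw [Function.update_of_ne (by omega), Function.update_of_ne (by omega),
          Function.update_of_ne (by omega)]
        exact hρ i hi
      · simp only [e1, e2, e3, iterPair_succ]
        funext i
        simp only [Function.update_apply]
        by_cases h0 : i = n
        · simp [h0, Nat.sub_sub]
        by_cases h1 : i = n + 1
        · simp [h1]
        by_cases h2 : i = n + 2
        · simp [h2]
        simp [h0, h1, h2]
    · intro x ρ N hρ hx hN j hj i
      obtain ⟨h1, h2⟩ := iterPair_le x (h x fun i => ρ (e i)) j (ρ (n + 1), ρ (n + 2)) hx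
        (hN _) (hN _)
      have h3 := hN i
      have h4 := hN n
      simp only [Function.update_apply, pow_one]
      split_ifs <;> omega
  · have e1 := fun v ρ => update_lt he le_rfl ρ v
    have e2 := fun v ρ => update_lt he3 le_rfl ρ v
    have e3 : ∀ σ : ℕ → ℕ, Fin.tail (Fin.tail fun i => σ ((Fin.cons (n + 1)
      (Fin.cons (n + 2) e : Fin (k + 1) → ℕ) : Fin (k + 2) → ℕ) i)) = fun i => σ (e i) :=
      fun _ => rfl
    have z1 := hρ.2 (n + 3) (by omega)
    have z2 := hρ.2 (n + 4) (by omega)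
    simp only [e2]
    simp only [e3, e1]
    have c1 : (Fin.cons (n + 1) (Fin.cons (n + 2) e : Fin (k + 1) → ℕ) : Fin (k + 2) → ℕ) 1 =
      n + 2 := rfl
    simp only [Fin.cons_zero, c1]
    funext i
    simp only [Function.update_apply]
    by_cases h0 : i = n
    · simp [h0]
    by_cases h1 : i = n + 1
    · simp [h1]
    by_cases h2 : i = n + 2
    · simp [h2]
    by_cases h3 : i = n + 3
    · simp [h3, z1]
    by_cases h4 : i = n + 4
    · simp [h4, z2]
    simp [h0, h1, h2, h3, h4]

theorem Num.iter {k : ℕ} {h : List Symbol → (Fin k → ℕ) → ℕ → ℕ}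
    (hh : Num fun x (w : Fin (k + 1) → ℕ) => h x (Fin.tail w) (w 0))
    {m a : List Symbol → (Fin k → ℕ) → ℕ} (hm : Num m) (ha : Num a) :
    Num fun x v => iter x (h x v) (m x v) (a x v) := by
  have := Num.iterPair (h := fun x v a _ => (h x v a, 0))
    (hh.rename (Fin.cons 0 fun i => i.succ.succ)) (.const 0) hm ha (.const 0)
  refine Eq.mp (congrArg Num ?_) this
  funext x v
  generalize m x v = m
  induction m with
  | zero => rfl
  | succ m ih =>
    rw [iterPair_succ, AutRel.iter, Function.iterate_succ_apply']
    simp only [ih]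
    rfl

/-! ### Outputs -/

namespace Out

variable {k l : ℕ} {F G : List Symbol → (Fin k → ℕ) → List Symbol}

theorem const (l : List Symbol) : Out fun _ (_ : Fin k → ℕ) => l := by
  intro e n he
  exact (Code.emits l).congr fun _ _ _ => ⟨trivial, rfl, rfl⟩

theorem append (hF : Out F) (hG : Out G) : Out fun x v => F x v ++ G x v :=
  fun e n he => (hF e n he).comp (hG e n he) fun _ _ h => h

theorem rename (hF : Out F) (r : Fin k → Fin l) :
    Out fun x (v : Fin l → ℕ) => F x fun i => v (r i) :=
  fun e n he => hF (fun i => e (r i)) n fun i => he (r i)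

theorem ite {b : List Symbol → (Fin k → ℕ) → Bool} (hb : Test b) (hF : Out F) (hG : Out G) :
    Out fun x v => if b x v = true then F x v else G x v := by
  intro e n he
  refine ((hb e n he).comp_left (Q := fun x ρ => ZeroFrom (n + 1) x ρ)
    (Code.ite (c := n) (((Code.clear n).of_imp (P := ZeroFrom (n + 1)) fun _ _ _ => trivial).comp_left (hF e n he) ?_) (hG e n he) (fun _ _ h _ => h) ?_) fun x ρ hρ => hρ.update _).congr
    fun x ρ hρ => ⟨hρ, ?_, ?_⟩
  · intro x ρ hρ i hi
    by_cases h : i = n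
    · simp [h]
    · rw [Function.update_of_ne h]; exact hρ i (by omega)
  · intro x ρ hρ h i hi
    by_cases h' : i = n
    · rw [h', h]
    · exact hρ i (by omega)
  · have h2 := hρ n le_rfl
    cases h : b x fun i => ρ (e i)
    · simp [h, ← h2]
    · simp [h, ← h2]
  · cases h : b x fun i => ρ (e i)
    · simp [h, update_lt he le_rfl]
    · simp [h, update_lt he le_rfl]

theorem bind {F : List Symbol → (Fin k → ℕ) → ℕ → List Symbol}
    (hF : Out fun x (w : Fin (k + 1) → ℕ) => F x (Fin.tail w) (w 0))
    {g : List Symbol → (Fin k → ℕ) → ℕ} (hg : Num g) : Out fun x v => F x v (g x v) := by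
  intro e n he
  refine (((hg e n he).comp_left (hF (Fin.cons n e) (n + 1) (cons_lt he))
    fun x ρ hρ => hρ.update _).comp (Code.clear n) fun _ _ _ => trivial).congr fun x ρ hρ =>
    ⟨hρ, ?_, ?_⟩
  · have h2 := hρ n le_rfl
    simp [← h2]
  · have h1 : Fin.tail (fun i => Function.update ρ n (g x fun i => ρ (e i))
      ((Fin.cons n e : Fin (k + 1) → ℕ) i)) = fun i => ρ (e i) := update_lt he le_rfl _ _
    simp [h1]

theorem comp1 {F : List Symbol → ℕ → List Symbol} (hF : Out fun x (v : Fin 1 → ℕ) => F x (v 0))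
    {g : List Symbol → (Fin k → ℕ) → ℕ} (hg : Num g) : Out fun x v => F x (g x v) :=
  bind (F := fun x _ a => F x a) (hF.rename fun _ => 0) hg

/-- Register `n` counts the remaining rounds down while register `n + 1` counts the index up. -/
theorem flatMap {F : List Symbol → (Fin k → ℕ) → ℕ → List Symbol}
    (hF : Out fun x (w : Fin (k + 1) → ℕ) => F x (Fin.tail w) (w 0))
    {m : List Symbol → (Fin k → ℕ) → ℕ} (hm : Num m) :
    Out fun x v => (List.range (m x v)).flatMap (F x v) := by
  intro e n he
  have he2 : ∀ i, (Fin.cons (n + 1) e : Fin (k + 1) → ℕ) i < n + 2 := by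
    refine Fin.cases (by simp) fun i => ?_
    simpa using (he i).trans (by omega)
  have hz : ∀ (x : List Symbol) (ρ : ℕ → ℕ), 0 < ρ n ∧ ZeroFrom (n + 2) x ρ →
      ZeroFrom (n + 2) x (Function.update ρ n (ρ n - 1)) := fun x ρ hρ i hi => by
    rw [Function.update_of_ne (by omega)]; exact hρ.2 i hi
  have body := ((((Code.dec n).of_imp (P := fun x ρ => 0 < ρ n ∧ ZeroFrom (n + 2) x ρ)
    fun x ρ h => h.1).comp_left (hF (Fin.cons (n + 1) e) (n + 2) he2) hz).comp
    (Code.inc (n + 1)) fun _ _ _ => trivial).congr (t := fun x ρ =>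
      Function.update (Function.update ρ n (ρ n - 1)) (n + 1) (ρ (n + 1) + 1))
    (F := fun x ρ => F x (fun i => ρ (e i)) (ρ (n + 1))) fun x ρ hρ => ⟨hρ, ?_, ?_⟩
  · have lp := Code.loop (P := fun x ρ => ZeroFrom (n + 1) x ρ) (c := n) (fun x ρ j =>
      Function.update (Function.update ρ n (ρ n - j)) (n + 1) j)
      (fun x ρ j => F x (fun i => ρ (e i)) j) 1 body ?_ ?_ ?_ ?_
    · refine (((hm e n he).comp_left lp fun x ρ hρ => hρ.update _).comp (Code.clear (n + 1))
        fun _ _ _ => trivial).congr fun x ρ hρ => ⟨hρ, ?_, ?_⟩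
      · have z0 := hρ n le_rfl
        have z1 := hρ (n + 1) (by omega)
        funext i
        simp only [Function.update_apply]
        by_cases h0 : i = n
        · simp [h0, z0]
        by_cases h1 : i = n + 1
        · simp [h1, z1]
        simp [h0, h1]
      · simp [update_lt he le_rfl]
    · intro x ρ hρ
      have z1 := hρ (n + 1) (by omega)
      simp only [Nat.sub_zero, Function.update_eq_self]
      exact z1 ▸ Function.update_eq_self (n + 1) ρ
    · intro x ρ j hρ hj
      simp
    · intro x ρ j hρ hj
      refine ⟨⟨by simpa using hj, fun i hi => ?_⟩, ?_, ?_⟩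
      · rw [Function.update_of_ne (by omega), Function.update_of_ne (by omega)]
        exact hρ i (by omega)
      · funext i
        simp only [Function.update_apply]
        by_cases h0 : i = n
        · simp [h0, Nat.sub_sub]
        by_cases h1 : i = n + 1
        · simp [h1]
        simp [h0, h1]
      · simp [update_lt he le_rfl, update_lt he (show n ≤ n + 1 by omega)]
    · intro x ρ N hρ hx hN j hj i
      have h3 := hN i
      have h4 := hN n
      simp only [Function.update_apply, pow_one]
      split_ifs <;> omega
  · simp
  · have e3 : ∀ σ : ℕ → ℕ, (Fin.tail fun i => σ ((Fin.cons (n + 1) e : Fin (k + 1) → ℕ) i)) =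
      fun i => σ (e i) := fun _ => rfl
    simp [e3, update_lt he le_rfl]

end Out

/-- An output need not fit in memory, so it cannot be computed and then recoded; instead every
output action is replaced. This is used to print names that stand for strings. -/
def Prog.mapEmit (φ : Symbol → List Symbol) : Prog → Prog
  | .skip => .skip
  | .act (.emit s) => (φ s).foldr (fun a p => .seq (.act (.emit a)) p) .skip
  | .act a => .act a
  | .seq p q => .seq (p.mapEmit φ) (q.mapEmit φ)
  | .ite c p q => .ite c (p.mapEmit φ) (q.mapEmit φ)
  | .loop c p => .loop c (p.mapEmit φ)

theorem Prog.runs_emits {B : ℕ} {x : List Symbol} (l : List Symbol) (σ : Store) :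
    Prog.Runs B x (l.foldr (fun a p => .seq (.act (.emit a)) p) .skip) σ
      { σ with out := σ.out ++ l } := by
  induction l generalizing σ with
  | nil => simpa using Runs.skip σ
  | cons a l ih =>
    have := ih { σ with out := σ.out ++ [a] }
    simp only [List.append_assoc, List.singleton_append] at this
    exact .seq (.act (.emit a σ)) this

theorem Prog.Runs.mapEmit {B : ℕ} {x : List Symbol} (φ : Symbol → List Symbol) (o : List Symbol)
    {p : Prog} {σ σ' : Store} (h : p.Runs B x σ σ') :
    (p.mapEmit φ).Runs B x { σ with out := o ++ σ.out.flatMap φ }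
      { σ' with out := o ++ σ'.out.flatMap φ } := by
  have hc : ∀ (c : Cond) (σ : Store) (o : List Symbol),
      c.holds x { σ with out := o } = c.holds x σ := fun c σ o => by cases c <;> rfl
  induction h with
  | skip => exact .skip _
  | @act a σ σ' h =>
    cases h with
    | emit s =>
      have := runs_emits (B := B) (x := x) (φ s) { σ with out := o ++ σ.out.flatMap φ }
      simpa [Prog.mapEmit] using this
    | inc i _ h => exact .act (.inc i { σ with out := o ++ σ.out.flatMap φ } h)
    | dec i _ h => exact .act (.dec i { σ with out := o ++ σ.out.flatMap φ } h)
    | move m => exact .act (.move m { σ with out := o ++ σ.out.flatMap φ })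
  | seq _ _ h h' => exact .seq h h'
  | iteTrue hc' _ h => exact .iteTrue ((hc _ _ _).trans hc') h
  | iteFalse hc' _ h => exact .iteFalse ((hc _ _ _).trans hc') h
  | loopTrue hc' _ _ h h' => exact .loopTrue ((hc _ _ _).trans hc') h h'
  | loopFalse hc' => exact .loopFalse ((hc _ _ _).trans hc')

theorem Out.translate {k : ℕ} {F : List Symbol → (Fin k → ℕ) → List Symbol} (hF : Out F)
    (φ : Symbol → List Symbol) : Out fun x v => (F x v).flatMap φ := by
  intro e n he
  obtain ⟨p, d, h⟩ := hF e n he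
  refine ⟨p.mapEmit φ, d, fun x ρ o N hρ hx hN => ?_⟩
  simpa using (h x ρ [] N hρ hx hN).mapEmit φ o

/-! ### Navigating in encodings by positions. -/

/-! ### Reading encodings -/

def isLpar : Option Symbol → Bool
  | some .lpar => true
  | _ => false

def isRpar : Option Symbol → Bool
  | some .rpar => true
  | _ => false

/-- The string `l` occurs in `x` at position `p`. -/
def At (x : List Symbol) (p : ℕ) (l : List Symbol) : Prop := l <+: x.drop p

namespace At

variable {x : List Symbol} {p : ℕ} {l l' : List Symbol}

theorem append_iff : At x p (l ++ l') ↔ At x p l ∧ At x (p + l.length) l' := by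
  constructor
  · rintro ⟨r, hr⟩
    refine ⟨⟨l' ++ r, by rw [← hr, List.append_assoc]⟩, ⟨r, ?_⟩⟩
    rw [← List.drop_drop, ← hr, List.append_assoc, List.drop_left]
  · rintro ⟨⟨r, hr⟩, ⟨r', hr'⟩⟩
    refine ⟨r', ?_⟩
    rw [← List.drop_drop, ← hr, List.drop_left] at hr'
    rw [← hr, ← hr', List.append_assoc]

theorem cons_iff {s : Symbol} : At x p (s :: l) ↔ x[p]? = some s ∧ At x (p + 1) l := by
  rw [← List.singleton_append, append_iff, List.length_singleton]
  refine and_congr_left fun _ => ?_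
  constructor
  · rintro ⟨r, hr⟩
    have := congrArg (fun l => l[0]?) hr
    simpa using this.symm
  · intro h
    have hp := (List.getElem?_eq_some_iff.1 h).1
    refine ⟨x.drop (p + 1), ?_⟩
    rw [List.singleton_append, List.drop_eq_getElem_cons hp]
    simp [(List.getElem?_eq_some_iff.1 h).2]

theorem le (h : At x p l) (hp : p ≤ x.length) : p + l.length ≤ x.length := by
  have := List.IsPrefix.length_le h
  rw [List.length_drop] at this
  omega

theorem lt_of_cons {s : Symbol} (h : At x p (s :: l)) : p < x.length :=
  (List.getElem?_eq_some_iff.1 (cons_iff.1 h).1).1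

theorem getElem? (h : At x p l) {i : ℕ} (hi : i < l.length) : x[p + i]? = l[i]? := by
  obtain ⟨r, hr⟩ := h
  rw [← List.getElem?_drop, ← hr, List.getElem?_append_left hi]

end At

/-- The function `past` skips codes that are given by `e`. -/
structure Parser {α : Type} (e : α → List Symbol) (past : List Symbol → ℕ → ℕ) : Prop where
  code : IsCode e
  head : ∀ a, (e a).head? = some .lpar
  past_eq : ∀ x p a, At x p (e a) → past x p = p + (e a).length
  num : Num fun x (v : Fin 1 → ℕ) => past x (v 0)

namespace Parser

variable {α : Type} {e : α → List Symbol} {past : List Symbol → ℕ → ℕ}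

theorem exists_cons (h : Parser e past) (a : α) : ∃ l, e a = .lpar :: l := by
  have := h.head a
  cases h' : e a with
  | nil => simp [h'] at this
  | cons b l => rw [h'] at this; simp at this; exact ⟨l, by rw [this]⟩

theorem isLpar (h : Parser e past) {x : List Symbol} {p : ℕ} {a : α} (ha : At x p (e a)) :
    isLpar x[p]? = true := by
  obtain ⟨l, hl⟩ := h.exists_cons a
  rw [hl, At.cons_iff] at ha
  rw [ha.1]; rfl

theorem le (h : Parser e past) {x : List Symbol} {p : ℕ} {a : α} (ha : At x p (e a)) :
    p + (e a).length ≤ x.length := by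
  obtain ⟨l, hl⟩ := h.exists_cons a
  exact ha.le (by rw [hl] at ha; exact ha.lt_of_cons.le)

theorem length_pos (h : Parser e past) (a : α) : 0 < (e a).length := by
  obtain ⟨l, hl⟩ := h.exists_cons a
  simp [hl]

theorem length_flatMap (h : Parser e past) (l : List α) : l.length ≤ (l.flatMap e).length := by
  induction l with
  | nil => simp
  | cons a l ih =>
    have := h.length_pos a
    simp only [List.length_cons, List.flatMap_cons, List.length_append]
    omega

end Parser

theorem iter_succ (x : List Symbol) (h : ℕ → ℕ) (m s : ℕ) :
    iter x h (m + 1) s = iter x h m (min (h s) x.length) :=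
  Function.iterate_succ_apply _ _ _

theorem iter_fixed (x : List Symbol) (h : ℕ → ℕ) (m s : ℕ) (hs : min (h s) x.length = s) :
    iter x h m s = s := by
  induction m with
  | zero => rfl
  | succ m ih => rw [iter_succ, hs, ih]

/-! ### Names -/

/-- The position after a name. -/
def pastName (x : List Symbol) (p : ℕ) : ℕ :=
  iter x (fun q => if isRpar x[q]? = true then q else q + 1) x.length p + 1

theorem iter_pastName {x : List Symbol} (l : List Symbol) {p n : ℕ}
    (hl : ∀ s ∈ l, isRpar (some s) = false) (h : At x p (l ++ [.rpar])) (hn : l.length ≤ n) :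
    iter x (fun q => if isRpar x[q]? = true then q else q + 1) n p = p + l.length := by
  induction l generalizing p n with
  | nil =>
    rw [List.nil_append, At.cons_iff] at h
    refine iter_fixed _ _ _ _ ?_
    have := (List.getElem?_eq_some_iff.1 h.1).1
    rw [h.1]
    simp [isRpar]; omega
  | cons s l ih =>
    obtain ⟨n, rfl⟩ : ∃ m, n = m + 1 := ⟨n - 1, by simp at hn; omega⟩
    rw [List.cons_append] at h
    have h1 := h.lt_of_cons
    rw [At.cons_iff] at h
    rw [iter_succ, h.1, hl s (by simp), if_neg (by simp), min_eq_left (by omega),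
      ih (fun s hs => hl s (by simp [hs])) h.2 (by simpa using hn), List.length_cons]
    omega

theorem parser_name : Parser encName pastName where
  code := isCode_encName
  head := fun a => by simp [encName]
  past_eq := by
    intro x p s h
    have h1 := h.le (by rw [encName] at h; exact h.lt_of_cons.le)
    rw [pastName, iter_pastName (.lpar :: s.map encBit) ?_ (by simpa [encName] using h)]
    · simp [encName]; omega
    · simp [encName] at h1 ⊢; omega
    · intro a ha
      simp only [List.mem_cons, List.mem_map] at ha
      rcases ha with rfl | ⟨b, _, rfl⟩
      · rfl
      · cases b <;> rfl
  num := by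
    refine (Num.iter ?_ .length (.var 0)).add (.const 1)
    exact .ite (.letter isRpar (.var 0)) (.var 0) (.add (.var 0) (.const 1))

theorem parser_unary : Parser encUnary pastName where
  code := isCode_encUnary
  head := fun a => by simp [encUnary, encName]
  past_eq := fun x p n h => parser_name.past_eq x p _ h
  num := parser_name.num

theorem Num.pastName {k : ℕ} {g : List Symbol → (Fin k → ℕ) → ℕ} (hg : Num g) :
    Num fun x v => pastName x (g x v) :=
  Num.comp1 parser_name.num hg

/-! ### Options and pairs -/

def pastOption (past : List Symbol → ℕ → ℕ) (x : List Symbol) (p : ℕ) : ℕ :=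
  if isLpar x[p]? = true then past x p else p + 1

theorem Parser.pastOption_eq {α : Type} {e : α → List Symbol} {past : List Symbol → ℕ → ℕ}
    (h : Parser e past) {x : List Symbol} {p : ℕ} {o : Option α} (ho : At x p (encOption e o)) :
    pastOption past x p = p + (encOption e o).length := by
  cases o with
  | none =>
    rw [encOption, At.cons_iff] at ho
    simp [pastOption, ho.1, AutRel.isLpar, encOption]
  | some a => rw [pastOption, if_pos (h.isLpar ho)]; exact h.past_eq x p a ho

theorem Num.pastOption {k : ℕ} {past : List Symbol → ℕ → ℕ}
    (h : Num fun x (v : Fin 1 → ℕ) => past x (v 0))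
    {g : List Symbol → (Fin k → ℕ) → ℕ} (hg : Num g) :
    Num fun x v => pastOption past x (g x v) :=
  .ite (.letter isLpar hg) (Num.comp1 h hg) (.add hg (.const 1))

def pastLetterPair (x : List Symbol) (p : ℕ) : ℕ :=
  pastOption pastName x (pastOption pastName x (p + 1))

theorem parser_letterPair : Parser encLetterPair pastLetterPair where
  code := isCode_encLetterPair
  head := fun a => by simp [encLetterPair]
  past_eq := by
    intro x p a h
    rw [encLetterPair, At.cons_iff, encPair, At.append_iff] at h
    rw [pastLetterPair, parser_name.pastOption_eq h.2.1, parser_name.pastOption_eq h.2.2]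
    simp only [encLetterPair, encPair, List.length_cons, List.length_append]
    omega
  num := .pastOption parser_name.num (.pastOption parser_name.num (.add (.var 0) (.const 1)))

/-! ### Lists -/

/-- The positions of consecutive codes, starting at `p`. -/
def elemsFuel (past : List Symbol → ℕ → ℕ) (x : List Symbol) : ℕ → ℕ → List ℕ
  | 0, _ => []
  | n + 1, p =>
    if isLpar x[p]? = true then p :: elemsFuel past x n (min (past x p) x.length) else []

def elems (past : List Symbol → ℕ → ℕ) (x : List Symbol) (p : ℕ) : List ℕ :=
  elemsFuel past x x.length p

/-- The position of the element with number `n` of the elements starting at `p`, or the end. -/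
def elemPos (past : List Symbol → ℕ → ℕ) (x : List Symbol) (p n : ℕ) : ℕ :=
  iter x (fun q => if isLpar x[q]? = true then past x q else q) n p

theorem Num.elemPos {k : ℕ} {past : List Symbol → ℕ → ℕ}
    (h : Num fun x (v : Fin 1 → ℕ) => past x (v 0)) {f g : List Symbol → (Fin k → ℕ) → ℕ}
    (hf : Num f) (hg : Num g) : Num fun x v => elemPos past x (f x v) (g x v) :=
  Num.iter (.ite (.letter isLpar (.var 0)) (Num.comp1 h (.var 0)) (.var 0)) hg hf

/-- The strings between `p` and `q` are codes at the positions `ps`. -/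
inductive Chain (past : List Symbol → ℕ → ℕ) (x : List Symbol) : ℕ → List ℕ → ℕ → Prop
  | nil (p : ℕ) : Chain past x p [] p
  | cons {p : ℕ} {ps : List ℕ} {q : ℕ} (hp : isLpar x[p]? = true) (hl : past x p ≤ x.length)
      (h : Chain past x (past x p) ps q) : Chain past x p (p :: ps) q

namespace Chain

variable {past : List Symbol → ℕ → ℕ} {x : List Symbol} {p q : ℕ} {ps : List ℕ}

theorem elemsFuel_eq (h : Chain past x p ps q) (hq : isLpar x[q]? = false) {n : ℕ}
    (hn : ps.length ≤ n) : elemsFuel past x n p = ps := by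
  induction h generalizing n with
  | nil p => cases n <;> simp [elemsFuel, hq]
  | @cons p ps q hp hl _ ih =>
    obtain ⟨n, rfl⟩ : ∃ m, n = m + 1 := ⟨n - 1, by simp at hn; omega⟩
    rw [elemsFuel, if_pos hp, min_eq_left hl, ih hq (by simpa using hn)]

theorem elemPos_end (h : Chain past x p ps q) (hq : isLpar x[q]? = false) (hq' : q ≤ x.length)
    {n : ℕ} (hn : ps.length ≤ n) : elemPos past x p n = q := by
  induction h generalizing n with
  | nil p => exact iter_fixed _ _ _ _ (by simp [hq, hq'])
  | @cons p ps q hp hl _ ih =>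
    obtain ⟨n, rfl⟩ : ∃ m, n = m + 1 := ⟨n - 1, by simp at hn; omega⟩
    rw [elemPos, iter_succ, if_pos hp, min_eq_left hl]
    exact ih hq hq' (by simpa using hn)

theorem elemPos_getElem (h : Chain past x p ps q) {i : ℕ} (hi : i < ps.length) :
    elemPos past x p i = ps[i] := by
  induction h generalizing i with
  | nil p => simp at hi
  | @cons p ps q hp hl _ ih =>
    cases i with
    | zero => rfl
    | succ i =>
      rw [elemPos, iter_succ, if_pos hp, min_eq_left hl]
      exact ih (by simpa using hi)

end Chain

theorem Parser.exists_chain {α : Type} {e : α → List Symbol} {past : List Symbol → ℕ → ℕ}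
    (h : Parser e past) {x : List Symbol} {p : ℕ} {l : List α} (hl : At x p (l.flatMap e)) :
    ∃ ps, Chain past x p ps (p + (l.flatMap e).length) ∧
      List.Forall₂ (fun q a => At x q (e a)) ps l ∧
      ∀ q ∈ ps, p ≤ q ∧ q < p + (l.flatMap e).length := by
  induction l generalizing p with
  | nil => exact ⟨[], by simpa using .nil p, .nil, by simp⟩
  | cons a l ih =>
    rw [List.flatMap_cons, At.append_iff] at hl
    obtain ⟨ps, h1, h2, h4⟩ := ih hl.2
    have h3 := h.past_eq x p a hl.1
    have h5 := h.length_pos a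
    rw [List.flatMap_cons, List.length_append, ← add_assoc]
    refine ⟨p :: ps, .cons (h.isLpar hl.1) (h3 ▸ h.le hl.1) ?_, .cons hl.1 h2, ?_⟩
    · rw [h3]
      exact h1
    · intro q hq
      rcases List.mem_cons.1 hq with rfl | hq
      · omega
      · have := h4 q hq
        omega

theorem Parser.exists_chain_list {α : Type} {e : α → List Symbol} {past : List Symbol → ℕ → ℕ}
    (h : Parser e past) {x : List Symbol} {p : ℕ} {l : List α} (hl : At x p (encList e l)) :
    ∃ q, Chain past x (p + 1) (elems past x (p + 1)) q ∧ x[q]? = some .rpar ∧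
      q + 1 = p + (encList e l).length ∧
      List.Forall₂ (fun q a => At x q (e a)) (elems past x (p + 1)) l ∧
      ∀ q' ∈ elems past x (p + 1), p < q' ∧ q' < q := by
  have hp := hl.lt_of_cons
  rw [encList, List.cons_append, At.cons_iff, At.append_iff, At.cons_iff] at hl
  obtain ⟨-, hl, hr, -⟩ := hl
  obtain ⟨ps, h1, h2, h3⟩ := h.exists_chain hl
  have h4 : elems past x (p + 1) = ps := by
    rw [elems, h1.elemsFuel_eq (by rw [hr]; rfl)]
    rw [h2.length_eq]
    have := hl.le hp
    have := h.length_flatMap l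
    omega
  rw [h4]
  refine ⟨_, h1, hr, ?_, h2, h3⟩
  simp only [encList, List.length_append, List.length_cons, List.length_nil]
  omega

theorem Parser.forall₂_elems {α : Type} {e : α → List Symbol} {past : List Symbol → ℕ → ℕ}
    (h : Parser e past) {x : List Symbol} {p : ℕ} {l : List α} (hl : At x p (encList e l)) :
    List.Forall₂ (fun q a => At x q (e a)) (elems past x (p + 1)) l :=
  let ⟨_, _, _, _, h, _⟩ := h.exists_chain_list hl
  h

def pastList (past : List Symbol → ℕ → ℕ) (x : List Symbol) (p : ℕ) : ℕ :=
  elemPos past x (p + 1) x.length + 1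

theorem Parser.list {α : Type} {e : α → List Symbol} {past : List Symbol → ℕ → ℕ}
    (h : Parser e past) : Parser (encList e) (pastList past) where
  code := h.code.list
  head := fun a => by simp [encList]
  past_eq := by
    intro x p l hl
    have hp := hl.lt_of_cons
    rw [encList, List.cons_append, At.cons_iff, At.append_iff, At.cons_iff] at hl
    obtain ⟨-, hl, hr, -⟩ := hl
    obtain ⟨ps, h1, h2, -⟩ := h.exists_chain hl
    have h3 := hl.le hp
    have h4 := h.length_flatMap l
    rw [pastList, h1.elemPos_end (by rw [hr]; rfl) h3 (by rw [h2.length_eq]; omega)]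
    simp only [encList, List.length_append, List.length_cons, List.length_nil]
    omega
  num := (Num.elemPos h.num (.add (.var 0) (.const 1)) .length).add (.const 1)

theorem Num.pastList {k : ℕ} {past : List Symbol → ℕ → ℕ}
    (h : Num fun x (v : Fin 1 → ℕ) => past x (v 0))
    {g : List Symbol → (Fin k → ℕ) → ℕ} (hg : Num g) : Num fun x v => pastList past x (g x v) :=
  (Num.elemPos h (.add hg (.const 1)) .length).add (.const 1)

theorem flatMap_eq_of_forall₂ {α β γ : Type} {R : α → β → Prop} {F : α → List γ}
    {G : β → List γ} {l : List α} {l' : List β} (h : List.Forall₂ R l l')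
    (hFG : ∀ a, ∀ b ∈ l', R a b → F a = G b) : l.flatMap F = l'.flatMap G := by
  induction h with
  | nil => rfl
  | cons h _ ih =>
    rw [List.flatMap_cons, List.flatMap_cons, hFG _ _ (by simp) h,
      ih fun a b hb => hFG a b (by simp [hb])]

/-- A list of positions cannot be stored. So the position with number `j` is recomputed from the
start for each `j` below the input length; after the last element it no longer points to a left
parenthesis, and such rounds print nothing. -/
theorem Out.elems {k : ℕ} {past : List Symbol → ℕ → ℕ}
    (h : Num fun x (v : Fin 1 → ℕ) => past x (v 0))
    {F : List Symbol → (Fin k → ℕ) → ℕ → List Symbol}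
    (hF : Out fun x (w : Fin (k + 1) → ℕ) => F x (Fin.tail w) (w 0))
    {g : List Symbol → (Fin k → ℕ) → ℕ} (hg : Num g) :
    Out fun x v => (elems past x (g x v)).flatMap (F x v) := by
  have key : ∀ (x : List Symbol) (G : ℕ → List Symbol) (n p : ℕ),
      (elemsFuel past x n p).flatMap G = (List.range n).flatMap fun j =>
        if isLpar x[elemPos past x p j]? = true then G (elemPos past x p j) else [] := by
    intro x G n
    induction n with
    | zero => intro p; rfl
    | succ n ih =>
      intro p
      rw [List.range_succ_eq_map, List.flatMap_cons, List.flatMap_map]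
      have h0 : elemPos past x p 0 = p := rfl
      by_cases hp : isLpar x[p]? = true
      · have h1 : ∀ j, elemPos past x p j.succ = elemPos past x (min (past x p) x.length) j := by
          intro j
          rw [elemPos, Nat.succ_eq_add_one, iter_succ, if_pos hp]; rfl
        rw [elemsFuel, if_pos hp, List.flatMap_cons, ih, h0, if_pos hp]
        simp only [h1]
      · have h1 : ∀ j : ℕ, isLpar x[elemPos past x p j.succ]? = true ↔ False := by
          intro j
          rw [elemPos, Nat.succ_eq_add_one, iter_succ, if_neg hp]
          by_cases hl : p ≤ x.length
          · rw [min_eq_left hl, iter_fixed _ _ _ _ (by rw [if_neg hp, min_eq_left hl])]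
            exact iff_false_intro hp
          · have hx : ¬ isLpar x[x.length]? = true := by simp [AutRel.isLpar]
            rw [min_eq_right (by omega), iter_fixed _ _ _ _ (by rw [if_neg hx, min_self])]
            exact iff_false_intro hx
        rw [elemsFuel, if_neg hp, h0, if_neg hp]
        simp [h1]
  have : Out fun x (v : Fin k → ℕ) => (List.range x.length).flatMap fun j =>
      if isLpar x[elemPos past x (g x v) j]? = true then F x v (elemPos past x (g x v) j)
      else [] := by
    refine .flatMap ?_ .length
    refine .ite (.letter isLpar (.elemPos h hg.tail (.var 0))) ?_ (.const [])
    exact .bind (hF.rename (Fin.cons 0 fun i => i.succ.succ)) (.elemPos h hg.tail (.var 0))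
  refine Eq.mp (congrArg Out ?_) this
  funext x v
  exact (key x (F x v) x.length (g x v)).symm

/-! ### Segments -/

/-- The segment of `x` from `p` to `q`. -/
def segment (x : List Symbol) (p q : ℕ) : List Symbol :=
  (List.range (q - p)).flatMap fun i => x[p + i]?.toList

theorem segment_eq {x : List Symbol} {p q : ℕ} {l : List Symbol} (h : At x p l)
    (hq : q = p + l.length) : segment x p q = l := by
  have h1 : ∀ l : List Symbol, (List.range l.length).flatMap (fun i => l[i]?.toList) = l := by
    intro l
    induction l with
    | nil => rfl
    | cons a l ih =>
      rw [List.length_cons, List.range_succ_eq_map, List.flatMap_cons, List.flatMap_map]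
      simpa using ih
  subst hq
  rw [segment, Nat.add_sub_cancel_left]
  refine (List.flatMap_congr fun i hi => ?_).trans (h1 l)
  rw [h.getElem? (List.mem_range.1 hi)]

def symbolCode : Option Symbol → ℕ
  | none => 0
  | some .zero => 1
  | some .one => 2
  | some .bot => 3
  | some .lpar => 4
  | some .rpar => 5

theorem symbolCode_inj {a b : Option Symbol} : symbolCode a = symbolCode b ↔ a = b := by
  rcases a with _ | (_ | _ | _ | _ | _) <;> rcases b with _ | (_ | _ | _ | _ | _) <;>
    simp [symbolCode]

/-- Inspecting a cell yields one bit only; the code is a sum of five such bits, one for each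
threshold. -/
theorem Num.symbolCode {k : ℕ} {g : List Symbol → (Fin k → ℕ) → ℕ} (hg : Num g) :
    Num fun x v => symbolCode x[g x v]? := by
  have : Num fun x v => (Bool.toNat (Option.isSome x[g x v]?)) +
      ((AutRel.symbolCode x[g x v]? ∈ [2, 3, 4, 5] : Bool).toNat +
      ((AutRel.symbolCode x[g x v]? ∈ [3, 4, 5] : Bool).toNat +
      ((AutRel.symbolCode x[g x v]? ∈ [4, 5] : Bool).toNat +
      (AutRel.symbolCode x[g x v]? ∈ [5] : Bool).toNat))) :=
    (Num.letter (fun o => o.isSome) hg).add ((Num.letter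
      (fun o => decide (AutRel.symbolCode o ∈ [2, 3, 4, 5])) hg).add ((Num.letter
      (fun o => decide (AutRel.symbolCode o ∈ [3, 4, 5])) hg).add ((Num.letter
      (fun o => decide (AutRel.symbolCode o ∈ [4, 5])) hg).add (Num.letter
      (fun o => decide (AutRel.symbolCode o ∈ [5])) hg))))
  refine Eq.mp (congrArg Num ?_) this
  funext x v
  rcases x[g x v]? with _ | (_ | _ | _ | _ | _) <;> rfl

theorem Out.symbol {k : ℕ} {g : List Symbol → (Fin k → ℕ) → ℕ} (hg : Num g) :
    Out fun x v => x[g x v]?.toList := by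
  have key : ∀ (n : ℕ) (s : Symbol), Out fun x v =>
      if decide (symbolCode x[g x v]? = n) = true then [s] else [] :=
    fun n s => .ite (.eq (.symbolCode hg) (.const n)) (.const _) (.const _)
  refine Eq.mp (congrArg Out ?_) ((key 1 .zero).append ((key 2 .one).append
    ((key 3 .bot).append ((key 4 .lpar).append (key 5 .rpar)))))
  funext x v
  rcases x[g x v]? with _ | (_ | _ | _ | _ | _) <;> rfl

theorem Out.segment {k : ℕ} {f g : List Symbol → (Fin k → ℕ) → ℕ} (hf : Num f) (hg : Num g) :
    Out fun x v => segment x (f x v) (g x v) :=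
  .flatMap (.symbol (.add hf.tail (.var 0))) (.sub hg hf)

/-- Do the segments of length `l` at `p` and `q` agree? -/
def eqSegment (x : List Symbol) (p q l : ℕ) : Bool :=
  decide (iter x (fun i => if decide (symbolCode x[p + i]? = symbolCode x[q + i]?) = true
    then i + 1 else i) l 0 = l)

theorem Test.eqSegment {k : ℕ} {f g l : List Symbol → (Fin k → ℕ) → ℕ} (hf : Num f) (hg : Num g)
    (hl : Num l) : Test fun x v => eqSegment x (f x v) (g x v) (l x v) :=
  .eq (.iter (.ite (.eq (.symbolCode (.add hf.tail (.var 0)))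
    (.symbolCode (.add hg.tail (.var 0)))) (.add (.var 0) (.const 1)) (.var 0)) hl (.const 0)) hl

/-- The iterated counter advances while the symbols agree and is stuck forever at the first
difference, so it reaches `l` exactly if there is none. Truncation at the input length requires
`hl`. -/
theorem eqSegment_iff {x : List Symbol} {p q l : ℕ} (hl : l ≤ x.length) :
    eqSegment x p q l = true ↔ ∀ i < l, x[p + i]? = x[q + i]? := by
  set h : ℕ → ℕ := fun i => if decide (symbolCode x[p + i]? = symbolCode x[q + i]?) = true
    then i + 1 else i with hh
  have h1 : ∀ m ≤ x.length, iter x h m 0 ≤ m ∧ (iter x h m 0 = m ↔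
      ∀ i < m, x[p + i]? = x[q + i]?) := by
    intro m
    induction m with
    | zero => intro _; exact ⟨le_rfl, by simp [iter]⟩
    | succ m ih =>
      intro hm
      obtain ⟨h1, h2⟩ := ih (by omega)
      have h3 : iter x h (m + 1) 0 = min (h (iter x h m 0)) x.length :=
        Function.iterate_succ_apply' _ _ _
      rw [h3]
      by_cases h4 : iter x h m 0 = m
      · rw [h4]
        have h5 := h2.1 h4
        by_cases h6 : x[p + m]? = x[q + m]?
        · have : h m = m + 1 := by simp [hh, h6]
          rw [this]
          refine ⟨by omega, iff_of_true (by omega) fun i hi => ?_⟩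
          rcases Nat.lt_succ_iff_lt_or_eq.1 hi with hi | rfl
          · exact h5 i hi
          · exact h6
        · have : h m = m := by simp [hh, symbolCode_inj, h6]
          rw [this]
          exact ⟨by omega, iff_of_false (by omega) fun h => h6 (h m (by omega))⟩
      · have : h (iter x h m 0) ≤ iter x h m 0 + 1 := by
          simp only [hh]; split <;> omega
        exact ⟨by omega, iff_of_false (by omega) fun h => h4 (h2.2 fun i hi => h i (by omega))⟩
  rw [eqSegment, decide_eq_true_iff]
  exact (h1 l hl).2

/-- Codes are prefix-free: if the code of `a` occurs where the code of `b` stands, then `a = b`, so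
only the length of the first code has to be compared. -/
theorem Parser.eqSegment_iff {α : Type} {e : α → List Symbol} {past : List Symbol → ℕ → ℕ}
    (h : Parser e past) {x : List Symbol} {p q : ℕ} {a b : α} (ha : At x p (e a))
    (hb : At x q (e b)) : eqSegment x p q (past x p - p) = true ↔ a = b := by
  have h1 := h.le ha
  rw [h.past_eq x p a ha, Nat.add_sub_cancel_left, AutRel.eqSegment_iff (by omega)]
  constructor
  · intro heq
    obtain ⟨r, hr⟩ := hb
    have h2 : At x q (e a) := by
      refine List.prefix_iff_getElem?.2 fun i hi => ?_
      rw [List.getElem?_drop, ← heq i hi, ha.getElem? hi, List.getElem?_eq_getElem hi]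
    obtain ⟨s, hs⟩ := h2
    exact (h.code.inj a b s r (hs.trans hr.symm)).1
  · rintro rfl i hi
    rw [ha.getElem? hi, hb.getElem? hi]

/-! ### Optional objects -/

/-- Position `p` of `x` holds an optional object, where anything but a left parenthesis stands
for `none`. -/
def OptAt {α : Type} (e : α → List Symbol) (x : List Symbol) (p : ℕ) : Option α → Prop
  | none => isLpar x[p]? = false
  | some a => At x p (e a)

theorem OptAt.of_at {α : Type} {e : α → List Symbol} {x : List Symbol} {p : ℕ} {o : Option α}
    (h : At x p (encOption e o)) : OptAt e x p o := by
  cases o with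
  | none => rw [encOption, At.cons_iff] at h; rw [OptAt, h.1]; rfl
  | some a => exact h

/-- The end of the string is the position that represents missing objects, such as the additional
state of padded automata, which is written nowhere in the input. -/
theorem OptAt.none_of_length {α : Type} {e : α → List Symbol} {x : List Symbol} :
    OptAt e x x.length none := by
  simp [OptAt, isLpar]

theorem Parser.isLpar_eq {α : Type} {e : α → List Symbol} {past : List Symbol → ℕ → ℕ}
    (h : Parser e past) {x : List Symbol} {p : ℕ} {o : Option α} (ho : OptAt e x p o) :
    AutRel.isLpar x[p]? = o.isSome := by
  cases o with
  | none => exact ho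
  | some a => exact h.isLpar ho

def optionOut (past : List Symbol → ℕ → ℕ) (x : List Symbol) (p : ℕ) : List Symbol :=
  if isLpar x[p]? = true then segment x p (past x p) else [.bot]

theorem Out.optionOut {k : ℕ} {past : List Symbol → ℕ → ℕ}
    (h : Num fun x (v : Fin 1 → ℕ) => past x (v 0)) {g : List Symbol → (Fin k → ℕ) → ℕ}
    (hg : Num g) : Out fun x v => optionOut past x (g x v) :=
  .ite (.letter isLpar hg) (.segment hg (Num.comp1 h hg)) (.const _)

theorem Parser.optionOut_eq {α : Type} {e : α → List Symbol} {past : List Symbol → ℕ → ℕ}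
    (h : Parser e past) {x : List Symbol} {p : ℕ} {o : Option α} (ho : OptAt e x p o) :
    optionOut past x p = encOption e o := by
  rw [optionOut, h.isLpar_eq ho]
  cases o with
  | none => rfl
  | some a => exact segment_eq ho (h.past_eq x p a ho)

def optionEq (past : List Symbol → ℕ → ℕ) (x : List Symbol) (p q : ℕ) : Bool :=
  (isLpar x[p]? && isLpar x[q]? && eqSegment x p q (past x p - p)) ||
    (!isLpar x[p]? && !isLpar x[q]?)

theorem Test.optionEq {k : ℕ} {past : List Symbol → ℕ → ℕ}
    (h : Num fun x (v : Fin 1 → ℕ) => past x (v 0)) {f g : List Symbol → (Fin k → ℕ) → ℕ}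
    (hf : Num f) (hg : Num g) : Test fun x v => optionEq past x (f x v) (g x v) :=
  .or (.and (.and (.letter isLpar hf) (.letter isLpar hg))
    (.eqSegment hf hg (.sub (Num.comp1 h hf) hf)))
    (.and (.not (.letter isLpar hf)) (.not (.letter isLpar hg)))

theorem Parser.optionEq_iff {α : Type} {e : α → List Symbol} {past : List Symbol → ℕ → ℕ}
    (h : Parser e past) {x : List Symbol} {p q : ℕ} {a b : Option α} (ha : OptAt e x p a)
    (hb : OptAt e x q b) : optionEq past x p q = true ↔ a = b := by
  rw [optionEq, h.isLpar_eq ha, h.isLpar_eq hb]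
  cases a with
  | none => cases b <;> simp
  | some a =>
    cases b with
    | none => simp
    | some b => simp [h.eqSegment_iff ha hb]

/-! ### Names that stand for strings -/

/-- Symbols as bit strings of length three. -/
def symbolBits : Symbol → List Bool
  | .zero => [false, false, false]
  | .one => [false, false, true]
  | .bot => [false, true, false]
  | .lpar => [false, true, true]
  | .rpar => [true, false, false]

/-- The name that stands for a string. -/
def nameOf (l : List Symbol) : Name := l.flatMap symbolBits

theorem nameOf_injective : Function.Injective nameOf := by
  intro l l' h
  induction l generalizing l' with
  | nil =>
    cases l' with
    | nil => rfl
    | cons a l' => cases a <;> simp [nameOf, symbolBits] at h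
  | cons a l ih =>
    cases l' with
    | nil => cases a <;> simp [nameOf, symbolBits] at h
    | cons b l' =>
      have h' : symbolBits a ++ nameOf l = symbolBits b ++ nameOf l' := by
        simpa [nameOf] using h
      have h1 : a = b := by
        cases a <;> cases b <;> simp [symbolBits] at h' ⊢
      subst h1
      rw [ih (List.append_cancel_left h')]

/-- The code of the name that stands for a string. -/
def nameCode (l : List Symbol) : List Symbol :=
  .lpar :: l.flatMap (fun s => (symbolBits s).map encBit) ++ [.rpar]

theorem encName_nameOf (l : List Symbol) : encName (nameOf l) = nameCode l := by
  simp [encName, nameCode, nameOf, List.map_flatMap]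

theorem Out.nameCode {k : ℕ} {F : List Symbol → (Fin k → ℕ) → List Symbol} (hF : Out F) :
    Out fun x v => nameCode (F x v) :=
  (((Out.const [.lpar]).append (hF.translate fun s => (symbolBits s).map encBit)).append
    (.const [.rpar]))

/-! ### Words: from infinite cliques to recurrent reachability. -/

/-! ### Runs of word automata -/

/-- There is an accepting run on the word, with the given transitions and final states. -/
inductive WordRun {S α : Type} (T : S → Option α → S → Prop) (fin : S → Prop) :
    S → List α → Prop
  | nil {q : S} (h : fin q) : WordRun T fin q []
  | eps {q q' : S} {u : List α} (h : T q none q') (h' : WordRun T fin q' u) : WordRun T fin q u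
  | step {q q' : S} {a : α} {u : List α} (h : T q (some a) q') (h' : WordRun T fin q' u) :
      WordRun T fin q (a :: u)

theorem WordAutomaton.mem_accepts {α : Type} (A : WordAutomaton α) (u : List α) :
    u ∈ A.accepts ↔
      WordRun (fun q a q' => (q, a, q') ∈ A.trans) (fun q => q ∈ A.final) A.start u := by
  have h1 : u ∈ A.accepts ↔ u ∈ A.toεNFA.accepts := Iff.rfl
  rw [h1, εNFA.mem_accepts_iff_exists_path]
  clear h1
  constructor
  · rintro ⟨s, t, x, hs, ht, rfl, hp⟩
    obtain rfl : s = A.start := hs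
    generalize A.start = s at hp
    induction hp with
    | nil s => exact .nil ht
    | cons t s u a x h _ ih =>
      cases a with
      | none => exact .eps h (ih ht)
      | some a => exact .step h (ih ht)
  · intro h
    suffices ∃ t x, t ∈ A.toεNFA.accept ∧ x.reduceOption = u ∧ A.toεNFA.IsPath A.start t x by
      obtain ⟨t, x, h⟩ := this
      exact ⟨A.start, t, x, rfl, h⟩
    generalize A.start = s at h
    induction h with
    | @nil q h => exact ⟨q, [], h, rfl, .nil q⟩
    | @eps q q' u h _ ih =>
      obtain ⟨t, x, ht, hx, hp⟩ := ih
      exact ⟨t, none :: x, ht, hx, .cons q' _ _ _ _ h hp⟩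
    | @step q q' a u h _ ih =>
      obtain ⟨t, x, ht, rfl, hp⟩ := ih
      exact ⟨t, some a :: x, ht, rfl, .cons q' _ _ _ _ h hp⟩

/-- A word automaton with states of any type, which are named by strings. -/
structure AbstractWordAutomaton (S α : Type) where
  start : S
  final : List S
  trans : List (S × Option α × S)

namespace AbstractWordAutomaton

variable {S α : Type}

def toWordAutomaton (A : AbstractWordAutomaton S α) (c : S → List Symbol) : WordAutomaton α where
  start := nameOf (c A.start)
  final := A.final.map fun q => nameOf (c q)
  trans := A.trans.map fun t => (nameOf (c t.1), t.2.1, nameOf (c t.2.2))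

/-- Accepting runs from the state `q`. -/
abbrev Run (A : AbstractWordAutomaton S α) : S → List α → Prop :=
  WordRun (fun q a q' => (q, a, q') ∈ A.trans) (fun q => q ∈ A.final)

theorem mem_trans_iff {A : AbstractWordAutomaton S α} {c : S → List Symbol}
    (hc : Function.Injective c) {q : S} {a : Option α} {s : Name} :
    (nameOf (c q), a, s) ∈ (A.toWordAutomaton c).trans ↔
      ∃ q', s = nameOf (c q') ∧ (q, a, q') ∈ A.trans := by
  simp only [toWordAutomaton, List.mem_map]
  constructor
  · rintro ⟨⟨q₁, b, q₂⟩, h, h'⟩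
    simp only [Prod.mk.injEq] at h'
    obtain ⟨h1, rfl, rfl⟩ := h'
    obtain rfl := hc (nameOf_injective h1)
    exact ⟨q₂, rfl, h⟩
  · rintro ⟨q', rfl, h⟩
    exact ⟨_, h, rfl⟩

theorem mem_accepts {A : AbstractWordAutomaton S α} {c : S → List Symbol}
    (hc : Function.Injective c) {u : List α} :
    u ∈ (A.toWordAutomaton c).accepts ↔ A.Run A.start u := by
  rw [WordAutomaton.mem_accepts]
  have hfin : ∀ q, nameOf (c q) ∈ (A.toWordAutomaton c).final ↔ q ∈ A.final := by
    intro q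
    simp only [toWordAutomaton, List.mem_map]
    constructor
    · rintro ⟨q', h, h'⟩
      rwa [← hc (nameOf_injective h')]
    · exact fun h => ⟨q, h, rfl⟩
  constructor
  · have : ∀ s, WordRun (fun q a q' => (q, a, q') ∈ (A.toWordAutomaton c).trans)
        (fun q => q ∈ (A.toWordAutomaton c).final) s u → ∀ q, s = nameOf (c q) → A.Run q u := by
      intro s h
      induction h with
      | nil h => rintro q rfl; exact .nil ((hfin q).1 h)
      | eps h _ ih =>
        rintro q rfl
        obtain ⟨q', rfl, h'⟩ := (mem_trans_iff hc).1 h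
        exact .eps h' (ih q' rfl)
      | step h _ ih =>
        rintro q rfl
        obtain ⟨q', rfl, h'⟩ := (mem_trans_iff hc).1 h
        exact .step h' (ih q' rfl)
    exact fun h => this _ h _ rfl
  · have : ∀ q, A.Run q u → WordRun (fun q a q' => (q, a, q') ∈ (A.toWordAutomaton c).trans)
        (fun q => q ∈ (A.toWordAutomaton c).final) (nameOf (c q)) u := by
      intro q h
      induction h with
      | nil h => exact .nil ((hfin _).2 h)
      | eps h _ ih => exact .eps ((mem_trans_iff hc).2 ⟨_, rfl, h⟩) ih
      | step h _ ih => exact .step ((mem_trans_iff hc).2 ⟨_, rfl, h⟩) ih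
    exact this _

theorem isDFA {A : AbstractWordAutomaton S α} {c : S → List Symbol} (hc : Function.Injective c)
    (h : ∀ q q', (q, none, q') ∉ A.trans)
    (h' : ∀ q a q₁ q₂, (q, some a, q₁) ∈ A.trans → (q, some a, q₂) ∈ A.trans → q₁ = q₂) :
    (A.toWordAutomaton c).IsDFA := by
  constructor
  · intro q q' hq
    simp only [toWordAutomaton, List.mem_map] at hq
    obtain ⟨⟨q₁, b, q₂⟩, h1, h2⟩ := hq
    simp only [Prod.mk.injEq] at h2
    obtain ⟨-, rfl, -⟩ := h2
    exact h _ _ h1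
  · intro q a q₁ q₂ h1 h2
    have : ∃ s, q = nameOf (c s) := by
      simp only [toWordAutomaton, List.mem_map] at h1
      obtain ⟨⟨s, b, t⟩, h3, h4⟩ := h1
      exact ⟨s, (Prod.mk.inj h4).1.symm⟩
    obtain ⟨s, rfl⟩ := this
    obtain ⟨s₁, rfl, h3⟩ := (mem_trans_iff hc).1 h1
    obtain ⟨s₂, rfl, h4⟩ := (mem_trans_iff hc).1 h2
    rw [h' _ _ _ _ h3 h4]

end AbstractWordAutomaton

theorem WordRun.letters {S α : Type} {T : S → Option α → S → Prop} {fin : S → Prop} {q : S}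
    {u : List α} (h : WordRun T fin q u) : ∀ a ∈ u, ∃ q₁ q₂, T q₁ (some a) q₂ := by
  induction h with
  | nil => simp
  | eps _ _ ih => exact ih
  | step h _ ih =>
    intro b hb
    rcases List.mem_cons.1 hb with rfl | hb
    · exact ⟨_, _, h⟩
    · exact ih b hb

/-! ### Convolutions of words -/

namespace Word

theorem conv_nil_left (v : Word) : conv [] v = v.map fun b => (none, some b) := by
  rw [conv, List.nil_zipWithAll]

theorem conv_nil_right (u : Word) : conv u [] = u.map fun a => (some a, none) := by
  rw [conv, List.zipWithAll_nil]

theorem conv_cons (a b : Letter) (u v : Word) :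
    conv (a :: u) (b :: v) = (some a, some b) :: conv u v := rfl

theorem filterMap_fst_conv (u v : Word) : (conv u v).filterMap Prod.fst = u := by
  induction u generalizing v with
  | nil => simp [conv_nil_left]
  | cons a u ih =>
    cases v with
    | nil => simp [conv_nil_right]
    | cons b v => simp [conv_cons, ih]

theorem filterMap_snd_conv (u v : Word) : (conv u v).filterMap Prod.snd = v := by
  induction u generalizing v with
  | nil => simp [conv_nil_left]
  | cons a u ih =>
    cases v with
    | nil => simp [conv_nil_right]
    | cons b v => simp [conv_cons, ih]

theorem conv_inj {u v u' v' : Word} (h : conv u v = conv u' v') : u = u' ∧ v = v' :=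
  ⟨by rw [← filterMap_fst_conv u v, h, filterMap_fst_conv],
    by rw [← filterMap_snd_conv u v, h, filterMap_snd_conv]⟩

/-- The way in which an automaton reading a convolution notices that the second word is longer. -/
theorem exists_fst_eq_none_iff (u v : Word) :
    (∃ l ∈ conv u v, l.1 = none) ↔ u.length < v.length := by
  induction u generalizing v with
  | nil => cases v <;> simp [conv_nil_left]
  | cons a u ih =>
    cases v with
    | nil => simp [conv_nil_right]
    | cons b v => simp [conv_cons, ih]

theorem mem_of_mem_fst {u v : Word} {a : Letter} (h : a ∈ u) : ∃ b, (some a, b) ∈ conv u v := by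
  rw [← filterMap_fst_conv u v] at h
  obtain ⟨⟨c, b⟩, h1, h2⟩ := List.mem_filterMap.1 h
  simp only at h2
  subst h2
  exact ⟨b, h1⟩

end Word

/-- An injective sequence has a subsequence along which a function with finite fibres grows. -/
theorem exists_subsequence {X : Type} {a : ℕ → X} (ha : Function.Injective a) (f : X → ℕ)
    (hf : ∀ n, {x | x ∈ Set.range a ∧ f x ≤ n}.Finite) :
    ∃ φ : ℕ → ℕ, StrictMono φ ∧ StrictMono fun i => f (a (φ i)) := by
  have : Filter.Tendsto (fun i => f (a i)) Filter.atTop Filter.atTop := by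
    rw [Filter.tendsto_atTop]
    intro n
    have h1 : {i | f (a i) ≤ n}.Finite :=
      ((hf n).preimage ha.injOn).subset fun i hi => ⟨⟨i, rfl⟩, hi⟩
    rw [← Nat.cofinite_eq_atTop]
    refine (h1.subset fun i hi => ?_ : Set.Finite _)
    simp only [Set.mem_compl_iff, Set.mem_ofPred_eq, not_le] at hi ⊢
    exact hi.le
  exact Filter.strictMono_subseq_of_tendsto_atTop this

theorem finite_words (s : List Letter) (n : ℕ) :
    {u : Word | (∀ a ∈ u, a ∈ s) ∧ u.length ≤ n}.Finite := by
  have : Finite {a // a ∈ s} := (List.finite_toSet s)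
  refine ((List.finite_length_le {a // a ∈ s} n).image (List.map Subtype.val)).subset ?_
  rintro u ⟨h1, h2⟩
  exact ⟨u.pmap Subtype.mk h1, by simpa using h2, by simp [List.map_pmap]⟩

/-! ### Reduction of the infinite clique problem over words -/

/-- States of the automata to which an instance of the infinite clique problem is mapped. -/
inductive CliqueState : Type
  | init
  | all
  -- For words, the flag records that a letter without first component has been read; for trees, it
  -- demands that one occurs in the subtree.
  | copy (b : Bool) (q : Name)

namespace CliqueState

def code : CliqueState → List Symbol
  | init => []
  | all => [.bot]
  | copy b q => encBit b :: encName q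

theorem code_injective : Function.Injective code := by
  intro s t h
  rcases s with _ | _ | ⟨b, q⟩ <;> rcases t with _ | _ | ⟨b', q'⟩ <;>
    first
    | rfl
    | (simp only [code, List.cons.injEq] at h
       obtain ⟨h1, h2⟩ := h
       rw [isCode_encName.injective h2]
       cases b <;> cases b' <;> simp [encBit] at h1 ⊢)
    | (simp [code, encName] at h)

end CliqueState

namespace WordPairAutomaton

variable (A : WordPairAutomaton)

/-- The letters in the first component. -/
def firstLetters : List Letter := A.trans.filterMap fun t => t.2.1.bind Prod.fst

open CliqueState in
/-- The transitions that are obtained from one transition of the given automaton. -/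
def cliqueTrans (t : Name × Option (Option Letter × Option Letter) × Name) :
    List (CliqueState × Option (Option Letter × Option Letter) × CliqueState) :=
  (copy false t.1, t.2.1, copy false t.2.2) :: (copy true t.1, t.2.1, copy true t.2.2) ::
    match t.2.1 with
    | none => []
    | some (none, _) => [(copy false t.1, t.2.1, copy true t.2.2)]
    | some (some a, _) =>
      [(init, some (none, some a), all), (all, some (none, some a), all)]

/-- The automaton for the pairs in the relation the second component of which is longer, and the
pairs whose first component is empty. -/
def cliqueAutomaton : AbstractWordAutomaton CliqueState (Option Letter × Option Letter) where
  start := .init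
  final := .all :: A.final.map (.copy true)
  trans := (.init, none, .copy false A.start) :: A.trans.flatMap cliqueTrans

/-- The automaton for all words. -/
def allWords : AbstractWordAutomaton CliqueState Letter where
  start := .all
  final := [.all]
  trans := A.firstLetters.map fun a => (.all, some a, .all)

def toRecInput : WordRecInput where
  R := A.cliqueAutomaton.toWordAutomaton CliqueState.code
  L := A.allWords.toWordAutomaton CliqueState.code
  w := []

variable {A}

theorem mem_firstLetters {a : Letter} :
    a ∈ A.firstLetters ↔ ∃ q b q', (q, some (some a, b), q') ∈ A.trans := by
  simp only [firstLetters, List.mem_filterMap]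
  constructor
  · rintro ⟨⟨q, l, q'⟩, h, h'⟩
    obtain ⟨⟨c, b⟩, rfl, rfl⟩ := Option.bind_eq_some_iff.1 h'
    exact ⟨q, b, q', h⟩
  · rintro ⟨q, b, q', h⟩
    exact ⟨_, h, rfl⟩

theorem mem_cliqueAutomaton_trans {s s' : CliqueState}
    {l : Option (Option Letter × Option Letter)} :
    (s, l, s') ∈ A.cliqueAutomaton.trans ↔
      (s = .init ∧ l = none ∧ s' = .copy false A.start) ∨
      (∃ q q', (q, l, q') ∈ A.trans ∧ ((∃ b, s = .copy b q ∧ s' = .copy b q') ∨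
        ((∃ c, l = some (none, c)) ∧ s = .copy false q ∧ s' = .copy true q'))) ∨
      ∃ a ∈ A.firstLetters, l = some (none, some a) ∧ (s = .init ∨ s = .all) ∧ s' = .all := by
  simp only [cliqueAutomaton, List.mem_cons, List.mem_flatMap, Prod.mk.injEq]
  refine or_congr_right ?_
  constructor
  · rintro ⟨⟨q, l', q'⟩, ht, h⟩
    simp only [cliqueTrans, List.mem_cons, Prod.mk.injEq] at h
    rcases h with ⟨rfl, rfl, rfl⟩ | ⟨rfl, rfl, rfl⟩ | h
    · exact .inl ⟨q, q', ht, .inl ⟨_, rfl, rfl⟩⟩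
    · exact .inl ⟨q, q', ht, .inl ⟨_, rfl, rfl⟩⟩
    · rcases l' with _ | ⟨_ | a, b⟩
      · simp at h
      · simp only [List.mem_singleton, Prod.mk.injEq] at h
        obtain ⟨rfl, rfl, rfl⟩ := h
        exact .inl ⟨q, q', ht, .inr ⟨⟨b, rfl⟩, rfl, rfl⟩⟩
      · have ha : a ∈ A.firstLetters := mem_firstLetters.2 ⟨q, b, q', ht⟩
        simp only [List.mem_cons, Prod.mk.injEq, List.not_mem_nil, or_false] at h
        rcases h with ⟨rfl, rfl, rfl⟩ | ⟨rfl, rfl, rfl⟩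
        · exact .inr ⟨a, ha, rfl, .inl rfl, rfl⟩
        · exact .inr ⟨a, ha, rfl, .inr rfl, rfl⟩
  · rintro (⟨q, q', ht, ⟨b, rfl, rfl⟩ | ⟨⟨c, rfl⟩, rfl, rfl⟩⟩ | ⟨a, ha, rfl, h, rfl⟩)
    · refine ⟨_, ht, ?_⟩
      cases b <;> simp [cliqueTrans]
    · exact ⟨_, ht, by simp [cliqueTrans]⟩
    · obtain ⟨q, b, q', ht⟩ := mem_firstLetters.1 ha
      refine ⟨_, ht, ?_⟩
      rcases h with rfl | rfl <;> simp [cliqueTrans]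

abbrev Run (A : WordPairAutomaton) := WordRun (fun q a q' => (q, a, q') ∈ A.trans)
  (fun q => q ∈ A.final)

/-- Among the copies only those with flag `true` are final, and the flag can only be raised while
reading a letter without first component. Raising it is optional, so a run raises it at the last
such letter, for instance. -/
theorem cliqueAutomaton_run_copy {b : Bool} {q : Name}
    {x : List (Option Letter × Option Letter)} :
    A.cliqueAutomaton.Run (.copy b q) x ↔
      A.Run q x ∧ (b = true ∨ ∃ l ∈ x, l.1 = none) := by
  constructor
  · intro h
    generalize hs : CliqueState.copy b q = s at h
    induction h generalizing b q with
    | nil h =>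
      subst hs
      simp only [cliqueAutomaton, List.mem_cons, List.mem_map] at h
      rcases h with h | ⟨q', h, h'⟩
      · cases h
      · cases h'
        exact ⟨.nil h, .inl rfl⟩
    | eps h _ ih =>
      subst hs
      rcases mem_cliqueAutomaton_trans.1 h with ⟨h, -⟩ |
        ⟨q, q', ht, ⟨b, h1, rfl⟩ | ⟨⟨c, h2⟩, -⟩⟩ | ⟨a, -, h, -⟩
      · cases h
      · cases h1
        obtain ⟨h3, h4⟩ := ih rfl
        exact ⟨.eps ht h3, h4⟩
      · cases h2
      · cases h
    | step h _ ih =>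
      subst hs
      rcases mem_cliqueAutomaton_trans.1 h with ⟨h, -⟩ |
        ⟨q, q', ht, ⟨b, h1, rfl⟩ | ⟨⟨c, h2⟩, h1, rfl⟩⟩ | ⟨a, -, -, h | h, -⟩
      · cases h
      · cases h1
        obtain ⟨h3, h4⟩ := ih rfl
        exact ⟨.step ht h3, h4.imp_right fun ⟨l, h5, h6⟩ => ⟨l, by simp [h5], h6⟩⟩
      · cases h1
        cases h2
        exact ⟨.step ht (ih rfl).1, .inr ⟨_, List.mem_cons_self, rfl⟩⟩
      · cases h
      · cases h
  · rintro ⟨h, hb⟩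
    induction h generalizing b with
    | nil h =>
      obtain rfl : b = true := by simpa using hb
      refine .nil ?_
      simp only [cliqueAutomaton, List.mem_cons, List.mem_map]
      exact .inr ⟨_, h, rfl⟩
    | eps h _ ih =>
      exact .eps (mem_cliqueAutomaton_trans.2 (.inr (.inl ⟨_, _, h, .inl ⟨b, rfl, rfl⟩⟩))) (ih hb)
    | @step q q' l u h _ ih =>
      by_cases hl : b = true ∨ ∃ l ∈ u, l.1 = none
      · exact .step (mem_cliqueAutomaton_trans.2 (.inr (.inl ⟨_, _, h, .inl ⟨b, rfl, rfl⟩⟩)))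
          (ih hl)
      · push Not at hl
        have hl' : l.1 = none := by
          rcases hb with hb | ⟨l', h1, h2⟩
          · exact absurd hb hl.1
          · rcases List.mem_cons.1 h1 with rfl | h1
            · exact h2
            · exact absurd h2 (hl.2 l' h1)
        obtain rfl : b = false := by simpa using hl.1
        refine .step (mem_cliqueAutomaton_trans.2 (.inr (.inl ⟨_, _, h, .inr ⟨⟨l.2, ?_⟩, rfl,
          rfl⟩⟩))) (ih (.inl rfl))
        rw [← hl']

theorem cliqueAutomaton_run_all {x : List (Option Letter × Option Letter)} :
    A.cliqueAutomaton.Run .all x ↔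
      ∃ v : Word, (∀ a ∈ v, a ∈ A.firstLetters) ∧ x = v.map fun b => (none, some b) := by
  constructor
  · intro h
    generalize hs : CliqueState.all = s at h
    induction h with
    | nil => exact ⟨[], by simp, rfl⟩
    | eps h _ ih =>
      subst hs
      rcases mem_cliqueAutomaton_trans.1 h with ⟨h, -⟩ |
        ⟨q, q', ht, ⟨b, h1, rfl⟩ | ⟨⟨c, h2⟩, -⟩⟩ | ⟨a, -, h, -⟩
      · cases h
      · cases h1
      · cases h2
      · cases h
    | step h _ ih =>
      subst hs
      rcases mem_cliqueAutomaton_trans.1 h with ⟨h, -⟩ |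
        ⟨q, q', ht, ⟨b, h1, rfl⟩ | ⟨-, h2, -⟩⟩ | ⟨a, ha, hl, -, rfl⟩
      · cases h
      · cases h1
      · cases h2
      · obtain rfl := Option.some.inj hl
        obtain ⟨v, hv, rfl⟩ := ih rfl
        exact ⟨a :: v, by simpa using ⟨ha, hv⟩, rfl⟩
  · rintro ⟨v, hv, rfl⟩
    induction v with
    | nil => exact .nil (by simp [cliqueAutomaton])
    | cons a v ih =>
      exact .step (mem_cliqueAutomaton_trans.2 (.inr (.inr ⟨a, hv a (by simp), rfl, .inr rfl,
        rfl⟩))) (ih fun a ha => hv a (by simp [ha]))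

theorem cliqueAutomaton_accepts {x : List (Option Letter × Option Letter)} :
    x ∈ A.toRecInput.R.accepts ↔ (x ∈ A.accepts ∧ ∃ l ∈ x, l.1 = none) ∨
      ∃ v : Word, v ≠ [] ∧ (∀ a ∈ v, a ∈ A.firstLetters) ∧ x = Word.conv [] v := by
  refine (AbstractWordAutomaton.mem_accepts CliqueState.code_injective).trans ?_
  change A.cliqueAutomaton.Run .init x ↔ _
  rw [WordAutomaton.mem_accepts]
  constructor
  · intro h
    cases h with
    | nil h => simp [cliqueAutomaton] at h
    | eps h h' =>
      rcases mem_cliqueAutomaton_trans.1 h with ⟨-, -, rfl⟩ |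
        ⟨q, q', ht, ⟨b, h1, rfl⟩ | ⟨⟨c, h2⟩, -⟩⟩ | ⟨a, -, h, -⟩
      · obtain ⟨h1, h2⟩ := cliqueAutomaton_run_copy.1 h'
        exact .inl ⟨h1, by simpa using h2⟩
      · cases h1
      · cases h2
      · cases h
    | step h h' =>
      rcases mem_cliqueAutomaton_trans.1 h with ⟨-, h, -⟩ |
        ⟨q, q', ht, ⟨b, h1, rfl⟩ | ⟨-, h2, -⟩⟩ | ⟨a, ha, hl, -, rfl⟩
      · cases h
      · cases h1
      · cases h2
      · obtain rfl := Option.some.inj hl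
        obtain ⟨v, hv, rfl⟩ := cliqueAutomaton_run_all.1 h'
        exact .inr ⟨a :: v, by simp, by simpa using ⟨ha, hv⟩, by simp [Word.conv_nil_left]⟩
  · rintro (⟨h1, h2⟩ | ⟨v, hv, hv', rfl⟩)
    · exact .eps (mem_cliqueAutomaton_trans.2 (.inl ⟨rfl, rfl, rfl⟩))
        (cliqueAutomaton_run_copy.2 ⟨h1, .inr h2⟩)
    · obtain ⟨a, v, rfl⟩ := List.exists_cons_of_ne_nil hv
      rw [Word.conv_nil_left, List.map_cons]
      exact .step (mem_cliqueAutomaton_trans.2 (.inr (.inr ⟨a, hv' a (by simp), rfl, .inl rfl,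
        rfl⟩))) (cliqueAutomaton_run_all.2 ⟨v, fun b hb => hv' b (by simp [hb]), rfl⟩)

/-- The second alternative makes the empty word a predecessor of every nonempty word over the
alphabet, whether or not it has successors in the given relation. -/
theorem toRecInput_rel {u v : Word} : A.toRecInput.R.rel u v ↔
    (A.rel u v ∧ u.length < v.length) ∨
      (u = [] ∧ v ≠ [] ∧ ∀ a ∈ v, a ∈ A.firstLetters) := by
  rw [rel, cliqueAutomaton_accepts, Word.exists_fst_eq_none_iff]
  refine or_congr Iff.rfl ?_
  constructor
  · rintro ⟨v', h1, h2, h3⟩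
    obtain ⟨rfl, rfl⟩ := Word.conv_inj h3
    exact ⟨rfl, h1, h2⟩
  · rintro ⟨rfl, h1, h2⟩
    exact ⟨v, h1, h2, rfl⟩

theorem toRecInput_recognizes (hA : A.Recognizes A.rel) :
    A.toRecInput.R.Recognizes A.toRecInput.R.rel := by
  refine Set.Subset.antisymm (fun x hx => ?_) ?_
  · have : ∃ u v, x = Word.conv u v := by
      rcases cliqueAutomaton_accepts.1 hx with ⟨h, -⟩ | ⟨v, -, -, h⟩
      · rw [hA] at h
        obtain ⟨u, v, -, h⟩ := h
        exact ⟨u, v, h⟩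
      · exact ⟨[], v, h⟩
    obtain ⟨u, v, rfl⟩ := this
    exact ⟨u, v, hx, rfl⟩
  · rintro _ ⟨u, v, h, rfl⟩
    exact h

theorem mem_toRecInput_L {v : Word} :
    v ∈ A.toRecInput.L.accepts ↔ ∀ a ∈ v, a ∈ A.firstLetters := by
  refine (AbstractWordAutomaton.mem_accepts CliqueState.code_injective).trans ?_
  change A.allWords.Run .all v ↔ _
  constructor
  · intro h a ha
    obtain ⟨q₁, q₂, h⟩ := h.letters a ha
    simp only [allWords, List.mem_map, Prod.mk.injEq, Option.some.injEq] at h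
    obtain ⟨b, hb, -, rfl, -⟩ := h
    exact hb
  · intro h
    induction v with
    | nil => exact .nil (by simp [allWords])
    | cons a v ih =>
      refine .step (q' := .all) ?_ (ih fun b hb => h b (by simp [hb]))
      simpa [allWords] using h a (by simp)

theorem rel_letters {u v : Word} (h : A.rel u v) : ∀ a ∈ u, a ∈ A.firstLetters := by
  intro a ha
  obtain ⟨b, hb⟩ := Word.mem_of_mem_fst (v := v) ha
  obtain ⟨q₁, q₂, h⟩ := ((WordAutomaton.mem_accepts A _).1 h).letters _ hb
  exact mem_firstLetters.2 ⟨q₁, b, q₂, h⟩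

/-- Every element of a clique is the first component of some pair, hence a word over `firstLetters`.
This finite alphabet is what makes the lengths unbounded. -/
theorem hasInfiniteClique_iff : HasInfiniteClique A.rel ↔
    A.toRecInput.w ∈ Rec A.toRecInput.R.rel A.toRecInput.L.accepts := by
  constructor
  · rintro ⟨a, ha, hR⟩
    have hl : ∀ i, ∀ c ∈ a i, c ∈ A.firstLetters := fun i =>
      rel_letters (hR i (i + 1) (Nat.lt_succ_self i))
    obtain ⟨φ, hφ, hφ'⟩ := exists_subsequence ha List.length fun n =>
      (finite_words A.firstLetters n).subset (by
        rintro _ ⟨⟨i, rfl⟩, hi⟩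
        exact ⟨hl i, hi⟩)
    -- The first word of the subsequence is skipped because it may be empty; the following ones are
    -- longer, hence nonempty.
    refine ⟨fun i => i.casesOn [] fun i => a (φ (i + 1)), rfl, ?_, ?_⟩
    · intro i j hij
      obtain ⟨j, rfl⟩ : ∃ k, j = k + 1 := ⟨j - 1, by omega⟩
      rw [toRecInput_rel]
      cases i with
      | zero =>
        refine .inr ⟨rfl, fun h => ?_, hl _⟩
        have h1 := hφ' (Nat.zero_lt_succ j)
        simp only at h h1
        rw [h] at h1
        simp at h1
      | succ i => exact .inl ⟨hR _ _ (hφ hij), hφ' hij⟩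
    · refine Set.infinite_of_injective_forall_mem (f := fun i : ℕ => i + 1)
        (add_left_injective 1) fun i => ?_
      exact mem_toRecInput_L.2 (hl _)
  · rintro ⟨a, h0, hR, -⟩
    replace h0 : a 0 = [] := h0
    have h1 : ∀ i, a (i + 1) ≠ [] := by
      intro i h
      have := hR 0 (i + 1) (by omega)
      rw [toRecInput_rel, h0, h] at this
      simp at this
    have h2 : ∀ i j, i < j → A.rel (a (i + 1)) (a (j + 1)) ∧
        (a (i + 1)).length < (a (j + 1)).length := by
      intro i j hij
      rcases toRecInput_rel.1 (hR (i + 1) (j + 1) (by omega)) with h | ⟨h, -⟩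
      · exact h
      · exact absurd h (h1 i)
    -- Strictly growing lengths give injectivity.
    refine ⟨fun i => a (i + 1), fun i j hij => ?_, fun i j hij => (h2 i j hij).1⟩
    rcases lt_trichotomy i j with h | h | h
    · have := (h2 i j h).2
      simp only at hij
      rw [hij] at this
      omega
    · exact h
    · have := (h2 j i h).2
      simp only at hij
      rw [hij] at this
      omega

end WordPairAutomaton

/-! ### Reading word automata -/

namespace Parser

variable {α : Type} {e : α → List Symbol} {past : List Symbol → ℕ → ℕ}

theorem segment_eq (h : Parser e past) {x : List Symbol} {p : ℕ} {a : α} (ha : At x p (e a)) :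
    segment x p (past x p) = e a :=
  AutRel.segment_eq ha (h.past_eq x p a ha)

theorem at_append_iff (h : Parser e past) {x : List Symbol} {p : ℕ} {a : α} {l : List Symbol} :
    At x p (e a ++ l) ↔ At x p (e a) ∧ At x (past x p) l := by
  rw [At.append_iff]
  exact and_congr_right fun ha => by rw [h.past_eq x p a ha]

theorem at_option_append_iff (h : Parser e past) {x : List Symbol} {p : ℕ} {o : Option α}
    {l : List Symbol} : At x p (encOption e o ++ l) ↔
      At x p (encOption e o) ∧ At x (pastOption past x p) l := by
  rw [At.append_iff]
  exact and_congr_right fun ha => by rw [h.pastOption_eq ha]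

end Parser

/-- The name at position `p`. -/
def nameAt (x : List Symbol) (p : ℕ) : List Symbol := segment x p (pastName x p)

theorem nameAt_eq {x : List Symbol} {p : ℕ} {q : Name} (h : At x p (encName q)) :
    nameAt x p = encName q := parser_name.segment_eq h

theorem Out.nameAt {k : ℕ} {g : List Symbol → (Fin k → ℕ) → ℕ} (hg : Num g) :
    Out fun x v => nameAt x (g x v) := .segment hg hg.pastName

/-- The encoding of transitions of word automata. -/
abbrev encWordTrans {α : Type} (e : α → List Symbol) : Name × Option α × Name → List Symbol :=
  encPair encName (encPair (encOption e) encName)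

/-- The position of the target of the transition at position `p`. -/
def targetPos (past : List Symbol → ℕ → ℕ) (x : List Symbol) (p : ℕ) : ℕ :=
  pastOption past x (pastName x p)

def pastWordTrans (past : List Symbol → ℕ → ℕ) (x : List Symbol) (p : ℕ) : ℕ :=
  pastName x (targetPos past x p)

section

variable {α : Type} {e : α → List Symbol} {past : List Symbol → ℕ → ℕ}

theorem Num.targetPos {k : ℕ} (h : Num fun x (v : Fin 1 → ℕ) => past x (v 0))
    {g : List Symbol → (Fin k → ℕ) → ℕ} (hg : Num g) :
    Num fun x v => targetPos past x (g x v) := .pastOption h hg.pastName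

theorem Parser.at_wordTrans_iff (h : Parser e past) {x : List Symbol} {p : ℕ}
    {t : Name × Option α × Name} : At x p (encWordTrans e t) ↔ At x p (encName t.1) ∧
      At x (pastName x p) (encOption e t.2.1) ∧ At x (targetPos past x p) (encName t.2.2) := by
  rw [encWordTrans, encPair, parser_name.at_append_iff, encPair, h.at_option_append_iff]
  rfl

theorem Parser.wordTrans (h : Parser e past) : Parser (encWordTrans e) (pastWordTrans past) where
  code := isCode_encName.pair ((h.code.option h.head).pair isCode_encName)
  head := fun t => by simp [encWordTrans, encPair, encName]
  past_eq := by
    intro x p t ht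
    obtain ⟨h1, h2, h3⟩ := h.at_wordTrans_iff.1 ht
    rw [pastWordTrans, parser_name.past_eq _ _ _ h3, targetPos, h.pastOption_eq h2,
      parser_name.past_eq _ _ _ h1]
    simp only [encWordTrans, encPair, List.length_append]
    omega
  num := (Num.targetPos h.num (.var 0)).pastName

/-- The position of the list of transitions of the automaton at position `p`. -/
def transPos (x : List Symbol) (p : ℕ) : ℕ := pastList pastName x (pastName x p)

theorem Num.transPos {k : ℕ} {g : List Symbol → (Fin k → ℕ) → ℕ} (hg : Num g) :
    Num fun x v => transPos x (g x v) := .pastList parser_name.num hg.pastName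

/-- The position after the automaton at position `p`. -/
def pastWordAutomaton (past : List Symbol → ℕ → ℕ) (x : List Symbol) (p : ℕ) : ℕ :=
  pastList (pastWordTrans past) x (transPos x p)

theorem Num.pastWordAutomaton {k : ℕ} (h : Num fun x (v : Fin 1 → ℕ) => past x (v 0))
    {g : List Symbol → (Fin k → ℕ) → ℕ} (hg : Num g) :
    Num fun x v => pastWordAutomaton past x (g x v) :=
  .pastList (Num.targetPos h (.var 0)).pastName hg.transPos

theorem Parser.at_wordAutomaton_iff (h : Parser e past) {x : List Symbol} {p : ℕ}
    {A : WordAutomaton α} {l : List Symbol} : At x p (A.enc e ++ l) ↔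
      At x p (encName A.start) ∧ At x (pastName x p) (encList encName A.final) ∧
      At x (transPos x p) (encList (encWordTrans e) A.trans) ∧
      At x (pastWordAutomaton past x p) l := by
  rw [WordAutomaton.enc, List.append_assoc, parser_name.at_append_iff, List.append_assoc,
    parser_name.list.at_append_iff, h.wordTrans.list.at_append_iff]
  rfl

theorem Parser.wordAutomaton (h : Parser e past) :
    Parser (WordAutomaton.enc e) (pastWordAutomaton past) where
  code := WordAutomaton.isCode_enc (h.code.option h.head)
  head := fun A => by simp [WordAutomaton.enc, encName]
  past_eq := by
    intro x p A hA
    obtain ⟨h1, h2, h3, -⟩ := h.at_wordAutomaton_iff.1 (by rwa [List.append_nil] : At x p (_ ++ []))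
    rw [AutRel.pastWordAutomaton, h.wordTrans.list.past_eq _ _ _ h3, transPos,
      parser_name.list.past_eq _ _ _ h2, parser_name.past_eq _ _ _ h1]
    simp only [WordAutomaton.enc, encWordTrans, List.length_append]
    omega
  num := .pastWordAutomaton h.num (.var 0)

end

/-- The position of the first component of the optional letter at position `p`. -/
def fstPos (x : List Symbol) (p : ℕ) : ℕ := if isLpar x[p]? = true then p + 1 else p

/-- The position of the second component of the optional letter at position `p`. -/
def sndPos (x : List Symbol) (p : ℕ) : ℕ :=
  if isLpar x[p]? = true then pastOption pastName x (p + 1) else p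

theorem Num.fstPos {k : ℕ} {g : List Symbol → (Fin k → ℕ) → ℕ} (hg : Num g) :
    Num fun x v => fstPos x (g x v) := .ite (.letter _ hg) (.add hg (.const 1)) hg

theorem Num.sndPos {k : ℕ} {g : List Symbol → (Fin k → ℕ) → ℕ} (hg : Num g) :
    Num fun x v => sndPos x (g x v) :=
  .ite (.letter _ hg) (.pastOption parser_name.num (.add hg (.const 1))) hg

theorem OptAt.fst_snd {x : List Symbol} {p : ℕ} {o : Option (Option Letter × Option Letter)}
    (h : OptAt encLetterPair x p o) :
    OptAt encName x (fstPos x p) (o.bind Prod.fst) ∧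
      OptAt encName x (sndPos x p) (o.bind Prod.snd) := by
  cases o with
  | none =>
    have h' : isLpar x[p]? = false := h
    rw [fstPos, sndPos, h', if_neg Bool.false_ne_true, if_neg Bool.false_ne_true]
    exact ⟨h', h'⟩
  | some a =>
    have h' : At x p (encLetterPair a) := h
    rw [fstPos, sndPos, if_pos (parser_letterPair.isLpar h'), if_pos (parser_letterPair.isLpar h')]
    rw [encLetterPair, At.cons_iff, encPair, parser_name.at_option_append_iff] at h'
    exact ⟨.of_at h'.2.1, .of_at h'.2.2⟩

theorem Out.encList {k : ℕ} {F : List Symbol → (Fin k → ℕ) → List Symbol} (hF : Out F) :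
    Out fun x v => Symbol.lpar :: F x v ++ [.rpar] :=
  ((Out.const [.lpar]).append hF).append (.const _)

theorem Out.cons {k : ℕ} (s : Symbol) {F : List Symbol → (Fin k → ℕ) → List Symbol}
    (hF : Out F) : Out fun x v => s :: F x v := (Out.const [s]).append hF

theorem AbstractWordAutomaton.enc_toWordAutomaton {S α : Type} (A : AbstractWordAutomaton S α)
    (c : S → List Symbol) (e : α → List Symbol) : (A.toWordAutomaton c).enc e =
      nameCode (c A.start) ++ (.lpar :: A.final.flatMap (fun q => nameCode (c q)) ++ [.rpar] ++
        (.lpar :: A.trans.flatMap (fun t =>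
          nameCode (c t.1) ++ (encOption e t.2.1 ++ nameCode (c t.2.2))) ++ [.rpar])) := by
  simp only [WordAutomaton.enc, encList, toWordAutomaton, encPair, List.flatMap_map,
    encName_nameOf]

/-! ### Computation of the reduction of the infinite clique problem over words -/

/-- The code of the optional letter `l` and of the names of the states before and after it. -/
def printTrans (s l s' : List Symbol) : List Symbol := nameCode s ++ (l ++ nameCode s')

theorem Out.printTrans {k : ℕ} {F G H : List Symbol → (Fin k → ℕ) → List Symbol} (hF : Out F)
    (hG : Out G) (hH : Out H) : Out fun x v => printTrans (F x v) (G x v) (H x v) :=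
  hF.nameCode.append (hG.append hH.nameCode)

/-- Follows `cliqueTrans` and `CliqueState.code`: `[]` and `[.bot]` are the codes of `init` and
`all`, a leading `.zero` or `.one` is the flag of a copy. In `.lpar :: .bot :: _` a first component
is printed as a second one. -/
def cliqueTransOut (x : List Symbol) (t : ℕ) : List Symbol :=
  printTrans (.zero :: nameAt x t) (optionOut pastLetterPair x (pastName x t))
    (.zero :: nameAt x (targetPos pastLetterPair x t)) ++
  (printTrans (.one :: nameAt x t) (optionOut pastLetterPair x (pastName x t))
    (.one :: nameAt x (targetPos pastLetterPair x t)) ++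
  if isLpar x[pastName x t]? = true then
    if isLpar x[fstPos x (pastName x t)]? = true then
      printTrans [] (.lpar :: .bot :: nameAt x (fstPos x (pastName x t))) [.bot] ++
      printTrans [.bot] (.lpar :: .bot :: nameAt x (fstPos x (pastName x t))) [.bot]
    else
      printTrans (.zero :: nameAt x t) (optionOut pastLetterPair x (pastName x t))
        (.one :: nameAt x (targetPos pastLetterPair x t))
  else [])

theorem out_cliqueTransOut : Out fun x (v : Fin 1 → ℕ) => cliqueTransOut x (v 0) := by
  have h1 : Out fun x (v : Fin 1 → ℕ) => nameAt x (v 0) := .nameAt (.var 0)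
  have h2 : Num fun x (v : Fin 1 → ℕ) => pastName x (v 0) := (Num.var 0).pastName
  have h3 : Out fun x (v : Fin 1 → ℕ) => optionOut pastLetterPair x (pastName x (v 0)) :=
    .optionOut parser_letterPair.num h2
  have h4 : Out fun x (v : Fin 1 → ℕ) => nameAt x (targetPos pastLetterPair x (v 0)) :=
    .nameAt (.targetPos parser_letterPair.num (.var 0))
  have h5 : Out fun x (v : Fin 1 → ℕ) => nameAt x (fstPos x (pastName x (v 0))) :=
    .nameAt h2.fstPos
  refine ((h1.cons _).printTrans h3 (h4.cons _)).append
    (((h1.cons _).printTrans h3 (h4.cons _)).append (.ite (.letter _ h2)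
      (.ite (.letter _ h2.fstPos) ?_ ((h1.cons _).printTrans h3 (h4.cons _))) (.const _)))
  exact ((Out.const []).printTrans ((h5.cons _).cons _) (.const _)).append
    ((Out.const [.bot]).printTrans ((h5.cons _).cons _) (.const _))

def firstLetterOut (x : List Symbol) (t : ℕ) : List Symbol :=
  if isLpar x[pastName x t]? = true then
    if isLpar x[fstPos x (pastName x t)]? = true then
      printTrans [.bot] (nameAt x (fstPos x (pastName x t))) [.bot]
    else []
  else []

theorem out_firstLetterOut : Out fun x (v : Fin 1 → ℕ) => firstLetterOut x (v 0) := by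
  have h2 : Num fun x (v : Fin 1 → ℕ) => pastName x (v 0) := (Num.var 0).pastName
  exact .ite (.letter _ h2) (.ite (.letter _ h2.fstPos)
    ((Out.const [.bot]).printTrans (.nameAt h2.fstPos) (.const _)) (.const _)) (.const _)

/-- The reduction on strings. -/
def wordCliqueReduction (x : List Symbol) : List Symbol :=
  nameCode [] ++ (.lpar :: (nameCode [.bot] ++ (elems pastName x (pastName x 0 + 1)).flatMap
      fun q => nameCode (.one :: nameAt x q)) ++ [.rpar] ++
    (.lpar :: (printTrans [] [.bot] (.zero :: nameAt x 0) ++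
      (elems (pastWordTrans pastLetterPair) x (transPos x 0 + 1)).flatMap (cliqueTransOut x)) ++
        [.rpar])) ++
  (nameCode [.bot] ++ (.lpar :: nameCode [.bot] ++ [.rpar] ++
    (.lpar :: (elems (pastWordTrans pastLetterPair) x (transPos x 0 + 1)).flatMap
      (firstLetterOut x) ++ [.rpar])) ++ [.lpar, .rpar])

theorem logspaceComputable_wordCliqueReduction : LogspaceComputable wordCliqueReduction := by
  refine .of_out ?_
  have h0 : Num fun x (_ : Fin 0 → ℕ) => transPos x 0 + 1 :=
    (Num.transPos (.const 0)).add (.const 1)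
  have h1 : Num fun x (_ : Fin 0 → ℕ) => pastName x 0 + 1 :=
    (Num.pastName (.const 0)).add (.const 1)
  refine ((Out.const _).append (((Out.const _).append ?_).encList.append
    (((Out.const []).printTrans (.const [.bot]) ((Out.nameAt (.const 0)).cons _)).append
      ?_).encList)).append
    (((Out.const _).append ((Out.const _).encList.append (Out.encList ?_))).append (.const _))
  · exact .elems parser_name.num ((Out.nameAt (.var 0)).cons _).nameCode h1
  · exact .elems parser_letterPair.wordTrans.num (.comp1 out_cliqueTransOut (.var 0)) h0
  · exact .elems parser_letterPair.wordTrans.num (.comp1 out_firstLetterOut (.var 0)) h0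

-- Each loop over positions is matched with the loop over the objects written there by
-- `flatMap_eq_of_forall₂`; what remains is to compare the strings printed for one object.
open CliqueState in
theorem wordCliqueReduction_code (A : WordPairAutomaton) :
    wordCliqueReduction A.code = A.toRecInput.code := by
  have h0 : At A.code 0 (A.enc encLetterPair ++ []) := by
    rw [List.append_nil]; exact List.prefix_refl _
  obtain ⟨hs, hf, ht, -⟩ := parser_letterPair.at_wordAutomaton_iff.1 h0
  generalize A.code = x at *
  have hf' := parser_name.forall₂_elems hf
  have ht' := parser_letterPair.wordTrans.forall₂_elems ht
  have e1 : (elems pastName x (pastName x 0 + 1)).flatMap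
      (fun q => nameCode (.one :: nameAt x q)) =
      A.final.flatMap fun q => nameCode (CliqueState.code (.copy true q)) :=
    flatMap_eq_of_forall₂ hf' fun p q _ h => by rw [nameAt_eq h]; rfl
  have e2 : (elems (pastWordTrans pastLetterPair) x (transPos x 0 + 1)).flatMap
      (cliqueTransOut x) = A.trans.flatMap fun t => (WordPairAutomaton.cliqueTrans t).flatMap
        fun t => printTrans (CliqueState.code t.1) (encOption encLetterPair t.2.1)
          (CliqueState.code t.2.2) := by
    refine flatMap_eq_of_forall₂ ht' fun p t _ h => ?_
    obtain ⟨h1, h2, h3⟩ := parser_letterPair.at_wordTrans_iff.1 h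
    have h4 := OptAt.of_at h2
    have h5 := h4.fst_snd.1
    rw [cliqueTransOut, nameAt_eq h1, nameAt_eq h3, parser_letterPair.optionOut_eq h4,
      parser_letterPair.isLpar_eq h4, parser_name.isLpar_eq h5]
    obtain ⟨q, _ | ⟨_ | a, b⟩, q'⟩ := t
    · simp [WordPairAutomaton.cliqueTrans, CliqueState.code, encBit]
    · simp [WordPairAutomaton.cliqueTrans, CliqueState.code, encBit]
    · rw [nameAt_eq h5]
      simp [WordPairAutomaton.cliqueTrans, CliqueState.code, encBit, encOption, encLetterPair,
        encPair]
  have e3 : (elems (pastWordTrans pastLetterPair) x (transPos x 0 + 1)).flatMap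
      (firstLetterOut x) = A.firstLetters.flatMap fun a =>
        printTrans [.bot] (encName a) [.bot] := by
    rw [WordPairAutomaton.firstLetters, List.filterMap_eq_flatMap_toList, List.flatMap_assoc]
    refine flatMap_eq_of_forall₂ ht' fun p t _ h => ?_
    obtain ⟨h1, h2, h3⟩ := parser_letterPair.at_wordTrans_iff.1 h
    have h4 := OptAt.of_at h2
    have h5 := h4.fst_snd.1
    rw [firstLetterOut, parser_letterPair.isLpar_eq h4, parser_name.isLpar_eq h5]
    obtain ⟨q, _ | ⟨_ | a, b⟩, q'⟩ := t
    · simp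
    · simp
    · rw [nameAt_eq h5]
      simp
  rw [wordCliqueReduction, e1, e2, e3, nameAt_eq hs]
  simp only [WordRecInput.code, WordPairAutomaton.code, WordPairAutomaton.toRecInput,
    AbstractWordAutomaton.enc_toWordAutomaton, WordPairAutomaton.cliqueAutomaton,
    WordPairAutomaton.allWords, List.flatMap_cons, List.flatMap_map, List.flatMap_assoc,
    List.flatMap_nil, List.append_nil, CliqueState.code, encBit, printTrans, encOption, encList,
    List.cons_append, List.nil_append, List.append_assoc]

theorem wordClique_reduces_wordRec : LogspaceReduces (wordClique .nfa) (wordRec .nfa) :=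
  ⟨wordCliqueReduction, logspaceComputable_wordCliqueReduction, fun A hA =>
    ⟨A.toRecInput, wordCliqueReduction_code A,
      ⟨trivial, trivial, WordPairAutomaton.toRecInput_recognizes hA.2⟩,
      WordPairAutomaton.hasInfiniteClique_iff⟩⟩

/-- Induction over the `ε`-transitions at the beginning of a run. -/
theorem WordRun.eps_induction {S α : Type} {T : S → Option α → S → Prop} {fin : S → Prop} {q : S}
    {u : List α} (h : WordRun T fin q u) {P : S → Prop}
    (h1 : ∀ q q', T q none q' → WordRun T fin q' u → P q' → P q)
    (h2 : u = [] → ∀ q, fin q → P q)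
    (h3 : ∀ a v, u = a :: v → ∀ q q', T q (some a) q' → WordRun T fin q' v → P q) : P q := by
  induction h with
  | nil h => exact h2 rfl _ h
  | eps h h' ih => exact h1 _ _ h h' (ih h1 h2 h3)
  | step h h' _ => exact h3 _ _ rfl _ _ h h'

/-! ### Words: from recurrent reachability to infinite cliques. -/

/-! ### Words with padding -/

section Padding

variable {α β : Type} [DecidableEq β] (f : α → β) (blank : β) (A : WordAutomaton α)

/-- The automaton for the words in the language that are padded with blanks. -/
def WordAutomaton.padded : AbstractWordAutomaton (Option Name) β where
  start := some A.start
  final := A.final.map some ++ [none]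
  -- A given transition that reads the blank is dropped, so that blanks are only read as padding and
  -- always lead to the new state. No convolution contains the pair of blanks, so nothing useful is
  -- lost.
  trans := (A.trans.flatMap fun t => if t.2.1.map f = some blank then [] else
      [(some t.1, t.2.1.map f, some t.2.2)]) ++
    (A.final.map fun q => (some q, some blank, none)) ++ [(none, some blank, none)]

variable {f blank A}

theorem WordAutomaton.mem_padded_trans {s s' : Option Name} {l : Option β} :
    (s, l, s') ∈ (A.padded f blank).trans ↔
      (∃ q a q', (q, a, q') ∈ A.trans ∧ s = some q ∧ s' = some q' ∧ l = a.map f ∧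
        l ≠ some blank) ∨ (s ∈ (A.padded f blank).final ∧ s' = none ∧ l = some blank) := by
  simp only [padded, List.mem_append, List.mem_flatMap, List.mem_map, Prod.mk.injEq,
    List.mem_singleton, or_assoc]
  refine or_congr ?_ ?_
  · constructor
    · rintro ⟨⟨q, a, q'⟩, h, h'⟩
      split_ifs at h' with hl
      · simp at h'
      · simp only [List.mem_singleton, Prod.mk.injEq] at h'
        obtain ⟨rfl, rfl, rfl⟩ := h'
        exact ⟨q, a, q', h, rfl, rfl, rfl, hl⟩
    · rintro ⟨q, a, q', h, rfl, rfl, rfl, hl⟩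
      exact ⟨_, h, by simp [hl]⟩
  · constructor
    · rintro (⟨q, h, rfl, rfl, rfl⟩ | ⟨rfl, rfl, rfl⟩)
      · exact ⟨.inl ⟨q, h, rfl⟩, rfl, rfl⟩
      · exact ⟨.inr rfl, rfl, rfl⟩
    · rintro ⟨⟨q, h, rfl⟩ | rfl, rfl, rfl⟩
      · exact .inl ⟨q, h, rfl, rfl, rfl⟩
      · exact .inr ⟨rfl, rfl, rfl⟩

theorem WordAutomaton.padded_blank {s s' : Option Name} :
    (s, some blank, s') ∈ (A.padded f blank).trans ↔
      s ∈ (A.padded f blank).final ∧ s' = none := by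
  rw [mem_padded_trans]
  constructor
  · rintro (⟨_, _, _, _, _, _, _, h⟩ | ⟨h, h', -⟩)
    · exact absurd rfl h
    · exact ⟨h, h'⟩
  · rintro ⟨h, h'⟩
    exact .inr ⟨h, h', rfl⟩

theorem WordAutomaton.none_mem_padded_final : none ∈ (A.padded f blank).final := by
  simp [padded]

theorem WordAutomaton.some_mem_padded_final {q : Name} :
    some q ∈ (A.padded f blank).final ↔ q ∈ A.final := by
  simp [padded]

theorem WordAutomaton.padded_run_none {s : List β} :
    (A.padded f blank).Run none s ↔ ∃ k, s = List.replicate k blank := by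
  constructor
  · intro h
    generalize hq : (none : Option Name) = q at h
    induction h with
    | nil => exact ⟨0, rfl⟩
    | eps h _ ih =>
      subst hq
      rcases mem_padded_trans.1 h with ⟨_, _, _, _, h, _⟩ | ⟨-, -, h⟩ <;> cases h
    | step h _ ih =>
      subst hq
      rcases mem_padded_trans.1 h with ⟨_, _, _, _, h, _⟩ | ⟨-, rfl, hl⟩
      · cases h
      · obtain ⟨k, rfl⟩ := ih rfl
        exact ⟨k + 1, by rw [Option.some.inj hl]; rfl⟩
  · rintro ⟨k, rfl⟩
    induction k with
    | zero => exact .nil none_mem_padded_final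
    | succ k ih => exact .step (padded_blank.2 ⟨none_mem_padded_final, rfl⟩) ih

theorem WordAutomaton.padded_run {q : Name} {s : List β} :
    (A.padded f blank).Run (some q) s ↔
      ∃ u k, s = u.map f ++ List.replicate k blank ∧
        WordRun (fun q a q' => (q, a, q') ∈ A.trans) (fun q => q ∈ A.final) q u ∧
        ∀ a ∈ u, f a ≠ blank := by
  constructor
  · intro h
    generalize hq : some q = q' at h
    induction h generalizing q with
    | nil h =>
      subst hq
      exact ⟨[], 0, rfl, .nil (some_mem_padded_final.1 h), by simp⟩
    | eps h _ ih =>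
      subst hq
      rcases mem_padded_trans.1 h with ⟨q, a, q', ht, h1, rfl, h3, -⟩ | ⟨-, -, h⟩
      · cases h1
        obtain rfl : a = none := by simpa using h3.symm
        obtain ⟨u, k, h4, h5, h6⟩ := ih rfl
        exact ⟨u, k, h4, .eps ht h5, h6⟩
      · cases h
    | step h h' ih =>
      subst hq
      rcases mem_padded_trans.1 h with ⟨q, a, q', ht, h1, rfl, h3, h7⟩ | ⟨hf, rfl, hl⟩
      · cases h1
        obtain ⟨a, rfl, rfl⟩ := Option.map_eq_some_iff.1 h3.symm
        obtain ⟨u, k, rfl, h5, h6⟩ := ih rfl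
        refine ⟨a :: u, k, rfl, .step ht h5, ?_⟩
        intro b hb
        rcases List.mem_cons.1 hb with rfl | hb
        · exact fun h => h7 (by rw [h])
        · exact h6 b hb
      · obtain ⟨k, rfl⟩ := padded_run_none.1 h'
        exact ⟨[], k + 1, by rw [Option.some.inj hl]; rfl, .nil (some_mem_padded_final.1 hf),
          by simp⟩
  · rintro ⟨u, k, rfl, h, h'⟩
    induction h with
    | nil h =>
      cases k with
      | zero => exact .nil (some_mem_padded_final.2 h)
      | succ k =>
        have h1 := (padded_blank (f := f) (blank := blank)).2 ⟨some_mem_padded_final.2 h, rfl⟩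
        exact .step h1 (padded_run_none.2 ⟨k, rfl⟩)
    | eps h _ ih =>
      exact .eps (mem_padded_trans.2 (.inl ⟨_, _, _, h, rfl, rfl, rfl, by simp⟩)) (ih h')
    | step h _ ih =>
      exact .step (mem_padded_trans.2 (.inl ⟨_, _, _, h, rfl, rfl, rfl,
        by simpa using h' _ List.mem_cons_self⟩)) (ih fun a ha => h' a (by simp [ha]))

/-- The transitions of the product are listed by triples of transitions, even if only one component
makes an `ε`-move. So the other two states must have some transition; at final states the padding
transition serves. -/
theorem AbstractWordAutomaton.Run.exists_trans {s : Option Name} {u : List β}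
    (h : (A.padded f blank).Run s u) : ∃ l s', (s, l, s') ∈ (A.padded f blank).trans := by
  cases h with
  | nil h => exact ⟨_, _, WordAutomaton.padded_blank.2 ⟨h, rfl⟩⟩
  | eps h => exact ⟨_, _, h⟩
  | step h => exact ⟨_, _, h⟩

theorem WordAutomaton.IsDFA.padded_eps (hA : A.IsDFA) {s s' : Option Name} :
    (s, none, s') ∉ (A.padded f blank).trans := by
  intro h
  rcases mem_padded_trans.1 h with ⟨q, a, q', ht, -, -, h3, -⟩ | ⟨-, -, h⟩
  · obtain rfl : a = none := by simpa using h3.symm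
    exact hA.1 _ _ ht
  · cases h

theorem WordAutomaton.IsDFA.padded_eq (hA : A.IsDFA) (hf : Function.Injective f)
    {s s₁ s₂ : Option Name} {b : β} (h1 : (s, some b, s₁) ∈ (A.padded f blank).trans)
    (h2 : (s, some b, s₂) ∈ (A.padded f blank).trans) : s₁ = s₂ := by
  rcases mem_padded_trans.1 h1 with ⟨q, a, q', ht, rfl, rfl, h3, h4⟩ | ⟨hs, rfl, h⟩
  · rcases mem_padded_trans.1 h2 with ⟨q₂, a₂, q₂', ht₂, h5, rfl, h6, h7⟩ | ⟨-, -, h⟩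
    · cases h5
      obtain ⟨a, rfl, rfl⟩ := Option.map_eq_some_iff.1 h3.symm
      obtain ⟨a₂, rfl, h8⟩ := Option.map_eq_some_iff.1 h6.symm
      rw [hf h8] at ht₂
      rw [hA.2 _ _ _ _ ht ht₂]
    · exact absurd h h4
  · rw [h] at h2
    exact (padded_blank.1 h2).2.symm

end Padding

/-! ### Overlaying words with padding -/

/-- The pairs of letters of `q` and corresponding letters of `p`, which is padded if necessary. -/
def overlay {α : Type} : List (Option α) → List (Option α) → List (Option α × Option α)
  | _, [] => []
  | p, b :: q => (p.head?.join, b) :: overlay p.tail q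

section Overlay

variable {α : Type}

theorem map_snd_overlay (p q : List (Option α)) : (overlay p q).map Prod.snd = q := by
  induction q generalizing p with
  | nil => rfl
  | cons b q ih => simp [overlay, ih]

theorem map_fst_overlay {p q : List (Option α)} (h : p.length ≤ q.length) :
    (overlay p q).map Prod.fst = p ++ List.replicate (q.length - p.length) none := by
  induction q generalizing p with
  | nil =>
    obtain rfl : p = [] := by simpa using h
    rfl
  | cons b q ih =>
    cases p with
    | nil =>
      have := ih (p := []) (Nat.zero_le q.length)
      simp only [List.length_nil, Nat.sub_zero, List.nil_append] at this
      simp [overlay, this, List.replicate_succ]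
    | cons a p => simp [overlay, ih (p := p) (by simpa using h)]

theorem map_fst_conv (u v : Word) :
    (Word.conv u v).map Prod.fst = u.map some ++ List.replicate (v.length - u.length) none := by
  induction u generalizing v with
  | nil => simp [Word.conv_nil_left, Function.comp_def]
  | cons a u ih =>
    cases v <;>
      simp [Word.conv_nil_right, Word.conv_cons, ih, Function.comp_def]

theorem map_snd_conv (u v : Word) :
    (Word.conv u v).map Prod.snd = v.map some ++ List.replicate (u.length - v.length) none := by
  induction u generalizing v with
  | nil => simp [Word.conv_nil_left, Function.comp_def]
  | cons a u ih =>
    cases v <;>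
      simp [Word.conv_nil_right, Word.conv_cons, ih, Function.comp_def, List.replicate_succ]

theorem eq_of_map_fst_snd {β γ : Type} {l l' : List (β × γ)}
    (h : l.map Prod.fst = l'.map Prod.fst) (h' : l.map Prod.snd = l'.map Prod.snd) : l = l' := by
  rw [← List.zip_unzip l, ← List.zip_unzip l']
  simp only [List.unzip_eq_map, h, h']

theorem eq_map_some_append {p : List (Option α)} {x : List α} {i j : ℕ}
    (h : p ++ List.replicate i none = x.map some ++ List.replicate j none) :
    ∃ n, p = x.map some ++ List.replicate n none := by
  induction x generalizing p with
  | nil =>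
    rw [List.map_nil, List.nil_append, List.append_eq_replicate_iff] at h
    exact ⟨p.length, by simpa using h.2.1⟩
  | cons c x ih =>
    cases p with
    | nil => cases i <;> simp [List.replicate_succ] at h
    | cons a p =>
      simp only [List.map_cons, List.cons_append, List.cons.injEq] at h
      obtain ⟨n, hn⟩ := ih h.2
      exact ⟨n, by rw [h.1, hn]; rfl⟩

theorem map_some_append_inj {x y : List α} {i j : ℕ}
    (h : x.map some ++ List.replicate i none = y.map some ++ List.replicate j none) : x = y := by
  have := congrArg (List.filterMap id) h
  simpa [List.filterMap_append, List.filterMap_map, List.filterMap_replicate] using this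

/-- Overlaying two padded words gives their convolution followed by pairs of blanks, and both words
can be recovered componentwise. The overlay is as long as `q`, hence the hypothesis. -/
theorem overlay_eq_iff {p q : List (Option Letter)} (h : p.length ≤ q.length) {x y : Word} :
    (∃ k, overlay p q = Word.conv x y ++ List.replicate k (none, none)) ↔
      (∃ n, p = x.map some ++ List.replicate n none) ∧
        ∃ n, q = y.map some ++ List.replicate n none := by
  constructor
  · rintro ⟨k, hk⟩
    constructor
    · have := congrArg (List.map Prod.fst) hk
      rw [map_fst_overlay h, List.map_append, map_fst_conv, List.map_replicate, List.append_assoc,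
        List.replicate_append_replicate] at this
      exact eq_map_some_append this
    · have := congrArg (List.map Prod.snd) hk
      rw [map_snd_overlay, List.map_append, map_snd_conv, List.map_replicate, List.append_assoc,
        List.replicate_append_replicate] at this
      exact ⟨_, this⟩
  · rintro ⟨⟨n, rfl⟩, ⟨m, rfl⟩⟩
    simp only [List.length_append, List.length_map, List.length_replicate] at h
    refine ⟨y.length + m - max x.length y.length, eq_of_map_fst_snd ?_ ?_⟩
    · rw [map_fst_overlay (by simpa using h), List.map_append, map_fst_conv, List.map_replicate,
        List.append_assoc, List.append_assoc, List.replicate_append_replicate,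
        List.replicate_append_replicate]
      congr 2
      simp only [List.length_append, List.length_map, List.length_replicate]
      omega
    · rw [map_snd_overlay, List.map_append, map_snd_conv, List.map_replicate,
        List.append_assoc, List.replicate_append_replicate]
      congr 2
      omega

end Overlay

/-- An automaton that recognizes a relation accepts convolutions only. So a run on arbitrary lists
of optional letters already forces all blanks to be at the end, and the product need not check the
shape of its input. -/
theorem WordPairAutomaton.padded_run_overlay {A : WordPairAutomaton} (hA : A.Recognizes A.rel)
    {p q : List (Option Letter)} (h : p.length ≤ q.length) :
    (A.padded id (none, none)).Run (some A.start) (overlay p q) ↔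
      ∃ x y, A.rel x y ∧ (∃ n, p = x.map some ++ List.replicate n none) ∧
        ∃ n, q = y.map some ++ List.replicate n none := by
  have hconv : ∀ (x y : Word), ∀ a ∈ Word.conv x y, id a ≠ (none, none) := by
    intro x
    induction x with
    | nil => intro y; simp [Word.conv_nil_left]
    | cons c x ih =>
      intro y
      cases y with
      | nil => simp [Word.conv_nil_right]
      | cons d y =>
        rw [Word.conv_cons]
        intro a ha
        rcases List.mem_cons.1 ha with rfl | ha
        · simp
        · exact ih y a ha
  rw [WordAutomaton.padded_run]
  simp only [List.map_id, ← WordAutomaton.mem_accepts]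
  constructor
  · rintro ⟨u, k, hk, hu, -⟩
    have hu' := hu
    rw [hA] at hu'
    obtain ⟨x, y, hxy, rfl⟩ := hu'
    exact ⟨x, y, hxy, (overlay_eq_iff h).1 ⟨k, hk⟩⟩
  · rintro ⟨x, y, hxy, h'⟩
    obtain ⟨k, hk⟩ := (overlay_eq_iff h).2 h'
    exact ⟨_, k, hk, hxy, hconv x y⟩

theorem WordAutomaton.padded_run_some {A : WordAutomaton Letter} {q : List (Option Letter)} :
    (A.padded some none).Run (some A.start) q ↔
      ∃ y ∈ A.accepts, ∃ n, q = y.map some ++ List.replicate n none := by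
  rw [WordAutomaton.padded_run]
  simp only [← WordAutomaton.mem_accepts]
  constructor
  · rintro ⟨u, k, hk, hu, -⟩
    exact ⟨u, hu, k, hk⟩
  · rintro ⟨y, hy, k, hk⟩
    exact ⟨y, k, hk, hy, by simp⟩

/-! ### Reduction of recurrent reachability over words -/

/-- States of the automaton to which an instance of recurrent reachability is mapped: the first
component tells whether the first word has ended, then there are states of the three automata
that are simulated, and the rest of the given word. -/
abbrev RecState : Type := Bool × Option Name × Option Name × Option Name × Word

def RecState.code (s : RecState) : List Symbol :=
  encBit s.1 :: encPair (encOption encName) (encPair (encOption encName)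
    (encPair (encOption encName) (encList encName))) s.2

theorem RecState.code_injective : Function.Injective RecState.code := by
  rintro ⟨b, s⟩ ⟨c, t⟩ h
  simp only [code, List.cons.injEq] at h
  have h1 := (isCode_encOption_encName.pair (isCode_encOption_encName.pair
    (isCode_encOption_encName.pair isCode_encName.list))).injective h.2
  have h2 : b = c := by
    have := h.1
    cases b <;> cases c <;> simp [encBit] at this ⊢
  rw [h1, h2]

/-- The name of a letter or of the symbol that is used for padding words. -/
def padName (a : Option Letter) : Letter := nameOf (encOption encName a)

theorem padName_injective : Function.Injective padName := fun _ _ h =>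
  isCode_encOption_encName.injective (nameOf_injective h)

/-- The word `u` followed by `n` padding symbols. -/
def padWord (u : Word) (n : ℕ) : Word := (u.map some ++ List.replicate n none).map padName

/-- Transitions of padded automata. -/
abbrev PaddedTrans (β : Type) : Type := Option Name × Option β × Option Name

namespace WordRecInput

variable (I : WordRecInput)

/-- Steps of the simulations that do not read a letter. -/
def epsTrans (r : PaddedTrans (Option Letter × Option Letter)) (l : PaddedTrans (Option Letter))
    (s : PaddedTrans (Option Letter × Option Letter)) (u : Word) (b : Bool) :
    List (RecState × Option (Option Letter × Option Letter) × RecState) :=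
  (if r.2.1.isSome then [] else [((b, r.1, l.1, s.1, u), none, (b, r.2.2, l.1, s.1, u))]) ++
  ((if l.2.1.isSome then [] else [((b, r.1, l.1, s.1, u), none, (b, r.1, l.2.2, s.1, u))]) ++
  (if s.2.1.isSome then [] else [((b, r.1, l.1, s.1, u), none, (b, r.1, l.1, s.2.2, u))]))

/-- Steps of the simulations that read a letter. -/
def stepTrans (r : PaddedTrans (Option Letter × Option Letter)) (l : PaddedTrans (Option Letter))
    (s : PaddedTrans (Option Letter × Option Letter)) (u : Word) :
    List (RecState × Option (Option Letter × Option Letter) × RecState) :=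
  -- All three simulations read the same second letter, and the third reads the next letter of the
  -- given word as first one, or a blank if that word is used up.
  if r.2.1.isSome ∧ l.2.1.isSome ∧ s.2.1.isSome ∧ l.2.1.join = r.2.1.bind Prod.snd ∧
      s.2.1.bind Prod.snd = r.2.1.bind Prod.snd ∧ s.2.1.bind Prod.fst = u.head? then
    ((false, r.1, l.1, s.1, u), some (some (padName (r.2.1.bind Prod.fst)),
      some (padName (r.2.1.bind Prod.snd))), (false, r.2.2, l.2.2, s.2.2, u.tail)) ::
    -- For the simulation of `R` it makes no difference whether the first word shows a padding
    -- symbol or has ended; only the latter sets the flag.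
    if (r.2.1.bind Prod.fst).isSome then [] else
      [((false, r.1, l.1, s.1, u), some (none, some (padName (r.2.1.bind Prod.snd))),
        (true, r.2.2, l.2.2, s.2.2, u.tail)),
       ((true, r.1, l.1, s.1, u), some (none, some (padName (r.2.1.bind Prod.snd))),
        (true, r.2.2, l.2.2, s.2.2, u.tail))]
  else []

def recTrans (r : PaddedTrans (Option Letter × Option Letter)) (l : PaddedTrans (Option Letter))
    (s : PaddedTrans (Option Letter × Option Letter)) (u : Word) :
    List (RecState × Option (Option Letter × Option Letter) × RecState) :=
  epsTrans r l s u false ++ (epsTrans r l s u true ++ stepTrans r l s u)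

/-- The automaton that simulates the given automata on padded words. -/
def recAutomaton : AbstractWordAutomaton RecState (Option Letter × Option Letter) where
  start := (false, some I.R.start, some I.L.start, some I.R.start, I.w)
  -- The flag `true` means that the second padded word is strictly longer than the first; the empty
  -- rest means that the given word has been read completely.
  final := (I.R.padded id (none, none)).final.flatMap fun r =>
    (I.L.padded some none).final.flatMap fun l =>
      (I.R.padded id (none, none)).final.flatMap fun s => [(true, r, l, s, [])]
  trans := (I.R.padded id (none, none)).trans.flatMap fun r =>
    (I.L.padded some none).trans.flatMap fun l =>
      (I.R.padded id (none, none)).trans.flatMap fun s => I.w.tails.flatMap fun u =>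
        recTrans r l s u

def toClique : WordPairAutomaton := I.recAutomaton.toWordAutomaton RecState.code

variable {I}

theorem mem_recAutomaton_final {b : Bool} {r l s : Option Name} {u : Word} :
    (b, r, l, s, u) ∈ I.recAutomaton.final ↔ b = true ∧ u = [] ∧
      r ∈ (I.R.padded id (none, none)).final ∧ l ∈ (I.L.padded some none).final ∧
      s ∈ (I.R.padded id (none, none)).final := by
  simp only [recAutomaton, List.mem_flatMap, List.mem_singleton, Prod.mk.injEq]
  constructor
  · rintro ⟨r, hr, l, hl, s, hs, rfl, rfl, rfl, rfl, rfl⟩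
    exact ⟨rfl, rfl, hr, hl, hs⟩
  · rintro ⟨rfl, rfl, hr, hl, hs⟩
    exact ⟨r, hr, l, hl, s, hs, rfl, rfl, rfl, rfl, rfl⟩

theorem mem_recAutomaton_eps {b b' : Bool} {r l s r' l' s' : Option Name} {u u' : Word} :
    ((b, r, l, s, u), none, (b', r', l', s', u')) ∈ I.recAutomaton.trans ↔
      (∃ a r₁, (r, a, r₁) ∈ (I.R.padded id (none, none)).trans ∧
       ∃ d l₁, (l, d, l₁) ∈ (I.L.padded some none).trans ∧
       ∃ c s₁, (s, c, s₁) ∈ (I.R.padded id (none, none)).trans ∧ b' = b ∧ u' = u ∧ u <:+ I.w ∧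
        ((a = none ∧ r' = r₁ ∧ l' = l ∧ s' = s) ∨ (d = none ∧ r' = r ∧ l' = l₁ ∧ s' = s) ∨
          (c = none ∧ r' = r ∧ l' = l ∧ s' = s₁))) := by
  simp only [recAutomaton, List.mem_flatMap, List.mem_tails]
  constructor
  · rintro ⟨⟨r₀, a, r₁⟩, hr, ⟨l₀, d, l₁⟩, hl, ⟨s₀, c, s₁⟩, hs, v, hv, h⟩
    have : ((b, r, l, s, u), none, (b', r', l', s', u')) ∈
        epsTrans (r₀, a, r₁) (l₀, d, l₁) (s₀, c, s₁) v b := by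
      simp only [recTrans, List.mem_append] at h
      rcases h with h | h | h
      · cases b
        · exact h
        · simp [epsTrans] at h
      · cases b
        · simp [epsTrans] at h
        · exact h
      · simp only [stepTrans] at h
        split_ifs at h <;> simp at h
    simp only [epsTrans, List.mem_append] at this
    rcases this with h | h | h <;> split_ifs at h with h' <;> simp at h <;>
      obtain ⟨⟨rfl, rfl, rfl, rfl⟩, rfl, rfl, rfl, rfl, rfl⟩ := h <;>
      refine ⟨_, _, hr, _, _, hl, _, _, hs, rfl, rfl, hv, ?_⟩ <;> simp at h' <;> simp [h']
  · rintro ⟨a, r₁, hr, d, l₁, hl, c, s₁, hs, rfl, rfl, hu, h⟩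
    refine ⟨_, hr, _, hl, _, hs, _, hu, ?_⟩
    rcases h with ⟨rfl, rfl, rfl, rfl⟩ | ⟨rfl, rfl, rfl, rfl⟩ | ⟨rfl, rfl, rfl, rfl⟩ <;>
      cases b' <;> simp [recTrans, epsTrans]

theorem mem_recAutomaton_step {b b' : Bool} {r l s r' l' s' : Option Name} {u u' : Word}
    {z : Option Letter × Option Letter} :
    ((b, r, l, s, u), some z, (b', r', l', s', u')) ∈ I.recAutomaton.trans ↔
      ∃ a d, (r, some (a, d), r') ∈ (I.R.padded id (none, none)).trans ∧
        (l, some d, l') ∈ (I.L.padded some none).trans ∧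
        (s, some (u.head?, d), s') ∈ (I.R.padded id (none, none)).trans ∧ u <:+ I.w ∧
        u' = u.tail ∧
        ((b = false ∧ b' = false ∧ z = (some (padName a), some (padName d))) ∨
          (a = none ∧ b' = true ∧ z = (none, some (padName d)))) := by
  simp only [recAutomaton, List.mem_flatMap, List.mem_tails]
  constructor
  · rintro ⟨⟨r₀, a, r₁⟩, hr, ⟨l₀, d, l₁⟩, hl, ⟨s₀, c, s₁⟩, hs, v, hv, h⟩
    simp only [recTrans, List.mem_append] at h
    rcases h with h | h | h
    · simp only [epsTrans, List.mem_append] at h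
      rcases h with h | h | h <;> split_ifs at h <;> simp at h
    · simp only [epsTrans, List.mem_append] at h
      rcases h with h | h | h <;> split_ifs at h <;> simp at h
    · simp only [stepTrans] at h
      split_ifs at h with h1
      all_goals try simp at h; done
      all_goals
        obtain ⟨ha, hd, hc, h3, h4, h5⟩ := h1
        obtain ⟨⟨a, e⟩, rfl⟩ := Option.isSome_iff_exists.1 ha
        obtain ⟨d, rfl⟩ := Option.isSome_iff_exists.1 hd
        obtain ⟨⟨c, c'⟩, rfl⟩ := Option.isSome_iff_exists.1 hc
        simp only [Option.join_some, Option.bind_some] at h h3 h4 h5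
        subst h3 h4 h5
        simp only [List.mem_cons, Prod.mk.injEq, Option.some.injEq, List.not_mem_nil, or_false] at h
      · obtain ⟨⟨rfl, rfl, rfl, rfl, rfl⟩, rfl, rfl, rfl, rfl, rfl, rfl⟩ := h
        exact ⟨a, c', hr, hl, hs, hv, rfl, .inl ⟨rfl, rfl, rfl⟩⟩
      · have ha : a = none := by simp_all
        subst ha
        rcases h with ⟨⟨rfl, rfl, rfl, rfl, rfl⟩, rfl, rfl, rfl, rfl, rfl, rfl⟩ |
          ⟨⟨rfl, rfl, rfl, rfl, rfl⟩, rfl, rfl, rfl, rfl, rfl, rfl⟩ |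
          ⟨⟨rfl, rfl, rfl, rfl, rfl⟩, rfl, rfl, rfl, rfl, rfl, rfl⟩
        · exact ⟨none, c', hr, hl, hs, hv, rfl, .inl ⟨rfl, rfl, rfl⟩⟩
        · exact ⟨none, c', hr, hl, hs, hv, rfl, .inr ⟨rfl, rfl, rfl⟩⟩
        · exact ⟨none, c', hr, hl, hs, hv, rfl, .inr ⟨rfl, rfl, rfl⟩⟩
  · rintro ⟨a, d, hr, hl, hs, hu, rfl, h⟩
    refine ⟨_, hr, _, hl, _, hs, _, hu, ?_⟩
    rcases h with ⟨rfl, rfl, rfl⟩ | ⟨rfl, rfl, rfl⟩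
    · simp [recTrans, stepTrans]
    · cases b <;> simp [recTrans, stepTrans]

/-- The lists `p` and `q` of optional letters need not be padded words yet; this will follow from
what the simulated automata accept. -/
theorem run_of_recAutomaton_run {b : Bool} {r l s : Option Name} {u : Word}
    {z : List (Option Letter × Option Letter)} (h : I.recAutomaton.Run (b, r, l, s, u) z) :
    ∃ p q : List (Option Letter), z = Word.conv (p.map padName) (q.map padName) ∧
      (if b = true then p = [] else p.length < q.length) ∧ u.length ≤ q.length ∧
      (I.R.padded id (none, none)).Run r (overlay p q) ∧ (I.L.padded some none).Run l q ∧
      (I.R.padded id (none, none)).Run s (overlay (u.map some) q) := by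
  generalize ht : (b, r, l, s, u) = t at h
  induction h generalizing b r l s u with
  | nil h =>
    subst ht
    obtain ⟨rfl, rfl, hr, hl, hs⟩ := mem_recAutomaton_final.1 h
    exact ⟨[], [], rfl, rfl, le_rfl, .nil hr, .nil hl, .nil hs⟩
  | @eps _ t' _ h _ ih =>
    subst ht
    obtain ⟨b', r', l', s', u'⟩ := t'
    obtain ⟨a, r₁, hr, d, l₁, hl, c, s₁, hs, rfl, rfl, hu, h⟩ := mem_recAutomaton_eps.1 h
    obtain ⟨p, q, h1, h2, h3, h4, h5, h6⟩ := ih rfl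
    rcases h with ⟨rfl, rfl, rfl, rfl⟩ | ⟨rfl, rfl, rfl, rfl⟩ | ⟨rfl, rfl, rfl, rfl⟩
    · exact ⟨p, q, h1, h2, h3, .eps hr h4, h5, h6⟩
    · exact ⟨p, q, h1, h2, h3, h4, .eps hl h5, h6⟩
    · exact ⟨p, q, h1, h2, h3, h4, h5, .eps hs h6⟩
  | @step _ t' c z h _ ih =>
    subst ht
    obtain ⟨b', r', l', s', u'⟩ := t'
    obtain ⟨a, d, hr, hl, hs, hu, rfl, hz⟩ := mem_recAutomaton_step.1 h
    obtain ⟨p, q, rfl, h2, h3, h4, h5, h6⟩ := ih rfl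
    have h3' : u.length ≤ (d :: q).length := by
      simp only [List.length_tail, List.length_cons] at h3 ⊢; omega
    have hs' : (I.R.padded id (none, none)).Run s (overlay (u.map some) (d :: q)) := by
      rw [overlay, List.head?_map, ← List.map_tail]
      refine .step (q' := s') ?_ h6
      cases u <;> exact hs
    rcases hz with ⟨rfl, rfl, rfl⟩ | ⟨rfl, rfl, rfl⟩
    · exact ⟨a :: p, d :: q, rfl, by simpa using h2, h3', .step hr h4, .step hl h5, hs'⟩
    · obtain rfl : p = [] := by simpa using h2
      refine ⟨[], d :: q, by simp [Word.conv_nil_left], by simp, h3', .step hr h4, .step hl h5,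
        hs'⟩

/-- Before each letter, and at the end, the `ε`-moves of the three components are made one component
after the other by `eps_induction`; then all three read the letter together. -/
theorem recAutomaton_run {b : Bool} {r l s : Option Name} {u : Word} (hu : u <:+ I.w)
    {p q : List (Option Letter)} (hb : if b = true then p = [] else p.length < q.length)
    (hq : u.length ≤ q.length) (hr : (I.R.padded id (none, none)).Run r (overlay p q))
    (hl : (I.L.padded some none).Run l q)
    (hs : (I.R.padded id (none, none)).Run s (overlay (u.map some) q)) :
    I.recAutomaton.Run (b, r, l, s, u) (Word.conv (p.map padName) (q.map padName)) := by
  induction q generalizing b r l s u p with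
  | nil =>
    obtain rfl : u = [] := by simpa using hq
    have hb' : b = true ∧ p = [] := by cases b <;> simp at hb ⊢; exact hb
    obtain ⟨rfl, rfl⟩ := hb'
    refine hr.eps_induction (P := fun r => I.recAutomaton.Run (_, r, _, _, _) _)
      (fun r r' h h' ih => ?_) (fun _ r hr' => ?_) (by simp [overlay])
    · obtain ⟨_, _, hl⟩ := hl.exists_trans
      obtain ⟨_, _, hs⟩ := hs.exists_trans
      exact .eps (mem_recAutomaton_eps.2 ⟨_, _, h, _, _, hl, _, _, hs, rfl, rfl, hu,
        .inl ⟨rfl, rfl, rfl, rfl⟩⟩) ih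
    have hr : (I.R.padded id (none, none)).Run r [] := .nil hr'
    refine hl.eps_induction (P := fun l => I.recAutomaton.Run (_, _, l, _, _) _)
      (fun l l' h h' ih => ?_) (fun _ l hl' => ?_) (by simp)
    · obtain ⟨_, _, hr⟩ := hr.exists_trans
      obtain ⟨_, _, hs⟩ := hs.exists_trans
      exact .eps (mem_recAutomaton_eps.2 ⟨_, _, hr, _, _, h, _, _, hs, rfl, rfl, hu,
        .inr (.inl ⟨rfl, rfl, rfl, rfl⟩)⟩) ih
    have hl : (I.L.padded some none).Run l [] := .nil hl'
    refine hs.eps_induction (P := fun s => I.recAutomaton.Run (_, _, _, s, _) _)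
      (fun s s' h h' ih => ?_) (fun _ s hs' => ?_) (by simp [overlay])
    · obtain ⟨_, _, hr⟩ := hr.exists_trans
      obtain ⟨_, _, hl⟩ := hl.exists_trans
      exact .eps (mem_recAutomaton_eps.2 ⟨_, _, hr, _, _, hl, _, _, h, rfl, rfl, hu,
        .inr (.inr ⟨rfl, rfl, rfl, rfl⟩)⟩) ih
    exact .nil (mem_recAutomaton_final.2 ⟨rfl, rfl, hr', hl', hs'⟩)
  | cons d q ih' =>
    refine hr.eps_induction (P := fun r => I.recAutomaton.Run (_, r, _, _, _) _)
      (fun r r' h h' ih => ?_) (by simp [overlay]) (fun c v hv r r' hrt hr' => ?_)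
    · obtain ⟨_, _, hl⟩ := hl.exists_trans
      obtain ⟨_, _, hs⟩ := hs.exists_trans
      exact .eps (mem_recAutomaton_eps.2 ⟨_, _, h, _, _, hl, _, _, hs, rfl, rfl, hu,
        .inl ⟨rfl, rfl, rfl, rfl⟩⟩) ih
    obtain ⟨rfl, rfl⟩ := List.cons.inj hv
    refine hl.eps_induction (P := fun l => I.recAutomaton.Run (_, _, l, _, _) _)
      (fun l l' h h' ih => ?_) (by simp) (fun c v hv l l' hlt hl' => ?_)
    · obtain ⟨_, _, hs⟩ := hs.exists_trans
      exact .eps (mem_recAutomaton_eps.2 ⟨_, _, hrt, _, _, h, _, _, hs, rfl, rfl, hu,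
        .inr (.inl ⟨rfl, rfl, rfl, rfl⟩)⟩) ih
    obtain ⟨rfl, rfl⟩ := List.cons.inj hv
    refine hs.eps_induction (P := fun s => I.recAutomaton.Run (_, _, _, s, _) _)
      (fun s s' h h' ih => ?_) (by simp [overlay]) (fun c v hv s s' hst hs' => ?_)
    · exact .eps (mem_recAutomaton_eps.2 ⟨_, _, hrt, _, _, hlt, _, _, h, rfl, rfl, hu,
        .inr (.inr ⟨rfl, rfl, rfl, rfl⟩)⟩) ih
    obtain ⟨rfl, rfl⟩ := List.cons.inj hv
    have hst' : (s, some (u.head?, d), s') ∈ (I.R.padded id (none, none)).trans := by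
      cases u <;> exact hst
    have hu' : u.tail <:+ I.w := (List.tail_suffix u).trans hu
    have hq' : u.tail.length ≤ q.length := by
      simp only [List.length_tail, List.length_cons] at hq ⊢; omega
    rw [← List.map_tail] at hs'
    cases p with
    | nil =>
      have := ih' (b := true) hu' (p := []) (by simp) hq' hr' hl' hs'
      rw [List.map_nil, Word.conv_nil_left] at this ⊢
      exact .step (mem_recAutomaton_step.2 ⟨_, _, hrt, hlt, hst', hu, rfl,
        .inr ⟨rfl, rfl, rfl⟩⟩) this
    | cons a p =>
      obtain rfl : b = false := by cases b <;> simp at hb ⊢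
      exact .step (mem_recAutomaton_step.2 ⟨_, _, hrt, hlt, hst', hu, rfl,
        .inl ⟨rfl, rfl, rfl⟩⟩) (ih' hu' (by simpa using hb) hq' hr' hl' hs')

theorem mem_toClique_accepts (hR : I.R.Recognizes I.R.rel)
    {z : List (Option Letter × Option Letter)} : z ∈ I.toClique.accepts ↔
      ∃ x n y m, z = Word.conv (padWord x n) (padWord y m) ∧ I.R.rel x y ∧ y ∈ I.L.accepts ∧
        I.R.rel I.w y ∧ x.length + n < y.length + m ∧ I.w.length ≤ y.length + m := by
  refine (AbstractWordAutomaton.mem_accepts RecState.code_injective).trans ?_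
  constructor
  · intro h
    obtain ⟨p, q, rfl, h1, h2, h3, h4, h5⟩ := run_of_recAutomaton_run h
    have h1 : p.length < q.length := by simpa using h1
    obtain ⟨x, y, hxy, ⟨n, rfl⟩, m, rfl⟩ :=
      (WordPairAutomaton.padded_run_overlay hR h1.le).1 h3
    obtain ⟨y', hy, m', hm⟩ := WordAutomaton.padded_run_some.1 h4
    -- Every simulation finds its own unpadding of the second word; padded words determine the word,
    -- so these agree.
    obtain rfl := map_some_append_inj hm
    obtain ⟨w', y', hwy, ⟨n', hn'⟩, m', hm'⟩ :=
      (WordPairAutomaton.padded_run_overlay hR (by simpa using h2)).1 h5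
    obtain rfl := map_some_append_inj hm'
    have : I.w = w' := map_some_append_inj (i := 0) (by simpa using hn')
    subst this
    exact ⟨x, n, y, m, rfl, hxy, hy, hwy, by simpa using h1, by simpa using h2⟩
  · rintro ⟨x, n, y, m, rfl, hxy, hy, hwy, h1, h2⟩
    refine recAutomaton_run (List.suffix_refl _) (by simpa using h1) (by simpa using h2) ?_ ?_ ?_
    · exact (WordPairAutomaton.padded_run_overlay hR (by simpa using h1.le)).2
        ⟨x, y, hxy, ⟨n, rfl⟩, m, rfl⟩
    · exact WordAutomaton.padded_run_some.2 ⟨y, hy, m, rfl⟩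
    · exact (WordPairAutomaton.padded_run_overlay hR (by simpa using h2)).2
        ⟨I.w, y, hwy, ⟨0, by simp⟩, m, rfl⟩

theorem padWord_inj {x y : Word} {n m : ℕ} (h : padWord x n = padWord y m) : x = y :=
  map_some_append_inj (List.map_injective_iff.2 padName_injective h)

theorem length_padWord (x : Word) (n : ℕ) : (padWord x n).length = x.length + n := by
  simp [padWord]

theorem toClique_rel (hR : I.R.Recognizes I.R.rel) {u v : Word} : I.toClique.rel u v ↔
    ∃ x n y m, u = padWord x n ∧ v = padWord y m ∧ I.R.rel x y ∧ y ∈ I.L.accepts ∧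
        I.R.rel I.w y ∧ x.length + n < y.length + m ∧ I.w.length ≤ y.length + m := by
  rw [WordPairAutomaton.rel, mem_toClique_accepts hR]
  constructor
  · rintro ⟨x, n, y, m, h, h'⟩
    obtain ⟨rfl, rfl⟩ := Word.conv_inj h
    exact ⟨x, n, y, m, rfl, rfl, h'⟩
  · rintro ⟨x, n, y, m, rfl, rfl, h'⟩
    exact ⟨x, n, y, m, rfl, h'⟩

theorem toClique_recognizes (hR : I.R.Recognizes I.R.rel) :
    I.toClique.Recognizes I.toClique.rel := by
  refine Set.Subset.antisymm (fun z hz => ?_) ?_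
  · obtain ⟨x, n, y, m, rfl, -⟩ := (mem_toClique_accepts hR).1 hz
    exact ⟨_, _, hz, rfl⟩
  · rintro _ ⟨u, v, h, rfl⟩
    exact h

/-- The middle word is determined by its padded form, so `R` can be composed; lengths compose
through the length of that form, and the other conditions concern the last word only. -/
theorem toClique_trans (hR : I.R.Recognizes I.R.rel) (h : IsTrans Word I.R.rel) :
    IsTrans Word I.toClique.rel := by
  refine ⟨fun u v t h1 h2 => ?_⟩
  obtain ⟨x, n, y, m, rfl, rfl, hxy, -, -, hl, -⟩ := (toClique_rel hR).1 h1
  obtain ⟨y', m', z, k, h3, rfl, hyz, hz, hwz, hl', hk⟩ := (toClique_rel hR).1 h2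
  have h4 := congrArg List.length h3
  rw [length_padWord, length_padWord] at h4
  obtain rfl := padWord_inj h3
  exact (toClique_rel hR).2 ⟨x, n, z, k, rfl, rfl, h.trans _ _ _ hxy hyz, hz, hwz, by omega, hk⟩

/-- The letter that is read determines the new flag and the letters read by the first two
simulations, by injectivity of `padName`; a missing first component stands for a blank. The letter
for the third simulation is determined by the rest of the given word in the state. -/
theorem toClique_isDFA (hR : I.R.IsDFA) (hL : I.L.IsDFA) : I.toClique.IsDFA := by
  refine AbstractWordAutomaton.isDFA RecState.code_injective ?_ ?_
  · rintro ⟨b, r, l, s, u⟩ ⟨b', r', l', s', u'⟩ h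
    obtain ⟨a, r₁, hr, d, l₁, hl, c, s₁, hs, rfl, rfl, hu, h⟩ := mem_recAutomaton_eps.1 h
    rcases h with ⟨rfl, -⟩ | ⟨rfl, -⟩ | ⟨rfl, -⟩
    · exact hR.padded_eps hr
    · exact hL.padded_eps hl
    · exact hR.padded_eps hs
  · rintro ⟨b, r, l, s, u⟩ z ⟨b₁, r₁, l₁, s₁, u₁⟩ ⟨b₂, r₂, l₂, s₂, u₂⟩ h1 h2
    obtain ⟨a, d, hr, hl, hs, -, rfl, h⟩ := mem_recAutomaton_step.1 h1
    obtain ⟨a', d', hr', hl', hs', -, rfl, h'⟩ := mem_recAutomaton_step.1 h2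
    have : b₁ = b₂ ∧ a = a' ∧ d = d' := by
      rcases h with ⟨rfl, rfl, rfl⟩ | ⟨rfl, rfl, rfl⟩ <;>
        rcases h' with ⟨h3, rfl, h4⟩ | ⟨rfl, rfl, h4⟩ <;>
        simp only [Prod.mk.injEq, Option.some.injEq, padName_injective.eq_iff, reduceCtorEq,
          false_and] at h4
      · exact ⟨rfl, h4.1, h4.2⟩
      · exact ⟨rfl, rfl, h4.2⟩
    obtain ⟨rfl, rfl, rfl⟩ := this
    rw [hR.padded_eq Function.injective_id hr hr', hR.padded_eq Function.injective_id hs hs',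
      hL.padded_eq (Option.some_injective _) hl hl']

theorem mem_rec_iff (hR : I.R.Recognizes I.R.rel) :
    I.w ∈ Rec I.R.rel I.L.accepts ↔ HasInfiniteClique I.toClique.rel := by
  constructor
  · rintro ⟨a, h0, ha, hL⟩
    -- Index 0 is removed so that `w = a 0` is related to all elements that are kept.
    have hL' : ({i | a i ∈ I.L.accepts} \ {0}).Infinite := hL.sdiff (Set.finite_singleton 0)
    obtain ⟨φ, hφ, hφ'⟩ : ∃ φ : ℕ → ℕ, StrictMono φ ∧
        ∀ i, φ i ∈ {i | a i ∈ I.L.accepts} \ {0} :=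
      ⟨_, Nat.nth_strictMono hL', fun i => Nat.nth_mem_of_infinite hL' i⟩
    -- The length to which the word with number `j` is padded: strictly increasing, and at least the
    -- lengths of this word and of `w`.
    let T : ℕ → ℕ := fun j => I.w.length + j + ∑ i ∈ Finset.range (j + 1), (a (φ i)).length
    have hT : StrictMono T := strictMono_nat_of_lt_succ fun j => by
      simp only [T, Finset.sum_range_succ _ (j + 1)]; omega
    have hT' : ∀ j, (a (φ j)).length ≤ T j := fun j => by
      simp only [T, Finset.sum_range_succ]; omega
    have hlen : ∀ j, (padWord (a (φ j)) (T j - (a (φ j)).length)).length = T j := fun j => by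
      rw [length_padWord]; have := hT' j; omega
    refine ⟨fun j => padWord (a (φ j)) (T j - (a (φ j)).length), fun i j hij => ?_,
      fun i j hij => ?_⟩
    · refine hT.injective ?_
      rw [← hlen i, ← hlen j]
      exact congrArg List.length hij
    · refine (toClique_rel hR).2 ⟨_, _, _, _, rfl, rfl, ha _ _ (hφ hij), (hφ' j).1, ?_, ?_, ?_⟩
      · rw [← h0]
        refine ha _ _ (Nat.pos_of_ne_zero (hφ' j).2)
      · rw [← length_padWord, ← length_padWord, hlen, hlen]
        exact hT hij
      · rw [← length_padWord, hlen]
        simp only [T]; omega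
  -- Distinctness is not needed here, since a sequence for recurrent reachability may repeat its
  -- elements.
  · rintro ⟨c, -, hc⟩
    have : ∀ i, ∃ x n, c i = padWord x n := by
      intro i
      obtain ⟨x, n, y, m, h, -⟩ := (toClique_rel hR).1 (hc i (i + 1) (Nat.lt_succ_self i))
      exact ⟨x, n, h⟩
    choose x n hx using this
    have key : ∀ i j, i < j → I.R.rel (x i) (x j) ∧ x j ∈ I.L.accepts ∧ I.R.rel I.w (x j) := by
      intro i j hij
      obtain ⟨x', n', y, m, h1, h2, h3, h4, h5, -⟩ := (toClique_rel hR).1 (hc i j hij)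
      rw [hx] at h1 h2
      rw [padWord_inj h1, padWord_inj h2]
      exact ⟨h3, h4, h5⟩
    -- Membership in `L` and the relation to `w` are only known for second components, so `x 0`
    -- gives way to `w`.
    refine ⟨fun i => i.casesOn I.w fun i => x (i + 1), rfl, ?_, ?_⟩
    · intro i j hij
      obtain ⟨j, rfl⟩ : ∃ k, j = k + 1 := ⟨j - 1, by omega⟩
      cases i with
      | zero => exact (key 0 (j + 1) (by omega)).2.2
      | succ i => exact (key _ _ hij).1
    · refine Set.infinite_of_injective_forall_mem (f := fun i : ℕ => i + 1)
        (add_left_injective 1) fun i => ?_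
      exact (key 0 (i + 1) (by omega)).2.1

end WordRecInput

/-! ### Transitions of padded automata in strings -/

section Items

variable {α β : Type} {e : α → List Symbol} {past : List Symbol → ℕ → ℕ}

/-- Does position `t` belong to the list of transitions of the automaton at position `p`? -/
def isTransPos (x : List Symbol) (p t : ℕ) : Bool :=
  decide (transPos x p ≤ t) && decide (t < x.length)

/-- The position of the target. -/
def dstPos (past : List Symbol → ℕ → ℕ) (x : List Symbol) (p t : ℕ) : ℕ :=
  if isTransPos x p t = true then targetPos past x t else x.length

/-- The position of the letter. -/
def letPos (x : List Symbol) (p t : ℕ) : ℕ :=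
  if isTransPos x p t = true then pastName x t else x.length

/-- Does the transition read a letter? -/
def isStep (x : List Symbol) (p t : ℕ) : Bool :=
  !isTransPos x p t || isLpar x[pastName x t]?

/-- The positions that stand for the transitions of the padded version of the automaton at
position `p`: those of its transitions and final states, and the end of the string. -/
def paddedPos (past : List Symbol → ℕ → ℕ) (skip : List Symbol → ℕ → Bool) (x : List Symbol)
    (p : ℕ) : List ℕ :=
  (elems (pastWordTrans past) x (transPos x p + 1)).flatMap
    (fun t => if skip x t = true then [] else [t]) ++
  (elems pastName x (pastName x p + 1) ++ [x.length])

/-- The positions that stand for the final states of the padded automaton. -/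
def finalPos (x : List Symbol) (p : ℕ) : List ℕ := elems pastName x (pastName x p + 1) ++ [x.length]

section

variable {k : ℕ} {f g : List Symbol → (Fin k → ℕ) → ℕ}

theorem test_isTransPos (hf : Num f) (hg : Num g) :
    Test fun x v => isTransPos x (f x v) (g x v) := .and (.le hf.transPos hg) (.lt hg .length)

theorem num_dstPos (h : Num fun x (v : Fin 1 → ℕ) => past x (v 0)) (hf : Num f) (hg : Num g) :
    Num fun x v => dstPos past x (f x v) (g x v) :=
  .ite (test_isTransPos hf hg) (.targetPos h hg) .length

theorem num_letPos (hf : Num f) (hg : Num g) : Num fun x v => letPos x (f x v) (g x v) :=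
  .ite (test_isTransPos hf hg) hg.pastName .length

theorem test_isStep (hf : Num f) (hg : Num g) : Test fun x v => isStep x (f x v) (g x v) :=
  .or (.not (test_isTransPos hf hg)) (.letter isLpar hg.pastName)

theorem out_finalPos {F : List Symbol → (Fin k → ℕ) → ℕ → List Symbol}
    (hF : Out fun x (w : Fin (k + 1) → ℕ) => F x (Fin.tail w) (w 0)) (hf : Num f) :
    Out fun x v => (finalPos x (f x v)).flatMap (F x v) := by
  have : Out fun x v => (elems pastName x (AutRel.pastName x (f x v) + 1)).flatMap (F x v) ++
      F x v x.length :=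
    .append (.elems parser_name.num hF (hf.pastName.add (.const 1))) (.bind hF .length)
  simpa only [AutRel.finalPos, List.flatMap_append, List.flatMap_singleton] using this

theorem out_paddedPos {skip : List Symbol → ℕ → Bool}
    (h : Num fun x (v : Fin 1 → ℕ) => past x (v 0))
    (hs : Test fun x (v : Fin 1 → ℕ) => skip x (v 0))
    {F : List Symbol → (Fin k → ℕ) → ℕ → List Symbol}
    (hF : Out fun x (w : Fin (k + 1) → ℕ) => F x (Fin.tail w) (w 0)) (hf : Num f) :
    Out fun x v => (paddedPos past skip x (f x v)).flatMap (F x v) := by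
  have h1 : Out fun x v => (elems (pastWordTrans past) x (transPos x (f x v) + 1)).flatMap
      (fun t => if skip x t = true then [] else F x v t) :=
    .elems (Num.targetPos h (.var 0)).pastName (.ite (hs.comp1 (.var 0)) (.const []) hF)
      (hf.transPos.add (.const 1))
  have := h1.append (out_finalPos hF hf)
  have h2 : ∀ (x : List Symbol) (v : Fin k → ℕ) (t : ℕ),
      (if skip x t = true then [] else [t]).flatMap (F x v) =
        if skip x t = true then [] else F x v t := by
    intro x v t; split <;> simp
  simpa only [AutRel.finalPos, AutRel.paddedPos, List.flatMap_append, List.flatMap_singleton,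
    List.flatMap_assoc, h2, List.append_assoc] using this

end

/-- Position `t` stands for the transition `(s, l, s')` of the padded version of the automaton at
position `p`. -/
structure PaddedAt (e : α → List Symbol) (past : List Symbol → ℕ → ℕ) (f : α → β) (blank : β)
    (x : List Symbol) (p t : ℕ) (i : PaddedTrans β) : Prop where
  src : OptAt encName x t i.1
  dst : OptAt encName x (dstPos past x p t) i.2.2
  isStep : isStep x p t = i.2.1.isSome
  letter : ∃ o, OptAt e x (letPos x p t) o ∧ (i.2.1 = o.map f ∨ o = none ∧ i.2.1 = some blank)

/-- Transitions and final states both begin with the name of a state, the source, and the end of the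
string stands for the new state. Final states are written before the list of transitions, so a
comparison of positions (`isTransPos`) distinguishes the given transitions from the padding ones. -/
theorem Parser.paddedAt [DecidableEq β] (h : Parser e past) {f : α → β} {blank : β}
    {skip : List Symbol → ℕ → Bool}
    (hskip : ∀ x t i, At x t (encWordTrans e i) → (skip x t = true ↔ i.2.1.map f = some blank))
    {x : List Symbol} {p : ℕ} {A : WordAutomaton α} {l : List Symbol}
    (hA : At x p (A.enc e ++ l)) :
    List.Forall₂ (PaddedAt e past f blank x p) (paddedPos past skip x p)
      (A.padded f blank).trans := by
  obtain ⟨-, hf, ht, -⟩ := h.at_wordAutomaton_iff.1 hA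
  obtain ⟨qf, -, -, hqf, hf, hf'⟩ := parser_name.exists_chain_list hf
  obtain ⟨qt, -, hqt, -, ht, ht'⟩ := h.wordTrans.exists_chain_list ht
  have hqt' := (List.getElem?_eq_some_iff.1 hqt).1
  have hlen : OptAt encName x x.length none := .none_of_length
  have hpos : ∀ t, isTransPos x p t = false → ∀ s, OptAt encName x t s →
      PaddedAt e past f blank x p t (s, some blank, none) := by
    intro t h1 s h2
    refine ⟨h2, by simpa [dstPos, h1] using hlen, by simp [AutRel.isStep, h1], none, ?_,
      .inr ⟨rfl, rfl⟩⟩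
    simp only [letPos, h1, Bool.false_eq_true, if_false]
    exact .none_of_length
  rw [paddedPos, WordAutomaton.padded, List.append_assoc]
  refine List.rel_append ?_ (List.rel_append ?_ ?_)
  · generalize elems (pastWordTrans past) x (transPos x p + 1) = ps at ht ht'
    generalize A.trans = ts at ht
    induction ht with
    | nil => exact .nil
    | @cons t i ps l' hi _ ih =>
      rw [List.flatMap_cons, List.flatMap_cons]
      refine List.rel_append ?_ (ih fun q hq => ht' q (List.mem_cons_of_mem _ hq))
      by_cases hb : i.2.1.map f = some blank
      · rw [if_pos ((hskip x t i hi).2 hb), if_pos hb]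
        exact .nil
      · rw [if_neg (mt (hskip x t i hi).1 hb), if_neg hb]
        obtain ⟨h1, h2, h3⟩ := h.at_wordTrans_iff.1 hi
        have h4 := ht' t List.mem_cons_self
        have h5 : isTransPos x p t = true := by
          simp only [isTransPos, Bool.and_eq_true, decide_eq_true_eq]
          omega
        refine .cons ⟨h1, ?_, ?_, i.2.1, ?_, .inl rfl⟩ .nil
        · rw [dstPos, if_pos h5]
          exact h3
        · rw [AutRel.isStep, h5, h.isLpar_eq (.of_at h2)]
          simp
        · rw [letPos, if_pos h5]
          exact .of_at h2
  · generalize elems pastName x (pastName x p + 1) = ps at hf hf'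
    generalize hfs : A.final = fs at hf
    have hle : ∀ q ∈ ps, isTransPos x p q = false := by
      intro q hq
      have h1 := hf' q hq
      have : ¬ transPos x p ≤ q := by
        have h3 : transPos x p = qf + 1 := by
          rw [transPos, parser_name.list.past_eq x _ A.final]
          · exact hqf.symm
          · exact ((h.at_wordAutomaton_iff.1 hA).2.1)
        omega
      simp [isTransPos, this]
    clear hf' hfs
    induction hf with
    | nil => exact .nil
    | cons hi _ ih =>
      exact .cons (hpos _ (hle _ List.mem_cons_self) _ hi)
        (ih fun q hq => hle q (List.mem_cons_of_mem _ hq))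
  · exact .cons (hpos _ (by simp [isTransPos]) _ hlen) .nil

theorem Parser.finalAt [DecidableEq β] (h : Parser e past) {f : α → β} {blank : β}
    {x : List Symbol} {p : ℕ} {A : WordAutomaton α} {l : List Symbol}
    (hA : At x p (A.enc e ++ l)) :
    List.Forall₂ (OptAt encName x) (finalPos x p) (A.padded f blank).final := by
  obtain ⟨-, hf, -⟩ := h.at_wordAutomaton_iff.1 hA
  rw [finalPos, WordAutomaton.padded]
  refine List.rel_append ?_ (.cons .none_of_length .nil)
  exact List.forall₂_map_right_iff.2 (parser_name.forall₂_elems hf)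

end Items

/-! ### Suffixes of words in strings -/

/-- The suffix `u` of the word whose code ends with the string `x` begins at `q`. -/
def RestAt (x : List Symbol) (q : ℕ) (u : Word) : Prop :=
  At x q (u.flatMap encName ++ [.rpar]) ∧ q + (u.flatMap encName ++ [Symbol.rpar]).length = x.length

def tailPos (x : List Symbol) (q : ℕ) : ℕ := if isLpar x[q]? = true then pastName x q else q

/-- The positions of all suffixes of the word at position `p`. -/
def restPos (x : List Symbol) (p : ℕ) : List ℕ := elems pastName x (p + 1) ++ [x.length - 1]

namespace RestAt

variable {x : List Symbol} {q : ℕ} {u : Word}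

/-- As the word is the last part of the input, the code of a suffix is a parenthesis followed by a
final segment of the input. -/
theorem segment_eq (h : RestAt x q u) : .lpar :: segment x q x.length = encList encName u := by
  rw [AutRel.segment_eq h.1 h.2.symm]
  rfl

theorem head (h : RestAt x q u) : OptAt encName x q u.head? := by
  obtain ⟨h, -⟩ := h
  cases u with
  | nil =>
    rw [List.flatMap_nil, List.nil_append, At.cons_iff] at h
    simp [OptAt, h.1, isLpar]
  | cons a u =>
    rw [List.flatMap_cons, List.append_assoc, At.append_iff] at h
    exact h.1

theorem tail (h : RestAt x q u) : RestAt x (tailPos x q) u.tail := by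
  have h1 := h.head
  rw [tailPos, parser_name.isLpar_eq h1]
  cases u with
  | nil => exact h
  | cons a u =>
    obtain ⟨h2, h3⟩ := h
    rw [List.flatMap_cons, List.append_assoc] at h2 h3
    rw [parser_name.at_append_iff] at h2
    refine ⟨by simpa using h2.2, ?_⟩
    have := parser_name.past_eq _ _ _ h2.1
    simp only [List.head?_cons, Option.isSome_some, if_true, List.tail_cons, this]
    rw [List.length_append] at h3
    omega

/-- Nonempty suffixes begin at the letters of the word; the empty one is represented by the closing
parenthesis, the last symbol of the input. -/
theorem forall₂_tails {p : ℕ} (h : At x p (encList encName u))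
    (h' : p + (encList encName u).length = x.length) :
    List.Forall₂ (RestAt x) (restPos x p) u.tails := by
  have key : ∀ (ps : List ℕ) (q : ℕ) (u : Word), RestAt x q u →
      Chain pastName x q ps (x.length - 1) →
      List.Forall₂ (RestAt x) (ps ++ [x.length - 1]) u.tails := by
    intro ps
    induction ps with
    | nil =>
      intro q u hu hc
      cases hc
      have : u = [] := by
        have h2 := hu.2
        have h3 := parser_name.length_flatMap u
        simp only [List.length_append, List.length_singleton] at h2
        exact List.length_eq_zero_iff.1 (by omega)
      subst this
      exact .cons hu .nil
    | cons p ps ih =>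
      intro q u hu hc
      cases hc with
      | cons hp _ hc =>
        cases u with
        | nil =>
          have := hu.head
          rw [List.head?_nil, OptAt, hp] at this
          cases this
        | cons a u =>
          rw [List.tails_cons]
          have h1 := hu.tail
          rw [tailPos, if_pos hp] at h1
          exact .cons hu (ih _ _ h1 hc)
  obtain ⟨q, hc, -, hq, -⟩ := parser_name.exists_chain_list h
  obtain rfl : q = x.length - 1 := by omega
  refine key _ _ _ ⟨(At.cons_iff.1 h).2, ?_⟩ hc
  simp only [encList, List.length_cons, List.length_append, List.cons_append] at h' ⊢
  omega

end RestAt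

section

variable {k : ℕ} {f g : List Symbol → (Fin k → ℕ) → ℕ}

theorem num_tailPos (hf : Num f) : Num fun x v => tailPos x (f x v) :=
  .ite (.letter _ hf) hf.pastName hf

theorem out_restPos {F : List Symbol → (Fin k → ℕ) → ℕ → List Symbol}
    (hF : Out fun x (w : Fin (k + 1) → ℕ) => F x (Fin.tail w) (w 0)) (hf : Num f) :
    Out fun x v => (restPos x (f x v)).flatMap (F x v) := by
  have : Out fun x v => (elems pastName x (f x v + 1)).flatMap (F x v) ++
      F x v (x.length - 1) :=
    .append (.elems parser_name.num hF (hf.add (.const 1)))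
      (.bind hF (.sub .length (.const 1)))
  simpa only [AutRel.restPos, List.flatMap_append, List.flatMap_singleton] using this

end

/-! ### Computation of the reduction of recurrent reachability over words -/

section Program

variable (x : List Symbol)

/-- The position of the second automaton. -/
def secondPos : ℕ := pastWordAutomaton pastLetterPair x 0

/-- The position of the word. -/
def wordPos : ℕ := pastWordAutomaton pastName x (secondPos x)

/-- Is the letter the pair of two blanks? -/
def isBlankPair (t : ℕ) : Bool :=
  isLpar x[pastName x t]? && (!isLpar x[fstPos x (pastName x t)]? &&
    !isLpar x[sndPos x (pastName x t)]?)

def stateOut (b : Bool) (r l s u : ℕ) : List Symbol :=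
  encBit b :: (optionOut pastName x r ++ (optionOut pastName x l ++ (optionOut pastName x s ++
    (.lpar :: segment x u x.length))))

def epsOut (b : Bool) (r l s u : ℕ) : List Symbol :=
  (if isStep x 0 r = true then [] else printTrans (stateOut x b r l s u) [.bot]
    (stateOut x b (dstPos pastLetterPair x 0 r) l s u)) ++
  ((if isStep x (secondPos x) l = true then [] else printTrans (stateOut x b r l s u) [.bot]
    (stateOut x b r (dstPos pastName x (secondPos x) l) s u)) ++
  (if isStep x 0 s = true then [] else printTrans (stateOut x b r l s u) [.bot]
    (stateOut x b r l (dstPos pastLetterPair x 0 s) u)))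

def nextOut (b : Bool) (r l s u : ℕ) : List Symbol :=
  stateOut x b (dstPos pastLetterPair x 0 r) (dstPos pastName x (secondPos x) l)
    (dstPos pastLetterPair x 0 s) (tailPos x u)

def padOut (p : ℕ) : List Symbol := nameCode (optionOut pastName x p)

def stepOut (r l s u : ℕ) : List Symbol :=
  if (isStep x 0 r && (isStep x (secondPos x) l && (isStep x 0 s &&
    (optionEq pastName x (letPos x (secondPos x) l) (sndPos x (letPos x 0 r)) &&
    (optionEq pastName x (sndPos x (letPos x 0 s)) (sndPos x (letPos x 0 r)) &&
    optionEq pastName x (fstPos x (letPos x 0 s)) u))))) = true then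
    printTrans (stateOut x false r l s u) (.lpar :: (padOut x (fstPos x (letPos x 0 r)) ++
      padOut x (sndPos x (letPos x 0 r)))) (nextOut x false r l s u) ++
    if isLpar x[fstPos x (letPos x 0 r)]? = true then [] else
      printTrans (stateOut x false r l s u) (.lpar :: .bot :: padOut x (sndPos x (letPos x 0 r)))
        (nextOut x true r l s u) ++
      printTrans (stateOut x true r l s u) (.lpar :: .bot :: padOut x (sndPos x (letPos x 0 r)))
        (nextOut x true r l s u)
  else []

/-- The reduction on strings. -/
def wordRecReduction : List Symbol :=
  nameCode (.zero :: (nameAt x 0 ++ (nameAt x (secondPos x) ++ (nameAt x 0 ++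
    (.lpar :: segment x (wordPos x + 1) x.length))))) ++
  (.lpar :: ((finalPos x 0).flatMap fun r => (finalPos x (secondPos x)).flatMap fun l =>
    (finalPos x 0).flatMap fun s => nameCode (.one :: (optionOut pastName x r ++
      (optionOut pastName x l ++ (optionOut pastName x s ++ [.lpar, .rpar]))))) ++ [.rpar] ++
  (.lpar :: ((paddedPos pastLetterPair isBlankPair x 0).flatMap fun r =>
    (paddedPos pastName (fun _ _ => false) x (secondPos x)).flatMap fun l =>
    (paddedPos pastLetterPair isBlankPair x 0).flatMap fun s =>
    (restPos x (wordPos x)).flatMap fun u =>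
      epsOut x false r l s u ++ (epsOut x true r l s u ++ stepOut x r l s u)) ++ [.rpar]))

end Program

section

variable {k : ℕ} {r l s u : List Symbol → (Fin k → ℕ) → ℕ}

theorem num_secondPos : Num fun x (_ : Fin k → ℕ) => secondPos x :=
  .pastWordAutomaton parser_letterPair.num (.const 0)

theorem num_wordPos : Num fun x (_ : Fin k → ℕ) => wordPos x :=
  .pastWordAutomaton parser_name.num num_secondPos

theorem test_isBlankPair (hr : Num r) : Test fun x v => isBlankPair x (r x v) :=
  .and (.letter _ hr.pastName) (.and (.not (.letter isLpar hr.pastName.fstPos))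
    (.not (.letter isLpar hr.pastName.sndPos)))

theorem out_stateOut (b : Bool) (hr : Num r) (hl : Num l) (hs : Num s) (hu : Num u) :
    Out fun x v => stateOut x b (r x v) (l x v) (s x v) (u x v) :=
  .cons _ ((Out.optionOut parser_name.num hr).append ((Out.optionOut parser_name.num hl).append
    ((Out.optionOut parser_name.num hs).append (.cons _ (.segment hu .length)))))

theorem out_epsOut (b : Bool) (hr : Num r) (hl : Num l) (hs : Num s) (hu : Num u) :
    Out fun x v => epsOut x b (r x v) (l x v) (s x v) (u x v) := by
  have h := out_stateOut b hr hl hs hu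
  refine .append (.ite (test_isStep (.const 0) hr) (.const _) (h.printTrans (.const _) ?_))
    (.append (.ite (test_isStep num_secondPos hl) (.const _) (h.printTrans (.const _) ?_))
      (.ite (test_isStep (.const 0) hs) (.const _) (h.printTrans (.const _) ?_)))
  · exact out_stateOut b (num_dstPos parser_letterPair.num (.const 0) hr) hl hs hu
  · exact out_stateOut b hr (num_dstPos parser_name.num num_secondPos hl) hs hu
  · exact out_stateOut b hr hl (num_dstPos parser_letterPair.num (.const 0) hs) hu

theorem out_nextOut (b : Bool) (hr : Num r) (hl : Num l) (hs : Num s) (hu : Num u) :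
    Out fun x v => nextOut x b (r x v) (l x v) (s x v) (u x v) :=
  out_stateOut b (num_dstPos parser_letterPair.num (.const 0) hr)
    (num_dstPos parser_name.num num_secondPos hl)
    (num_dstPos parser_letterPair.num (.const 0) hs) (num_tailPos hu)

theorem out_padOut (hr : Num r) : Out fun x v => padOut x (r x v) :=
  (Out.optionOut parser_name.num hr).nameCode

theorem out_stepOut (hr : Num r) (hl : Num l) (hs : Num s) (hu : Num u) :
    Out fun x v => stepOut x (r x v) (l x v) (s x v) (u x v) := by
  have hr' := num_letPos (.const 0) hr
  have hs' := num_letPos (.const 0) hs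
  have hf := out_padOut hr'.fstPos
  have hd := out_padOut hr'.sndPos
  have h0 := out_stateOut false hr hl hs hu
  have h1 := out_stateOut true hr hl hs hu
  have hn := out_nextOut true hr hl hs hu
  refine .ite (.and (test_isStep (.const 0) hr) (.and (test_isStep num_secondPos hl)
    (.and (test_isStep (.const 0) hs) (.and ?_ (.and ?_ ?_))))) (.append
      (h0.printTrans (.cons _ (hf.append hd)) (out_nextOut false hr hl hs hu))
      (.ite (.letter isLpar hr'.fstPos) (.const _) (.append ?_ ?_))) (.const _)
  · exact .optionEq parser_name.num (num_letPos num_secondPos hl) hr'.sndPos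
  · exact .optionEq parser_name.num hs'.sndPos hr'.sndPos
  · exact .optionEq parser_name.num hs'.fstPos hu
  · exact h0.printTrans (.cons _ (.cons _ hd)) hn
  · exact h1.printTrans (.cons _ (.cons _ hd)) hn

end

theorem logspaceComputable_wordRecReduction : LogspaceComputable wordRecReduction := by
  refine .of_out (.append (Out.nameCode ?_) (.append (Out.encList ?_) (Out.encList ?_)))
  · exact .cons _ (.append (.nameAt (.const 0)) (.append (.nameAt num_secondPos)
      (.append (.nameAt (.const 0)) (.cons _ (.segment (num_wordPos.add (.const 1)) .length)))))
  · refine out_finalPos (out_finalPos (out_finalPos (Out.nameCode (.cons _ ?_)) (.const 0)) num_secondPos)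
      (.const 0)
    exact .append (.optionOut parser_name.num (.var 2)) (.append
      (.optionOut parser_name.num (.var 1)) (.append (.optionOut parser_name.num (.var 0))
        (.const _)))
  · refine out_paddedPos parser_letterPair.num (test_isBlankPair (.var 0))
      (out_paddedPos parser_name.num (skip := fun _ _ => false) (.const 0)
      (out_paddedPos parser_letterPair.num (test_isBlankPair (.var 0))
        (out_restPos (.append ?_ (.append ?_ ?_)) num_wordPos) (.const 0)) num_secondPos) (.const 0)
    -- Each loop puts its variable in front of the earlier ones, so the outermost variable, the
    -- transition `r`, has index 3.
    · exact out_epsOut false (.var 3) (.var 2) (.var 1) (.var 0)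
    · exact out_epsOut true (.var 3) (.var 2) (.var 1) (.var 0)
    · exact out_stepOut (.var 3) (.var 2) (.var 1) (.var 0)

section

variable {x : List Symbol} {r l s u : ℕ}

theorem stateOut_eq {b : Bool} {r' l' s' : Option Name} {u' : Word} (hr : OptAt encName x r r')
    (hl : OptAt encName x l l') (hs : OptAt encName x s s') (hu : RestAt x u u') :
    stateOut x b r l s u = RecState.code (b, r', l', s', u') := by
  rw [stateOut, parser_name.optionOut_eq hr, parser_name.optionOut_eq hl,
    parser_name.optionOut_eq hs, hu.segment_eq]
  rfl

variable {r' s' : PaddedTrans (Option Letter × Option Letter)} {l' : PaddedTrans (Option Letter)}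
  {u' : Word} (hr : PaddedAt encLetterPair pastLetterPair id (none, none) x 0 r r')
  (hl : PaddedAt encName pastName some none x (secondPos x) l l')
  (hs : PaddedAt encLetterPair pastLetterPair id (none, none) x 0 s s') (hu : RestAt x u u')

include hr in
theorem PaddedAt.fst_snd : OptAt encName x (fstPos x (letPos x 0 r)) (r'.2.1.bind Prod.fst) ∧
    OptAt encName x (sndPos x (letPos x 0 r)) (r'.2.1.bind Prod.snd) := by
  obtain ⟨o, ho, h | ⟨rfl, h⟩⟩ := hr.letter
  · rw [h, Option.map_id]
    exact ho.fst_snd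
  · rw [h]
    exact ho.fst_snd

include hl in
theorem PaddedAt.letPos_join : OptAt encName x (letPos x (secondPos x) l) l'.2.1.join := by
  obtain ⟨o, ho, h | ⟨rfl, h⟩⟩ := hl.letter
  · rw [h]
    cases o <;> exact ho
  · rw [h]
    exact ho

include hr hl hs hu

theorem epsOut_eq (b : Bool) : epsOut x b r l s u = (WordRecInput.epsTrans r' l' s' u' b).flatMap
    fun t => printTrans t.1.code (encOption encLetterPair t.2.1) t.2.2.code := by
  rw [epsOut, stateOut_eq hr.src hl.src hs.src hu, stateOut_eq hr.dst hl.src hs.src hu,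
    stateOut_eq hr.src hl.dst hs.src hu, stateOut_eq hr.src hl.src hs.dst hu, hr.isStep, hl.isStep,
    hs.isStep, WordRecInput.epsTrans, List.flatMap_append, List.flatMap_append]
  congr 1
  · split <;> simp [encOption]
  · congr 1 <;> split <;> simp [encOption]

theorem stepOut_eq : stepOut x r l s u = (WordRecInput.stepTrans r' l' s' u').flatMap
    fun t => printTrans t.1.code (encOption encLetterPair t.2.1) t.2.2.code := by
  obtain ⟨h1, h2⟩ := hr.fst_snd
  obtain ⟨h3, h4⟩ := hs.fst_snd
  have h5 := hl.letPos_join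
  rw [stepOut, WordRecInput.stepTrans, nextOut, nextOut, stateOut_eq hr.src hl.src hs.src hu,
    stateOut_eq hr.src hl.src hs.src hu, stateOut_eq hr.dst hl.dst hs.dst hu.tail,
    stateOut_eq hr.dst hl.dst hs.dst hu.tail, hr.isStep, hl.isStep, hs.isStep, padOut, padOut,
    parser_name.optionOut_eq h1, parser_name.optionOut_eq h2, parser_name.isLpar_eq h1]
  simp only [Bool.and_eq_true, parser_name.optionEq_iff h5 h2, parser_name.optionEq_iff h4 h2,
    parser_name.optionEq_iff h3 hu.head]
  split
  · rw [List.flatMap_cons]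
    congr 1
    · simp [encOption, encLetterPair, encPair, padName, encName_nameOf]
    · split <;> simp [encOption, encLetterPair, encPair, padName, encName_nameOf]
  · rfl

end

theorem wordRecReduction_code (I : WordRecInput) :
    wordRecReduction I.code = I.toClique.code := by
  have h0 : At I.code 0 (I.R.enc encLetterPair ++ (I.L.enc encName ++ encList encName I.w)) :=
    List.prefix_refl _
  have hR := parser_letterPair.at_wordAutomaton_iff.1 h0
  have h1 : At I.code (secondPos I.code) (I.L.enc encName ++ encList encName I.w) := hR.2.2.2
  have hL := parser_name.at_wordAutomaton_iff.1 h1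
  have h2 : At I.code (wordPos I.code) (encList encName I.w) := hL.2.2.2
  have h3 : wordPos I.code + (encList encName I.w).length = I.code.length := by
    have h3 := parser_letterPair.wordAutomaton.past_eq _ _ _ (At.append_iff.1 h0).1
    have h4 := parser_name.wordAutomaton.past_eq _ _ _ (At.append_iff.1 h1).1
    rw [wordPos, h4, secondPos, h3]
    simp only [WordRecInput.code, WordPairAutomaton.code, List.length_append]
    omega
  have hf := parser_letterPair.finalAt (f := id) (blank := (none, none)) h0
  have hf' := parser_name.finalAt (f := some) (blank := none) h1
  have ht := parser_letterPair.paddedAt (f := id) (blank := (none, none)) (skip := isBlankPair)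
    (fun x t i hi => by
      obtain ⟨-, h, -⟩ := parser_letterPair.at_wordTrans_iff.1 hi
      have h4 := OptAt.of_at h
      rw [isBlankPair, parser_letterPair.isLpar_eq h4, parser_name.isLpar_eq h4.fst_snd.1,
        parser_name.isLpar_eq h4.fst_snd.2]
      obtain ⟨q, _ | ⟨_ | a, _ | b⟩, q'⟩ := i <;> simp) h0
  have ht' := parser_name.paddedAt (f := some) (blank := none) (skip := fun _ _ => false)
    (fun x t i hi => by simp) h1
  have hu := RestAt.forall₂_tails h2 h3
  have hw : RestAt I.code (wordPos I.code + 1) I.w := by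
    refine ⟨(At.cons_iff.1 h2).2, ?_⟩
    simp only [encList, List.length_cons, List.length_append, List.cons_append] at h3 ⊢
    omega
  rw [wordRecReduction, nameAt_eq hR.1, nameAt_eq hL.1, hw.segment_eq, WordPairAutomaton.code,
    WordRecInput.toClique, AbstractWordAutomaton.enc_toWordAutomaton]
  refine congr (congrArg _ rfl) (congr (congrArg _ ?_) ?_)
  · simp only [WordRecInput.recAutomaton, List.flatMap_assoc]
    refine congrArg (fun l => Symbol.lpar :: l ++ [Symbol.rpar]) ?_
    refine flatMap_eq_of_forall₂ hf fun r r' _ hr => ?_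
    refine flatMap_eq_of_forall₂ hf' fun l l' _ hl => ?_
    refine flatMap_eq_of_forall₂ hf fun s s' _ hs => ?_
    rw [parser_name.optionOut_eq hr, parser_name.optionOut_eq hl, parser_name.optionOut_eq hs]
    simp [RecState.code, encPair, encList, encBit]
  · simp only [WordRecInput.recAutomaton, List.flatMap_assoc]
    refine congrArg (fun l => Symbol.lpar :: l ++ [Symbol.rpar]) ?_
    refine flatMap_eq_of_forall₂ ht fun r r' _ hr => ?_
    refine flatMap_eq_of_forall₂ ht' fun l l' _ hl => ?_
    refine flatMap_eq_of_forall₂ ht fun s s' _ hs => ?_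
    refine flatMap_eq_of_forall₂ hu fun u u' _ hu => ?_
    rw [epsOut_eq hr hl hs hu, epsOut_eq hr hl hs hu, stepOut_eq hr hl hs hu,
      WordRecInput.recTrans, List.flatMap_append, List.flatMap_append]
    rfl

theorem wordRec_reduces_wordClique (K : WordModel) :
    IsReduction (wordRec K) (wordClique K) wordRecReduction ∧
      Preserves (wordRec K) (wordClique K) wordRecReduction
        (fun I => IsTrans Word I.R.rel) (fun A => IsTrans Word A.rel) := by
  constructor
  · intro I hI
    refine ⟨I.toClique, wordRecReduction_code I, ⟨?_, WordRecInput.toClique_recognizes hI.2.2⟩,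
      WordRecInput.mem_rec_iff hI.2.2⟩
    cases K with
    | nfa => trivial
    | dfa => exact WordRecInput.toClique_isDFA hI.1 hI.2.1
  · intro I A hI h hT
    obtain rfl := WordPairAutomaton.isCode_code.injective ((wordRecReduction_code I).symm.trans h)
    exact WordRecInput.toClique_trans hI.2.2 hT

/-! ### Trees: from infinite cliques to recurrent reachability. -/

/-! ### Tree automata with structured states -/

section

variable {α : Type} {rk : α → ℕ}

/-- The target with number `i`, if there is one. -/
def TreeTransition.target (t : TreeTransition rk) (i : ℕ) : Option Name :=
  if h : i < rk t.letter then some (t.targets ⟨i, h⟩) else none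

theorem TreeAutomaton.hasRun_node {A : TreeAutomaton rk} {a : α} {c : Fin (rk a) → RankedTree rk}
    {q : Name} : A.HasRun (.node a c) q ↔ ∃ t ∈ A.trans, t.source = q ∧ t.letter = a ∧
      ∀ i : Fin (rk a), ∃ s, t.target i = some s ∧ A.HasRun (c i) s := by
  constructor
  · rintro ⟨qs, h, h'⟩
    exact ⟨_, h, rfl, rfl, fun i => ⟨qs i, by simp [TreeTransition.target], h' i⟩⟩
  · rintro ⟨⟨q, a, qs⟩, h, rfl, rfl, h'⟩
    refine ⟨qs, h, fun i => ?_⟩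
    obtain ⟨s, h1, h2⟩ := h' i
    obtain rfl : qs i = s := by simpa [TreeTransition.target] using h1
    exact h2

/-- A tree automaton with states of any type, which are named by strings. A transition has
infinitely many targets, of which only those are used whose number is below the rank. -/
structure AbstractTreeAutomaton (S : Type) (rk : α → ℕ) where
  root : List S
  trans : List (S × α × (ℕ → S))

namespace AbstractTreeAutomaton

variable {S : Type}

def toTreeAutomaton (A : AbstractTreeAutomaton S rk) (c : S → List Symbol) : TreeAutomaton rk where
  root := A.root.map fun q => nameOf (c q)
  trans := A.trans.map fun t => ⟨nameOf (c t.1), t.2.1, fun i => nameOf (c (t.2.2 i))⟩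

/-- There is a run on the tree with the given state at the root. -/
def Run (A : AbstractTreeAutomaton S rk) : RankedTree rk → S → Prop
  | .node a c, q => ∃ qs, (q, a, qs) ∈ A.trans ∧ ∀ i : Fin (rk a), A.Run (c i) (qs i)

variable {A : AbstractTreeAutomaton S rk} {c : S → List Symbol}

theorem mem_trans_iff (hc : Function.Injective c) {q : S} {a : α} {qs : Fin (rk a) → Name} :
    ⟨nameOf (c q), a, qs⟩ ∈ (A.toTreeAutomaton c).trans ↔
      ∃ ts, (q, a, ts) ∈ A.trans ∧ qs = fun i : Fin (rk a) => nameOf (c (ts i)) := by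
  simp only [toTreeAutomaton, List.mem_map]
  constructor
  · rintro ⟨⟨s, b, ts⟩, h, h'⟩
    simp only [TreeTransition.mk.injEq] at h'
    obtain ⟨h1, rfl, h2⟩ := h'
    obtain rfl := hc (nameOf_injective h1)
    exact ⟨ts, h, (eq_of_heq h2).symm⟩
  · rintro ⟨ts, h, rfl⟩
    exact ⟨_, h, rfl⟩

theorem hasRun_iff (hc : Function.Injective c) {t : RankedTree rk} {q : S} :
    (A.toTreeAutomaton c).HasRun t (nameOf (c q)) ↔ A.Run t q := by
  induction t generalizing q with
  | node a d ih =>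
    constructor
    · rintro ⟨qs, h, h'⟩
      obtain ⟨ts, hts, rfl⟩ := (mem_trans_iff hc).1 h
      exact ⟨ts, hts, fun i => (ih i).1 (h' i)⟩
    · rintro ⟨ts, h, h'⟩
      exact ⟨_, (mem_trans_iff hc).2 ⟨ts, h, rfl⟩, fun i => (ih i).2 (h' i)⟩

theorem mem_accepts (hc : Function.Injective c) {t : RankedTree rk} :
    t ∈ (A.toTreeAutomaton c).accepts ↔ ∃ q ∈ A.root, A.Run t q := by
  constructor
  · rintro ⟨_, h, h'⟩
    obtain ⟨q, hq, rfl⟩ := List.mem_map.1 h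
    exact ⟨q, hq, (hasRun_iff hc).1 h'⟩
  · rintro ⟨q, h, h'⟩
    exact ⟨_, List.mem_map_of_mem h, (hasRun_iff hc).2 h'⟩

theorem isNTA {q : S} (h : A.root = [q]) : (A.toTreeAutomaton c).IsNTA :=
  ⟨nameOf (c q), by simp [toTreeAutomaton, h]⟩

theorem isTopDownDet (hc : Function.Injective c) {q : S} (h : A.root = [q])
    (h' : ∀ q a ts ts', (q, a, ts) ∈ A.trans → (q, a, ts') ∈ A.trans → ∀ i < rk a, ts i = ts' i) :
    (A.toTreeAutomaton c).IsTopDownDet := by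
  refine ⟨isNTA h, ?_⟩
  intro q a qs qs' h1 h2
  have : ∃ s, q = nameOf (c s) := by
    simp only [toTreeAutomaton, List.mem_map] at h1
    obtain ⟨t, -, h4⟩ := h1
    exact ⟨t.1, (TreeTransition.mk.inj h4).1.symm⟩
  obtain ⟨s, rfl⟩ := this
  obtain ⟨ts, h3, rfl⟩ := (mem_trans_iff hc).1 h1
  obtain ⟨ts', h4, rfl⟩ := (mem_trans_iff hc).1 h2
  exact funext fun i => by rw [h' _ _ _ _ h3 h4 i i.isLt]

theorem isBottomUpDet (hc : Function.Injective c)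
    (h : ∀ q q' a ts ts', (q, a, ts) ∈ A.trans → (q', a, ts') ∈ A.trans →
      (∀ i < rk a, ts i = ts' i) → q = q') : (A.toTreeAutomaton c).IsBottomUpDet := by
  intro q q' a qs h1 h2
  have key : ∀ q, ⟨q, a, qs⟩ ∈ (A.toTreeAutomaton c).trans → ∃ s, q = nameOf (c s) := by
    intro q h1
    simp only [toTreeAutomaton, List.mem_map] at h1
    obtain ⟨t, -, h4⟩ := h1
    exact ⟨t.1, (TreeTransition.mk.inj h4).1.symm⟩
  obtain ⟨s, rfl⟩ := key q h1
  obtain ⟨s', rfl⟩ := key q' h2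
  obtain ⟨ts, h3, rfl⟩ := (mem_trans_iff hc).1 h1
  obtain ⟨ts', h4, h5⟩ := (mem_trans_iff hc).1 h2
  rw [h _ _ _ _ _ h3 h4 fun i hi => hc (nameOf_injective (congrFun h5 ⟨i, hi⟩))]

end AbstractTreeAutomaton

end

/-! ### Convolutions of trees -/

/-- The first component of a convolution. -/
def PairTree.fst : PairTree → Tree
  | .node (some a, _) c => .node a fun i =>
      PairTree.fst (c ⟨i, lt_of_lt_of_le i.isLt (Nat.le_max_left a.rank _)⟩)
  -- An arbitrary value: in a convolution this case is not reached from the root, because the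
  -- recursion only visits children that exist in the first tree.
  | .node (none, _) _ => .node ⟨[], 0⟩ Fin.elim0

/-- The second component of a convolution. -/
def PairTree.snd : PairTree → Tree
  | .node (_, some b) c => .node b fun i =>
      PairTree.snd (c ⟨i, lt_of_lt_of_le i.isLt (Nat.le_max_right _ b.rank)⟩)
  | .node (_, none) _ => .node ⟨[], 0⟩ Fin.elim0

namespace Tree

theorem fst_convLeft (s : Tree) : PairTree.fst (convLeft s) = s := by
  induction s with
  | node a c ih => simp only [convLeft, PairTree.fst, ih]

theorem snd_convRight (s : Tree) : PairTree.snd (convRight s) = s := by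
  induction s with
  | node a c ih => simp only [convRight, PairTree.snd, ih]

theorem fst_conv (s t : Tree) : PairTree.fst (conv s t) = s := by
  induction s generalizing t with
  | node a c ih =>
    obtain ⟨b, d⟩ := t
    simp only [conv, PairTree.fst, Fin.is_lt, dif_pos, Fin.eta]
    congr 1
    funext i
    split
    · exact ih _ _
    · exact fst_convLeft _

theorem snd_conv (s t : Tree) : PairTree.snd (conv s t) = t := by
  induction t generalizing s with
  | node b d ih =>
    obtain ⟨a, c⟩ := s
    simp only [conv, PairTree.snd, Fin.is_lt, dif_pos, Fin.eta]
    congr 1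
    funext i
    split
    · exact ih _ _
    · exact snd_convRight _

theorem conv_inj {s t s' t' : Tree} (h : conv s t = conv s' t') : s = s' ∧ t = t' :=
  ⟨by rw [← fst_conv s t, h, fst_conv], by rw [← snd_conv s t, h, snd_conv]⟩

def height : Tree → ℕ
  | .node a c => Finset.univ.sup fun i : Fin a.rank => height (c i) + 1

/-- All letters of the tree belong to the list. -/
def Over (l : List RankedLetter) : Tree → Prop
  | .node a c => a ∈ l ∧ ∀ i, Over l (c i)

/-- By induction on the height: a tree is given by one of finitely many root letters and a tuple of
lower trees. -/
theorem finite_over (l : List RankedLetter) (n : ℕ) :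
    {t : Tree | Over l t ∧ height t ≤ n}.Finite := by
  have key : ∀ n, {t : Tree | Over l t ∧ height t < n}.Finite := by
    intro n
    induction n with
    | zero => simp
    | succ n ih =>
      have h1 : (⋃ a ∈ {a | a ∈ l}, (fun c : Fin a.rank → Tree => RankedTree.node a c) ''
          Set.pi Set.univ fun _ => {t : Tree | Over l t ∧ height t < n}).Finite :=
        Set.Finite.biUnion (List.finite_toSet l) fun a _ => (Set.Finite.pi' fun _ => ih).image _
          |>.subset (Set.image_mono fun c hc i => hc i trivial)
      refine h1.subset ?_
      rintro ⟨a, c⟩ ⟨⟨h2, h3⟩, h4⟩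
      simp only [Set.mem_iUnion]
      refine ⟨a, h2, c, fun i _ => ⟨h3 i, ?_⟩, rfl⟩
      have : height (c i) + 1 ≤ height (.node a c) := by
        rw [height]
        exact Finset.le_sup (f := fun i => height (c i) + 1) (Finset.mem_univ i)
      omega
  exact (key (n + 1)).subset fun t ht => ⟨ht.1, Nat.lt_succ_of_le ht.2⟩

end Tree

/-- Some position only belongs to the second component. -/
def PairTree.HasPad : PairTree → Prop
  | .node l c => l.1 = none ∨ ∃ i, PairTree.HasPad (c i)

namespace Tree

/-- Hence demanding a pad forces the elements of a sequence to be distinct, which is all that the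
reduction needs from it. -/
theorem not_hasPad_conv_self (t : Tree) : ¬ PairTree.HasPad (conv t t) := by
  induction t with
  | node a c ih =>
    simp only [conv, PairTree.HasPad, reduceCtorEq, false_or, not_exists]
    intro i
    have hi : i < a.rank := lt_of_lt_of_eq i.isLt (Nat.max_self a.rank)
    rw [dif_pos hi, dif_pos hi]
    exact ih _

theorem hasPad_convRight (t : Tree) : PairTree.HasPad (convRight t) := by
  cases t
  rw [convRight, PairTree.HasPad]
  exact .inl rfl

/-- Descend in the higher tree into a child that is too high for the other tree: either the children
still have different heights, or the other tree has no such child. -/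
theorem hasPad_conv {s t : Tree} (h : height s < height t) : PairTree.HasPad (conv s t) := by
  induction t generalizing s with
  | node b d ih =>
    obtain ⟨a, c⟩ := s
    have hb : height (.node b d) = Finset.univ.sup fun i => height (d i) + 1 := by rw [height]
    rw [hb, Finset.lt_sup_iff] at h
    obtain ⟨j, -, hj⟩ := h
    rw [conv, PairTree.HasPad]
    refine .inr ⟨⟨j, lt_of_lt_of_le j.isLt (Nat.le_max_right _ _)⟩, ?_⟩
    split
    · rename_i h1
      rw [dif_pos j.isLt]
      refine ih j ?_
      have : height (c ⟨j, h1⟩) + 1 ≤ height (.node a c) := by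
        rw [height]
        exact Finset.le_sup (f := fun i => height (c i) + 1) (Finset.mem_univ (⟨j, h1⟩ : Fin _))
      simp only at this ⊢
      omega
    · exact hasPad_convRight _

end Tree

/-! ### Reduction of the infinite clique problem over trees -/

namespace TreePairAutomaton

variable (A : TreePairAutomaton)

/-- The letters in the first component. -/
def firstLetters : List RankedLetter := A.trans.filterMap fun t => t.letter.1

/-- The symbol on top of a tree. -/
def topLetter : RankedLetter := ⟨[], 1⟩

/-- The unary root separates the trees of a sequence from `startTree`, whatever letters the given
automaton uses, and lets a single initial state choose between the two kinds of pairs. -/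
def topTree (t : Tree) : Tree := .node topLetter fun _ => t

/-- The tree at which the sequences begin. -/
def startTree : Tree := .node ⟨[], 0⟩ Fin.elim0

/-- The targets, with flags. -/
def flagged (t : TreeTransition pairRank) (g : ℕ → Bool) (i : ℕ) : CliqueState :=
  .copy (g i) ((t.target i).getD [])

open CliqueState in
/-- The transitions that are obtained from one transition of the given automaton. -/
def cliqueTrans (t : TreeTransition pairRank) :
    List (CliqueState × (Option RankedLetter × Option RankedLetter) × (ℕ → CliqueState)) :=
  (copy false t.source, t.letter, flagged t fun _ => false) ::
    -- In a copy with flag `true` a pad has to be found: the demand is passed on to one child `j`,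
    -- or it is met by a letter without first component.
    ((List.range (pairRank t.letter)).map (fun j =>
        (copy true t.source, t.letter, flagged t fun i => decide (i = j))) ++
      [match t.letter.1 with
      | none => (copy true t.source, t.letter, flagged t fun _ => false)
      | some a => (all, (none, some a), fun _ => all)])

/-- The automaton for the relation of the constructed instance. -/
def cliqueAutomaton : AbstractTreeAutomaton CliqueState pairRank where
  root := [.init]
  trans := (.init, (some ⟨[], 0⟩, some topLetter), fun _ => .all) ::
    (A.root.map (fun q => (.init, (some topLetter, some topLetter), fun _ => .copy true q)) ++
      A.trans.flatMap cliqueTrans)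

/-- The automaton for all trees below the top letter. -/
def allTrees : AbstractTreeAutomaton CliqueState RankedLetter.rank where
  root := [.init]
  trans := (.init, topLetter, fun _ => .all) :: A.firstLetters.map fun a => (.all, a, fun _ => .all)

def toRecInput : TreeRecInput where
  R := A.cliqueAutomaton.toTreeAutomaton CliqueState.code
  L := A.allTrees.toTreeAutomaton CliqueState.code
  t := startTree

variable {A}

theorem mem_firstLetters {a : RankedLetter} :
    a ∈ A.firstLetters ↔ ∃ t ∈ A.trans, t.letter.1 = some a := by
  simp [firstLetters]

theorem mem_cliqueAutomaton_init {l : Option RankedLetter × Option RankedLetter}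
    {ts : ℕ → CliqueState} : (.init, l, ts) ∈ A.cliqueAutomaton.trans ↔
      (l = (some ⟨[], 0⟩, some topLetter) ∧ ts = fun _ => .all) ∨
      ∃ q ∈ A.root, l = (some topLetter, some topLetter) ∧ ts = fun _ => .copy true q := by
  simp only [cliqueAutomaton, List.mem_cons, List.mem_append, List.mem_map, List.mem_flatMap,
    Prod.mk.injEq, true_and]
  refine or_congr_right (Iff.trans (or_iff_left ?_) (exists_congr fun q => and_congr_right
    fun _ => and_congr eq_comm eq_comm))
  rintro ⟨t, -, h⟩
  simp only [cliqueTrans, List.mem_cons, List.mem_append, List.mem_map, Prod.mk.injEq,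
    reduceCtorEq, false_and, and_false, exists_false, false_or, List.not_mem_nil, or_false] at h
  split at h <;> simp at h

theorem mem_cliqueAutomaton_all {l : Option RankedLetter × Option RankedLetter}
    {ts : ℕ → CliqueState} : (.all, l, ts) ∈ A.cliqueAutomaton.trans ↔
      ∃ a ∈ A.firstLetters, l = (none, some a) ∧ ts = fun _ => .all := by
  simp only [cliqueAutomaton, List.mem_cons, List.mem_append, List.mem_map, List.mem_flatMap,
    Prod.mk.injEq, reduceCtorEq, false_and, and_false, exists_false, false_or, cliqueTrans,
    List.not_mem_nil, or_false]
  constructor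
  · rintro ⟨t, ht, h⟩
    split at h
    · simp at h
    · rename_i a ha
      simp only [Prod.mk.injEq, true_and] at h
      exact ⟨a, mem_firstLetters.2 ⟨t, ht, ha⟩, h⟩
  · rintro ⟨a, ha, rfl, rfl⟩
    obtain ⟨t, ht, h⟩ := mem_firstLetters.1 ha
    exact ⟨t, ht, by rw [h]⟩

theorem mem_cliqueAutomaton_copy {b : Bool} {q : Name}
    {l : Option RankedLetter × Option RankedLetter} {ts : ℕ → CliqueState} :
    (.copy b q, l, ts) ∈ A.cliqueAutomaton.trans ↔ ∃ t ∈ A.trans, t.source = q ∧ t.letter = l ∧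
      ∃ g, ts = flagged t g ∧ ((b = false ∧ g = fun _ => false) ∨
        (b = true ∧ ∃ j < pairRank l, g = fun i => decide (i = j)) ∨
        (b = true ∧ l.1 = none ∧ g = fun _ => false)) := by
  simp only [cliqueAutomaton, List.mem_cons, List.mem_append, List.mem_map, List.mem_flatMap,
    Prod.mk.injEq, reduceCtorEq, false_and, and_false, exists_false, false_or, cliqueTrans,
    List.not_mem_nil, or_false, List.mem_range, CliqueState.copy.injEq]
  refine exists_congr fun t => and_congr_right fun _ => ?_
  constructor
  · rintro (⟨⟨rfl, rfl⟩, rfl, rfl⟩ | ⟨j, hj, ⟨rfl, rfl⟩, rfl, rfl⟩ | h)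
    · exact ⟨rfl, rfl, _, rfl, .inl ⟨rfl, rfl⟩⟩
    · exact ⟨rfl, rfl, _, rfl, .inr (.inl ⟨rfl, j, hj, rfl⟩)⟩
    · split at h
      · rename_i hl
        simp only [Prod.mk.injEq, CliqueState.copy.injEq] at h
        obtain ⟨⟨rfl, rfl⟩, rfl, rfl⟩ := h
        exact ⟨rfl, rfl, _, rfl, .inr (.inr ⟨rfl, hl, rfl⟩)⟩
      · simp at h
  · rintro ⟨rfl, rfl, g, rfl, ⟨rfl, rfl⟩ | ⟨rfl, j, hj, rfl⟩ | ⟨rfl, hl, rfl⟩⟩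
    · exact .inl ⟨⟨rfl, rfl⟩, rfl, rfl⟩
    · exact .inr (.inl ⟨j, hj, ⟨rfl, rfl⟩, rfl, rfl⟩)
    · exact .inr (.inr (by rw [hl]))

theorem cliqueAutomaton_run_copy {b : Bool} {q : Name} {x : PairTree} :
    A.cliqueAutomaton.Run x (.copy b q) ↔ A.HasRun x q ∧ (b = true → PairTree.HasPad x) := by
  induction x generalizing b q with
  | node l c ih =>
    rw [TreeAutomaton.hasRun_node, AbstractTreeAutomaton.Run, PairTree.HasPad]
    constructor
    · rintro ⟨ts, h, h'⟩
      obtain ⟨t, ht, rfl, rfl, g, rfl, hg⟩ := mem_cliqueAutomaton_copy.1 h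
      refine ⟨⟨t, ht, rfl, rfl, fun i => ?_⟩, ?_⟩
      · have := ((ih i).1 (h' i)).1
        exact ⟨t.targets i, by simp [TreeTransition.target],
          by simpa [TreeTransition.target] using this⟩
      · rintro rfl
        rcases hg with ⟨h1, -⟩ | ⟨-, j, hj, rfl⟩ | ⟨-, hl, -⟩
        · cases h1
        · exact .inr ⟨⟨j, hj⟩, ((ih _).1 (h' ⟨j, hj⟩)).2 (by simp)⟩
        · exact .inl hl
    · rintro ⟨⟨t, ht, rfl, rfl, h⟩, h'⟩
      have key : ∀ g, (∀ i : Fin (pairRank t.letter), g i = true → PairTree.HasPad (c i)) →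
          ∀ i : Fin (pairRank t.letter), A.cliqueAutomaton.Run (c i) (flagged t g i) := by
        intro g hg i
        obtain ⟨s, h1, h2⟩ := h i
        rw [flagged, h1]
        exact (ih i).2 ⟨h2, hg i⟩
      cases b with
      | false =>
        exact ⟨_, mem_cliqueAutomaton_copy.2 ⟨t, ht, rfl, rfl, _, rfl, .inl ⟨rfl, rfl⟩⟩,
          key _ (by simp)⟩
      | true =>
        rcases h' rfl with hl | ⟨j, hj⟩
        · exact ⟨_, mem_cliqueAutomaton_copy.2 ⟨t, ht, rfl, rfl, _, rfl,
            .inr (.inr ⟨rfl, hl, rfl⟩)⟩, key _ (by simp)⟩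
        · refine ⟨_, mem_cliqueAutomaton_copy.2 ⟨t, ht, rfl, rfl, _, rfl,
            .inr (.inl ⟨rfl, j, j.isLt, rfl⟩)⟩, key _ fun i hi => ?_⟩
          obtain rfl : i = j := Fin.ext (of_decide_eq_true hi)
          exact hj

theorem cliqueAutomaton_run_all {x : PairTree} : A.cliqueAutomaton.Run x .all ↔
    ∃ t, Tree.Over A.firstLetters t ∧ x = Tree.convRight t := by
  constructor
  · intro h
    induction x with
    | node l c ih =>
      rw [AbstractTreeAutomaton.Run] at h
      obtain ⟨ts, h, h'⟩ := h
      obtain ⟨a, ha, rfl, rfl⟩ := mem_cliqueAutomaton_all.1 h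
      choose d hd hd' using fun i => ih i (h' i)
      refine ⟨.node a fun i => d ⟨i, lt_of_lt_of_eq i.isLt (Nat.zero_max a.rank).symm⟩, ?_, ?_⟩
      · rw [Tree.Over]
        exact ⟨ha, fun i => hd _⟩
      · rw [Tree.convRight]
        exact congrArg _ (funext hd')
  · rintro ⟨t, ht, rfl⟩
    induction t with
    | node a c ih =>
      rw [Tree.Over] at ht
      rw [Tree.convRight, AbstractTreeAutomaton.Run]
      exact ⟨_, mem_cliqueAutomaton_all.2 ⟨a, ht.1, rfl, rfl⟩, fun i => ih _ (ht.2 _)⟩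

theorem conv_topTree (s t : Tree) : Tree.conv (topTree s) (topTree t) =
    .node (some topLetter, some topLetter) fun _ => Tree.conv s t := by
  rw [topTree, topTree, Tree.conv]
  congr 1
  funext i
  have : (i : ℕ) < 1 := i.isLt
  rw [dif_pos (by exact this), dif_pos (by exact this)]

theorem conv_startTree (t : Tree) : Tree.conv startTree (topTree t) =
    .node (some ⟨[], 0⟩, some topLetter) fun _ => Tree.convRight t := by
  rw [startTree, topTree, Tree.conv]
  congr 1

theorem cliqueAutomaton_accepts (hA : A.Recognizes A.rel) {x : PairTree} :
    x ∈ A.toRecInput.R.accepts ↔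
      (∃ s t, A.rel s t ∧ PairTree.HasPad (Tree.conv s t) ∧
        x = Tree.conv (topTree s) (topTree t)) ∨
      ∃ t, Tree.Over A.firstLetters t ∧ x = Tree.conv startTree (topTree t) := by
  have h0 : x ∈ A.toRecInput.R.accepts ↔ A.cliqueAutomaton.Run x .init :=
    (AbstractTreeAutomaton.mem_accepts CliqueState.code_injective).trans
      (by simp [cliqueAutomaton])
  rw [h0]
  simp only [conv_topTree, conv_startTree]
  obtain ⟨l, c⟩ := x
  rw [AbstractTreeAutomaton.Run]
  constructor
  · rintro ⟨ts, h, h'⟩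
    rcases mem_cliqueAutomaton_init.1 h with ⟨rfl, rfl⟩ | ⟨q, hq, rfl, rfl⟩
    · obtain ⟨t, ht, ht'⟩ := cliqueAutomaton_run_all.1 (h' (0 : Fin 1))
      refine .inr ⟨t, ht, congrArg _ (funext fun i => ?_)⟩
      rw [← ht', Subsingleton.elim (α := Fin 1) i 0]
    · obtain ⟨h1, h2⟩ := cliqueAutomaton_run_copy.1 (h' (0 : Fin 1))
      have h3 : c (0 : Fin 1) ∈ A.accepts := ⟨q, hq, h1⟩
      have h4 := h3
      rw [hA] at h4
      obtain ⟨s, t, h5, h6⟩ := h4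
      refine .inl ⟨s, t, h5, ?_, congrArg _ (funext fun i => ?_)⟩
      · rw [← h6]
        exact h2 rfl
      · rw [← h6, Subsingleton.elim (α := Fin 1) i 0]
  · rintro (⟨s, t, ⟨q, hq, h1⟩, h2, h3⟩ | ⟨t, ht, h3⟩) <;> cases h3
    · exact ⟨_, mem_cliqueAutomaton_init.2 (.inr ⟨q, hq, rfl, rfl⟩), fun i =>
        cliqueAutomaton_run_copy.2 ⟨h1, fun _ => h2⟩⟩
    · exact ⟨_, mem_cliqueAutomaton_init.2 (.inl ⟨rfl, rfl⟩), fun i =>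
        cliqueAutomaton_run_all.2 ⟨t, ht, rfl⟩⟩

theorem toRecInput_rel (hA : A.Recognizes A.rel) {u v : Tree} : A.toRecInput.R.rel u v ↔
    (∃ s t, A.rel s t ∧ PairTree.HasPad (Tree.conv s t) ∧ u = topTree s ∧ v = topTree t) ∨
      ∃ t, Tree.Over A.firstLetters t ∧ u = startTree ∧ v = topTree t := by
  rw [rel, cliqueAutomaton_accepts hA]
  have key : ∀ u' v', Tree.conv u v = Tree.conv u' v' ↔ u = u' ∧ v = v' := fun u' v' =>
    ⟨Tree.conv_inj, fun ⟨h, h'⟩ => by rw [h, h']⟩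
  simp only [key]

theorem toRecInput_recognizes (hA : A.Recognizes A.rel) :
    A.toRecInput.R.Recognizes A.toRecInput.R.rel := by
  refine Set.Subset.antisymm (fun x hx => ?_) ?_
  · rcases (cliqueAutomaton_accepts hA).1 hx with ⟨s, t, -, -, rfl⟩ | ⟨t, -, rfl⟩ <;>
      exact ⟨_, _, hx, rfl⟩
  · rintro _ ⟨u, v, h, rfl⟩
    exact h

theorem topTree_injective : Function.Injective topTree := by
  intro s t h
  rw [topTree, topTree, RankedTree.node.injEq] at h
  exact congrFun (eq_of_heq h.2) (0 : Fin 1)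

theorem topTree_mem_L {t : Tree} (ht : Tree.Over A.firstLetters t) :
    topTree t ∈ A.toRecInput.L.accepts := by
  refine (AbstractTreeAutomaton.mem_accepts CliqueState.code_injective).2 ⟨.init, by simp [allTrees],
    ?_⟩
  rw [topTree, AbstractTreeAutomaton.Run]
  refine ⟨fun _ => .all, by simp [allTrees], fun _ => ?_⟩
  induction t with
  | node a c ih =>
    rw [Tree.Over] at ht
    rw [AbstractTreeAutomaton.Run]
    exact ⟨fun _ => .all, by simp [allTrees, ht.1], fun i => ih i (ht.2 i)⟩

/-- Every node of the first tree is a node of the convolution, so its letter is in a transition. The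
subtrees where the second tree has ended need an induction of their own. -/
theorem rel_over {s t : Tree} (h : A.rel s t) : Tree.Over A.firstLetters s := by
  have key : ∀ (s : Tree) q, A.HasRun (Tree.convLeft s) q → Tree.Over A.firstLetters s := by
    intro s
    induction s with
    | node a c ih =>
      intro q h
      rw [Tree.convLeft, TreeAutomaton.hasRun_node] at h
      obtain ⟨t, ht, -, hl, h⟩ := h
      rw [Tree.Over]
      refine ⟨mem_firstLetters.2 ⟨t, ht, by rw [hl]⟩, fun i => ?_⟩
      obtain ⟨s, -, hs⟩ := h ⟨i, lt_of_lt_of_eq i.isLt (Nat.max_zero a.rank).symm⟩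
      exact ih i _ hs
  obtain ⟨q, -, h⟩ := h
  induction s generalizing q t with
  | node a c ih =>
    obtain ⟨b, d⟩ := t
    rw [Tree.conv, TreeAutomaton.hasRun_node] at h
    obtain ⟨t, ht, -, hl, h⟩ := h
    rw [Tree.Over]
    refine ⟨mem_firstLetters.2 ⟨t, ht, by rw [hl]⟩, fun i => ?_⟩
    obtain ⟨s, -, hs⟩ := h ⟨i, lt_of_lt_of_le i.isLt (Nat.le_max_left a.rank _)⟩
    rw [dif_pos i.isLt] at hs
    split at hs
    · exact ih i _ hs
    · exact key _ _ hs

/-- Growing heights select the subsequence, but the relation only keeps the weaker condition of a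
pad, which suffices for distinctness. -/
theorem hasInfiniteClique_iff (hA : A.Recognizes A.rel) : HasInfiniteClique A.rel ↔
    A.toRecInput.t ∈ Rec A.toRecInput.R.rel A.toRecInput.L.accepts := by
  constructor
  · rintro ⟨a, ha, hR⟩
    have hl : ∀ i, Tree.Over A.firstLetters (a i) := fun i =>
      rel_over (hR i (i + 1) (Nat.lt_succ_self i))
    obtain ⟨φ, hφ, hφ'⟩ := exists_subsequence ha Tree.height fun n =>
      (Tree.finite_over A.firstLetters n).subset (by
        rintro _ ⟨⟨i, rfl⟩, hi⟩
        exact ⟨hl i, hi⟩)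
    refine ⟨fun i => i.casesOn startTree fun i => topTree (a (φ i)), rfl, ?_, ?_⟩
    · intro i j hij
      obtain ⟨j, rfl⟩ : ∃ k, j = k + 1 := ⟨j - 1, by omega⟩
      rw [toRecInput_rel hA]
      cases i with
      | zero => exact .inr ⟨_, hl _, rfl, rfl⟩
      | succ i =>
        have hij : i < j := by omega
        exact .inl ⟨_, _, hR _ _ (hφ hij), Tree.hasPad_conv (hφ' hij), rfl, rfl⟩
    · refine Set.infinite_of_injective_forall_mem (f := fun i : ℕ => i + 1)
        (add_left_injective 1) fun i => ?_
      exact topTree_mem_L (hl _)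
  · rintro ⟨a, h0, hR, -⟩
    replace h0 : a 0 = startTree := h0
    have hne : ∀ t, topTree t ≠ startTree := by
      intro t h
      rw [topTree, startTree, RankedTree.node.injEq] at h
      simp [topLetter] at h
    have h1 : ∀ i, ∃ t, a (i + 1) = topTree t := by
      intro i
      rcases (toRecInput_rel hA).1 (hR 0 (i + 1) (by omega)) with ⟨s, t, -, -, -, h⟩ | ⟨t, -, -, h⟩ <;>
        exact ⟨t, h⟩
    choose t ht using h1
    have h2 : ∀ i j, i < j → A.rel (t i) (t j) ∧ PairTree.HasPad (Tree.conv (t i) (t j)) := by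
      intro i j hij
      rcases (toRecInput_rel hA).1 (hR (i + 1) (j + 1) (by omega)) with
        ⟨s, s', h, h', h3, h4⟩ | ⟨s, -, h, -⟩
      · rw [ht] at h3 h4
        obtain rfl := topTree_injective h3
        obtain rfl := topTree_injective h4
        exact ⟨h, h'⟩
      · rw [ht] at h
        exact absurd h (hne _)
    refine ⟨t, fun i j hij => ?_, fun i j hij => (h2 i j hij).1⟩
    rcases lt_trichotomy i j with h | h | h
    · have := (h2 i j h).2
      rw [hij] at this
      exact absurd this (Tree.not_hasPad_conv_self _)
    · exact h
    · have := (h2 j i h).2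
      rw [hij] at this
      exact absurd this (Tree.not_hasPad_conv_self _)

end TreePairAutomaton

/-! ### Reading tree automata -/

/-- The function `past` skips codes that are given by `e`, which may begin with any symbol. -/
structure Skipper {α : Type} (e : α → List Symbol) (past : List Symbol → ℕ → ℕ) : Prop where
  code : IsCode e
  past_eq : ∀ x p a, At x p (e a) → past x p = p + (e a).length
  num : Num fun x (v : Fin 1 → ℕ) => past x (v 0)

theorem Parser.skipper {α : Type} {e : α → List Symbol} {past : List Symbol → ℕ → ℕ}
    (h : Parser e past) : Skipper e past := ⟨h.code, h.past_eq, h.num⟩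

def pastRanked (x : List Symbol) (p : ℕ) : ℕ := pastName x (pastName x p)

theorem Num.pastRanked {k : ℕ} {g : List Symbol → (Fin k → ℕ) → ℕ} (hg : Num g) :
    Num fun x v => pastRanked x (g x v) := hg.pastName.pastName

theorem parser_ranked : Parser encRankedLetter pastRanked where
  code := isCode_encRankedLetter
  head := fun a => by simp [encRankedLetter, encName]
  past_eq := by
    intro x p a h
    rw [encRankedLetter, parser_name.at_append_iff] at h
    rw [pastRanked, parser_unary.past_eq _ _ _ h.2, parser_name.past_eq _ _ _ h.1]
    simp only [encRankedLetter, List.length_append]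
    omega
  num := (Num.var 0).pastRanked

def pastRankedPair (x : List Symbol) (p : ℕ) : ℕ :=
  pastOption pastRanked x (pastOption pastRanked x p)

theorem skipper_rankedPair : Skipper encRankedLetterPair pastRankedPair where
  code := isCode_encRankedLetterPair
  past_eq := by
    intro x p a h
    rw [encRankedLetterPair, encPair, parser_ranked.at_option_append_iff] at h
    rw [pastRankedPair, parser_ranked.pastOption_eq h.2, parser_ranked.pastOption_eq h.1]
    simp only [encRankedLetterPair, encPair, List.length_append]
    omega
  num := .pastOption parser_ranked.num (.pastOption parser_ranked.num (.var 0))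

theorem optAt_rankedPair {x : List Symbol} {p : ℕ} {l : Option RankedLetter × Option RankedLetter}
    (h : At x p (encRankedLetterPair l)) : OptAt encRankedLetter x p l.1 ∧
      OptAt encRankedLetter x (pastOption pastRanked x p) l.2 := by
  rw [encRankedLetterPair, encPair, parser_ranked.at_option_append_iff] at h
  exact ⟨.of_at h.1, .of_at h.2⟩

/-- The rank of the optional letter at position `p`. -/
def rankAt (x : List Symbol) (p : ℕ) : ℕ :=
  -- The rank is written in unary between two parentheses, which are subtracted.
  if isLpar x[p]? = true then pastRanked x p - pastName x p - 2 else 0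

theorem Num.rankAt {k : ℕ} {g : List Symbol → (Fin k → ℕ) → ℕ} (hg : Num g) :
    Num fun x v => rankAt x (g x v) :=
  .ite (.letter _ hg) (.sub (.sub hg.pastRanked hg.pastName) (.const 2)) (.const 0)

theorem rankAt_eq {x : List Symbol} {p : ℕ} {o : Option RankedLetter}
    (h : OptAt encRankedLetter x p o) : rankAt x p = o.elim 0 RankedLetter.rank := by
  rw [rankAt, parser_ranked.isLpar_eq h]
  cases o with
  | none => rfl
  | some a =>
    have h' : At x p (encRankedLetter a) := h
    rw [encRankedLetter, parser_name.at_append_iff] at h'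
    rw [Option.isSome_some, if_pos rfl, pastRanked, parser_unary.past_eq _ _ _ h'.2]
    simp only [encUnary, encName, List.length_append, List.length_cons, List.length_map,
      List.length_replicate, List.length_nil, Option.elim_some]
    omega

section

variable {α : Type} {rk : α → ℕ} {e : α → List Symbol} {past : List Symbol → ℕ → ℕ}

/-- The position of the list of targets of the transition at position `p`. -/
def targetsPos (past : List Symbol → ℕ → ℕ) (x : List Symbol) (p : ℕ) : ℕ := past x (pastName x p)

/-- The position of the target with number `i`. -/
def nthTargetPos (past : List Symbol → ℕ → ℕ) (x : List Symbol) (p i : ℕ) : ℕ :=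
  elemPos pastName x (targetsPos past x p + 1) i

def pastTreeTrans (past : List Symbol → ℕ → ℕ) (x : List Symbol) (p : ℕ) : ℕ :=
  pastList pastName x (targetsPos past x p)

/-- The position of the list of transitions of the automaton at position `p`. -/
def treeTransPos (x : List Symbol) (p : ℕ) : ℕ := pastList pastName x p

def pastTreeAutomaton (past : List Symbol → ℕ → ℕ) (x : List Symbol) (p : ℕ) : ℕ :=
  pastList (pastTreeTrans past) x (treeTransPos x p)

section

variable {k : ℕ} {f g : List Symbol → (Fin k → ℕ) → ℕ}

theorem Num.targetsPos (h : Num fun x (v : Fin 1 → ℕ) => past x (v 0)) (hf : Num f) :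
    Num fun x v => targetsPos past x (f x v) := Num.comp1 (f := past) h hf.pastName

theorem Num.nthTargetPos (h : Num fun x (v : Fin 1 → ℕ) => past x (v 0)) (hf : Num f)
    (hg : Num g) : Num fun x v => nthTargetPos past x (f x v) (g x v) :=
  .elemPos parser_name.num ((Num.targetsPos h hf).add (.const 1)) hg

theorem Num.treeTransPos (hf : Num f) : Num fun x v => treeTransPos x (f x v) :=
  .pastList parser_name.num hf

theorem Num.pastTreeTrans (h : Num fun x (v : Fin 1 → ℕ) => past x (v 0)) (hf : Num f) :
    Num fun x v => pastTreeTrans past x (f x v) := .pastList parser_name.num (.targetsPos h hf)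

theorem Num.pastTreeAutomaton (h : Num fun x (v : Fin 1 → ℕ) => past x (v 0)) (hf : Num f) :
    Num fun x v => pastTreeAutomaton past x (f x v) :=
  .pastList (Num.pastTreeTrans h (.var 0)) hf.treeTransPos

end

theorem Skipper.at_append_iff (h : Skipper e past) {x : List Symbol} {p : ℕ} {a : α}
    {l : List Symbol} : At x p (e a ++ l) ↔ At x p (e a) ∧ At x (past x p) l := by
  rw [At.append_iff]
  exact and_congr_right fun ha => by rw [h.past_eq x p a ha]

theorem Skipper.at_treeTrans_iff (h : Skipper e past) {x : List Symbol} {p : ℕ}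
    {t : TreeTransition rk} : At x p (t.enc e) ↔ At x p (encName t.source) ∧
      At x (pastName x p) (e t.letter) ∧
      At x (targetsPos past x p) (encList encName (List.ofFn t.targets)) := by
  rw [TreeTransition.enc, parser_name.at_append_iff, h.at_append_iff]
  rfl

theorem Skipper.segment_letter (h : Skipper e past) {x : List Symbol} {p : ℕ}
    {t : TreeTransition rk} (ht : At x p (t.enc e)) :
    segment x (pastName x p) (targetsPos past x p) = e t.letter := by
  have h1 := (h.at_treeTrans_iff.1 ht).2.1
  exact segment_eq h1 (h.past_eq _ _ _ h1)

theorem Skipper.treeTrans (h : Skipper e past) :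
    Parser (TreeTransition.enc (rk := rk) e) (pastTreeTrans past) where
  code := TreeTransition.isCode_enc h.code
  head := fun t => by simp [TreeTransition.enc, encName]
  past_eq := by
    intro x p t ht
    obtain ⟨h1, h2, h3⟩ := h.at_treeTrans_iff.1 ht
    rw [pastTreeTrans, parser_name.list.past_eq _ _ _ h3, targetsPos, h.past_eq _ _ _ h2,
      parser_name.past_eq _ _ _ h1]
    simp only [TreeTransition.enc, List.length_append]
    omega
  num := .pastTreeTrans h.num (.var 0)

/-- For numbers beyond the rank the search stays at the closing parenthesis of the list of targets,
and this position counts as `none`. -/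
theorem Skipper.optAt_target (h : Skipper e past) {x : List Symbol} {p : ℕ}
    {t : TreeTransition rk} (ht : At x p (t.enc e)) (i : ℕ) :
    OptAt encName x (nthTargetPos past x p i) (t.target i) := by
  obtain ⟨q, hc, hq, hq', hf, -⟩ :=
    parser_name.exists_chain_list (h.at_treeTrans_iff.1 ht).2.2
  have hl := hf.length_eq
  rw [List.length_ofFn] at hl
  rw [nthTargetPos, TreeTransition.target]
  split
  · rename_i hi
    rw [hc.elemPos_getElem (by omega)]
    have := List.forall₂_iff_get.1 hf |>.2 i (by omega) (by simpa using hi)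
    rw [OptAt]
    simpa using this
  · rw [hc.elemPos_end (by rw [hq]; rfl) (List.getElem?_eq_some_iff.1 hq).1.le (by omega), OptAt, hq]
    rfl

theorem Skipper.at_treeAutomaton_iff (h : Skipper e past) {x : List Symbol} {p : ℕ}
    {A : TreeAutomaton rk} {l : List Symbol} : At x p (A.enc e ++ l) ↔
      At x p (encList encName A.root) ∧
      At x (treeTransPos x p) (encList (TreeTransition.enc e) A.trans) ∧
      At x (pastTreeAutomaton past x p) l := by
  rw [TreeAutomaton.enc, List.append_assoc, parser_name.list.at_append_iff,
    h.treeTrans.list.at_append_iff]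
  rfl

theorem Skipper.treeAutomaton (h : Skipper e past) :
    Parser (TreeAutomaton.enc (rk := rk) e) (pastTreeAutomaton past) where
  code := TreeAutomaton.isCode_enc h.code
  head := fun A => by simp [TreeAutomaton.enc, encList]
  past_eq := by
    intro x p A hA
    obtain ⟨h1, h2, -⟩ := h.at_treeAutomaton_iff.1 (by rwa [List.append_nil] : At x p (_ ++ []))
    rw [pastTreeAutomaton, h.treeTrans.list.past_eq _ _ _ h2, treeTransPos,
      parser_name.list.past_eq _ _ _ h1]
    simp only [TreeAutomaton.enc, List.length_append]
    omega
  num := .pastTreeAutomaton h.num (.var 0)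

end

/-! ### Printing tree automata -/

/-- The code of a letter and of the names of the states at and below it. -/
def printTreeTrans (s l ts : List Symbol) : List Symbol :=
  nameCode s ++ (l ++ (.lpar :: ts ++ [.rpar]))

theorem Out.printTreeTrans {k : ℕ} {F G H : List Symbol → (Fin k → ℕ) → List Symbol} (hF : Out F)
    (hG : Out G) (hH : Out H) : Out fun x v => printTreeTrans (F x v) (G x v) (H x v) :=
  hF.nameCode.append (hG.append hH.encList)

theorem flatMap_ofFn {α β : Type} (n : ℕ) (g : ℕ → α) (e : α → List β) :
    (List.ofFn fun i : Fin n => g i).flatMap e = (List.range n).flatMap fun i => e (g i) := by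
  rw [← List.map_coe_finRange_eq_range, List.flatMap_map, List.ofFn_eq_map, List.flatMap_map]

/-- The code of a transition with the given source, letter and targets. -/
def encAbstractTrans {S α : Type} {rk : α → ℕ} (c : S → List Symbol) (e : α → List Symbol)
    (t : S × α × (ℕ → S)) : List Symbol :=
  printTreeTrans (c t.1) (e t.2.1) ((List.range (rk t.2.1)).flatMap fun i => nameCode (c (t.2.2 i)))

theorem AbstractTreeAutomaton.enc_toTreeAutomaton {S α : Type} {rk : α → ℕ}
    (A : AbstractTreeAutomaton S rk) (c : S → List Symbol) (e : α → List Symbol) :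
    (A.toTreeAutomaton c).enc e = .lpar :: A.root.flatMap (fun q => nameCode (c q)) ++ [.rpar] ++
      (.lpar :: A.trans.flatMap (encAbstractTrans (rk := rk) c e) ++ [.rpar]) := by
  simp only [TreeAutomaton.enc, encList, toTreeAutomaton, List.flatMap_map, TreeTransition.enc,
    encName_nameOf]
  congr 4
  funext t
  rw [flatMap_ofFn (rk t.2.1) (fun i => nameOf (c (t.2.2 i)))]
  simp only [encName_nameOf]
  rfl

/-! ### Computation of the reduction of the infinite clique problem over trees -/

section Program

variable (x : List Symbol)

/-- The rank of the pair of letters of the transition at position `t`. -/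
def pairRankAt (t : ℕ) : ℕ :=
  max (rankAt x (pastName x t)) (rankAt x (pastOption pastRanked x (pastName x t)))

def flaggedOut (b : Bool) (t i : ℕ) : List Symbol :=
  encBit b :: nameAt x (nthTargetPos pastRankedPair x t i)

def copyOut (b : Bool) (t : ℕ) : List Symbol :=
  printTreeTrans (encBit b :: nameAt x t) (segment x (pastName x t) (targetsPos pastRankedPair x t))
    ((List.range (pairRankAt x t)).flatMap fun i => nameCode (flaggedOut x false t i))

def markOut (t j : ℕ) : List Symbol :=
  printTreeTrans (.one :: nameAt x t) (segment x (pastName x t) (targetsPos pastRankedPair x t))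
    ((List.range (pairRankAt x t)).flatMap fun i =>
      if decide (i = j) = true then nameCode (flaggedOut x true t i)
      else nameCode (flaggedOut x false t i))

/-- The letter in the first component of the letter of the transition at position `t`. -/
def firstOut (t : ℕ) : List Symbol := segment x (pastName x t) (pastRanked x (pastName x t))

def allOut (t : ℕ) : List Symbol :=
  (List.range (rankAt x (pastName x t))).flatMap fun _ => nameCode [.bot]

def treeCliqueTransOut (t : ℕ) : List Symbol :=
  copyOut x false t ++ ((List.range (pairRankAt x t)).flatMap (markOut x t) ++
    if isLpar x[pastName x t]? = true then
      printTreeTrans [.bot] (.bot :: firstOut x t) (allOut x t)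
    else copyOut x true t)

def treeFirstLetterOut (t : ℕ) : List Symbol :=
  if isLpar x[pastName x t]? = true then printTreeTrans [.bot] (firstOut x t) (allOut x t) else []

open TreePairAutomaton in
/-- The reduction on strings. -/
def treeCliqueReduction : List Symbol :=
  (.lpar :: nameCode [] ++ [.rpar] ++
    (.lpar :: (printTreeTrans [] (encRankedLetterPair (some ⟨[], 0⟩, some topLetter))
        (nameCode [.bot]) ++
      ((elems pastName x 1).flatMap (fun q => printTreeTrans []
        (encRankedLetterPair (some topLetter, some topLetter)) (nameCode (.one :: nameAt x q))) ++
      (elems (pastTreeTrans pastRankedPair) x (treeTransPos x 0 + 1)).flatMap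
        (treeCliqueTransOut x))) ++ [.rpar])) ++
  ((.lpar :: nameCode [] ++ [.rpar] ++
    (.lpar :: (printTreeTrans [] (encRankedLetter topLetter) (nameCode [.bot]) ++
      (elems (pastTreeTrans pastRankedPair) x (treeTransPos x 0 + 1)).flatMap
        (treeFirstLetterOut x)) ++ [.rpar])) ++ Tree.enc startTree)

end Program

section

variable {k : ℕ} {f g : List Symbol → (Fin k → ℕ) → ℕ}

theorem num_pairRankAt (hf : Num f) : Num fun x v => pairRankAt x (f x v) :=
  .max hf.pastName.rankAt (Num.rankAt (.pastOption parser_ranked.num hf.pastName))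

theorem out_flaggedOut (b : Bool) (hf : Num f) (hg : Num g) :
    Out fun x v => flaggedOut x b (f x v) (g x v) :=
  .cons _ (.nameAt (.nthTargetPos skipper_rankedPair.num hf hg))

theorem out_copyOut (b : Bool) (hf : Num f) : Out fun x v => copyOut x b (f x v) :=
  .printTreeTrans (.cons _ (.nameAt hf))
    (.segment hf.pastName (.targetsPos skipper_rankedPair.num hf))
    (.flatMap (out_flaggedOut false hf.tail (.var 0)).nameCode (num_pairRankAt hf))

theorem out_markOut (hf : Num f) (hg : Num g) : Out fun x v => markOut x (f x v) (g x v) :=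
  .printTreeTrans (.cons _ (.nameAt hf))
    (.segment hf.pastName (.targetsPos skipper_rankedPair.num hf))
    (.flatMap (.ite (.eq (.var 0) hg.tail) (out_flaggedOut true hf.tail (.var 0)).nameCode
      (out_flaggedOut false hf.tail (.var 0)).nameCode) (num_pairRankAt hf))

theorem out_firstOut (hf : Num f) : Out fun x v => firstOut x (f x v) :=
  .segment hf.pastName hf.pastName.pastRanked

theorem out_allOut (hf : Num f) : Out fun x v => allOut x (f x v) :=
  .flatMap (.const _) hf.pastName.rankAt

theorem out_treeCliqueTransOut (hf : Num f) : Out fun x v => treeCliqueTransOut x (f x v) :=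
  .append (out_copyOut false hf) (.append
    (.flatMap (out_markOut hf.tail (.var 0)) (num_pairRankAt hf))
    (.ite (.letter _ hf.pastName)
      (.printTreeTrans (.const _) (.cons _ (out_firstOut hf)) (out_allOut hf))
      (out_copyOut true hf)))

theorem out_treeFirstLetterOut (hf : Num f) : Out fun x v => treeFirstLetterOut x (f x v) :=
  .ite (.letter _ hf.pastName) (.printTreeTrans (.const _) (out_firstOut hf) (out_allOut hf))
    (.const _)

end

theorem logspaceComputable_treeCliqueReduction : LogspaceComputable treeCliqueReduction := by
  have h0 : Num fun x (_ : Fin 0 → ℕ) => treeTransPos x 0 + 1 :=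
    (Num.treeTransPos (.const 0)).add (.const 1)
  refine .of_out (.append (.append (.const _) (Out.encList (.append (.const _) (.append ?_ ?_))))
    (.append (.append (.const _) (Out.encList (.append (.const _) ?_))) (.const _)))
  · exact .elems parser_name.num (.printTreeTrans (.const _) (.const _)
      (Out.nameCode (.cons _ (.nameAt (.var 0))))) (.const 1)
  · exact .elems (Num.pastTreeTrans skipper_rankedPair.num (.var 0))
      (out_treeCliqueTransOut (.var 0)) h0
  · exact .elems (Num.pastTreeTrans skipper_rankedPair.num (.var 0))
      (out_treeFirstLetterOut (.var 0)) h0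

section

variable {x : List Symbol} {p : ℕ} {t : TreeTransition pairRank}
  (ht : At x p (t.enc encRankedLetterPair))

include ht

theorem pairRankAt_eq : pairRankAt x p = pairRank t.letter := by
  have h := optAt_rankedPair (skipper_rankedPair.at_treeTrans_iff.1 ht).2.1
  rw [pairRankAt, rankAt_eq h.1, rankAt_eq h.2, pairRank]

theorem flaggedOut_eq {b : Bool} {i : ℕ} (hi : i < pairRank t.letter) :
    flaggedOut x b p i = CliqueState.code (.copy b ((t.target i).getD [])) := by
  have h := skipper_rankedPair.optAt_target ht i
  have h1 : t.target i = some (t.targets ⟨i, hi⟩) := dif_pos hi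
  rw [h1] at h ⊢
  rw [flaggedOut, nameAt_eq h]
  rfl

theorem copyOut_eq (b : Bool) : copyOut x b p = encAbstractTrans (rk := pairRank) CliqueState.code
    encRankedLetterPair (.copy b t.source, t.letter,
      TreePairAutomaton.flagged t fun _ => false) := by
  rw [copyOut, encAbstractTrans, nameAt_eq (skipper_rankedPair.at_treeTrans_iff.1 ht).1,
    skipper_rankedPair.segment_letter ht, pairRankAt_eq ht]
  refine congrArg _ (List.flatMap_congr fun i hi => ?_)
  rw [flaggedOut_eq ht (List.mem_range.1 hi)]
  rfl

theorem markOut_eq (j : ℕ) : markOut x p j = encAbstractTrans (rk := pairRank) CliqueState.code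
    encRankedLetterPair (.copy true t.source, t.letter,
      TreePairAutomaton.flagged t fun i => decide (i = j)) := by
  rw [markOut, encAbstractTrans, nameAt_eq (skipper_rankedPair.at_treeTrans_iff.1 ht).1,
    skipper_rankedPair.segment_letter ht, pairRankAt_eq ht]
  refine congrArg _ (List.flatMap_congr fun i hi => ?_)
  rw [flaggedOut_eq ht (List.mem_range.1 hi), flaggedOut_eq ht (List.mem_range.1 hi)]
  simp only [TreePairAutomaton.flagged]
  split
  · rename_i h; rw [h]
  · rename_i h; rw [Bool.eq_false_of_not_eq_true h]

theorem isLpar_letter : isLpar x[pastName x p]? = t.letter.1.isSome :=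
  parser_ranked.isLpar_eq
    (optAt_rankedPair (skipper_rankedPair.at_treeTrans_iff.1 ht).2.1).1

theorem firstOut_eq {a : RankedLetter} (ha : t.letter.1 = some a) :
    firstOut x p = encRankedLetter a := by
  have h := (optAt_rankedPair (skipper_rankedPair.at_treeTrans_iff.1 ht).2.1).1
  rw [ha] at h
  exact parser_ranked.segment_eq h

theorem allOut_eq {a : RankedLetter} (ha : t.letter.1 = some a) :
    allOut x p = (List.range a.rank).flatMap fun _ => nameCode [.bot] := by
  have h := (optAt_rankedPair (skipper_rankedPair.at_treeTrans_iff.1 ht).2.1).1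
  rw [allOut, rankAt_eq h, ha]
  rfl

theorem treeCliqueTransOut_eq : treeCliqueTransOut x p =
    (TreePairAutomaton.cliqueTrans t).flatMap (encAbstractTrans (rk := pairRank) CliqueState.code
      encRankedLetterPair) := by
  rw [treeCliqueTransOut, copyOut_eq ht, copyOut_eq ht, pairRankAt_eq ht, isLpar_letter ht,
    TreePairAutomaton.cliqueTrans, List.flatMap_cons, List.flatMap_append, List.flatMap_map,
    List.flatMap_singleton]
  refine congrArg _ (congr (congrArg _ (List.flatMap_congr fun j _ => markOut_eq ht j)) ?_)
  rcases hl : t.letter.1 with _ | a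
  · rfl
  · rw [firstOut_eq ht hl, allOut_eq ht hl]
    simp [encAbstractTrans, encRankedLetterPair, encPair, encOption, pairRank, CliqueState.code]

theorem treeFirstLetterOut_eq : treeFirstLetterOut x p = t.letter.1.toList.flatMap fun a =>
    encAbstractTrans (rk := RankedLetter.rank) CliqueState.code encRankedLetter
      (.all, a, fun _ => .all) := by
  rw [treeFirstLetterOut, isLpar_letter ht]
  rcases hl : t.letter.1 with _ | a
  · rfl
  · rw [firstOut_eq ht hl, allOut_eq ht hl]
    simp [encAbstractTrans, CliqueState.code]

end

theorem treeCliqueReduction_code (A : TreePairAutomaton) :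
    treeCliqueReduction A.code = A.toRecInput.code := by
  have h0 : At A.code 0 (A.enc encRankedLetterPair ++ []) := by
    rw [List.append_nil]; exact List.prefix_refl _
  obtain ⟨hr, ht, -⟩ := skipper_rankedPair.at_treeAutomaton_iff.1 h0
  generalize A.code = x at *
  have hr' := parser_name.forall₂_elems hr
  have ht' := skipper_rankedPair.treeTrans.forall₂_elems ht
  have e1 : (elems pastName x 1).flatMap (fun q => printTreeTrans []
        (encRankedLetterPair (some TreePairAutomaton.topLetter, some TreePairAutomaton.topLetter))
          (nameCode (.one :: nameAt x q))) =
      A.root.flatMap fun q => encAbstractTrans (rk := pairRank) CliqueState.code encRankedLetterPair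
        (.init, (some TreePairAutomaton.topLetter, some TreePairAutomaton.topLetter),
          fun _ => .copy true q) :=
    flatMap_eq_of_forall₂ hr' fun p q _ h => by
      rw [nameAt_eq h]
      simp [encAbstractTrans, CliqueState.code, pairRank, TreePairAutomaton.topLetter, encBit]
  have e2 : (elems (pastTreeTrans pastRankedPair) x (treeTransPos x 0 + 1)).flatMap
      (treeCliqueTransOut x) = A.trans.flatMap fun t => (TreePairAutomaton.cliqueTrans t).flatMap
        (encAbstractTrans (rk := pairRank) CliqueState.code encRankedLetterPair) :=
    flatMap_eq_of_forall₂ ht' fun p t _ h => treeCliqueTransOut_eq h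
  have e3 : (elems (pastTreeTrans pastRankedPair) x (treeTransPos x 0 + 1)).flatMap
      (treeFirstLetterOut x) = A.firstLetters.flatMap fun a =>
        encAbstractTrans (rk := RankedLetter.rank) CliqueState.code encRankedLetter
          (.all, a, fun _ => .all) := by
    rw [TreePairAutomaton.firstLetters, List.filterMap_eq_flatMap_toList, List.flatMap_assoc]
    exact flatMap_eq_of_forall₂ ht' fun p t _ h => treeFirstLetterOut_eq h
  rw [treeCliqueReduction, e1, e2, e3]
  simp only [TreeRecInput.code, TreePairAutomaton.code, TreePairAutomaton.toRecInput,
    AbstractTreeAutomaton.enc_toTreeAutomaton, TreePairAutomaton.cliqueAutomaton,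
    TreePairAutomaton.allTrees, List.flatMap_cons, List.flatMap_map, List.flatMap_assoc,
    List.flatMap_append, List.flatMap_nil, List.append_nil]
  simp [encAbstractTrans, CliqueState.code, pairRank, TreePairAutomaton.topLetter]

theorem treeClique_reduces_treeRec : LogspaceReduces (treeClique .nta) (treeRec .nta) :=
  ⟨treeCliqueReduction, logspaceComputable_treeCliqueReduction, fun A hA =>
    ⟨A.toRecInput, treeCliqueReduction_code A,
      ⟨AbstractTreeAutomaton.isNTA rfl, AbstractTreeAutomaton.isNTA rfl,
        TreePairAutomaton.toRecInput_recognizes hA.2⟩,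
      TreePairAutomaton.hasInfiniteClique_iff hA.2⟩⟩

/-! ### Trees: from recurrent reachability to infinite cliques. -/

instance : DecidableEq RankedLetter := fun a b =>
  decidable_of_iff (a.name = b.name ∧ a.rank = b.rank) (by cases a; cases b; simp)

/-! ### Optional trees -/

section

variable {α : Type} {rk : α → ℕ}

/-- A missing subtree is treated as a tree without label all of whose children are missing. Then
convolutions, overlays and runs satisfy one equation at each child number, without distinguishing
which trees exist there. -/
def rootLabel : Option (RankedTree rk) → Option α
  | none => none
  | some (.node a _) => some a

/-- The subtree at the child with number `i`, if there is one. -/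
def childAt : Option (RankedTree rk) → ℕ → Option (RankedTree rk)
  | none, _ => none
  | some (.node a c), i => if h : i < rk a then some (c ⟨i, h⟩) else none

theorem rootLabel_eq_none {X : Option (RankedTree rk)} : rootLabel X = none ↔ X = none := by
  rcases X with _ | ⟨a, c⟩ <;> simp [rootLabel]

theorem childAt_some {a : α} {c : Fin (rk a) → RankedTree rk} (i : Fin (rk a)) :
    childAt (some (.node a c)) i = some (c i) := by
  simp [childAt]

theorem childAt_eq_none {X : Option (RankedTree rk)} {i : ℕ} (h : (rootLabel X).elim 0 rk ≤ i) :
    childAt X i = none := by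
  rcases X with _ | ⟨a, c⟩
  · rfl
  · exact dif_neg (not_lt.2 h)

theorem eq_of_rootLabel_childAt {X Y : Option (RankedTree rk)} (h : rootLabel X = rootLabel Y)
    (h' : ∀ i, childAt X i = childAt Y i) : X = Y := by
  rcases X with _ | ⟨a, c⟩
  · exact (rootLabel_eq_none.1 h.symm).symm
  · rcases Y with _ | ⟨b, d⟩
    · cases h
    · obtain rfl : a = b := Option.some.inj h
      refine congrArg _ (congrArg _ (funext fun i => ?_))
      have := h' i
      rw [childAt_some, childAt_some] at this
      exact Option.some.inj this

theorem optTree_induction {P : Option (RankedTree rk) → Prop} (h0 : P none)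
    (h : ∀ X, X ≠ none → (∀ i, P (childAt X i)) → P X) (X : Option (RankedTree rk)) : P X := by
  cases X with
  | none => exact h0
  | some t =>
    induction t with
    | node a c ih =>
      refine h _ (by simp) fun i => ?_
      rw [childAt]
      split
      · exact ih _
      · exact h0

end

theorem pairRank_eq (a b : Option RankedLetter) :
    pairRank (a, b) = max (a.elim 0 RankedLetter.rank) (b.elim 0 RankedLetter.rank) := rfl

/-- The convolution of two trees that may be missing. -/
def optConv : Option Tree → Option Tree → Option PairTree
  | none, none => none
  | some s, none => some (Tree.convLeft s)
  | none, some t => some (Tree.convRight t)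
  | some s, some t => some (Tree.conv s t)

/-- A pair of optional objects that are not both missing. -/
def optPair {α β : Type} : Option α → Option β → Option (Option α × Option β)
  | none, none => none
  | a, b => some (a, b)

theorem optPair_getD {α β : Type} (a : Option α) (b : Option β) :
    (optPair a b).getD (none, none) = (a, b) := by
  cases a <;> cases b <;> rfl

theorem optPair_ne {α β : Type} (a : Option α) (b : Option β) :
    optPair a b ≠ some (none, none) := by
  cases a <;> cases b <;> simp [optPair]

theorem optPair_eq_some {α β : Type} {a : Option α} {b : Option β} (h : a ≠ none ∨ b ≠ none) :
    optPair a b = some (a, b) := by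
  cases a <;> cases b <;> simp [optPair] at h ⊢

theorem eq_optPair {α β : Type} {o : Option (Option α × Option β)} {a : Option α} {b : Option β}
    (h : o ≠ some (none, none)) (h' : o.getD (none, none) = (a, b)) : o = optPair a b := by
  rcases o with _ | ⟨_ | c, _ | d⟩ <;> simp at h h' <;> obtain ⟨rfl, rfl⟩ := h' <;> rfl

theorem rootLabel_optConv (s t : Option Tree) :
    rootLabel (optConv s t) = optPair (rootLabel s) (rootLabel t) := by
  rcases s with _ | ⟨a, c⟩ <;> rcases t with _ | ⟨b, d⟩ <;>
    simp [optConv, rootLabel, optPair, Tree.convLeft, Tree.convRight, Tree.conv]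

/-- Replaces the three mutually dependent recursions for convolutions by a single equation. -/
theorem childAt_optConv (s t : Option Tree) (i : ℕ) :
    childAt (optConv s t) i = optConv (childAt s i) (childAt t i) := by
  rcases s with _ | ⟨a, c⟩ <;> rcases t with _ | ⟨b, d⟩
  · rfl
  · simp only [optConv, Tree.convRight, childAt, pairRank_eq, Option.elim_none, Option.elim_some,
      Nat.zero_max]
    split <;> rfl
  · simp only [optConv, Tree.convLeft, childAt, pairRank_eq, Option.elim_none, Option.elim_some,
      Nat.max_zero]
    split <;> rfl
  · simp only [optConv, Tree.conv, childAt, pairRank_eq, Option.elim_some, lt_max_iff]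
    by_cases h1 : i < a.rank <;> by_cases h2 : i < b.rank <;> simp [h1, h2]

/-! ### Runs on optional trees -/

section

variable {α β : Type} {rk : α → ℕ} [DecidableEq β] {f : α → β} {blank : β} {A : TreeAutomaton rk}

/-- Transitions of a tree automaton with an additional state at the missing subtrees. -/
abbrev PaddedTreeTrans (β : Type) : Type := Option Name × β × (ℕ → Option Name)

/-- The transitions of the automaton, with an additional one for missing subtrees. -/
def TreeAutomaton.padded (f : α → β) (blank : β) (A : TreeAutomaton rk) :
    List (PaddedTreeTrans β) :=
  (A.trans.flatMap fun t => if f t.letter = blank then [] else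
    [(some t.source, f t.letter, t.target)]) ++ [(none, blank, fun _ => none)]

/-- There is a run with the state `σ` at the root, where `none` is only allowed if the tree is
missing. -/
def TreeAutomaton.OptRun (A : TreeAutomaton rk) : Option Name → Option (RankedTree rk) → Prop
  | none, X => X = none
  | some q, some t => A.HasRun t q
  | some _, none => False

namespace TreeAutomaton

theorem mem_padded {σ : Option Name} {l : β} {ts : ℕ → Option Name} :
    (σ, l, ts) ∈ A.padded f blank ↔
      (∃ t ∈ A.trans, f t.letter ≠ blank ∧ σ = some t.source ∧ l = f t.letter ∧ ts = t.target) ∨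
        (σ = none ∧ l = blank ∧ ts = fun _ => none) := by
  simp only [padded, List.mem_append, List.mem_flatMap, List.mem_singleton, Prod.mk.injEq]
  refine or_congr_left (exists_congr fun t => and_congr_right fun _ => ?_)
  split
  · rename_i h
    simp [h]
  · rename_i h
    simp [h]

theorem target_eq_none {t : TreeTransition rk} {i : ℕ} (h : rk t.letter ≤ i) : t.target i = none :=
  dif_neg (not_lt.2 h)

theorem padded_target {rk' : β → ℕ} (hrk : ∀ a, rk' (f a) = rk a) {σ : Option Name} {l : β}
    {ts : ℕ → Option Name} (h : (σ, l, ts) ∈ A.padded f blank) {i : ℕ} (hi : rk' l ≤ i) :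
    ts i = none := by
  rcases mem_padded.1 h with ⟨t, -, -, -, rfl, rfl⟩ | ⟨-, -, rfl⟩
  · exact target_eq_none (by rwa [hrk] at hi)
  · rfl

/-- Unfolds a run at the root into a transition of the padded automaton and runs at all child
numbers; `exists_optRun` conversely builds a tree together with a run. -/
theorem OptRun.exists_trans {σ : Option Name} {X : Option (RankedTree rk)} (h : A.OptRun σ X)
    (hX : ∀ a, rootLabel X = some a → f a ≠ blank) :
    ∃ ts, (σ, (rootLabel X).elim blank f, ts) ∈ A.padded f blank ∧
      ∀ i, A.OptRun (ts i) (childAt X i) := by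
  rcases σ with _ | q <;> rcases X with _ | ⟨a, c⟩
  · exact ⟨_, mem_padded.2 (.inr ⟨rfl, rfl, rfl⟩), fun _ => rfl⟩
  · cases h
  · exact h.elim
  · obtain ⟨t, ht, rfl, rfl, h'⟩ := hasRun_node.1 h
    refine ⟨_, mem_padded.2 (.inl ⟨t, ht, hX _ rfl, rfl, rfl, rfl⟩), fun i => ?_⟩
    by_cases hi : i < rk t.letter
    · obtain ⟨s, h1, h2⟩ := h' ⟨i, hi⟩
      rw [h1]
      rw [childAt, dif_pos hi]
      exact h2
    · rw [target_eq_none (not_lt.1 hi), childAt_eq_none (by simpa [rootLabel] using hi)]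
      rfl

theorem exists_optRun {σ : Option Name} {l : β} {ts : ℕ → Option Name}
    (h : (σ, l, ts) ∈ A.padded f blank) {Y : ℕ → Option (RankedTree rk)}
    (hY : ∀ i, A.OptRun (ts i) (Y i)) : ∃ X, A.OptRun σ X ∧ (rootLabel X).elim blank f = l ∧
      (∀ a, rootLabel X = some a → f a ≠ blank) ∧ ∀ i, childAt X i = Y i := by
  rcases mem_padded.1 h with ⟨t, ht, hb, rfl, rfl, rfl⟩ | ⟨rfl, rfl, rfl⟩
  · have : ∀ i : Fin (rk t.letter), ∃ c, Y i = some c ∧ A.HasRun c (t.targets i) := by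
      intro i
      have h1 := hY i
      rw [TreeTransition.target, dif_pos i.isLt] at h1
      rcases hYi : Y i with _ | c <;> rw [hYi] at h1
      · exact h1.elim
      · exact ⟨c, rfl, h1⟩
    choose c hc hc' using this
    refine ⟨some (.node t.letter c), ⟨t.targets, ht, hc'⟩, rfl, ?_, fun i => ?_⟩
    · intro a ha
      cases ha
      exact hb
    · by_cases hi : i < rk t.letter
      · rw [childAt, dif_pos hi]
        exact (hc ⟨i, hi⟩).symm
      · have h1 := hY i
        rw [target_eq_none (not_lt.1 hi)] at h1
        rw [childAt_eq_none (by simpa [rootLabel] using hi)]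
        exact h1.symm
  · exact ⟨none, rfl, rfl, by simp [rootLabel], fun i => (hY i).symm⟩

theorem IsTopDownDet.padded (hA : A.IsTopDownDet) (hf : Function.Injective f) {σ : Option Name}
    {l : β} {ts ts' : ℕ → Option Name} (h : (σ, l, ts) ∈ A.padded f blank)
    (h' : (σ, l, ts') ∈ A.padded f blank) : ts = ts' := by
  rcases mem_padded.1 h with ⟨⟨q, a, qs⟩, ht, hb, rfl, rfl, rfl⟩ | ⟨rfl, rfl, rfl⟩ <;>
    rcases mem_padded.1 h' with ⟨⟨q', a', qs'⟩, ht', hb', h1, h2, rfl⟩ | ⟨h1, h2, rfl⟩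
  · cases h1
    obtain rfl := hf h2
    rw [hA.2 _ _ _ _ ht ht']
  · cases h1
  · cases h1
  · rfl

theorem IsBottomUpDet.padded (hA : A.IsBottomUpDet) (hf : Function.Injective f) {rk' : β → ℕ}
    (hrk : ∀ a, rk' (f a) = rk a) {σ σ' : Option Name} {l : β} {ts ts' : ℕ → Option Name}
    (h : (σ, l, ts) ∈ A.padded f blank) (h' : (σ', l, ts') ∈ A.padded f blank)
    (hts : ∀ i < rk' l, ts i = ts' i) : σ = σ' := by
  rcases mem_padded.1 h with ⟨⟨q, a, qs⟩, ht, hb, rfl, rfl, rfl⟩ | ⟨rfl, rfl, rfl⟩ <;>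
    rcases mem_padded.1 h' with ⟨⟨q', a', qs'⟩, ht', hb', rfl, h2, rfl⟩ | ⟨rfl, h2, rfl⟩
  · obtain rfl := hf h2
    have : qs = qs' := funext fun i => by
      have := hts i (by rw [hrk]; exact i.isLt)
      simpa [TreeTransition.target] using this
    subst this
    rw [hA _ _ _ _ ht ht']
  · exact absurd h2 hb
  · exact absurd h2.symm hb'
  · rfl

end TreeAutomaton

end

/-! ### Overlaying trees -/

/-- The rank of the label of the root. -/
def rootRank (x : Option Tree) : ℕ := (rootLabel x).elim 0 RankedLetter.rank

def optHeight (x : Option Tree) : ℕ := x.elim 0 fun t => Tree.height t + 1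

theorem optHeight_childAt_le (x : Option Tree) (i : ℕ) : optHeight (childAt x i) ≤ optHeight x ∧
    (i < rootRank x → optHeight (childAt x i) < optHeight x) := by
  rcases x with _ | ⟨a, c⟩
  · exact ⟨le_rfl, fun h => absurd h (Nat.not_lt_zero i)⟩
  · have h1 : ∀ j, Tree.height (c j) + 1 ≤ Tree.height (.node a c) := fun j => by
      rw [Tree.height]
      exact Finset.le_sup (f := fun i => Tree.height (c i) + 1) (Finset.mem_univ j)
    rw [childAt]
    split
    · rename_i h
      have := h1 ⟨i, h⟩
      simp only [optHeight, Option.elim_some]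
      omega
    · rename_i h
      exact ⟨Nat.zero_le _, fun h' => absurd h' h⟩

/-- The name of a letter that stands for a subtree of the given tree and a letter. -/
def overlayName (p : Option Tree) (a : Option RankedLetter) : Name :=
  nameOf (encOption Tree.enc p ++ encOption encRankedLetter a)

/-- The trees `p` and `x` on top of each other, where subtrees of `p` are put into the labels. -/
def overlayTree (p x : Option Tree) : Tree :=
  .node ⟨overlayName p (rootLabel x), max (rootRank p) (rootRank x)⟩
    fun i => overlayTree (childAt p i) (childAt x i)
termination_by optHeight p + optHeight x
decreasing_by
  -- Child `i` exists in at least one of the two trees; there the height drops, and in the other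
  -- tree it does not grow.
  have h1 := optHeight_childAt_le p i
  have h2 := optHeight_childAt_le x i
  rcases lt_max_iff.1 i.isLt with h | h
  · have := h1.2 h
    omega
  · have := h2.2 h
    omega

def overlayLetter (p : Option Tree) (a : Option RankedLetter) : Option RankedLetter :=
  if p.isSome ∨ a.isSome then
    some ⟨overlayName p a, max (rootRank p) (a.elim 0 RankedLetter.rank)⟩
  else none

def optOverlay (p x : Option Tree) : Option Tree :=
  if p.isSome ∨ x.isSome then some (overlayTree p x) else none

theorem isSome_rootLabel (x : Option Tree) : (rootLabel x).isSome = x.isSome := by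
  rcases x with _ | ⟨a, c⟩ <;> rfl

theorem rootLabel_optOverlay (p x : Option Tree) :
    rootLabel (optOverlay p x) = overlayLetter p (rootLabel x) := by
  rw [optOverlay, overlayLetter, isSome_rootLabel]
  split
  · rw [overlayTree, rootLabel]
    rfl
  · rfl

theorem childAt_optOverlay (p x : Option Tree) (i : ℕ) :
    childAt (optOverlay p x) i = optOverlay (childAt p i) (childAt x i) := by
  have key : ∀ y : Option Tree, i < rootRank y → (childAt y i).isSome = true := by
    intro y hy
    rcases y with _ | ⟨a, c⟩
    · exact absurd hy (Nat.not_lt_zero i)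
    · rw [childAt, dif_pos (by exact hy)]
      rfl
  rw [optOverlay]
  split
  · rw [overlayTree, childAt]
    split
    · rename_i h
      rw [optOverlay, if_pos ((lt_max_iff.1 h).imp (key _) (key _))]
    · rename_i h
      have h : ¬ i < max (rootRank p) (rootRank x) := h
      rw [lt_max_iff, not_or, not_lt, not_lt] at h
      rw [childAt_eq_none h.1, childAt_eq_none h.2]
      rfl
  · rename_i h
    rw [not_or, Option.not_isSome_iff_eq_none, Option.not_isSome_iff_eq_none] at h
    rw [h.1, h.2]
    rfl

theorem isCode_encOption_tree : IsCode (encOption Tree.enc) :=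
  Tree.isCode_enc.option fun t => by
    cases t
    simp [Tree.enc, encRankedLetter, encName]

theorem isCode_encOption_ranked : IsCode (encOption encRankedLetter) :=
  isCode_encRankedLetter.option fun a => by simp [encRankedLetter, encName]

theorem overlayName_inj {p p' : Option Tree} {a a' : Option RankedLetter}
    (h : overlayName p a = overlayName p' a') : p = p' ∧ a = a' := by
  obtain ⟨h1, h2⟩ := isCode_encOption_tree.inj _ _ _ _ (nameOf_injective h)
  exact ⟨h1, isCode_encOption_ranked.injective h2⟩

theorem overlayLetter_inj {p p' : Option Tree} {a a' : Option RankedLetter}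
    (h : overlayLetter p a = overlayLetter p' a') : p = p' ∧ a = a' := by
  rw [overlayLetter, overlayLetter] at h
  split_ifs at h with h1 h2 h2
  · exact overlayName_inj (RankedLetter.mk.inj (Option.some.inj h)).1
  · simp only [not_or, Option.not_isSome_iff_eq_none] at h1 h2
    exact ⟨h1.1.trans h2.1.symm, h1.2.trans h2.2.symm⟩

theorem overlayName_ne_nil (p : Option Tree) (a : Option RankedLetter) : overlayName p a ≠ [] := by
  intro h
  have h1 : encOption Tree.enc p ++ encOption encRankedLetter a = [] :=
    nameOf_injective (h.trans rfl)
  have h2 := isCode_encOption_tree.head p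
  rw [(List.append_eq_nil_iff.1 h1).1] at h2
  simp at h2

/-- Letters with the empty name are reserved for the root and the chains; so a letter shows which
kind of transition reads it, as bottom-up determinism requires. -/
theorem overlayLetter_ne (p : Option Tree) (a : Option RankedLetter) (n : ℕ) :
    overlayLetter p a ≠ some ⟨[], n⟩ := by
  rw [overlayLetter]
  split
  · exact fun h => overlayName_ne_nil p a (RankedLetter.mk.inj (Option.some.inj h)).1
  · simp

theorem overlayLetter_eq_none {p : Option Tree} {a : Option RankedLetter} :
    overlayLetter p a = none ↔ p = none ∧ a = none := by
  cases p <;> cases a <;> simp [overlayLetter]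

theorem overlayLetter_rank (p : Option Tree) (a : Option RankedLetter) :
    (overlayLetter p a).elim 0 RankedLetter.rank =
      max (rootRank p) (a.elim 0 RankedLetter.rank) := by
  rw [overlayLetter]
  split
  · rfl
  · rename_i h
    rw [not_or, Option.not_isSome_iff_eq_none, Option.not_isSome_iff_eq_none] at h
    rw [h.1, h.2]
    rfl

theorem optOverlay_inj {p x x' : Option Tree} (h : optOverlay p x = optOverlay p x') : x = x' := by
  have h1 : ∀ {p x x' : Option Tree}, optOverlay p x = optOverlay p x' →
      rootLabel x = rootLabel x' := by
    intro p x x' h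
    have := congrArg rootLabel h
    rw [rootLabel_optOverlay, rootLabel_optOverlay] at this
    exact (overlayLetter_inj this).2
  induction x using optTree_induction generalizing p x' with
  | h0 => exact (rootLabel_eq_none.1 (h1 h).symm).symm
  | h x hx ih =>
    refine eq_of_rootLabel_childAt (h1 h) fun i => ih i (p := childAt p i) ?_
    rw [← childAt_optOverlay, ← childAt_optOverlay, h]

/-! ### Reduction of recurrent reachability over trees -/

/-- The subtrees in prefix order. -/
def Tree.subtrees : Tree → List Tree
  | .node a c => .node a c :: (List.ofFn fun i => Tree.subtrees (c i)).flatten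

/-- The subtrees, together with the missing one. -/
def Tree.optSubtrees (t : Tree) : List (Option Tree) := (Tree.subtrees t).map some ++ [none]

theorem Tree.self_mem_subtrees (t : Tree) : t ∈ Tree.subtrees t := by
  cases t
  rw [Tree.subtrees]
  exact List.mem_cons_self

theorem Tree.subtrees_trans {t s : Tree} (h : s ∈ Tree.subtrees t) {i : ℕ} {r : Tree}
    (hr : childAt (some s) i = some r) : r ∈ Tree.subtrees t := by
  induction t with
  | node a c ih =>
    rw [Tree.subtrees, List.mem_cons, List.mem_flatten] at h ⊢
    right
    rcases h with rfl | ⟨l, hl, hs⟩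
    · rw [childAt] at hr
      split at hr
      · cases hr
        exact ⟨_, List.mem_ofFn.2 ⟨_, rfl⟩, Tree.self_mem_subtrees _⟩
      · cases hr
    · obtain ⟨j, rfl⟩ := List.mem_ofFn.1 hl
      exact ⟨_, List.mem_ofFn.2 ⟨j, rfl⟩, ih j hs⟩

theorem Tree.childAt_mem_optSubtrees {t : Tree} {p : Option Tree} (h : p ∈ Tree.optSubtrees t)
    (i : ℕ) : childAt p i ∈ Tree.optSubtrees t := by
  simp only [Tree.optSubtrees, List.mem_append, List.mem_map, List.mem_singleton] at h ⊢
  rcases h with ⟨s, hs, rfl⟩ | rfl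
  · rcases hr : childAt (some s) i with _ | r
    · exact .inr rfl
    · exact .inl ⟨r, Tree.subtrees_trans hs hr, rfl⟩
  · exact .inr rfl

/-- States of the automaton to which an instance of recurrent reachability is mapped. -/
inductive TreeRecState : Type
  | init
  | lower
  | both
  | prod (r l s : Option Name) (p : Option Tree)

namespace TreeRecState

def code : TreeRecState → List Symbol
  | init => []
  | lower => [.zero]
  | both => [.one]
  | prod r l s p => .bot :: (encOption encName r ++ (encOption encName l ++
      (encOption encName s ++ encOption Tree.enc p)))

theorem code_injective : Function.Injective code := by
  intro s t h
  cases s <;> cases t <;> simp only [code, List.cons.injEq, reduceCtorEq, false_and,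
    List.nil_eq, List.cons_ne_nil] at h <;> try rfl
  obtain ⟨h1, h⟩ := isCode_encOption_encName.inj _ _ _ _ h.2
  obtain ⟨h2, h⟩ := isCode_encOption_encName.inj _ _ _ _ h
  obtain ⟨h3, h⟩ := isCode_encOption_encName.inj _ _ _ _ h
  rw [h1, h2, h3, isCode_encOption_tree.injective h]

end TreeRecState

/-- A tree of height `n` without branching. -/
def chain : ℕ → Tree
  | 0 => .node ⟨[], 0⟩ Fin.elim0
  | n + 1 => .node ⟨[], 1⟩ fun _ => chain n

/-- The tree `x` together with the given tree `w` and a number. -/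
def padTree (w x : Tree) (n : ℕ) : Tree :=
  .node ⟨[], 2⟩ fun i => if (i : ℕ) = 0 then overlayTree (some w) (some x) else chain n

theorem chain_injective : Function.Injective chain := by
  intro n m h
  induction n generalizing m with
  | zero =>
    cases m with
    | zero => rfl
    | succ m => rw [chain, chain, RankedTree.node.injEq] at h; simp at h
  | succ n ih =>
    cases m with
    | zero => rw [chain, chain, RankedTree.node.injEq] at h; simp at h
    | succ m =>
      rw [chain, chain, RankedTree.node.injEq] at h
      rw [ih (congrFun (eq_of_heq h.2) (0 : Fin 1))]

theorem padTree_inj {w x y : Tree} {n m : ℕ} (h : padTree w x n = padTree w y m) :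
    x = y ∧ n = m := by
  rw [padTree, padTree, RankedTree.node.injEq] at h
  have h0 := congrFun (eq_of_heq h.2) (0 : Fin 2)
  have h1 := congrFun (eq_of_heq h.2) (1 : Fin 2)
  refine ⟨?_, chain_injective (by simpa using h1)⟩
  have h2 : optOverlay (some w) (some x) = optOverlay (some w) (some y) :=
    congrArg some (by simpa using h0)
  exact Option.some.inj (optOverlay_inj h2)

theorem conv_padTree (w x y : Tree) (n m : ℕ) : Tree.conv (padTree w x n) (padTree w y m) =
    .node (some ⟨[], 2⟩, some ⟨[], 2⟩) fun i => if (i : ℕ) = 0 then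
      Tree.conv (overlayTree (some w) (some x)) (overlayTree (some w) (some y))
      else Tree.conv (chain n) (chain m) := by
  rw [padTree, padTree, Tree.conv]
  congr 1
  funext i
  have : (i : ℕ) < 2 := i.isLt
  rw [dif_pos (by exact this), dif_pos (by exact this)]
  dsimp only
  split <;> rfl

namespace TreeRecInput

variable (I : TreeRecInput)

/-- The three simulations agree on the second letter, and the third one reads the label of `p` as
first letter. The disjunction excludes the case in which all trees are missing, where there is no
node to be read. -/
def recTrans (r : PaddedTreeTrans (Option RankedLetter × Option RankedLetter))
    (l : PaddedTreeTrans (Option RankedLetter))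
    (s : PaddedTreeTrans (Option RankedLetter × Option RankedLetter)) (p : Option Tree) :
    List (TreeRecState × (Option RankedLetter × Option RankedLetter) × (ℕ → TreeRecState)) :=
  if (p.isSome ∨ r.2.1.1.isSome ∨ r.2.1.2.isSome) ∧ l.2.1 = r.2.1.2 ∧ s.2.1.2 = r.2.1.2 ∧
      s.2.1.1 = rootLabel p then
    [(.prod r.1 l.1 s.1 p, (overlayLetter p r.2.1.1, overlayLetter p r.2.1.2),
      fun i => .prod (r.2.2 i) (l.2.2 i) (s.2.2 i) (childAt p i))]
  else []

/-- The targets below the root. -/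
def rootTargets (r l s : Name) (i : ℕ) : TreeRecState :=
  if i = 0 then .prod (some r) (some l) (some s) (some I.t) else .both

open TreeRecState in
/-- The transitions at the nodes that do not belong to an overlaid tree and are not the root. -/
def chainTrans :
    List (TreeRecState × (Option RankedLetter × Option RankedLetter) × (ℕ → TreeRecState)) :=
  -- There is no way to end both chains at once or the second one first, so the first chain is
  -- strictly shorter.
  [(both, (some ⟨[], 1⟩, some ⟨[], 1⟩), fun _ => both),
    (both, (some ⟨[], 0⟩, some ⟨[], 1⟩), fun _ => lower),
    (lower, (none, some ⟨[], 1⟩), fun _ => lower), (lower, (none, some ⟨[], 0⟩), fun _ => lower)]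

/-- The automaton that simulates the given automata on overlaid trees. -/
def recAutomaton : AbstractTreeAutomaton TreeRecState pairRank where
  root := [.init]
  trans := chainTrans ++
    ((I.R.root.flatMap fun r => I.L.root.flatMap fun l => I.R.root.flatMap fun s =>
      [(.init, (some ⟨[], 2⟩, some ⟨[], 2⟩), I.rootTargets r l s)]) ++
    (I.R.padded id (none, none)).flatMap fun r => (I.L.padded some none).flatMap fun l =>
      (I.R.padded id (none, none)).flatMap fun s => (Tree.optSubtrees I.t).flatMap fun p =>
        recTrans r l s p)

def toClique : TreePairAutomaton := I.recAutomaton.toTreeAutomaton TreeRecState.code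

variable {I}

theorem mem_recAutomaton_trans {q : TreeRecState} {l : Option RankedLetter × Option RankedLetter}
    {ts : ℕ → TreeRecState} : (q, l, ts) ∈ I.recAutomaton.trans ↔ (q, l, ts) ∈ chainTrans ∨
      (∃ r ∈ I.R.root, ∃ s ∈ I.L.root, ∃ s' ∈ I.R.root, q = .init ∧
        l = (some ⟨[], 2⟩, some ⟨[], 2⟩) ∧ ts = I.rootTargets r s s') ∨
      ∃ a d r₀ r, (r₀, (a, d), r) ∈ I.R.padded id (none, none) ∧
        ∃ l₀ l', (l₀, d, l') ∈ I.L.padded some none ∧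
        ∃ p ∈ Tree.optSubtrees I.t, ∃ s₀ s,
          (s₀, (rootLabel p, d), s) ∈ I.R.padded id (none, none) ∧
        (p ≠ none ∨ a ≠ none ∨ d ≠ none) ∧ q = .prod r₀ l₀ s₀ p ∧
        l = (overlayLetter p a, overlayLetter p d) ∧
        ts = fun i => .prod (r i) (l' i) (s i) (childAt p i) := by
  simp only [recAutomaton, List.mem_append, List.mem_flatMap, List.mem_singleton, Prod.mk.injEq]
  refine or_congr_right (or_congr_right ?_)
  constructor
  · rintro ⟨⟨r₀, ⟨a, d⟩, r⟩, hr, ⟨l₀, d', l'⟩, hl, ⟨s₀, ⟨c, d''⟩, s⟩, hs, p, hp, h⟩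
    rw [recTrans] at h
    split_ifs at h with h'
    · obtain ⟨h1, rfl, rfl, rfl⟩ := h'
      simp only [List.mem_singleton, Prod.mk.injEq] at h
      simp only [← Option.isSome_iff_ne_none]
      exact ⟨a, _, r₀, r, hr, l₀, l', hl, p, hp, s₀, s, hs, h1, h⟩
    · simp at h
  · rintro ⟨a, d, r₀, r, hr, l₀, l', hl, p, hp, s₀, s, hs, h, rfl, rfl, rfl⟩
    refine ⟨_, hr, _, hl, _, hs, p, hp, ?_⟩
    simp only [← Option.isSome_iff_ne_none] at h
    simp [recTrans, h]

theorem mem_recAutomaton_chain {q : TreeRecState} (hq : q = .both ∨ q = .lower)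
    {l : Option RankedLetter × Option RankedLetter} {ts : ℕ → TreeRecState} :
    (q, l, ts) ∈ I.recAutomaton.trans ↔ (q, l, ts) ∈ chainTrans := by
  rw [mem_recAutomaton_trans]
  refine or_iff_left ?_
  rintro (⟨_, _, _, _, _, _, rfl, _⟩ | ⟨_, _, _, _, _, _, _, _, _, _, _, _, _, _, rfl, _⟩) <;>
    simp at hq

theorem recAutomaton_run_lower {z : PairTree} :
    I.recAutomaton.Run z .lower ↔ ∃ m, z = Tree.convRight (chain m) := by
  constructor
  · intro h
    induction z with
    | node l c ih =>
      rw [AbstractTreeAutomaton.Run] at h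
      obtain ⟨ts, h, h'⟩ := h
      rw [mem_recAutomaton_chain (.inr rfl)] at h
      simp only [chainTrans, List.mem_cons, Prod.mk.injEq, reduceCtorEq, false_and, true_and,
        List.not_mem_nil, or_false, false_or] at h
      rcases h with ⟨rfl, rfl⟩ | ⟨rfl, rfl⟩
      · obtain ⟨m, hm⟩ := ih (0 : Fin 1) (h' (0 : Fin 1))
        refine ⟨m + 1, ?_⟩
        rw [chain, Tree.convRight]
        exact congrArg _ (funext fun i => by rw [← hm, Subsingleton.elim (α := Fin 1) i 0])
      · refine ⟨0, ?_⟩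
        rw [chain, Tree.convRight]
        exact congrArg _ (funext fun i => Fin.elim0 (show Fin 0 from i))
  · rintro ⟨m, rfl⟩
    induction m with
    | zero =>
      rw [chain, Tree.convRight, AbstractTreeAutomaton.Run]
      exact ⟨fun _ => .lower, (mem_recAutomaton_chain (.inr rfl)).2 (by simp [chainTrans]),
        fun i => Fin.elim0 (show Fin 0 from i)⟩
    | succ m ih =>
      rw [chain, Tree.convRight, AbstractTreeAutomaton.Run]
      exact ⟨fun _ => .lower, (mem_recAutomaton_chain (.inr rfl)).2 (by simp [chainTrans]),
        fun i => ih⟩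

theorem conv_chain_succ (n m : ℕ) : Tree.conv (chain (n + 1)) (chain (m + 1)) =
    .node (some ⟨[], 1⟩, some ⟨[], 1⟩) fun _ => Tree.conv (chain n) (chain m) := by
  rw [chain, chain, Tree.conv]
  congr 1
  funext i
  have : (i : ℕ) < 1 := i.isLt
  rw [dif_pos (by exact this), dif_pos (by exact this)]

theorem conv_chain_zero (m : ℕ) : Tree.conv (chain 0) (chain (m + 1)) =
    .node (some ⟨[], 0⟩, some ⟨[], 1⟩) fun _ => Tree.convRight (chain m) := by
  rw [chain, chain, Tree.conv]
  congr 1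

theorem recAutomaton_run_both {z : PairTree} : I.recAutomaton.Run z .both ↔
    ∃ n m, n < m ∧ z = Tree.conv (chain n) (chain m) := by
  constructor
  · intro h
    induction z with
    | node l c ih =>
      rw [AbstractTreeAutomaton.Run] at h
      obtain ⟨ts, h, h'⟩ := h
      rw [mem_recAutomaton_chain (.inl rfl)] at h
      simp only [chainTrans, List.mem_cons, Prod.mk.injEq, reduceCtorEq, false_and, true_and,
        List.not_mem_nil, or_false] at h
      rcases h with ⟨rfl, rfl⟩ | ⟨rfl, rfl⟩
      · obtain ⟨n, m, hnm, hm⟩ := ih (0 : Fin 1) (h' (0 : Fin 1))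
        refine ⟨n + 1, m + 1, by omega, ?_⟩
        rw [conv_chain_succ]
        exact congrArg _ (funext fun i => by rw [← hm, Subsingleton.elim (α := Fin 1) i 0])
      · obtain ⟨m, hm⟩ := recAutomaton_run_lower.1 (h' (0 : Fin 1))
        refine ⟨0, m + 1, by omega, ?_⟩
        rw [conv_chain_zero]
        exact congrArg _ (funext fun i => by rw [← hm, Subsingleton.elim (α := Fin 1) i 0])
  · rintro ⟨n, m, h, rfl⟩
    induction n generalizing m with
    | zero =>
      obtain ⟨m, rfl⟩ : ∃ k, m = k + 1 := ⟨m - 1, by omega⟩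
      rw [conv_chain_zero, AbstractTreeAutomaton.Run]
      exact ⟨fun _ => .lower, (mem_recAutomaton_chain (.inl rfl)).2 (by simp [chainTrans]),
        fun i => recAutomaton_run_lower.2 ⟨m, rfl⟩⟩
    | succ n ih =>
      obtain ⟨m, rfl⟩ : ∃ k, m = k + 1 := ⟨m - 1, by omega⟩
      rw [conv_chain_succ, AbstractTreeAutomaton.Run]
      exact ⟨fun _ => .both, (mem_recAutomaton_chain (.inl rfl)).2 (by simp [chainTrans]),
        fun i => ih m (by omega)⟩

/-- The trees on which the given automata are simulated, and the tree that is read. -/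
inductive Overlaid : Option Tree → Option PairTree → Option Tree → Option PairTree →
    Option PairTree → Prop
  | nil : Overlaid none none none none none
  | node {p : Option Tree} {X : Option PairTree} {Y : Option Tree} {V Z : Option PairTree}
      {a d : Option RankedLetter} (h : p ≠ none ∨ a ≠ none ∨ d ≠ none)
      (hX : rootLabel X = optPair a d) (hY : rootLabel Y = d)
      (hV : rootLabel V = optPair (rootLabel p) d)
      (hZ : rootLabel Z = some (overlayLetter p a, overlayLetter p d))
      (hc : ∀ i, Overlaid (childAt p i) (childAt X i) (childAt Y i) (childAt V i) (childAt Z i)) :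
      Overlaid p X Y V Z

/-- `Overlaid` collects what a run enforces node by node. Once the first simulated tree is known to
be a convolution, it fixes the two trees, and everything else is determined by comparing labels. -/
theorem Overlaid.eq {p : Option Tree} {X : Option PairTree} {Y : Option Tree}
    {V Z : Option PairTree} (h : Overlaid p X Y V Z) {x y : Option Tree} (hX : X = optConv x y) :
    Y = y ∧ V = optConv p y ∧ Z = optConv (optOverlay p x) (optOverlay p y) := by
  induction h generalizing x y with
  | nil =>
    rcases x with _ | x <;> rcases y with _ | y <;> simp [optConv] at hX
    exact ⟨rfl, rfl, rfl⟩
  | @node p X Y V Z a d h hX' hY hV hZ hc ih =>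
    subst hX
    have h1 := congrArg (fun o => o.getD (none, none)) hX'
    simp only [rootLabel_optConv, optPair_getD, Prod.mk.injEq] at h1
    obtain ⟨rfl, rfl⟩ := h1
    have ih' := fun i => ih i (childAt_optConv x y i)
    refine ⟨eq_of_rootLabel_childAt hY fun i => (ih' i).1, eq_of_rootLabel_childAt ?_ fun i => ?_,
      eq_of_rootLabel_childAt ?_ fun i => ?_⟩
    · rw [hV, rootLabel_optConv]
    · rw [(ih' i).2.1, childAt_optConv]
    · rw [hZ, rootLabel_optConv, rootLabel_optOverlay, rootLabel_optOverlay, optPair_eq_some]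
      by_contra h2
      simp only [not_or, not_not, overlayLetter_eq_none] at h2
      simp [h2] at h
    · rw [(ih' i).2.2, childAt_optConv, childAt_optOverlay, childAt_optOverlay]

theorem pairRank_overlayLetter (p : Option Tree) (a d : Option RankedLetter) :
    pairRank (overlayLetter p a, overlayLetter p d) =
      max (max (rootRank p) (a.elim 0 RankedLetter.rank))
        (max (rootRank p) (d.elim 0 RankedLetter.rank)) := by
  rw [pairRank_eq, overlayLetter_rank, overlayLetter_rank]

/-- The three trees on which the given automata run are rebuilt from the leaves upwards. They need
not be convolutions yet, since this depends on acceptance at the root. -/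
theorem overlaid_of_run {z : PairTree} {r l s : Option Name} {p : Option Tree}
    (h : I.recAutomaton.Run z (.prod r l s p)) : ∃ X Y V, I.R.OptRun r X ∧ I.L.OptRun l Y ∧
      I.R.OptRun s V ∧ Overlaid p X Y V (some z) := by
  induction z generalizing r l s p with
  | node z c ih =>
    rw [AbstractTreeAutomaton.Run] at h
    obtain ⟨ts, h, h'⟩ := h
    rcases mem_recAutomaton_trans.1 h with h | ⟨_, _, _, _, _, _, h, _⟩ |
      ⟨a, d, r₀, r', hr, l₀, l', hl, p', -, s₀, s', hs, hne, h1, rfl, rfl⟩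
    · simp [chainTrans] at h
    · cases h
    · cases h1
      have key : ∀ i, ∃ X Y V, I.R.OptRun (r' i) X ∧ I.L.OptRun (l' i) Y ∧ I.R.OptRun (s' i) V ∧
          Overlaid (childAt p i) X Y V (childAt (some (.node (rk := pairRank)
            (overlayLetter p a, overlayLetter p d) c)) i) := by
        intro i
        by_cases hi : i < pairRank (overlayLetter p a, overlayLetter p d)
        · obtain ⟨X, Y, V, h1, h2, h3, h4⟩ := ih ⟨i, hi⟩ (h' ⟨i, hi⟩)
          refine ⟨X, Y, V, h1, h2, h3, ?_⟩
          rwa [childAt, dif_pos hi]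
        -- The rank of the overlaid letter is the maximum of the ranks involved, so beyond it all
        -- subtrees are missing and all simulations are in the state `none`.
        · rw [childAt, dif_neg hi]
          rw [pairRank_overlayLetter] at hi
          have h1 : r' i = none := TreeAutomaton.padded_target (rk' := pairRank) (fun _ => rfl) hr
            (by rw [pairRank_eq]; omega)
          have h2 : l' i = none := TreeAutomaton.padded_target
            (rk' := fun d : Option RankedLetter => d.elim 0 RankedLetter.rank) (fun _ => rfl) hl
            (by omega)
          have h3 : s' i = none := TreeAutomaton.padded_target (rk' := pairRank) (fun _ => rfl) hs
            (by rw [pairRank_eq]; unfold rootRank at hi; omega)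
          have h4 : childAt p i = none := childAt_eq_none (by unfold rootRank at hi; omega)
          rw [h1, h2, h3, h4]
          exact ⟨none, none, none, rfl, rfl, rfl, .nil⟩
      choose X Y V hX hY hV hZ using key
      obtain ⟨X', h1, h2, h3, h4⟩ := TreeAutomaton.exists_optRun hr hX
      obtain ⟨Y', h5, h6, -, h7⟩ := TreeAutomaton.exists_optRun hl hY
      obtain ⟨V', h8, h9, h10, h11⟩ := TreeAutomaton.exists_optRun hs hV
      have e1 : ∀ {o : Option (Option RankedLetter × Option RankedLetter)}
          {a d : Option RankedLetter}, o.elim (none, none) id = (a, d) →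
          (∀ b, o = some b → id b ≠ (none, none)) → o = optPair a d := fun {o} {a} {d} h1 h2 =>
        eq_optPair (fun h => h2 _ h rfl) (by cases o <;> exact h1)
      refine ⟨X', Y', V', h1, h5, h8, .node hne (e1 h2 h3) ?_ (e1 h9 h10) rfl fun i => ?_⟩
      · rw [← h6]
        cases rootLabel Y' <;> rfl
      · rw [h4, h7, h11]
        exact hZ i

/-- Only subtrees of the given tree occur in the transitions, which is why `hp` has to be carried
down to the children. -/
theorem recAutomaton_run_prod {z : PairTree} {r l s : Option Name} {p x y : Option Tree}
    (hp : p ∈ Tree.optSubtrees I.t) (hr : I.R.OptRun r (optConv x y)) (hl : I.L.OptRun l y)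
    (hs : I.R.OptRun s (optConv p y)) (hz : some z = optConv (optOverlay p x) (optOverlay p y)) :
    I.recAutomaton.Run z (.prod r l s p) := by
  induction z generalizing r l s p x y with
  | node z c ih =>
    have e1 : ∀ x y : Option Tree, (rootLabel (optConv x y)).elim (none, none) id =
        (rootLabel x, rootLabel y) := fun x y => by
      rw [rootLabel_optConv, ← optPair_getD (rootLabel x) (rootLabel y)]
      cases optPair (rootLabel x) (rootLabel y) <;> rfl
    have e2 : ∀ x y : Option Tree, ∀ a, rootLabel (optConv x y) = some a → id a ≠ (none, none) :=
      fun x y a h h' => by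
        rw [rootLabel_optConv] at h
        exact optPair_ne _ _ (h.trans (congrArg some h'))
    obtain ⟨rs, h1, h2⟩ := hr.exists_trans (e2 x y)
    obtain ⟨ls, h3, h4⟩ := hl.exists_trans (f := some) (blank := none) (by simp)
    obtain ⟨ss, h5, h6⟩ := hs.exists_trans (e2 p y)
    rw [e1] at h1 h5
    have h7 : (rootLabel y).elim none some = rootLabel y := by cases rootLabel y <;> rfl
    rw [h7] at h3
    have hne : p ≠ none ∨ rootLabel x ≠ none ∨ rootLabel y ≠ none := by
      by_contra h
      simp only [not_or, not_not, rootLabel_eq_none] at h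
      rw [h.1, h.2.1, h.2.2] at hz
      cases hz
    have h8 := congrArg rootLabel hz
    rw [rootLabel_optConv, rootLabel_optOverlay, rootLabel_optOverlay, optPair_eq_some] at h8
    swap
    · by_contra h
      simp only [not_or, not_not, overlayLetter_eq_none] at h
      simp [h] at hne
    obtain rfl : z = _ := Option.some.inj h8
    rw [AbstractTreeAutomaton.Run]
    refine ⟨_, mem_recAutomaton_trans.2 (.inr (.inr ⟨_, _, _, _, h1, _, _, h3, p, hp, _, _, h5, hne,
      rfl, rfl, rfl⟩)), fun i => ?_⟩
    refine ih i (Tree.childAt_mem_optSubtrees hp i) (x := childAt x i) (y := childAt y i) ?_ (h4 i)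
      ?_ ?_
    · rw [← childAt_optConv]
      exact h2 i
    · rw [← childAt_optConv]
      exact h6 i
    · rw [← childAt_optOverlay, ← childAt_optOverlay, ← childAt_optConv, ← hz, childAt_some]

theorem mem_toClique_accepts (hR : I.R.Recognizes I.R.rel) {z : PairTree} :
    z ∈ I.toClique.accepts ↔ ∃ x n y m, z = Tree.conv (padTree I.t x n) (padTree I.t y m) ∧
      I.R.rel x y ∧ y ∈ I.L.accepts ∧ I.R.rel I.t y ∧ n < m := by
  have h0 : z ∈ I.toClique.accepts ↔ I.recAutomaton.Run z .init :=
    (AbstractTreeAutomaton.mem_accepts TreeRecState.code_injective).trans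
      (by simp [recAutomaton])
  rw [h0]
  simp only [conv_padTree]
  obtain ⟨z, c⟩ := z
  rw [AbstractTreeAutomaton.Run]
  constructor
  · rintro ⟨ts, h, h'⟩
    rcases mem_recAutomaton_trans.1 h with h | ⟨r, hr, l, hl, s, hs, -, rfl, rfl⟩ |
      ⟨_, _, _, _, _, _, _, _, _, _, _, _, _, _, h, _⟩
    · simp [chainTrans] at h
    · obtain ⟨X, Y, V, h1, h2, h3, h4⟩ := overlaid_of_run (h' (0 : Fin 2))
      obtain ⟨n, m, hnm, h5⟩ := recAutomaton_run_both.1 (h' (1 : Fin 2))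
      rcases X with _ | X
      · exact h1.elim
      have hX : X ∈ I.R.accepts := ⟨r, hr, h1⟩
      rw [hR] at hX
      obtain ⟨x, y, hxy, rfl⟩ := hX
      -- The first simulation accepts its tree, which is thus a convolution because `R` is
      -- recognized; this pins down the other trees and the tree that is read.
      obtain ⟨rfl, rfl, h6⟩ := h4.eq (x := some x) (y := some y) rfl
      refine ⟨x, n, y, m, congrArg _ (funext fun i => ?_), hxy, ⟨l, hl, h2⟩, ⟨s, hs, h3⟩, hnm⟩
      have hi : i = (0 : Fin 2) ∨ i = (1 : Fin 2) := by
        have : (i : ℕ) < 2 := i.isLt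
        rcases (by omega : (i : ℕ) = 0 ∨ (i : ℕ) = 1) with h | h
        · exact .inl (Fin.ext h)
        · exact .inr (Fin.ext h)
      rcases hi with rfl | rfl
      · exact Option.some.inj h6
      · exact h5
    · cases h
  · rintro ⟨x, n, y, m, h, ⟨r, hr, h1⟩, ⟨l, hl, h2⟩, ⟨s, hs, h3⟩, hnm⟩
    cases h
    refine ⟨_, mem_recAutomaton_trans.2 (.inr (.inl ⟨r, hr, l, hl, s, hs, rfl, rfl, rfl⟩)),
      fun i => ?_⟩
    by_cases hi : (i : ℕ) = 0
    · simp only [rootTargets, hi, if_true]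
      refine recAutomaton_run_prod (x := some x) (y := some y) ?_ h1 h2 h3
        (by simp [optOverlay, optConv])
      simp [Tree.optSubtrees, Tree.self_mem_subtrees]
    · simp only [rootTargets, hi, if_false]
      exact recAutomaton_run_both.2 ⟨n, m, hnm, rfl⟩

theorem toClique_rel (hR : I.R.Recognizes I.R.rel) {u v : Tree} : I.toClique.rel u v ↔
    ∃ x n y m, u = padTree I.t x n ∧ v = padTree I.t y m ∧ I.R.rel x y ∧ y ∈ I.L.accepts ∧
      I.R.rel I.t y ∧ n < m := by
  rw [TreePairAutomaton.rel, mem_toClique_accepts hR]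
  constructor
  · rintro ⟨x, n, y, m, h, h'⟩
    obtain ⟨rfl, rfl⟩ := Tree.conv_inj h
    exact ⟨x, n, y, m, rfl, rfl, h'⟩
  · rintro ⟨x, n, y, m, rfl, rfl, h'⟩
    exact ⟨x, n, y, m, rfl, h'⟩

theorem toClique_recognizes (hR : I.R.Recognizes I.R.rel) :
    I.toClique.Recognizes I.toClique.rel := by
  refine Set.Subset.antisymm (fun z hz => ?_) ?_
  · obtain ⟨x, n, y, m, rfl, -⟩ := (mem_toClique_accepts hR).1 hz
    exact ⟨_, _, hz, rfl⟩
  · rintro _ ⟨u, v, h, rfl⟩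
    exact h

theorem toClique_trans (hR : I.R.Recognizes I.R.rel) (h : IsTrans Tree I.R.rel) :
    IsTrans Tree I.toClique.rel := by
  refine ⟨fun u v t h1 h2 => ?_⟩
  obtain ⟨x, n, y, m, rfl, rfl, hxy, -, -, hl⟩ := (toClique_rel hR).1 h1
  obtain ⟨y', m', z, k, h3, rfl, hyz, hz, hwz, hl'⟩ := (toClique_rel hR).1 h2
  obtain ⟨rfl, rfl⟩ := padTree_inj h3
  exact (toClique_rel hR).2 ⟨x, n, z, k, rfl, rfl, h.trans _ _ _ hxy hyz, hz, hwz, hl.trans hl'⟩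

theorem mem_rec_iff (hR : I.R.Recognizes I.R.rel) :
    I.t ∈ Rec I.R.rel I.L.accepts ↔ HasInfiniteClique I.toClique.rel := by
  constructor
  · rintro ⟨a, h0, ha, hL⟩
    have hL' : ({i | a i ∈ I.L.accepts} \ {0}).Infinite := hL.sdiff (Set.finite_singleton 0)
    obtain ⟨φ, hφ, hφ'⟩ : ∃ φ : ℕ → ℕ, StrictMono φ ∧
        ∀ i, φ i ∈ {i | a i ∈ I.L.accepts} \ {0} :=
      ⟨_, Nat.nth_strictMono hL', fun i => Nat.nth_mem_of_infinite hL' i⟩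
    -- The chain of length `j` makes the trees distinct even if the sequence repeats elements.
    refine ⟨fun j => padTree I.t (a (φ j)) j, fun i j hij => (padTree_inj hij).2, fun i j hij => ?_⟩
    refine (toClique_rel hR).2 ⟨_, _, _, _, rfl, rfl, ha _ _ (hφ hij), (hφ' j).1, ?_, hij⟩
    rw [← h0]
    exact ha _ _ (Nat.pos_of_ne_zero (hφ' j).2)
  · rintro ⟨c, -, hc⟩
    have : ∀ i, ∃ x n, c i = padTree I.t x n := by
      intro i
      obtain ⟨x, n, y, m, h, -⟩ := (toClique_rel hR).1 (hc i (i + 1) (Nat.lt_succ_self i))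
      exact ⟨x, n, h⟩
    choose x n hx using this
    have key : ∀ i j, i < j → I.R.rel (x i) (x j) ∧ x j ∈ I.L.accepts ∧ I.R.rel I.t (x j) := by
      intro i j hij
      obtain ⟨x', n', y, m, h1, h2, h3, h4, h5, -⟩ := (toClique_rel hR).1 (hc i j hij)
      rw [hx] at h1 h2
      rw [(padTree_inj h1).1, (padTree_inj h2).1]
      exact ⟨h3, h4, h5⟩
    -- As for words, `x 0` may lie outside `L` and is replaced by the given tree.
    refine ⟨fun i => i.casesOn I.t fun i => x (i + 1), rfl, ?_, ?_⟩
    · intro i j hij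
      obtain ⟨j, rfl⟩ : ∃ k, j = k + 1 := ⟨j - 1, by omega⟩
      cases i with
      | zero => exact (key 0 (j + 1) (by omega)).2.2
      | succ i => exact (key _ _ hij).1
    · refine Set.infinite_of_injective_forall_mem (f := fun i : ℕ => i + 1)
        (add_left_injective 1) fun i => ?_
      exact (key 0 (i + 1) (by omega)).2.1

theorem toClique_isNTA : I.toClique.IsNTA := AbstractTreeAutomaton.isNTA rfl

/-- The overlaid letter reveals the letters read by all simulations. At the root there is only one
transition because the given automata have one initial state each. -/
theorem toClique_isTopDownDet (hR : I.R.IsTopDownDet) (hL : I.L.IsTopDownDet) :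
    I.toClique.IsTopDownDet := by
  refine AbstractTreeAutomaton.isTopDownDet TreeRecState.code_injective rfl ?_
  intro q z ts ts' h h' i _
  suffices ts = ts' by rw [this]
  obtain ⟨qR, hqR⟩ := hR.1
  obtain ⟨qL, hqL⟩ := hL.1
  rcases mem_recAutomaton_trans.1 h with h | ⟨r, hr, l, hl, s, hs, rfl, rfl, rfl⟩ |
    ⟨a, d, r, rs, hr, l, ls, hl, p, -, s, ss, hs, -, rfl, rfl, rfl⟩
  · rcases mem_recAutomaton_trans.1 h' with h' | ⟨_, _, _, _, _, _, rfl, _⟩ |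
      ⟨_, _, _, _, _, _, _, _, _, _, _, _, _, _, rfl, _⟩
    · simp only [chainTrans, List.mem_cons, Prod.mk.injEq, List.not_mem_nil, or_false] at h h'
      rcases h with ⟨rfl, rfl, rfl⟩ | ⟨rfl, rfl, rfl⟩ | ⟨rfl, rfl, rfl⟩ | ⟨rfl, rfl, rfl⟩ <;>
        simp at h' <;> exact h'.symm
    · simp [chainTrans] at h
    · simp [chainTrans] at h
  · rcases mem_recAutomaton_trans.1 h' with h' | ⟨r', hr', l', hl', s', hs', -, -, rfl⟩ |
      ⟨_, _, _, _, _, _, _, _, _, _, _, _, _, _, h, _⟩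
    · simp [chainTrans] at h'
    · rw [hqR, List.mem_singleton] at hr hr' hs hs'
      rw [hqL, List.mem_singleton] at hl hl'
      rw [hr, hr', hs, hs', hl, hl']
    · cases h
  · rcases mem_recAutomaton_trans.1 h' with h' | ⟨_, _, _, _, _, _, h, _⟩ |
      ⟨a', d', r', rs', hr', l', ls', hl', p', -, s', ss', hs', -, h1, h2, rfl⟩
    · simp [chainTrans] at h'
    · cases h
    · cases h1
      obtain ⟨-, rfl⟩ := overlayLetter_inj (Prod.mk.inj h2).1
      obtain ⟨-, rfl⟩ := overlayLetter_inj (Prod.mk.inj h2).2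
      rw [hR.padded Function.injective_id hr hr', hL.padded (Option.some_injective _) hl hl',
        hR.padded Function.injective_id hs hs']

/-- The overlaid letter contains the subtree `p`, so the source is found from the letter and the
targets, even at leaves, where there are no targets. All root transitions have the source `init`, so
several final states of the given automata do no harm. -/
theorem toClique_isBottomUpDet (hR : I.R.IsBottomUpDet) (hL : I.L.IsBottomUpDet) :
    I.toClique.IsBottomUpDet := by
  refine AbstractTreeAutomaton.isBottomUpDet TreeRecState.code_injective ?_
  intro q q' z ts ts' h h' hts
  -- Letters of chains have rank below 2, unlike the letter of the root.
  have hchain : ∀ {q : TreeRecState} {z : Option RankedLetter × Option RankedLetter}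
      {ts : ℕ → TreeRecState}, (q, z, ts) ∈ chainTrans → ∃ n < 2, z.2 = some ⟨[], n⟩ := by
    intro q z ts h
    simp only [chainTrans, List.mem_cons, Prod.mk.injEq, List.not_mem_nil, or_false] at h
    rcases h with ⟨rfl, rfl, rfl⟩ | ⟨rfl, rfl, rfl⟩ | ⟨rfl, rfl, rfl⟩ | ⟨rfl, rfl, rfl⟩ <;> simp
  rcases mem_recAutomaton_trans.1 h with h | ⟨r, hr, l, hl, s, hs, rfl, rfl, rfl⟩ |
    ⟨a, d, r, rs, hr, l, ls, hl, p, -, s, ss, hs, -, rfl, rfl, rfl⟩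
  · rcases mem_recAutomaton_trans.1 h' with h' | ⟨_, _, _, _, _, _, _, rfl, _⟩ |
      ⟨_, _, _, _, _, _, _, _, _, _, _, _, _, _, _, rfl, _⟩
    · simp only [chainTrans, List.mem_cons, Prod.mk.injEq, List.not_mem_nil, or_false] at h h'
      rcases h with ⟨rfl, rfl, rfl⟩ | ⟨rfl, rfl, rfl⟩ | ⟨rfl, rfl, rfl⟩ | ⟨rfl, rfl, rfl⟩ <;>
        simp at h' <;> exact h'.1.symm
    · obtain ⟨n, hn, h⟩ := hchain h
      simp at h
      omega
    · obtain ⟨n, hn, h⟩ := hchain h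
      exact absurd h (overlayLetter_ne _ _ _)
  · rcases mem_recAutomaton_trans.1 h' with h' | ⟨_, _, _, _, _, _, rfl, _⟩ |
      ⟨_, _, _, _, _, _, _, _, _, _, _, _, _, _, _, h, _⟩
    · obtain ⟨n, hn, h⟩ := hchain h'
      simp at h
      omega
    · rfl
    · exact absurd (Prod.mk.inj h).2.symm (overlayLetter_ne _ _ _)
  · rcases mem_recAutomaton_trans.1 h' with h' | ⟨_, _, _, _, _, _, _, h, _⟩ |
      ⟨a', d', r', rs', hr', l', ls', hl', p', -, s', ss', hs', -, rfl, h2, rfl⟩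
    · obtain ⟨n, hn, h⟩ := hchain h'
      exact absurd h (overlayLetter_ne _ _ _)
    · exact absurd (Prod.mk.inj h).2 (overlayLetter_ne _ _ _)
    · obtain ⟨rfl, rfl⟩ := overlayLetter_inj (Prod.mk.inj h2).1
      obtain ⟨-, rfl⟩ := overlayLetter_inj (Prod.mk.inj h2).2
      rw [pairRank_overlayLetter] at hts
      simp only [TreeRecState.prod.injEq] at hts
      rw [hR.padded Function.injective_id (rk' := pairRank) (fun _ => rfl) hr hr'
          fun i hi => (hts i (by rw [pairRank_eq] at hi; omega)).1,
        hL.padded (Option.some_injective _)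
          (rk' := fun d : Option RankedLetter => d.elim 0 RankedLetter.rank) (fun _ => rfl) hl hl'
          fun i hi => (hts i (by omega)).2.1,
        hR.padded Function.injective_id (rk' := pairRank) (fun _ => rfl) hs hs'
          fun i hi => (hts i (by rw [pairRank_eq] at hi; unfold rootRank; omega)).2.2.1]

end TreeRecInput

/-! ### Trees in strings -/

/-- Iteration on the position of a forest and the number of its trees: the label of the first root
is skipped. -/
def forestStep (x : List Symbol) (q m : ℕ) : ℕ × ℕ :=
  (if decide (m = 0) = true then q else pastRanked x q,
    if decide (m = 0) = true then m else m - 1 + rankAt x q)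

def pastTree (x : List Symbol) (p : ℕ) : ℕ := (iterPair x (forestStep x) x.length (p, 1)).1

theorem num_pastTree {k : ℕ} {f : List Symbol → (Fin k → ℕ) → ℕ} (hf : Num f) :
    Num fun x v => pastTree x (f x v) := by
  refine Num.iterPair (h := fun x _ => forestStep x) ?_ ?_ .length hf (.const 1)
  · exact .ite (.eq (.var 1) (.const 0)) (.var 0) (Num.var 0).pastRanked
  · exact .ite (.eq (.var 1) (.const 0)) (.var 1)
      (((Num.var 1).sub (.const 1)).add (Num.var 0).rankAt)

theorem Tree.enc_node (a : RankedLetter) (c : Fin a.rank → Tree) :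
    Tree.enc (.node a c) = encRankedLetter a ++ (List.ofFn c).flatMap Tree.enc := by
  rw [Tree.enc, List.flatMap, List.map_ofFn]
  rfl

theorem Tree.flatMap_enc_cons (a : RankedLetter) (c : Fin a.rank → Tree) (ts : List Tree) :
    (RankedTree.node a c :: ts : List Tree).flatMap Tree.enc =
      encRankedLetter a ++ (List.ofFn c ++ ts).flatMap Tree.enc := by
  rw [List.flatMap_cons, Tree.enc_node, List.flatMap_append, List.append_assoc]

theorem Tree.length_le_flatMap_enc (ts : List Tree) :
    ts.length ≤ (ts.flatMap Tree.enc).length := by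
  induction ts with
  | nil => exact le_rfl
  | cons t ts ih =>
    obtain ⟨a, c⟩ := t
    have := parser_ranked.length_pos a
    rw [List.flatMap_cons, Tree.enc_node]
    simp only [List.length_cons, List.length_append]
    omega

/-- In prefix notation, skipping a label replaces one pending tree by its children. Each round
consumes at least one symbol, so the length of the code bounds the rounds; it also bounds the number
of pending trees, so truncation has no effect. -/
theorem iterPair_forestStep {x : List Symbol} {n p : ℕ} {ts : List Tree}
    (h : At x p (ts.flatMap Tree.enc)) (hp : p ≤ x.length) (hn : (ts.flatMap Tree.enc).length ≤ n) :
    (iterPair x (forestStep x) n (p, ts.length)).1 = p + (ts.flatMap Tree.enc).length := by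
  induction n generalizing p ts with
  | zero =>
    change p = _
    omega
  | succ n ih =>
    rw [iterPair, Function.iterate_succ_apply]
    change (iterPair x (forestStep x) n _).1 = _
    rcases ts with _ | ⟨⟨a, c⟩, ts⟩
    · have := ih (p := p) (ts := []) h hp (Nat.zero_le _)
      simpa [forestStep, hp] using this
    · have hle := h.le hp
      rw [Tree.flatMap_enc_cons] at h hn hle ⊢
      rw [List.length_append] at hn hle ⊢
      rw [parser_ranked.at_append_iff] at h
      have h1 := parser_ranked.past_eq _ _ _ h.1
      have h2 : rankAt x p = a.rank := rankAt_eq (o := some a) h.1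
      have h3 := parser_ranked.length_pos a
      have h4 := Tree.length_le_flatMap_enc (List.ofFn c ++ ts)
      rw [List.length_append, List.length_ofFn] at h4
      have h5 := ih h.2 (by omega) (by omega)
      have h6 : forestStep x p (RankedTree.node a c :: ts).length =
          (pastRanked x p, (List.ofFn c ++ ts).length) := by
        simp only [forestStep, List.length_cons, Nat.add_eq_zero_iff, one_ne_zero, and_false,
          decide_false, Bool.false_eq_true, if_false, h2, List.length_append, List.length_ofFn]
        congr 1
        omega
      rw [h6]
      dsimp only
      rw [min_eq_left (by omega), min_eq_left (by rw [List.length_append, List.length_ofFn]; omega),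
        h5, h1]
      omega

theorem parser_tree : Parser Tree.enc pastTree where
  code := Tree.isCode_enc
  head := fun t => by
    cases t
    simp [Tree.enc, encRankedLetter, encName]
  past_eq := by
    intro x p t h
    have hp : p ≤ x.length := by
      obtain ⟨a, c⟩ := t
      rw [Tree.enc_node, encRankedLetter, encName] at h
      exact (At.lt_of_cons h).le
    have h1 : At x p ([t].flatMap Tree.enc) := by rwa [List.flatMap_singleton]
    have h2 := h1.le hp
    have := iterPair_forestStep h1 hp (n := x.length) (by omega)
    rwa [List.flatMap_singleton] at this
  num := num_pastTree (.var 0)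

/-- In prefix notation a subtree begins at each label, so scanning label by label visits the
subtrees in prefix order. The induction has to be over forests, since what follows a label is one.
-/
theorem Tree.exists_chain_subtrees {x : List Symbol} {n p : ℕ} {ts : List Tree}
    (h : At x p (ts.flatMap Tree.enc)) (hn : (ts.flatMap Tree.enc).length ≤ n) :
    ∃ ps, Chain pastRanked x p ps (p + (ts.flatMap Tree.enc).length) ∧
      ps.length ≤ (ts.flatMap Tree.enc).length ∧
      List.Forall₂ (fun q s => At x q (Tree.enc s)) ps (ts.flatMap Tree.subtrees) := by
  induction n generalizing p ts with
  | zero =>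
    have h1 := Tree.length_le_flatMap_enc ts
    obtain rfl : ts = [] := List.length_eq_zero_iff.1 (by omega)
    exact ⟨[], .nil p, le_rfl, .nil⟩
  | succ n ih =>
    rcases ts with _ | ⟨⟨a, c⟩, ts⟩
    · exact ⟨[], .nil p, le_rfl, .nil⟩
    · have h0 := h
      rw [List.flatMap_cons, At.append_iff] at h0
      rw [Tree.flatMap_enc_cons] at h hn ⊢
      rw [List.length_append] at hn ⊢
      rw [parser_ranked.at_append_iff] at h
      have h1 := parser_ranked.past_eq _ _ _ h.1
      have h3 := parser_ranked.length_pos a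
      obtain ⟨ps, h4, h5, h6⟩ := ih h.2 (by omega)
      rw [h1, add_assoc] at h4
      refine ⟨p :: ps, .cons (parser_ranked.isLpar h.1) (h1 ▸ parser_ranked.le h.1) (h1 ▸ h4), ?_, ?_⟩
      · rw [List.length_cons]
        omega
      · have h7 : (RankedTree.node a c :: ts : List Tree).flatMap Tree.subtrees =
            .node a c :: (List.ofFn c ++ ts).flatMap Tree.subtrees := by
          rw [List.flatMap_cons, Tree.subtrees, List.flatMap_append, List.cons_append, List.flatMap,
            List.flatMap, List.map_ofFn]
          rfl
        rw [h7]
        exact .cons h0.1 h6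

/-- The positions of the subtrees of the tree at position `p`, which is the last part of the
string, and the end of the string. -/
def subtreePos (x : List Symbol) (p : ℕ) : List ℕ := elems pastRanked x p ++ [x.length]

theorem forall₂_subtreePos {x : List Symbol} {p : ℕ} {t : Tree} (h : At x p t.enc)
    (h' : p + t.enc.length = x.length) :
    List.Forall₂ (OptAt Tree.enc x) (subtreePos x p) t.optSubtrees := by
  have h1 : At x p ([t].flatMap Tree.enc) := by rwa [List.flatMap_singleton]
  obtain ⟨ps, h2, h3, h4⟩ := Tree.exists_chain_subtrees h1 le_rfl
  rw [List.flatMap_singleton] at h2 h3 h4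
  rw [h'] at h2
  rw [subtreePos, elems, h2.elemsFuel_eq (by simp [isLpar]) (by omega), Tree.optSubtrees]
  exact List.rel_append (R := OptAt Tree.enc x) (List.forall₂_map_right_iff.2 h4)
    (.cons .none_of_length .nil)

theorem optAt_rootLabel {x : List Symbol} {q : ℕ} {X : Option Tree} (h : OptAt Tree.enc x q X) :
    OptAt encRankedLetter x q (rootLabel X) := by
  rcases X with _ | ⟨a, c⟩
  · exact h
  · have h : At x q (Tree.enc (.node a c)) := h
    rw [Tree.enc_node, At.append_iff] at h
    exact h.1

/-- The position of the child with number `i` of the optional tree at position `q`. -/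
def childPos (x : List Symbol) (q i : ℕ) : ℕ :=
  if decide (i < rankAt x q) = true then elemPos pastTree x (pastRanked x q) i else x.length

theorem optAt_childAt {x : List Symbol} {q : ℕ} {X : Option Tree} (h : OptAt Tree.enc x q X)
    (i : ℕ) : OptAt Tree.enc x (childPos x q i) (childAt X i) := by
  have h1 := rankAt_eq (optAt_rootLabel h)
  simp only [childPos, h1, decide_eq_true_eq]
  split
  · rename_i hi
    rcases X with _ | ⟨a, c⟩
    · exact absurd hi (Nat.not_lt_zero i)
    · have hi : i < a.rank := hi
      have h : At x q (Tree.enc (.node a c)) := h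
      rw [Tree.enc_node, parser_ranked.at_append_iff] at h
      obtain ⟨ps, h2, h3, -⟩ := parser_tree.exists_chain h.2
      have hl := h3.length_eq
      rw [List.length_ofFn] at hl
      rw [h2.elemPos_getElem (by omega), childAt, dif_pos hi]
      have := List.forall₂_iff_get.1 h3 |>.2 i (by omega) (by simpa using hi)
      rw [OptAt]
      simpa using this
  · rename_i hi
    rw [childAt_eq_none (not_lt.1 hi)]
    exact .none_of_length

section

variable {k : ℕ} {f g : List Symbol → (Fin k → ℕ) → ℕ}

theorem num_childPos (hf : Num f) (hg : Num g) : Num fun x v => childPos x (f x v) (g x v) :=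
  .ite (.lt hg hf.rankAt) (.elemPos parser_tree.num hf.pastRanked hg) .length

theorem out_subtreePos {F : List Symbol → (Fin k → ℕ) → ℕ → List Symbol}
    (hF : Out fun x (w : Fin (k + 1) → ℕ) => F x (Fin.tail w) (w 0)) (hf : Num f) :
    Out fun x v => (subtreePos x (f x v)).flatMap (F x v) := by
  have : Out fun x v => (elems pastRanked x (f x v)).flatMap (F x v) ++ F x v x.length :=
    .append (.elems parser_ranked.num hF hf) (.bind hF .length)
  simpa only [AutRel.subtreePos, List.flatMap_append, List.flatMap_singleton] using this

end

/-! ### Transitions of padded tree automata in strings -/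

theorem isLpar_of_length_le {x : List Symbol} {p : ℕ} (h : x.length ≤ p) :
    isLpar x[p]? = false := by
  rw [List.getElem?_eq_none h]
  rfl

/-- The end of the string stands for the padding transition; its letter and targets, computed by the
same functions as for other transitions, must therefore also be at positions where nothing is
written. -/
theorem length_le_iter {x : List Symbol} {h : ℕ → ℕ} (hh : ∀ s, x.length ≤ s → x.length ≤ h s)
    (m : ℕ) {s : ℕ} (hs : x.length ≤ s) : x.length ≤ iter x h m s := by
  induction m generalizing s with
  | zero => exact hs
  | succ m ih =>
    rw [iter_succ]
    exact ih (le_min (hh _ hs) le_rfl)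

theorem length_le_pastName {x : List Symbol} {p : ℕ} (h : x.length ≤ p) :
    x.length ≤ pastName x p := by
  refine (length_le_iter (fun s hs => ?_) _ h).trans (Nat.le_succ _)
  split <;> omega

theorem length_le_pastOption {past : List Symbol → ℕ → ℕ} {x : List Symbol} {p : ℕ}
    (h : x.length ≤ p) : x.length ≤ pastOption past x p := by
  rw [pastOption, isLpar_of_length_le h, if_neg Bool.false_ne_true]
  omega

theorem length_le_elemPos {past : List Symbol → ℕ → ℕ} {x : List Symbol} {p : ℕ}
    (h : x.length ≤ p) (n : ℕ) : x.length ≤ elemPos past x p n := by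
  refine length_le_iter (fun s hs => ?_) n h
  rwa [isLpar_of_length_le hs, if_neg Bool.false_ne_true]

/-- The positions that stand for the transitions of the padded version of the tree automaton at
position `p`: those of its transitions and the end of the string. -/
def paddedTreePos (past : List Symbol → ℕ → ℕ) (skip : List Symbol → ℕ → Bool) (x : List Symbol)
    (p : ℕ) : List ℕ :=
  (elems (pastTreeTrans past) x (treeTransPos x p + 1)).flatMap
    (fun t => if skip x t = true then [] else [t]) ++ [x.length]

theorem out_paddedTreePos {k : ℕ} {f : List Symbol → (Fin k → ℕ) → ℕ}
    {past : List Symbol → ℕ → ℕ} {skip : List Symbol → ℕ → Bool}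
    (h : Num fun x (v : Fin 1 → ℕ) => past x (v 0))
    (hs : Test fun x (v : Fin 1 → ℕ) => skip x (v 0))
    {F : List Symbol → (Fin k → ℕ) → ℕ → List Symbol}
    (hF : Out fun x (w : Fin (k + 1) → ℕ) => F x (Fin.tail w) (w 0)) (hf : Num f) :
    Out fun x v => (paddedTreePos past skip x (f x v)).flatMap (F x v) := by
  have h1 : Out fun x v => (elems (pastTreeTrans past) x (treeTransPos x (f x v) + 1)).flatMap
      (fun t => if skip x t = true then [] else F x v t) :=
    .elems (Num.pastTreeTrans h (.var 0)) (.ite (hs.comp1 (.var 0)) (.const []) hF)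
      (hf.treeTransPos.add (.const 1))
  have := h1.append (.bind hF .length)
  have h2 : ∀ (x : List Symbol) (v : Fin k → ℕ) (t : ℕ),
      (if skip x t = true then [] else [t]).flatMap (F x v) =
        if skip x t = true then [] else F x v t := by
    intro x v t; split <;> simp
  simpa only [AutRel.paddedTreePos, List.flatMap_append, List.flatMap_singleton,
    List.flatMap_assoc, h2, List.append_assoc] using this

/-- Position `t` stands for the transition of a padded tree automaton, whose letters are
described by `letterAt`. -/
structure PaddedTreeAt {β : Type} (past : List Symbol → ℕ → ℕ)
    (letterAt : List Symbol → ℕ → β → Prop) (x : List Symbol) (t : ℕ) (i : PaddedTreeTrans β) :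
    Prop where
  src : OptAt encName x t i.1
  letter : letterAt x (pastName x t) i.2.1
  dst : ∀ j, OptAt encName x (nthTargetPos past x t j) (i.2.2 j)

theorem Skipper.paddedTreeAt {α β : Type} {rk : α → ℕ} {e : α → List Symbol}
    {past : List Symbol → ℕ → ℕ} [DecidableEq β] (h : Skipper e past) {f : α → β} {blank : β}
    {skip : List Symbol → ℕ → Bool} {letterAt : List Symbol → ℕ → β → Prop} {x : List Symbol}
    (hl : ∀ q a, At x q (e a) → letterAt x q (f a))
    (hend : ∀ q, x.length ≤ q → letterAt x q blank)
    (hpast : ∀ q, x.length ≤ q → x.length ≤ past x q)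
    (hskip : ∀ t a, At x (pastName x t) (e a) → (skip x t = true ↔ f a = blank))
    {p : ℕ} {A : TreeAutomaton rk} {l : List Symbol} (hA : At x p (A.enc e ++ l)) :
    List.Forall₂ (PaddedTreeAt past letterAt x) (paddedTreePos past skip x p)
      (A.padded f blank) := by
  have ht := h.treeTrans.forall₂_elems (h.at_treeAutomaton_iff.1 hA).2.1
  rw [paddedTreePos, TreeAutomaton.padded]
  refine List.rel_append ?_ (.cons ⟨.none_of_length, hend _ (length_le_pastName le_rfl), fun j => ?_⟩
    .nil)
  · generalize elems (pastTreeTrans past) x (treeTransPos x p + 1) = ps at ht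
    generalize A.trans = ts at ht
    induction ht with
    | nil => exact .nil
    | @cons t i ps l' hi _ ih =>
      rw [List.flatMap_cons, List.flatMap_cons]
      refine List.rel_append ?_ ih
      have h1 := h.at_treeTrans_iff.1 hi
      by_cases hb : f i.letter = blank
      · rw [if_pos ((hskip t _ h1.2.1).2 hb), if_pos hb]
        exact .nil
      · rw [if_neg (mt (hskip t _ h1.2.1).1 hb), if_neg hb]
        exact .cons ⟨h1.1, hl _ _ h1.2.1, fun j => h.optAt_target hi j⟩ .nil
  · refine isLpar_of_length_le (length_le_elemPos ?_ j)
    exact (hpast _ (length_le_pastName le_rfl)).trans (Nat.le_succ _)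

/-- Position `q` holds the pair of optional letters. -/
def PairAt (x : List Symbol) (q : ℕ) (l : Option RankedLetter × Option RankedLetter) : Prop :=
  OptAt encRankedLetter x q l.1 ∧ OptAt encRankedLetter x (pastOption pastRanked x q) l.2

/-! ### Computation of the reduction of recurrent reachability over trees -/

section Program

variable (x : List Symbol)

/-- The position of the second automaton. -/
def secondTreePos : ℕ := pastTreeAutomaton pastRankedPair x 0

/-- The position of the tree. -/
def treePos : ℕ := pastTreeAutomaton pastRanked x (secondTreePos x)

/-- The position of the second component of the letter of the transition at position `t`. -/
def sndLetterPos (t : ℕ) : ℕ := pastOption pastRanked x (pastName x t)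

/-- Is the letter the pair of two blanks? -/
def isBlankTreePair (t : ℕ) : Bool :=
  !isLpar x[pastName x t]? && !isLpar x[sndLetterPos x t]?

def unaryOut (n : ℕ) : List Symbol := .lpar :: (List.range n).flatMap (fun _ => [.one]) ++ [.rpar]

def overlayLetterOut (q a : ℕ) : List Symbol :=
  if (isLpar x[q]? || isLpar x[a]?) = true then
    nameCode (optionOut pastTree x q ++ optionOut pastRanked x a) ++
      unaryOut (max (rankAt x q) (rankAt x a))
  else [.bot]

def treeStateOut (r l s q : ℕ) : List Symbol :=
  .bot :: (optionOut pastName x r ++ (optionOut pastName x l ++ (optionOut pastName x s ++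
    optionOut pastTree x q)))

def treeRecTransOut (r l s q : ℕ) : List Symbol :=
  if ((isLpar x[q]? || (isLpar x[pastName x r]? || isLpar x[sndLetterPos x r]?)) &&
    (optionEq pastRanked x (pastName x l) (sndLetterPos x r) &&
    (optionEq pastRanked x (sndLetterPos x s) (sndLetterPos x r) &&
    optionEq pastRanked x (pastName x s) q))) = true then
    printTreeTrans (treeStateOut x r l s q)
      (overlayLetterOut x q (pastName x r) ++ overlayLetterOut x q (sndLetterPos x r))
      ((List.range (max (max (rankAt x q) (rankAt x (pastName x r)))
        (max (rankAt x q) (rankAt x (sndLetterPos x r))))).flatMap fun i =>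
          nameCode (treeStateOut x (nthTargetPos pastRankedPair x r i)
            (nthTargetPos pastRanked x l i) (nthTargetPos pastRankedPair x s i) (childPos x q i)))
  else []

def rootTransOut (r l s : ℕ) : List Symbol :=
  printTreeTrans [] (encRankedLetterPair (some ⟨[], 2⟩, some ⟨[], 2⟩))
    (nameCode (treeStateOut x r l s (treePos x)) ++ nameCode [.one])

/-- The reduction on strings. -/
def treeRecReduction : List Symbol :=
  .lpar :: nameCode [] ++ [.rpar] ++
  (.lpar :: (TreeRecInput.chainTrans.flatMap
      (encAbstractTrans (rk := pairRank) TreeRecState.code encRankedLetterPair) ++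
    (((elems pastName x 1).flatMap fun r => (elems pastName x (secondTreePos x + 1)).flatMap fun l =>
      (elems pastName x 1).flatMap fun s => rootTransOut x r l s) ++
    (paddedTreePos pastRankedPair isBlankTreePair x 0).flatMap fun r =>
      (paddedTreePos pastRanked (fun _ _ => false) x (secondTreePos x)).flatMap fun l =>
      (paddedTreePos pastRankedPair isBlankTreePair x 0).flatMap fun s =>
      (subtreePos x (treePos x)).flatMap fun q => treeRecTransOut x r l s q)) ++ [.rpar])

end Program

section

variable {k : ℕ} {r l s q : List Symbol → (Fin k → ℕ) → ℕ}

theorem num_secondTreePos : Num fun x (_ : Fin k → ℕ) => secondTreePos x :=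
  .pastTreeAutomaton skipper_rankedPair.num (.const 0)

theorem num_treePos : Num fun x (_ : Fin k → ℕ) => treePos x :=
  .pastTreeAutomaton parser_ranked.num num_secondTreePos

theorem num_sndLetterPos (hr : Num r) : Num fun x v => sndLetterPos x (r x v) :=
  .pastOption parser_ranked.num hr.pastName

theorem test_isBlankTreePair (hr : Num r) : Test fun x v => isBlankTreePair x (r x v) :=
  .and (.not (.letter isLpar hr.pastName)) (.not (.letter isLpar (num_sndLetterPos hr)))

theorem out_unaryOut (hr : Num r) : Out fun x v => unaryOut (r x v) :=
  Out.encList (.flatMap (.const _) hr)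

theorem out_overlayLetterOut (hq : Num q) (hr : Num r) :
    Out fun x v => overlayLetterOut x (q x v) (r x v) :=
  .ite (.or (.letter isLpar hq) (.letter isLpar hr))
    (.append (Out.nameCode ((Out.optionOut parser_tree.num hq).append
      (.optionOut parser_ranked.num hr))) (out_unaryOut (.max hq.rankAt hr.rankAt))) (.const _)

theorem out_treeStateOut (hr : Num r) (hl : Num l) (hs : Num s) (hq : Num q) :
    Out fun x v => treeStateOut x (r x v) (l x v) (s x v) (q x v) :=
  .cons _ ((Out.optionOut parser_name.num hr).append ((Out.optionOut parser_name.num hl).append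
    ((Out.optionOut parser_name.num hs).append (.optionOut parser_tree.num hq))))

theorem out_treeRecTransOut (hr : Num r) (hl : Num l) (hs : Num s) (hq : Num q) :
    Out fun x v => treeRecTransOut x (r x v) (l x v) (s x v) (q x v) := by
  have hd := num_sndLetterPos hr
  refine .ite (.and (.or (.letter isLpar hq) (.or (.letter isLpar hr.pastName)
    (.letter isLpar hd))) (.and (.optionEq parser_ranked.num hl.pastName hd)
      (.and (.optionEq parser_ranked.num (num_sndLetterPos hs) hd)
        (.optionEq parser_ranked.num hs.pastName hq))))
    (.printTreeTrans (out_treeStateOut hr hl hs hq)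
      ((out_overlayLetterOut hq hr.pastName).append (out_overlayLetterOut hq hd))
      (.flatMap (Out.nameCode (out_treeStateOut ?_ ?_ ?_ ?_))
        (.max (.max hq.rankAt hr.pastName.rankAt) (.max hq.rankAt hd.rankAt)))) (.const _)
  · exact .nthTargetPos skipper_rankedPair.num hr.tail (.var 0)
  · exact .nthTargetPos parser_ranked.num hl.tail (.var 0)
  · exact .nthTargetPos skipper_rankedPair.num hs.tail (.var 0)
  · exact num_childPos hq.tail (.var 0)

theorem out_rootTransOut (hr : Num r) (hl : Num l) (hs : Num s) :
    Out fun x v => rootTransOut x (r x v) (l x v) (s x v) :=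
  .printTreeTrans (.const _) (.const _)
    ((out_treeStateOut hr hl hs num_treePos).nameCode.append (.const _))

end

theorem logspaceComputable_treeRecReduction : LogspaceComputable treeRecReduction := by
  refine .of_out (.append (.const _) (Out.encList (.append (.const _) (.append ?_ ?_))))
  · refine .elems parser_name.num (.elems parser_name.num (.elems parser_name.num
      (out_rootTransOut (.var 2) (.var 1) (.var 0)) (.const 1))
      (num_secondTreePos.add (.const 1))) (.const 1)
  · exact out_paddedTreePos skipper_rankedPair.num (test_isBlankTreePair (.var 0))
      (out_paddedTreePos parser_ranked.num (skip := fun _ _ => false) (.const 0)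
      (out_paddedTreePos skipper_rankedPair.num (test_isBlankTreePair (.var 0))
        (out_subtreePos (out_treeRecTransOut (.var 3) (.var 2) (.var 1) (.var 0)) num_treePos)
        (.const 0)) num_secondTreePos) (.const 0)

section

variable {x : List Symbol} {r l s q a : ℕ} {p : Option Tree}

theorem unaryOut_eq (n : ℕ) : unaryOut n = encUnary n := by
  have : ∀ m, (List.range m).flatMap (fun _ => [Symbol.one]) =
      (List.replicate m true).map encBit := by
    intro m
    induction m with
    | zero => rfl
    | succ m ih =>
      rw [List.range_succ, List.flatMap_append, ih, List.replicate_succ', List.map_append]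
      rfl
  rw [unaryOut, this]
  rfl

theorem overlayLetterOut_eq (hq : OptAt Tree.enc x q p) {a' : Option RankedLetter}
    (ha : OptAt encRankedLetter x a a') :
    overlayLetterOut x q a = encOption encRankedLetter (overlayLetter p a') := by
  rw [overlayLetterOut, parser_tree.isLpar_eq hq, parser_ranked.isLpar_eq ha, overlayLetter,
    parser_tree.optionOut_eq hq, parser_ranked.optionOut_eq ha, rankAt_eq (optAt_rootLabel hq),
    rankAt_eq ha]
  simp only [Bool.or_eq_true]
  split
  · rw [unaryOut_eq, ← encName_nameOf]
    rfl
  · rfl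

theorem treeStateOut_eq {r' l' s' : Option Name} (hr : OptAt encName x r r')
    (hl : OptAt encName x l l') (hs : OptAt encName x s s') (hq : OptAt Tree.enc x q p) :
    treeStateOut x r l s q = TreeRecState.code (.prod r' l' s' p) := by
  rw [treeStateOut, parser_name.optionOut_eq hr, parser_name.optionOut_eq hl,
    parser_name.optionOut_eq hs, parser_tree.optionOut_eq hq]
  rfl

theorem treeRecTransOut_eq {r' s' : PaddedTreeTrans (Option RankedLetter × Option RankedLetter)}
    {l' : PaddedTreeTrans (Option RankedLetter)}
    (hr : PaddedTreeAt pastRankedPair PairAt x r r')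
    (hl : PaddedTreeAt pastRanked (OptAt encRankedLetter) x l l')
    (hs : PaddedTreeAt pastRankedPair PairAt x s s') (hq : OptAt Tree.enc x q p) :
    treeRecTransOut x r l s q = (TreeRecInput.recTrans r' l' s' p).flatMap
      (encAbstractTrans (rk := pairRank) TreeRecState.code encRankedLetterPair) := by
  have hq' := optAt_rootLabel hq
  obtain ⟨h1, h2⟩ := hr.letter
  obtain ⟨h3, h4⟩ := hs.letter
  have h5 := hl.letter
  rw [treeRecTransOut, TreeRecInput.recTrans, treeStateOut_eq hr.src hl.src hs.src hq, sndLetterPos,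
    sndLetterPos, overlayLetterOut_eq hq h1, overlayLetterOut_eq hq h2, rankAt_eq hq', rankAt_eq h1,
    rankAt_eq h2, parser_tree.isLpar_eq hq, parser_ranked.isLpar_eq h1, parser_ranked.isLpar_eq h2]
  simp only [Bool.and_eq_true, Bool.or_eq_true, parser_ranked.optionEq_iff h5 h2,
    parser_ranked.optionEq_iff h4 h2, parser_ranked.optionEq_iff h3 hq']
  split
  · rw [List.flatMap_singleton, encAbstractTrans, TreeRecInput.pairRank_overlayLetter]
    refine congrArg _ (List.flatMap_congr fun i _ => ?_)
    rw [treeStateOut_eq (hr.dst i) (hl.dst i) (hs.dst i) (optAt_childAt hq i)]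
  · rfl

end

theorem treeRecReduction_code (I : TreeRecInput) : treeRecReduction I.code = I.toClique.code := by
  have h0 : At I.code 0 (I.R.enc encRankedLetterPair ++ (I.L.enc encRankedLetter ++ I.t.enc)) :=
    List.prefix_refl _
  have hR := skipper_rankedPair.at_treeAutomaton_iff.1 h0
  have h1 : At I.code (secondTreePos I.code) (I.L.enc encRankedLetter ++ I.t.enc) := hR.2.2
  have hL := parser_ranked.skipper.at_treeAutomaton_iff.1 h1
  have h2 : At I.code (treePos I.code) I.t.enc := hL.2.2
  have h3 : treePos I.code + I.t.enc.length = I.code.length := by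
    have h3 := skipper_rankedPair.treeAutomaton.past_eq _ _ _ (At.append_iff.1 h0).1
    have h4 := parser_ranked.skipper.treeAutomaton.past_eq _ _ _ (At.append_iff.1 h1).1
    rw [treePos, h4, secondTreePos, h3]
    simp only [TreeRecInput.code, TreePairAutomaton.code, List.length_append]
    omega
  have hr := parser_name.forall₂_elems hR.1
  have hr' := parser_name.forall₂_elems hL.1
  have ht := skipper_rankedPair.paddedTreeAt (f := id) (blank := (none, none))
    (skip := isBlankTreePair) (letterAt := PairAt) (fun q a ha => optAt_rankedPair ha)
    (fun q hq => ⟨isLpar_of_length_le hq, isLpar_of_length_le (length_le_pastOption hq)⟩)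
    (fun q hq => length_le_pastOption (length_le_pastOption hq))
    (fun t a ha => by
      obtain ⟨h4, h5⟩ := optAt_rankedPair ha
      rw [isBlankTreePair, sndLetterPos, parser_ranked.isLpar_eq h4, parser_ranked.isLpar_eq h5]
      obtain ⟨_ | a, _ | b⟩ := a <;> simp) h0
  have ht' := parser_ranked.skipper.paddedTreeAt (f := some) (blank := none)
    (skip := fun _ _ => false) (letterAt := OptAt encRankedLetter) (fun q a ha => ha)
    (fun q hq => isLpar_of_length_le hq)
    (fun q hq => length_le_pastName (length_le_pastName hq)) (fun t a ha => by simp) h1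
  have hq := forall₂_subtreePos h2 h3
  rw [treeRecReduction, TreePairAutomaton.code, TreeRecInput.toClique,
    AbstractTreeAutomaton.enc_toTreeAutomaton]
  refine congr (congrArg _ rfl) (congrArg (fun l => Symbol.lpar :: l ++ [Symbol.rpar]) ?_)
  simp only [TreeRecInput.recAutomaton, List.flatMap_append, List.flatMap_assoc]
  refine congrArg _ (congr (congrArg _ ?_) ?_)
  · refine flatMap_eq_of_forall₂ hr fun r r' _ hr' => ?_
    refine flatMap_eq_of_forall₂ ‹_› fun l l' _ hl => ?_
    refine flatMap_eq_of_forall₂ hr fun s s' _ hs => ?_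
    rw [rootTransOut, treeStateOut_eq (r' := some r') (l' := some l') (s' := some s') hr' hl hs
      (p := some I.t) h2]
    simp [encAbstractTrans, pairRank, TreeRecInput.rootTargets, TreeRecState.code,
      List.range_succ]
  · refine flatMap_eq_of_forall₂ ht fun r r' _ hr => ?_
    refine flatMap_eq_of_forall₂ ht' fun l l' _ hl => ?_
    refine flatMap_eq_of_forall₂ ht fun s s' _ hs => ?_
    exact flatMap_eq_of_forall₂ hq fun q p _ hq => treeRecTransOut_eq hr hl hs hq

theorem treeRec_reduces_treeClique (K : TreeModel) :
    IsReduction (treeRec K) (treeClique K) treeRecReduction ∧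
      Preserves (treeRec K) (treeClique K) treeRecReduction
        (fun I => IsTrans Tree I.R.rel) (fun A => IsTrans Tree A.rel) := by
  constructor
  · intro I hI
    refine ⟨I.toClique, treeRecReduction_code I, ⟨?_, TreeRecInput.toClique_recognizes hI.2.2⟩,
      TreeRecInput.mem_rec_iff hI.2.2⟩
    cases K with
    | nta => exact TreeRecInput.toClique_isNTA
    | topDownDet => exact TreeRecInput.toClique_isTopDownDet hI.1 hI.2.1
    | bottomUpDet => exact TreeRecInput.toClique_isBottomUpDet hI.1 hI.2.1
  · intro I A hI h hT
    obtain rfl := TreePairAutomaton.isCode_code.injective ((treeRecReduction_code I).symm.trans h)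
    exact TreeRecInput.toClique_trans hI.2.2 hT

end AutRel

theorem mainTheorem10 :
    -- words: the two problems are logspace equivalent
    AutRel.LogspaceReduces (AutRel.wordClique .nfa) (AutRel.wordRec .nfa) ∧
    (∃ f : List AutRel.Symbol → List AutRel.Symbol, AutRel.LogspaceComputable f ∧
      ∀ K : AutRel.WordModel,
        AutRel.IsReduction (AutRel.wordRec K) (AutRel.wordClique K) f ∧
        AutRel.Preserves (AutRel.wordRec K) (AutRel.wordClique K) f
          (fun I => IsTrans AutRel.Word I.R.rel) (fun A => IsTrans AutRel.Word A.rel)) ∧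
    -- trees: the two problems are logspace equivalent
    AutRel.LogspaceReduces (AutRel.treeClique .nta) (AutRel.treeRec .nta) ∧
    (∃ f : List AutRel.Symbol → List AutRel.Symbol, AutRel.LogspaceComputable f ∧
      ∀ K : AutRel.TreeModel,
        AutRel.IsReduction (AutRel.treeRec K) (AutRel.treeClique K) f ∧
        AutRel.Preserves (AutRel.treeRec K) (AutRel.treeClique K) f
          (fun I => IsTrans AutRel.Tree I.R.rel) (fun A => IsTrans AutRel.Tree A.rel)) := by
  exact ⟨AutRel.wordClique_reduces_wordRec, ⟨AutRel.wordRecReduction,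
      AutRel.logspaceComputable_wordRecReduction, AutRel.wordRec_reduces_wordClique⟩,
    AutRel.treeClique_reduces_treeRec, ⟨AutRel.treeRecReduction,
      AutRel.logspaceComputable_treeRecReduction, AutRel.treeRec_reduces_treeClique⟩⟩
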